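/- Fix an integer $n>0$, and let $\mathbb F$ be the field with two elements. **The algebras.** Let $V(\Gamma_n)$ be the set of decreasing sequences of integers $n\ge x_0>\dots>x_i\ge 0$ (equivalently, subsets of $\{0,\dots,n\}$), with $[\emptyset]$ the empty sequence. Write $\mathbf x\xrightarrow{s}\mathbf y$ if $\mathbf y=\mathbf x\sqcup\{s+1,s\}$ as sets. $R_n$ is the $q$-graded unital $\mathbb F$-algebra generated by idempotents $e(\mathbf x)$ and arrows $r(\mathbf x\xrightarrow{s}\mathbf y)$ with relations $e(\mathbf x)e(\mathbf y)=\delta_{\mathbf x,\mathbf y}e(\mathbf x)$, $e(\mathbf x)r(\mathbf x\xrightarrow{s}\mathbf y)=r(\mathbf x\xrightarrow{s}\mathbf y)=r(\mathbf x\xrightarrow{s}\mathbf y)e(\mathbf y)$, $r(\mathbf x\xrightarrow{s}\mathbf y)r(\mathbf y\xrightarrow{t}\mathbf w)=r(\mathbf x\xrightarrow{t}\mathbf z)r(\mathbf z\xrightarrow{s}\mathbf w)$, $1=\sum_{\mathbf x}e(\mathbf x)$, where $\deg e(\mathbf x)=0$ and $\deg r(\mathbf x\xrightarrow{s}\mathbf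 y)=n-1-2s$; it is a DG algebra with $d=0$ in cohomological degree $0$. $R_n\boxtimes R_n$ is the $q$-graded DG algebra over $\mathbb F$ with idempotents $e(\mathbf x,\mathbf y)$ and arrows $l=r(\mathbf x,\mathbf y\xrightarrow{s,\emptyset}\mathbf x',\mathbf y)$ for $\mathbf x\xrightarrow{s}\mathbf x'$, $r=r(\mathbf x,\mathbf y\xrightarrow{\emptyset,t}\mathbf x,\mathbf y')$ for $\mathbf y\xrightarrow{t}\mathbf y'$, and $b=r(\mathbf x,\mathbf y\xrightarrow{s,s+1}\mathbf x',\mathbf y')$ for $\mathbf x\xrightarrow{s}\mathbf x'$, $\mathbf y\xrightarrow{s+1}\mathbf y'$; the $e(\mathbf x,\mathbf y)$ are orthogonal idempotents with sum $1$ which act as identities on the arrows that start (from the left) or end (from the right) at $(\mathbf x,\mathbf y)$, and any two arrows that can be composed in both orders commute (both products of parallel length-two paths with interchanged labels are equal), except a pair with labels $(s,\emptyset)$, $(\emptyset,s+1)$. The arrows $b$ have cohomological degree $-1$ and all other generators degree $0$; a label $(s,t)$ has $q$-degree $(n-1-2s)+(n-1-2t)$, where $\emptyset$ contributes $0$; and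 $d$ is $0$ on the $e$, $l$, $r$, while $$d\,r(\mathbf x,\mathbf y\xrightarrow{s,s+1}\mathbf x',\mathbf y')=r(\mathbf x,\mathbf y\xrightarrow{s,\emptyset}\mathbf x',\mathbf y)\,r(\mathbf x',\mathbf y\xrightarrow{\emptyset,s+1}\mathbf x',\mathbf y')+r(\mathbf x,\mathbf y\xrightarrow{\emptyset,s+1}\mathbf x,\mathbf y')\,r(\mathbf x,\mathbf y'\xrightarrow{s,\emptyset}\mathbf x',\mathbf y').$$ **Categories and Grothendieck groups.** For $A=R_n$ or $A=R_n\boxtimes R_n$ let $DGP(A)$ be the smallest full subcategory of the category of $q$-graded left DG $A$-modules that contains the $P(\mathbf x)=R_ne(\mathbf x)$, respectively the $P(\mathbf x,\mathbf y)=(R_n\boxtimes R_n)e(\mathbf x,\mathbf y)$, and is closed under the shifts $M[k]^{i,j}=M^{i+k,j}$, $M\{k\}^{i,j}=M^{i,j+k}$, mapping cones and isomorphisms (and contains $0$). $H^0(DGP(A))$ is its homotopy category, whose distinguished triangles are those isomorphic to mapping cone triangles. $K_0$ of it is the $\mathbb Z[q^{\pm1}]$-module generated by the classes $[M]$ with relations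 $[M\{1\}]=q[M]$ and $[Y]=[X]+[Z]$ for each distinguished triangle $X\to Y\to Z\to X[1]$. Write $K_0(R_n)=K_0(H^0(DGP(R_n)))$, $X_\emptyset=[P([\emptyset])]$ and $X_i=[P([i])]$. **The multiplication.** For $\mathbf x,\mathbf y\in V(\Gamma_n)$ let $s_1>\dots>s_p$ be the integers $s$ with $s\in\mathbf x$, $s+1\in\mathbf y$; put $s_0=+\infty$, $s_{p+1}=-\infty$. Let $\alpha_i$ be the decreasing sequence formed by the $a\in\mathbf x$ with $s_{i+1}+1\le a<s_i$ and the $b\in\mathbf y$ with $s_{i+1}+1<b\le s_i$, or $0$ if there are repetitions. Let $\beta(s)=q^{2s+1-n}[\emptyset]+h[s+1,s]$, and $\mu(\mathbf x,\mathbf y)=\sum(-1)^{a+b+1}$ over $a\in\mathbf x$, $b\in\mathbf y$ with $a<b-1$. Let $G$ be the multilinear gluing map which sends a list of sequences to their concatenation if this is decreasing, and to $0$ otherwise. Put $$M(\mathbf x,\mathbf y)=h^{\mu(\mathbf x,\mathbf y)}\,G(\alpha_0,\beta(s_1),\alpha_1,\dots,\beta(s_p),\alpha_p),\qquad m_n(\mathbf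 x,\mathbf y)=M(\mathbf x,\mathbf y)|_{h=-1}\in\mathbb Z[q^{\pm1}]\langle V(\Gamma_n)\rangle .$$ **The bimodule.** For $A\subseteq\{s_1,\dots,s_p\}$ let $M_A(\mathbf x,\mathbf y)\in V(\Gamma_n)\sqcup\{0\}$ be obtained from $G(\alpha_0,\beta(s_1),\dots,\alpha_p)$ by replacing $\beta(s)$ by $[s+1,s]$ if $s\in A$ and by $[\emptyset]$ if $s\notin A$; let $\eta(A)=\sum_{s\notin A}(2s+1-n)$ and $P(0)=0$. As a graded left $R_n$-module, $$T_n=\bigoplus_{\mathbf x,\mathbf y,A}P(M_A(\mathbf x,\mathbf y))\{\eta(A)\},$$ the summand $T_{\mathbf x,\mathbf y,A}$ lying in cohomological degree $\mu(\mathbf x,\mathbf y)+|A|$. In the following, maps between summands are right multiplications by elements of $R_n$, and $r(\mathbf u\xrightarrow{t}\mathbf v)$ is read as $0$ if $\mathbf u$ or $\mathbf v$ is $0$. The differential is the sum of the maps $T_{\mathbf x,\mathbf y,A}\to T_{\mathbf x,\mathbf y,A\sqcup\{s\}}$ given by $r(M_A\xrightarrow{s}M_{A\sqcup\{s\}})$.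 On the right, $e(\mathbf x,\mathbf y)$ acts as the projection to $\bigoplus_AT_{\mathbf x,\mathbf y,A}$; an arrow acts as $0$ on the summands for pairs other than its source $(\mathbf x,\mathbf y)$, and on these it acts as follows. The arrow $r(\mathbf x,\mathbf y\xrightarrow{\emptyset,t}\mathbf x,\mathbf y')$ maps $T_{\mathbf x,\mathbf y,A}$ to $T_{\mathbf x,\mathbf y',A'}$, where $A'=A\cup\{t-1\}$ if $t-1\in\mathbf x$ and $A'=A$ otherwise, by $r(M_A\xrightarrow{t}M_{A'})$ if $t\notin\mathbf x$ and by the identity of $M_A=M_{A'}$ if $t\in\mathbf x$. The arrow $r(\mathbf x,\mathbf y\xrightarrow{t,\emptyset}\mathbf x',\mathbf y)$ maps $T_{\mathbf x,\mathbf y,A}$ to $T_{\mathbf x',\mathbf y,A'}$, where $A'=A\cup\{t+1\}$ if $t+2\in\mathbf y$ and $A'=A$ otherwise, by $r(M_A\xrightarrow{t}M_{A'})$ if $t+1\notin\mathbf y$ and by the identity if $t+1\in\mathbf y$. The arrow $r(\mathbf x,\mathbf y\xrightarrow{t,t+1}\mathbf x',\mathbf y')$ maps $T_{\mathbf x,\mathbf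 y,A}$ to $T_{\mathbf x',\mathbf y',A}$ by the identity. **Theorem.** 1. $K_0(R_n)$ is a free $\mathbb Z[q^{\pm1}]$-module with basis $\{[P(\mathbf x)]\}_{\mathbf x\in V(\Gamma_n)}$. Identifying $[P(\mathbf x)]$ with $\mathbf x$, the $\mathbb Z[q^{\pm1}]$-bilinear multiplication $m_n$ makes $K_0(R_n)$ an associative $\mathbb Z[q^{\pm1}]$-algebra with unit $X_\emptyset$. This algebra is presented by the generators $X_i$, $0\le i\le n$, and the relations $$X_i^2=0;\qquad X_iX_j=-X_jX_i\ \text{ if } |i-j|>1;\qquad X_iX_{i+1}+X_{i+1}X_i=q^{2i+1-n}\ \ (0\le i<n).$$ It is the Clifford algebra, with generating vectors $X_0,\dots,X_n$, of the quadratic form $Q_n\bigl(\sum_i a_iX_i\bigr)=\sum_{i=0}^{n-1}a_ia_{i+1}q^{2i+1-n}$ on the free $\mathbb Z[q^{\pm1}]$-module on $X_0,\dots,X_n$. 2. The formulas above define a unique structure of a $q$-graded DG $(R_n,R_n\boxtimes R_n)$-bimodule on $T_n$. Tensoring with $T_n$ over $R_n\boxtimes R_n$ maps $DGP(R_n\boxtimes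 R_n)$ to $DGP(R_n)$ and induces an exact functor $H^0(DGP(R_n\boxtimes R_n))\to H^0(DGP(R_n))$. There is an isomorphism of $\mathbb Z[q^{\pm1}]$-modules $K_0(R_n)\otimes_{\mathbb Z[q^{\pm1}]}K_0(R_n)\cong K_0(H^0(DGP(R_n\boxtimes R_n)))$ with $[P(\mathbf x)]\otimes[P(\mathbf y)]\mapsto[P(\mathbf x,\mathbf y)]$, and under it the $\mathbb Z[q^{\pm1}]$-linear map induced by the functor on $K_0$ is $m_n$. -/

import Mathlib

open CategoryTheory

noncomputable section

/-- A `q`-graded differential graded algebra over the field `𝔽₂ = ZMod 2`. The degree is the pair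
`(cohomological degree, q-degree)`; over `𝔽₂` additive subgroups are the same as subspaces and
there are no signs. -/
structure QDGAlgebra where
  carrier : Type
  [ring : Ring carrier]
  [algebra : Algebra (ZMod 2) carrier]
  gr : ℤ × ℤ → AddSubgroup carrier
  internal : DirectSum.IsInternal gr
  one_mem : (1 : carrier) ∈ gr 0
  mul_mem : ∀ {g h a b}, a ∈ gr g → b ∈ gr h → a * b ∈ gr (g + h)
  d : carrier →+ carrier
  d_mem : ∀ {g a}, a ∈ gr g → d a ∈ gr (g + (1, 0))
  d_d : ∀ a, d (d a) = 0
  d_mul : ∀ a b, d (a * b) = d a * b + a * d b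

namespace QDGAlgebra

instance : CoeSort QDGAlgebra Type := ⟨QDGAlgebra.carrier⟩

attribute [instance] QDGAlgebra.ring QDGAlgebra.algebra

lemma add_self (A : QDGAlgebra) (a : A) : a + a = 0 := by
  have h : (2 : ZMod 2) = 0 := by decide
  have := congrArg (fun c : ZMod 2 => c • a) h
  simpa [two_smul] using this

lemma d_one (A : QDGAlgebra) : A.d 1 = 0 := by
  have := A.d_mul 1 1
  simpa using this

end QDGAlgebra

/-- A bigraded left module over the algebra underlying `A`. -/
structure GrModule (A : QDGAlgebra) where
  carrier : Type
  [addCommGroup : AddCommGroup carrier]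
  [module : Module A carrier]
  gr : ℤ × ℤ → AddSubgroup carrier
  internal : DirectSum.IsInternal gr
  smul_mem : ∀ {g h a m}, a ∈ A.gr g → m ∈ gr h → a • m ∈ gr (g + h)

instance (A : QDGAlgebra) : CoeSort (GrModule A) Type := ⟨GrModule.carrier⟩

attribute [instance] GrModule.addCommGroup GrModule.module

/-- A left `q`-graded DG module over `A`. -/
structure DGModule (A : QDGAlgebra) extends GrModule A where
  d : carrier →+ carrier
  d_mem : ∀ {g m}, m ∈ gr g → d m ∈ gr (g + (1, 0))
  d_d : ∀ m, d (d m) = 0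
  d_smul : ∀ (a : A) (m : carrier), d (a • m) = A.d a • m + a • d m

instance (A : QDGAlgebra) : CoeSort (DGModule A) Type := ⟨fun M => M.carrier⟩

/-! ### Internal gradings -/

section Grading

variable {G M : Type} [DecidableEq G] [AddCommGroup M] {gr : G → AddSubgroup M}

lemma exists_coaction (h : DirectSum.IsInternal gr) :
    ∃ δ : M →+ (G →₀ M), ∀ g, ∀ m ∈ gr g, δ m = Finsupp.single g m := by
  let e := AddEquiv.ofBijective _ h
  refine ⟨(DirectSum.toAddMonoid
    (fun g => (Finsupp.singleAddHom g).comp (gr g).subtype)).comp e.symm.toAddMonoidHom, ?_⟩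
  intro g m hm
  have : e.symm m = DirectSum.of (fun g => gr g) g ⟨m, hm⟩ := by
    rw [AddEquiv.symm_apply_eq]
    exact (DirectSum.coeAddMonoidHom_of gr g ⟨m, hm⟩).symm
  simp [this]

lemma internal_of_coaction' {M' : Type} [AddCommGroup M'] (j : M →+ M')
    (hj : Function.Injective j) (δ : M →+ (G →₀ M'))
    (h₁ : ∀ g, ∀ m ∈ gr g, δ m = Finsupp.single g (j m)) (h₂ : ∀ m, m ∈ ⨆ g, gr g) :
    DirectSum.IsInternal gr := by
  constructor
  · rw [injective_iff_map_eq_zero]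
    intro x hx
    have key : ∀ x : (DirectSum G fun g => gr g), ∀ g,
        δ (DirectSum.coeAddMonoidHom gr x) g = j (x g : M) := by
      intro x g
      induction x using DirectSum.induction_on with
      | zero => simp
      | of i y =>
        rw [DirectSum.coeAddMonoidHom_of, h₁ i _ y.2]
        by_cases hi : i = g
        · subst hi; simp
        · rw [Finsupp.single_eq_of_ne (Ne.symm hi), DirectSum.of_eq_of_ne _ _ _ (Ne.symm hi)]; simp
      | add x y hx hy => simp [hx, hy]
    ext g
    apply hj
    rw [← key x g, hx]
    simp
  · intro m
    have hle : (⨆ g, gr g) ≤ (DirectSum.coeAddMonoidHom gr).range :=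
      iSup_le fun g x hx => ⟨DirectSum.of (fun g => gr g) g ⟨x, hx⟩,
        DirectSum.coeAddMonoidHom_of gr g ⟨x, hx⟩⟩
    exact hle (h₂ m)

lemma internal_of_coaction (δ : M →+ (G →₀ M))
    (h₁ : ∀ g, ∀ m ∈ gr g, δ m = Finsupp.single g m) (h₂ : ∀ m, m ∈ ⨆ g, gr g) :
    DirectSum.IsInternal gr :=
  internal_of_coaction' (AddMonoidHom.id M) Function.injective_id δ h₁ h₂

lemma mem_iSup_of_internal (h : DirectSum.IsInternal gr) (m : M) : m ∈ ⨆ g, gr g := by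
  obtain ⟨x, rfl⟩ := h.2 m
  induction x using DirectSum.induction_on with
  | zero => simp
  | of i y =>
    rw [DirectSum.coeAddMonoidHom_of]
    exact AddSubgroup.mem_iSup_of_mem i y.2
  | add x y hx hy => rw [map_add]; exact add_mem hx hy

/-- Induction over the homogeneous elements. -/
lemma internal_induction (h : DirectSum.IsInternal gr) {p : M → Prop} (zero : p 0)
    (hom : ∀ g, ∀ m ∈ gr g, p m) (add : ∀ m m', p m → p m' → p (m + m')) (m : M) : p m := by
  obtain ⟨x, rfl⟩ := h.2 m
  induction x using DirectSum.induction_on with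
  | zero => simpa using zero
  | of i y =>
    rw [DirectSum.coeAddMonoidHom_of]
    exact hom i _ y.2
  | add x y hx hy => rw [map_add]; exact add _ _ hx hy

end Grading

lemma internal_reindex {G M : Type} [AddCommGroup G] [DecidableEq G] [AddCommGroup M]
    {gr : G → AddSubgroup M} (h : DirectSum.IsInternal gr) (c : G) :
    DirectSum.IsInternal (fun g => gr (g + c)) := by
  obtain ⟨δ, hδ⟩ := exists_coaction h
  refine internal_of_coaction
    ((Finsupp.mapDomain.addMonoidHom (fun g => g - c)).comp δ) ?_ ?_
  · intro g m hm
    simp [hδ _ m hm, Finsupp.mapDomain_single]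
  · intro m
    refine internal_induction h (zero_mem _) ?_ (fun _ _ => add_mem) m
    intro g m hm
    refine AddSubgroup.mem_iSup_of_mem (g - c) ?_
    simpa using hm

lemma internal_pi {G ι : Type} [DecidableEq G] [Fintype ι] {M : ι → Type}
    [∀ i, AddCommGroup (M i)] {gr : ∀ i, G → AddSubgroup (M i)}
    (h : ∀ i, DirectSum.IsInternal (gr i)) :
    DirectSum.IsInternal (fun g => AddSubgroup.pi Set.univ (fun i => gr i g)) := by
  classical
  choose δ hδ using fun i => exists_coaction (h i)
  refine internal_of_coaction (∑ i, (Finsupp.mapRange.addMonoidHom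
    (AddMonoidHom.single M i)).comp ((δ i).comp (Pi.evalAddMonoidHom M i))) ?_ ?_
  · intro g m hm
    have : ∀ i, δ i (m i) = Finsupp.single g (m i) := fun i => hδ i g _ (hm i trivial)
    simp only [AddMonoidHom.finsetSum_apply, AddMonoidHom.comp_apply, Pi.evalAddMonoidHom_apply,
      this, Finsupp.mapRange.addMonoidHom_apply, Finsupp.mapRange_single]
    rw [← Finsupp.single_finsetSum]
    congr 1
    exact Finset.univ_sum_single m
  · intro m
    rw [← Finset.univ_sum_single m]
    refine sum_mem fun i _ => ?_
    refine internal_induction (p := fun x => Pi.single i x ∈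
      ⨆ g, AddSubgroup.pi Set.univ (fun i => gr i g)) (h i) (by simp) ?_ ?_ (m i)
    · intro g x hx
      refine AddSubgroup.mem_iSup_of_mem g ?_
      intro j _
      by_cases hj : j = i
      · subst hj; simpa using hx
      · simp [Pi.single_eq_of_ne hj]
    · intro x y hx hy
      rw [Pi.single_add]
      exact add_mem hx hy

lemma internal_prod {G M N : Type} [DecidableEq G] [AddCommGroup M] [AddCommGroup N]
    {gr : G → AddSubgroup M} {gr' : G → AddSubgroup N}
    (h : DirectSum.IsInternal gr) (h' : DirectSum.IsInternal gr') :
    DirectSum.IsInternal (fun g => (gr g).prod (gr' g)) := by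
  obtain ⟨δ, hδ⟩ := exists_coaction h
  obtain ⟨δ', hδ'⟩ := exists_coaction h'
  refine internal_of_coaction
    (((Finsupp.mapRange.addMonoidHom (AddMonoidHom.inl M N)).comp
        (δ.comp (AddMonoidHom.fst M N))) +
      ((Finsupp.mapRange.addMonoidHom (AddMonoidHom.inr M N)).comp
        (δ'.comp (AddMonoidHom.snd M N)))) ?_ ?_
  · rintro g ⟨m, n⟩ ⟨hm, hn⟩
    simp only [AddMonoidHom.add_apply, AddMonoidHom.comp_apply, AddMonoidHom.coe_fst,
      AddMonoidHom.coe_snd, hδ g m hm, hδ' g n hn, Finsupp.mapRange.addMonoidHom_apply,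
      Finsupp.mapRange_single, ← Finsupp.single_add]
    simp
  · rintro ⟨m, n⟩
    have e : ((m, n) : M × N) = (m, 0) + (0, n) := by simp
    rw [e]
    refine add_mem ?_ ?_
    · refine internal_induction (p := fun x => ((x, 0) : M × N) ∈
        ⨆ g, (gr g).prod (gr' g)) h (zero_mem _) ?_ ?_ m
      · intro g x hx
        exact AddSubgroup.mem_iSup_of_mem g ⟨hx, zero_mem _⟩
      · intro x y hx hy
        have := add_mem hx hy
        simpa using this
    · refine internal_induction (p := fun x => ((0, x) : M × N) ∈
        ⨆ g, (gr g).prod (gr' g)) h' (zero_mem _) ?_ ?_ n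
      · intro g x hx
        exact AddSubgroup.mem_iSup_of_mem g ⟨zero_mem _, hx⟩
      · intro x y hx hy
        have := add_mem hx hy
        simpa using this

section DGMod

variable {A : QDGAlgebra}

/-- The module with degrees shifted by `c`: its part of degree `g` is the part of degree `g + c`
of `M`. -/
def GrModule.shift (M : GrModule A) (c : ℤ × ℤ) : GrModule A where
  carrier := M.carrier
  gr g := M.gr (g + c)
  internal := internal_reindex M.internal c
  smul_mem ha hm := by
    rw [add_assoc]
    exact M.smul_mem ha hm

/-- Finite direct sums of bigraded modules. -/
def GrModule.pi {ι : Type} [Fintype ι] (M : ι → GrModule A) : GrModule A where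
  carrier := ∀ i, (M i).carrier
  gr g := AddSubgroup.pi Set.univ (fun i => (M i).gr g)
  internal := internal_pi fun i => (M i).internal
  smul_mem ha hm := fun i _ => (M i).smul_mem ha (hm i trivial)

namespace DGModule

lemma add_self (M : DGModule A) (m : M) : m + m = 0 := by
  have : ((1 : A) + 1) • m = 0 := by rw [A.add_self, zero_smul]
  simpa [add_smul] using this

/-- The shift by `c = (k, l)`, that is `M[k]{l}`. -/
def shift (M : DGModule A) (c : ℤ × ℤ) : DGModule A where
  toGrModule := M.toGrModule.shift c
  d := M.d
  d_mem {g m} hm := by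
    change M.d m ∈ M.gr (g + (1, 0) + c)
    rw [add_right_comm]
    exact M.d_mem hm
  d_d := M.d_d
  d_smul := M.d_smul

/-- `Hom^k(M, N)`: the `A`-linear maps of degree `(k, 0)`. -/
def homDeg (M N : DGModule A) (k : ℤ) : AddSubgroup (M →ₗ[A] N) where
  carrier := {f | ∀ g, ∀ m ∈ M.gr g, f m ∈ N.gr (g + (k, 0))}
  zero_mem' := fun _ _ _ => zero_mem _
  add_mem' := fun hf hg g m hm => add_mem (hf g m hm) (hg g m hm)
  neg_mem' := fun hf g m hm => neg_mem (hf g m hm)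

/-- The differential `f ↦ d ∘ f + f ∘ d` on homomorphisms. -/
def dHom (M N : DGModule A) : (M →ₗ[A] N) →+ (M →ₗ[A] N) where
  toFun f :=
    { toFun := fun m => N.d (f m) + f (M.d m)
      map_add' := fun m m' => by simp only [map_add]; abel
      map_smul' := fun a m => by
        simp only [map_smul, map_add, N.d_smul, M.d_smul, RingHom.id_apply, smul_add]
        have := N.add_self (A.d a • f m)
        calc _ = (A.d a • f m + A.d a • f m) + (a • N.d (f m) + a • f (M.d m)) := by abel
          _ = _ := by rw [this, zero_add] }
  map_zero' := by ext; simp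
  map_add' f g := by ext m; simp; abel

/-- `Z⁰ Hom(M, N)`: the closed morphisms of degree `0`. -/
def Z0 (M N : DGModule A) : AddSubgroup (M →ₗ[A] N) := homDeg M N 0 ⊓ (dHom M N).ker

/-- `B⁰ Hom(M, N)`: the exact morphisms of degree `0`. -/
def B0 (M N : DGModule A) : AddSubgroup (M →ₗ[A] N) := (homDeg M N (-1)).map (dHom M N)

lemma mem_Z0 {M N : DGModule A} {f : M →ₗ[A] N} :
    f ∈ Z0 M N ↔ (∀ g, ∀ m ∈ M.gr g, f m ∈ N.gr g) ∧ ∀ m, f (M.d m) = N.d (f m) := by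
  have h0 : ∀ g : ℤ × ℤ, g + (0, 0) = g := fun g => add_zero g
  refine and_congr ?_ ?_
  · simp [homDeg, h0]
  · change dHom M N f = 0 ↔ _
    refine ⟨fun h m => ?_, fun h => ?_⟩
    · have h1 : N.d (f m) + f (M.d m) = 0 := LinearMap.congr_fun h m
      have h2 := N.add_self (N.d (f m))
      exact add_left_cancel (h1.trans h2.symm)
    · ext m
      change N.d (f m) + f (M.d m) = 0
      rw [h, N.add_self]

lemma comp_mem_Z0 {M N K : DGModule A} {f : M →ₗ[A] N} {g : N →ₗ[A] K} (hf : f ∈ Z0 M N)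
    (hg : g ∈ Z0 N K) : g ∘ₗ f ∈ Z0 M K := by
  rw [mem_Z0] at *
  exact ⟨fun i m hm => hg.1 i _ (hf.1 i m hm), fun m => by simp [hf.2, hg.2]⟩

/-- The category `Z⁰(DG(A))`. -/
instance category : Category (DGModule A) where
  Hom M N := Z0 M N
  id M := ⟨LinearMap.id, mem_Z0.2 ⟨fun _ _ h => h, fun _ => rfl⟩⟩
  comp f g := ⟨g.1 ∘ₗ f.1, comp_mem_Z0 f.2 g.2⟩

lemma hom_ext' {M N : DGModule A} {f g : M ⟶ N} (h : ∀ m, f.1 m = g.1 m) : f = g :=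
  Subtype.ext (LinearMap.ext h)

instance preadditive : Preadditive (DGModule A) where
  homGroup M N := inferInstanceAs (AddCommGroup (Z0 M N))
  add_comp _ _ _ _ _ h := hom_ext' fun _ => map_add h.1 _ _
  comp_add _ _ _ _ _ _ := hom_ext' fun _ => rfl

lemma add_val {M N : DGModule A} (f g : M ⟶ N) : (f + g).1 = f.1 + g.1 := rfl

/-- Two closed morphisms of degree `0` are homotopic if their difference is exact. -/
def homotopic (A : QDGAlgebra) : HomRel (DGModule A) := fun M N f g => f.1 - g.1 ∈ B0 M N

instance homotopic_congruence : Congruence (homotopic A) where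
  comp_left {M N K} f g g' h := by
    obtain ⟨s, hs, e⟩ := h
    refine ⟨s ∘ₗ f.1, fun i m hm => hs i _ ((mem_Z0.1 f.2).1 i m hm), ?_⟩
    ext m
    have := LinearMap.congr_fun e (f.1 m)
    change K.d (s (f.1 m)) + s (N.d (f.1 m)) = g.1 (f.1 m) - g'.1 (f.1 m) at this
    change K.d (s (f.1 m)) + s (f.1 (M.d m)) = g.1 (f.1 m) - g'.1 (f.1 m)
    rw [(mem_Z0.1 f.2).2, this]
  comp_right {M N K f f'} g h := by
    obtain ⟨s, hs, e⟩ := h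
    refine ⟨g.1 ∘ₗ s, fun i m hm => (mem_Z0.1 g.2).1 _ _ (hs i m hm), ?_⟩
    ext m
    have := congrArg g.1 (LinearMap.congr_fun e m)
    change g.1 (N.d (s m) + s (M.d m)) = g.1 (f.1 m - f'.1 m) at this
    change K.d (g.1 (s m)) + g.1 (s (M.d m)) = g.1 (f.1 m) - g.1 (f'.1 m)
    rw [← (mem_Z0.1 g.2).2, ← map_add, this, map_sub]
  equivalence {M N} :=
    { refl := fun f => by
        change f.1 - f.1 ∈ _
        rw [sub_self]
        exact zero_mem _
      symm := fun {f g} h => by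
        have h1 : f.1 - g.1 ∈ B0 M N := h
        change g.1 - f.1 ∈ _
        rw [← neg_sub]
        exact neg_mem h1
      trans := fun {f g k} h h' => by
        have h1 : f.1 - g.1 ∈ B0 M N := h
        have h2 : g.1 - k.1 ∈ B0 M N := h'
        change f.1 - k.1 ∈ _
        rw [← sub_add_sub_cancel f.1 g.1 k.1]
        exact add_mem h1 h2 }

/-- The shift functor by `c` on `Z⁰(DG(A))`. -/
def shiftFunctor (A : QDGAlgebra) (c : ℤ × ℤ) : DGModule A ⥤ DGModule A where
  obj M := M.shift c
  map {M N} f := ⟨f.1, mem_Z0.2 ⟨fun g m hm => (mem_Z0.1 f.2).1 (g + c) m hm, (mem_Z0.1 f.2).2⟩⟩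

/-- The identity map as an isomorphism between two shifts by equal amounts. -/
def shiftIso (M : DGModule A) (c c' : ℤ × ℤ) (h : c = c') : M.shift c ≅ M.shift c' where
  hom := ⟨LinearMap.id, mem_Z0.2 ⟨fun _ _ hm => h ▸ hm, fun _ => rfl⟩⟩
  inv := ⟨LinearMap.id, mem_Z0.2 ⟨fun _ _ hm => h ▸ hm, fun _ => rfl⟩⟩

lemma eqToHom_shift (M : DGModule A) {c c' : ℤ × ℤ} (h : c = c') (h' : M.shift c = M.shift c') :
    eqToHom h' = (shiftIso M c c' h).hom := by
  subst h
  rfl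

def shiftZero (A : QDGAlgebra) : shiftFunctor A (0, 0) ≅ 𝟭 (DGModule A) :=
  NatIso.ofComponents (fun M =>
    { hom := ⟨LinearMap.id, mem_Z0.2 ⟨fun g m hm => by
        have h : m ∈ M.gr (g + (0, 0)) := hm
        rwa [show g + ((0, 0) : ℤ × ℤ) = g from add_zero g] at h, fun _ => rfl⟩⟩
      inv := ⟨LinearMap.id, mem_Z0.2 ⟨fun g m hm => by
        change m ∈ M.gr (g + (0, 0))
        rwa [show g + ((0, 0) : ℤ × ℤ) = g from add_zero g], fun _ => rfl⟩⟩ })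
    (fun _ => rfl)

def shiftAdd (A : QDGAlgebra) (a b : ℤ) :
    shiftFunctor A (a + b, 0) ≅ shiftFunctor A (a, 0) ⋙ shiftFunctor A (b, 0) :=
  have key : ∀ g : ℤ × ℤ, g + (b, 0) + (a, 0) = g + (a + b, 0) := fun g => by
    ext <;> simp; ring
  NatIso.ofComponents (fun M =>
    { hom := ⟨LinearMap.id, mem_Z0.2 ⟨fun g m hm => by
        have h : m ∈ M.gr (g + (a + b, 0)) := hm
        change m ∈ M.gr (g + (b, 0) + (a, 0))
        rwa [key], fun _ => rfl⟩⟩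
      inv := ⟨LinearMap.id, mem_Z0.2 ⟨fun g m hm => by
        have h : m ∈ M.gr (g + (b, 0) + (a, 0)) := hm
        change m ∈ M.gr (g + (a + b, 0))
        rwa [key] at h, fun _ => rfl⟩⟩ })
    (fun _ => rfl)

instance hasShift : HasShift (DGModule A) ℤ := hasShiftMk _ _
  { F := fun k => shiftFunctor A (k, 0)
    zero := shiftZero A
    add := shiftAdd A
    assoc_hom_app := fun a b c M => by
      erw [eqToHom_shift M (by rw [add_assoc])]
      rfl
    zero_add_hom_app := fun a M => by
      erw [eqToHom_shift M (by rw [zero_add])]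
      rfl
    add_zero_hom_app := fun a M => by
      erw [eqToHom_shift M (by rw [add_zero])]
      rfl }

instance : (homotopic A).IsCompatibleWithShift ℤ where
  condition k M N f g h := by
    obtain ⟨s, hs, e⟩ := h
    refine ⟨s, fun i m hm => ?_, e⟩
    change s m ∈ N.gr (i + (-1, 0) + (k, 0))
    rw [add_right_comm]
    exact hs _ m hm

/-- The mapping cone `C(f) = N ⊕ M[1]`. -/
def cone {M N : DGModule A} (f : M ⟶ N) : DGModule A where
  carrier := N.carrier × M.carrier
  gr g := (N.gr g).prod (M.gr (g + (1, 0)))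
  internal := internal_prod N.internal (internal_reindex M.internal (1, 0))
  smul_mem ha hm := ⟨N.smul_mem ha hm.1, by
    rw [add_assoc]
    exact M.smul_mem ha hm.2⟩
  d := AddMonoidHom.mk' (fun x => (N.d x.1 + f.1 x.2, M.d x.2)) (fun x y => by
    refine Prod.ext ?_ (map_add M.d _ _)
    change N.d (x.1 + y.1) + f.1 (x.2 + y.2) = N.d x.1 + f.1 x.2 + (N.d y.1 + f.1 y.2)
    rw [map_add, map_add]
    abel)
  d_mem {g x} hx := ⟨add_mem (N.d_mem hx.1) ((mem_Z0.1 f.2).1 _ _ hx.2), M.d_mem hx.2⟩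
  d_d x := by
    refine Prod.ext ?_ (M.d_d _)
    change N.d (N.d x.1 + f.1 x.2) + f.1 (M.d x.2) = 0
    rw [map_add, N.d_d, zero_add, (mem_Z0.1 f.2).2, N.add_self]
  d_smul a x := by
    refine Prod.ext ?_ (M.d_smul _ _)
    change N.d (a • x.1) + f.1 (a • x.2) = A.d a • x.1 + a • (N.d x.1 + f.1 x.2)
    rw [N.d_smul, map_smul, smul_add, add_assoc]

/-- The inclusion `N ⟶ C(f)`. -/
def coneInl {M N : DGModule A} (f : M ⟶ N) : N ⟶ cone f :=
  ⟨LinearMap.inl A N.carrier M.carrier, mem_Z0.2 ⟨fun _ _ hm => ⟨hm, zero_mem _⟩, fun n => by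
    refine Prod.ext ?_ (map_zero M.d).symm
    change N.d n = N.d n + f.1 0
    rw [map_zero, add_zero]⟩⟩

/-- The projection `C(f) ⟶ M[1]`. -/
def coneSnd {M N : DGModule A} (f : M ⟶ N) : cone f ⟶ M⟦(1 : ℤ)⟧ :=
  ⟨LinearMap.snd A N.carrier M.carrier, mem_Z0.2 ⟨fun _ _ hm => hm.2, fun _ => rfl⟩⟩

/-- The triangle `M ⟶ N ⟶ C(f) ⟶ M[1]`. -/
def coneTriangle {M N : DGModule A} (f : M ⟶ N) : Pretriangulated.Triangle (DGModule A) :=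
  Pretriangulated.Triangle.mk f (coneInl f) (coneSnd f)

end DGModule

/-- The `0`-th homology category `H⁰(DG(A))`. -/
abbrev H0DG (A : QDGAlgebra) := Quotient (DGModule.homotopic A)

instance (A : QDGAlgebra) : Preadditive (H0DG A) :=
  Quotient.preadditive _ (fun M N f₁ f₂ g₁ g₂ h h' => by
    have h1 : f₁.1 - f₂.1 ∈ DGModule.B0 M N := h
    have h2 : g₁.1 - g₂.1 ∈ DGModule.B0 M N := h'
    change (f₁ + g₁).1 - (f₂ + g₂).1 ∈ DGModule.B0 M N
    rw [DGModule.add_val, DGModule.add_val, add_sub_add_comm]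
    exact add_mem h1 h2)

/-- The distinguished triangles of `H⁰(DG(A))`: those isomorphic to the triangle of a cone. -/
def H0DG.distinguished (A : QDGAlgebra) (T : Pretriangulated.Triangle (H0DG A)) : Prop :=
  ∃ (M N : DGModule A) (f : M ⟶ N),
    Nonempty (T ≅ (Quotient.functor (DGModule.homotopic A)).mapTriangle.obj
      (DGModule.coneTriangle f))

/-- The objects of `DGP(A)` generated by a family `P` of DG modules: the smallest class of DG
modules which contains the `P i` and the zero module and is closed under the shifts `[k]`, `{l}`
(`k l : ℤ`), mapping cones, and isomorphisms of DG modules. -/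
inductive DGP {ι : Type} (P : ι → DGModule A) : DGModule A → Prop
  | proj (i : ι) : DGP P (P i)
  | zero (M : DGModule A) [Subsingleton M] : DGP P M
  | shift {M : DGModule A} (c : ℤ × ℤ) : DGP P M → DGP P (M.shift c)
  | cone {M N : DGModule A} (f : M ⟶ N) : DGP P M → DGP P N → DGP P (DGModule.cone f)
  | iso {M N : DGModule A} : (M ≅ N) → DGP P M → DGP P N

section

variable {ι : Type} (P : ι → DGModule A)

/-- `DGP(A)` as a class of objects of `H⁰(DG(A))`. -/
def DGP.property : ObjectProperty (H0DG A) := fun X => DGP P X.as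

instance DGP.stable : (DGP.property P).IsStableUnderShift ℤ where
  isStableUnderShiftBy k := ⟨fun X hX => by
    have h : X⟦k⟧ = (Quotient.functor (DGModule.homotopic A)).obj (X.as.shift (k, 0)) :=
      Quotient.functor_obj_shift (DGModule.homotopic A) ℤ X.as k
    change DGP.property P (X⟦k⟧)
    rw [h]
    exact DGP.shift (k, 0) hX⟩

/-- The category `H⁰(DGP(A))`, a full subcategory of `H⁰(DG(A))`. -/
abbrev H0DGP := (DGP.property P).FullSubcategory

/-- The object of `H⁰(DGP(A))` given by a DG module in `DGP(A)`. -/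
def H0DGP.mk (M : DGModule A) (h : DGP P M) : H0DGP P := ⟨⟨M⟩, h⟩

variable {P}

/-- The `q`-shift `{1}`. -/
def H0DGP.qshift (X : H0DGP P) : H0DGP P := ⟨⟨X.obj.as.shift (0, 1)⟩, DGP.shift _ X.property⟩

variable (P)

/-- The distinguished triangles of `H⁰(DGP(A))`. -/
def H0DGP.distinguished (T : Pretriangulated.Triangle (H0DGP P)) : Prop :=
  H0DG.distinguished A ((DGP.property P).ι.mapTriangle.obj T)

open LaurentPolynomial in
/-- The relations `[M{1}] = q[M]` and `[Y] = [X] + [Z]` for distinguished `X ⟶ Y ⟶ Z ⟶ X[1]`. -/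
def K0.relations : Submodule ℤ[T;T⁻¹] (H0DGP P →₀ ℤ[T;T⁻¹]) :=
  Submodule.span _
    ({r | ∃ X : H0DGP P, r = Finsupp.single X.qshift 1 - Finsupp.single X (T 1)} ∪
     {r | ∃ D : Pretriangulated.Triangle (H0DGP P), H0DGP.distinguished P D ∧
        r = Finsupp.single D.obj₂ 1 - Finsupp.single D.obj₁ 1 - Finsupp.single D.obj₃ 1})

open LaurentPolynomial in
/-- The Grothendieck group of the triangulated category `H⁰(DGP(A))`, as a module over
`ℤ[q, q⁻¹]` (the variable `T 1` is `q`). -/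
abbrev K0 := (H0DGP P →₀ ℤ[T;T⁻¹]) ⧸ K0.relations P

/-- The class of an object in the Grothendieck group. -/
def K0.cls (X : H0DGP P) : K0 P := (K0.relations P).mkQ (Finsupp.single X 1)

end

/-- Exact functors between the categories `H⁰(DGP)`: additive functors which commute with the
shift up to natural isomorphism and preserve distinguished triangles. -/
def IsExactFunctor {A B : QDGAlgebra} {ι κ : Type} {P : ι → DGModule A} {Q : κ → DGModule B}
    (F : H0DGP P ⥤ H0DGP Q) : Prop :=
  F.Additive ∧ ∃ _ : F.CommShift ℤ, ∀ D : Pretriangulated.Triangle (H0DGP P),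
    H0DGP.distinguished P D → H0DGP.distinguished Q (F.mapTriangle.obj D)

end DGMod

/-- The structure of a `q`-graded DG `(A, B)`-bimodule on a bigraded left `A`-module `M`: a
differential and a right action `act m b = m × b` of `B`. -/
structure DGBimoduleStr {A : QDGAlgebra} (M : GrModule A) (B : QDGAlgebra) where
  d : M →+ M
  d_mem : ∀ {g m}, m ∈ M.gr g → d m ∈ M.gr (g + (1, 0))
  d_d : ∀ m, d (d m) = 0
  d_smul : ∀ (a : A) (m : M), d (a • m) = A.d a • m + a • d m
  act : M →+ B →+ M
  act_one : ∀ m, act m 1 = m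
  act_mul : ∀ m b c, act m (b * c) = act (act m b) c
  smul_act : ∀ (a : A) m b, act (a • m) b = a • act m b
  act_mem : ∀ {g h m b}, m ∈ M.gr g → b ∈ B.gr h → act m b ∈ M.gr (g + h)
  d_act : ∀ m b, d (act m b) = act (d m) b + act m (B.d b)

namespace DGBimoduleStr

open TensorProduct

variable {A B : QDGAlgebra} {M : GrModule A} (τ : DGBimoduleStr M B)

/-- The set of elements `m × b ⊗ n - m ⊗ b n` of `M ⊗_ℤ N`. -/
def balance (N : DGModule B) : Set (M.carrier ⊗[ℤ] N.carrier) :=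
  {z | ∃ (m : M) (b : B) (n : N), z = τ.act m b ⊗ₜ n - m ⊗ₜ (b • n)}

/-- The underlying left `A`-module of `M ⊗_B N`: the quotient of `M ⊗_ℤ N` by the relations
`m × b ⊗ n = m ⊗ b n`. -/
abbrev Tens (N : DGModule B) : Type :=
  (M.carrier ⊗[ℤ] N.carrier) ⧸ (Submodule.span A (τ.balance N))

/-- The class of `m ⊗ n`. -/
def tmk (N : DGModule B) (m : M) (n : N) : τ.Tens N :=
  (Submodule.span A (τ.balance N)).mkQ (m ⊗ₜ[ℤ] n)

variable (N : DGModule B)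

lemma tmk_add_left (m m' : M) (n : N) : τ.tmk N (m + m') n = τ.tmk N m n + τ.tmk N m' n := by
  simp [tmk, TensorProduct.add_tmul]

lemma tmk_add_right (m : M) (n n' : N) : τ.tmk N m (n + n') = τ.tmk N m n + τ.tmk N m n' := by
  simp [tmk, TensorProduct.tmul_add]

lemma smul_tmk (a : A) (m : M) (n : N) : a • τ.tmk N m n = τ.tmk N (a • m) n := rfl

lemma tmk_act (m : M) (b : B) (n : N) : τ.tmk N (τ.act m b) n = τ.tmk N m (b • n) := by
  rw [← sub_eq_zero]
  change (Submodule.span A (τ.balance N)).mkQ _ - (Submodule.span A (τ.balance N)).mkQ _ = 0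
  rw [← map_sub, Submodule.mkQ_apply, Submodule.Quotient.mk_eq_zero]
  exact Submodule.subset_span ⟨m, b, n, rfl⟩

lemma tens_induction {p : τ.Tens N → Prop} (zero : p 0) (tmk : ∀ m n, p (τ.tmk N m n))
    (add : ∀ x y, p x → p y → p (x + y)) (x : τ.Tens N) : p x := by
  obtain ⟨z, rfl⟩ := (Submodule.span A (τ.balance N)).mkQ_surjective x
  induction z using TensorProduct.induction_on with
  | zero => simpa using zero
  | tmul m n => exact tmk m n
  | add x y hx hy => rw [map_add]; exact add _ _ hx hy

/-- Additive maps out of `M ⊗_B N`. -/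
lemma exists_tens_lift {K : Type} [AddCommGroup K] (f : M →+ N →+ K)
    (hf : ∀ m b n, f (τ.act m b) n = f m (b • n)) :
    ∃ F : τ.Tens N →+ K, ∀ m n, F (τ.tmk N m n) = f m n := by
  let F₀ : M.carrier ⊗[ℤ] N.carrier →+ K := TensorProduct.liftAddHom f (fun r m n => by simp)
  have hF₀ : ∀ m n, F₀ (m ⊗ₜ n) = f m n := fun m n => rfl
  have hsmul : ∀ (a : A) z, z ∈ AddSubgroup.closure (τ.balance N) →
      a • z ∈ AddSubgroup.closure (τ.balance N) := by
    intro a z hz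
    induction hz using AddSubgroup.closure_induction with
    | mem z hz =>
      obtain ⟨m, b, n, rfl⟩ := hz
      refine AddSubgroup.subset_closure ⟨a • m, b, n, ?_⟩
      rw [smul_sub, TensorProduct.smul_tmul', TensorProduct.smul_tmul', τ.smul_act]
    | zero => rw [smul_zero]; exact zero_mem _
    | add x y _ _ hx hy => rw [smul_add]; exact add_mem hx hy
    | neg x _ hx => rw [smul_neg]; exact neg_mem hx
  have hspan : ∀ z ∈ Submodule.span A (τ.balance N), z ∈ AddSubgroup.closure (τ.balance N) := by
    intro z hz
    induction hz using Submodule.span_induction with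
    | mem z hz => exact AddSubgroup.subset_closure hz
    | zero => exact zero_mem _
    | add x y _ _ hx hy => exact add_mem hx hy
    | smul a x _ hx => exact hsmul a x hx
  have hle : AddSubgroup.closure (τ.balance N) ≤ F₀.ker := by
    rw [AddSubgroup.closure_le]
    rintro _ ⟨m, b, n, rfl⟩
    change F₀ _ = 0
    rw [map_sub, hF₀, hF₀, hf, sub_self]
  have hker : ∀ z ∈ Submodule.span A (τ.balance N), F₀ z = 0 := fun z hz => hle (hspan z hz)
  exact ⟨QuotientAddGroup.lift (Submodule.span A (τ.balance N)).toAddSubgroup F₀ hker,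
    fun m n => rfl⟩

/-- The degree `g` part of `M ⊗_B N`, spanned by the `m ⊗ n` with `m`, `n` homogeneous of degrees
adding up to `g`. -/
def tensGr (g : ℤ × ℤ) : AddSubgroup (τ.Tens N) :=
  AddSubgroup.closure {z | ∃ (a b : ℤ × ℤ) (m : M) (n : N),
    m ∈ M.gr a ∧ n ∈ N.gr b ∧ a + b = g ∧ z = τ.tmk N m n}

lemma tmk_mem {a b : ℤ × ℤ} {m : M} {n : N} (hm : m ∈ M.gr a) (hn : n ∈ N.gr b) :
    τ.tmk N m n ∈ τ.tensGr N (a + b) :=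
  AddSubgroup.subset_closure ⟨a, b, m, n, hm, hn, rfl, rfl⟩

lemma tmk_zero_left (n : N) : τ.tmk N 0 n = 0 := by simp [tmk]

lemma tmk_zero_right (m : M) : τ.tmk N m 0 = 0 := by simp [tmk]

/-- `tmk` as a biadditive map. -/
def tmkHom : M →+ N →+ τ.Tens N :=
  AddMonoidHom.mk' (fun m => AddMonoidHom.mk' (fun n => τ.tmk N m n) (τ.tmk_add_right N m))
    (fun m m' => by ext n; exact τ.tmk_add_left N m m' n)

lemma tens_internal : DirectSum.IsInternal (τ.tensGr N) := by
  obtain ⟨δ, hδ⟩ := exists_coaction M.internal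
  obtain ⟨ε, hε⟩ := exists_coaction N.internal
  let base (a b : ℤ × ℤ) (x : M) : N →+ ((ℤ × ℤ) →₀ τ.Tens N) :=
    (Finsupp.singleAddHom (a + b)).comp (τ.tmkHom N x)
  let inner (a : ℤ × ℤ) : M →+ N →+ ((ℤ × ℤ) →₀ τ.Tens N) :=
    AddMonoidHom.mk' (fun x => (Finsupp.liftAddHom (fun b => base a b x)).comp ε) (by
      intro x y
      ext1 n
      simp only [AddMonoidHom.comp_apply, AddMonoidHom.add_apply, Finsupp.liftAddHom_apply]
      rw [← Finsupp.sum_add]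
      refine Finsupp.sum_congr fun b _ => ?_
      simp [base])
  let f : M →+ N →+ ((ℤ × ℤ) →₀ τ.Tens N) := (Finsupp.liftAddHom inner).comp δ
  have hf : ∀ a b m n, m ∈ M.gr a → n ∈ N.gr b →
      f m n = Finsupp.single (a + b) (τ.tmk N m n) := by
    intro a b m n hm hn
    have h1 : f m = inner a m := by simp [f, hδ a m hm]
    have h2 : inner a m n = base a b m n := by
      change Finsupp.liftAddHom (fun b => base a b m) (ε n) = _
      rw [hε b n hn, Finsupp.liftAddHom_apply_single]
    rw [h1, h2]
    rfl
  have hbal : ∀ m b n, f (τ.act m b) n = f m (b • n) := by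
    intro m b n
    refine internal_induction (p := fun m => f (τ.act m b) n = f m (b • n)) M.internal
      (by simp) ?_ (fun x y hx hy => by simp [hx, hy]) m
    intro i m hm
    refine internal_induction (p := fun b => f (τ.act m b) n = f m (b • n)) B.internal
      (by simp) ?_ (fun x y hx hy => by simp [hx, hy, add_smul]) b
    intro j b hb
    refine internal_induction (p := fun n => f (τ.act m b) n = f m (b • n)) N.internal
      (by simp) ?_ (fun x y hx hy => by simp [hx, hy]) n
    intro k n hn
    rw [hf _ _ _ _ (τ.act_mem hm hb) hn, hf _ _ _ _ hm (N.smul_mem hb hn), tmk_act, add_assoc]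
  obtain ⟨F, hF⟩ := τ.exists_tens_lift N f hbal
  refine internal_of_coaction F ?_ ?_
  · intro g z hz
    induction hz using AddSubgroup.closure_induction with
    | mem z hz =>
      obtain ⟨a, b, m, n, hm, hn, rfl, rfl⟩ := hz
      rw [hF, hf a b m n hm hn]
    | zero => simp
    | add x y _ _ hx hy => rw [map_add, hx, hy, Finsupp.single_add]
    | neg x _ hx => rw [map_neg, hx, Finsupp.single_neg]
  · intro z
    refine τ.tens_induction N (zero_mem _) ?_ (fun _ _ => add_mem) z
    intro m n
    refine internal_induction (p := fun m => τ.tmk N m n ∈ ⨆ g, τ.tensGr N g) M.internal ?_ ?_ ?_ m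
    · rw [tmk_zero_left]; exact zero_mem _
    · intro a m hm
      refine internal_induction (p := fun n => τ.tmk N m n ∈ ⨆ g, τ.tensGr N g) N.internal
        ?_ ?_ ?_ n
      · rw [tmk_zero_right]; exact zero_mem _
      · intro b n hn
        exact AddSubgroup.mem_iSup_of_mem (a + b) (τ.tmk_mem N hm hn)
      · intro x y hx hy
        rw [tmk_add_right]; exact add_mem hx hy
    · intro x y hx hy
      rw [tmk_add_left]; exact add_mem hx hy

lemma exists_tensD : ∃ D : τ.Tens N →+ τ.Tens N, ∀ m n,
    D (τ.tmk N m n) = τ.tmk N (τ.d m) n + τ.tmk N m (N.d n) := by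
  refine τ.exists_tens_lift N (AddMonoidHom.mk' (fun m => AddMonoidHom.mk'
    (fun n => τ.tmk N (τ.d m) n + τ.tmk N m (N.d n)) ?_) ?_) ?_
  · intro n n'
    simp only [map_add, tmk_add_right]
    abel
  · intro m m'
    ext n
    simp only [map_add, tmk_add_left, AddMonoidHom.mk'_apply, AddMonoidHom.add_apply]
    abel
  · intro m b n
    simp only [AddMonoidHom.mk'_apply, τ.d_act, N.d_smul, tmk_add_left, tmk_add_right, tmk_act,
      add_assoc]

/-- The DG `A`-module `M ⊗_B N`, with differential `d(m ⊗ n) = d m ⊗ n + m ⊗ d n`. -/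
def tensor : DGModule A where
  carrier := τ.Tens N
  gr := τ.tensGr N
  internal := τ.tens_internal N
  smul_mem {g h a z} ha hz := by
    induction hz using AddSubgroup.closure_induction with
    | mem z hz =>
      obtain ⟨i, j, m, n, hm, hn, rfl, rfl⟩ := hz
      rw [smul_tmk, ← add_assoc]
      exact τ.tmk_mem N (M.smul_mem ha hm) hn
    | zero => rw [smul_zero]; exact zero_mem _
    | add x y _ _ hx hy => rw [smul_add]; exact add_mem hx hy
    | neg x _ hx => rw [smul_neg]; exact neg_mem hx
  d := (τ.exists_tensD N).choose
  d_mem {g z} hz := by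
    induction hz using AddSubgroup.closure_induction with
    | mem z hz =>
      obtain ⟨i, j, m, n, hm, hn, rfl, rfl⟩ := hz
      rw [(τ.exists_tensD N).choose_spec]
      refine add_mem ?_ ?_
      · rw [add_right_comm]
        exact τ.tmk_mem N (τ.d_mem hm) hn
      · rw [add_assoc]
        exact τ.tmk_mem N hm (N.d_mem hn)
    | zero => rw [map_zero]; exact zero_mem _
    | add x y _ _ hx hy => rw [map_add]; exact add_mem hx hy
    | neg x _ hx => rw [map_neg]; exact neg_mem hx
  d_d z := by
    refine τ.tens_induction N (p := fun z => (τ.exists_tensD N).choose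
      ((τ.exists_tensD N).choose z) = 0) (by rw [map_zero, map_zero]) ?_
      (fun x y hx hy => by rw [map_add, map_add, hx, hy, add_zero]) z
    intro m n
    simp only [(τ.exists_tensD N).choose_spec, map_add, τ.d_d, N.d_d, tmk_zero_left,
      tmk_zero_right, zero_add, add_zero]
    have : τ.tmk N (τ.d m) (N.d n) + τ.tmk N (τ.d m) (N.d n) =
      τ.tmk N ((1 : A) • τ.d m + (1 : A) • τ.d m) (N.d n) := by
        rw [one_smul, tmk_add_left]
    rw [this, ← add_smul, A.add_self, zero_smul, tmk_zero_left]
  d_smul a z := by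
    refine τ.tens_induction N (p := fun z => (τ.exists_tensD N).choose (a • z) =
      A.d a • z + a • (τ.exists_tensD N).choose z)
      (by simp only [smul_zero, map_zero, add_zero]) ?_
      (fun x y hx hy => ?_) z
    · intro m n
      rw [smul_tmk, (τ.exists_tensD N).choose_spec, (τ.exists_tensD N).choose_spec, τ.d_smul,
        tmk_add_left, smul_add, smul_tmk, smul_tmk, smul_tmk, add_assoc]
    · rw [smul_add, map_add, hx, hy, map_add, smul_add, smul_add]
      abel

/-- The element `m ⊗ n` of `M ⊗_B N`. -/
def tmul (m : M) (n : N) : τ.tensor N := τ.tmk N m n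

lemma tensor_induction {p : τ.tensor N → Prop} (zero : p 0) (tmul : ∀ m n, p (τ.tmul N m n))
    (add : ∀ x y, p x → p y → p (x + y)) (x : τ.tensor N) : p x :=
  τ.tens_induction N zero tmul add x

lemma tmul_add (m : M) (n n' : N) : τ.tmul N m (n + n') = τ.tmul N m n + τ.tmul N m n' :=
  τ.tmk_add_right N m n n'

lemma tmul_sub (m : M) (n n' : N) : τ.tmul N m (n - n') = τ.tmul N m n - τ.tmul N m n' :=
  map_sub (τ.tmkHom N m) n n'

lemma tmul_zero (m : M) : τ.tmul N m 0 = 0 := τ.tmk_zero_right N m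

lemma tensor_d (m : M) (n : N) :
    (τ.tensor N).d (τ.tmul N m n) = τ.tmul N (τ.d m) n + τ.tmul N m (N.d n) :=
  (τ.exists_tensD N).choose_spec m n

variable {N}

/-- The map `id ⊗ f`. -/
def tensMap {N N' : DGModule B} (f : N →ₗ[B] N') : τ.tensor N →ₗ[A] τ.tensor N' :=
  (Submodule.mapQ _ _ (AlgebraTensorModule.map (LinearMap.id (R := A) (M := M))
    f.toAddMonoidHom.toIntLinearMap) (by
      rw [Submodule.span_le]
      rintro _ ⟨m, b, n, rfl⟩
      refine Submodule.subset_span ⟨m, b, f n, ?_⟩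
      simp) : τ.Tens N →ₗ[A] τ.Tens N')

lemma tensMap_tmul {N N' : DGModule B} (f : N →ₗ[B] N') (m : M) (n : N) :
    τ.tensMap f (τ.tmul N m n) = τ.tmul N' m (f n) := rfl

lemma tensor_hom_ext {N : DGModule B} {K : DGModule A} {f g : τ.tensor N →ₗ[A] K}
    (h : ∀ m n, f (τ.tmul N m n) = g (τ.tmul N m n)) : f = g :=
  LinearMap.ext fun z => τ.tensor_induction N (p := fun z => f z = g z) (by rw [map_zero, map_zero]) h
    (fun x y hx hy => by rw [map_add, map_add, hx, hy]) z

lemma tensMap_deg {N N' : DGModule B} {k : ℤ} {f : N →ₗ[B] N'} (hf : f ∈ DGModule.homDeg N N' k) :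
    τ.tensMap f ∈ DGModule.homDeg (τ.tensor N) (τ.tensor N') k := by
  intro g z hz
  have hle : τ.tensGr N g ≤
      ((τ.tensor N').gr (g + (k, 0))).comap (τ.tensMap f).toAddMonoidHom := by
    refine (AddSubgroup.closure_le _).2 ?_
    rintro _ ⟨i, j, m, n, hm, hn, rfl, rfl⟩
    change τ.tmk N' m (f n) ∈ τ.tensGr N' (i + j + (k, 0))
    rw [add_assoc]
    exact τ.tmk_mem N' hm (hf _ _ hn)
  exact hle hz

lemma dHom_tensMap {N N' : DGModule B} (f : N →ₗ[B] N') :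
    DGModule.dHom (τ.tensor N) (τ.tensor N') (τ.tensMap f) =
      τ.tensMap (DGModule.dHom N N' f) := by
  refine τ.tensor_hom_ext fun m n => ?_
  change (τ.tensor N').d (τ.tensMap f (τ.tmul N m n)) +
    τ.tensMap f ((τ.tensor N).d (τ.tmul N m n)) = τ.tmul N' m (N'.d (f n) + f (N.d n))
  rw [tensMap_tmul, tensor_d, tensor_d, map_add, tensMap_tmul, tensMap_tmul, tmul_add]
  have := (τ.tensor N').add_self (τ.tmul N' (τ.d m) (f n))
  calc _ = (τ.tmul N' (τ.d m) (f n) + τ.tmul N' (τ.d m) (f n)) +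
        (τ.tmul N' m (N'.d (f n)) + τ.tmul N' m (f (N.d n))) := by abel
    _ = _ := by rw [this, zero_add]

/-- The functor `M ⊗_B -` from `Z⁰(DG(B))` to `Z⁰(DG(A))`. -/
def tensorFunctor : DGModule B ⥤ DGModule A where
  obj N := τ.tensor N
  map {N N'} f := ⟨τ.tensMap f.1, τ.tensMap_deg f.2.1, by
    have h : DGModule.dHom N N' f.1 = 0 := f.2.2
    change DGModule.dHom (τ.tensor N) (τ.tensor N') (τ.tensMap f.1) = 0
    rw [dHom_tensMap, h]
    exact τ.tensor_hom_ext fun m n => τ.tmul_zero N' m⟩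
  map_id N := Subtype.ext (τ.tensor_hom_ext fun _ _ => rfl)
  map_comp {N N' N''} f g := Subtype.ext (τ.tensor_hom_ext fun _ _ => rfl)

/-- The functor `M ⊗_B -` from `H⁰(DG(B))` to `H⁰(DG(A))`. -/
def tensorH0 : H0DG B ⥤ H0DG A :=
  CategoryTheory.Quotient.lift _ (τ.tensorFunctor ⋙ CategoryTheory.Quotient.functor _) (by
    rintro N N' f g ⟨s, hs, e⟩
    refine CategoryTheory.Quotient.sound _ ⟨τ.tensMap s, τ.tensMap_deg hs, ?_⟩
    refine (τ.dHom_tensMap s).trans ?_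
    rw [e]
    exact τ.tensor_hom_ext fun m n => τ.tmul_sub N' m (f.1 n) (g.1 n))

/-- The functor `H⁰(DGP(B)) ⥤ H⁰(DGP(A))` induced by `M ⊗_B -`. -/
def tensorDGP {ι κ : Type} {P : ι → DGModule B} {Q : κ → DGModule A}
    (h : ∀ N, DGP P N → DGP Q (τ.tensor N)) : H0DGP P ⥤ H0DGP Q :=
  (DGP.property Q).lift ((DGP.property P).ι ⋙ τ.tensorH0) (fun X => h _ X.property)

end DGBimoduleStr

/-! ### The DG modules `A e` and DG algebras given by generators and relations -/

/-- The left DG module `A e`, for a closed element `e` of degree `0`. -/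
def DGModule.principal (A : QDGAlgebra) (e : A) (he : e ∈ A.gr 0) (hd : A.d e = 0) :
    DGModule A where
  carrier := Submodule.span A {e}
  gr g := (A.gr g).comap (Submodule.span A {e}).subtype.toAddMonoidHom
  internal := by
    obtain ⟨δ, hδ⟩ := exists_coaction A.internal
    refine internal_of_coaction' (Submodule.span A {e}).subtype.toAddMonoidHom
      Subtype.val_injective (δ.comp (Submodule.span A {e}).subtype.toAddMonoidHom)
      (fun g m hm => hδ g _ hm) ?_
    rintro ⟨m, hm⟩
    obtain ⟨a, rfl⟩ := Submodule.mem_span_singleton.1 hm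
    have key : ∀ a : A, (⟨a • e, Submodule.mem_span_singleton.2 ⟨a, rfl⟩⟩ : Submodule.span A {e}) ∈
        ⨆ g, (A.gr g).comap (Submodule.span A {e}).subtype.toAddMonoidHom := by
      intro a
      refine internal_induction (p := fun a =>
        (⟨a • e, Submodule.mem_span_singleton.2 ⟨a, rfl⟩⟩ : Submodule.span A {e}) ∈
        ⨆ g, (A.gr g).comap (Submodule.span A {e}).subtype.toAddMonoidHom) A.internal ?_ ?_ ?_ a
      · rw [show (⟨(0 : A) • e, Submodule.mem_span_singleton.2 ⟨0, rfl⟩⟩ :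
          Submodule.span A {e}) = 0 from Subtype.ext (zero_smul _ _)]
        exact zero_mem _
      · intro g a ha
        refine AddSubgroup.mem_iSup_of_mem g ?_
        have := A.mul_mem ha he
        rwa [add_zero] at this
      · intro a b ha hb
        convert add_mem ha hb
        simp [add_mul]
    exact key a
  smul_mem ha hm := A.mul_mem ha hm
  d := (A.d.comp (Submodule.span A {e}).subtype.toAddMonoidHom).codRestrict
    (Submodule.span A {e}).toAddSubgroup (by
      rintro ⟨m, hm⟩
      obtain ⟨a, rfl⟩ := Submodule.mem_span_singleton.1 hm
      change A.d (a * e) ∈ Submodule.span A {e}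
      rw [A.d_mul, hd, mul_zero, add_zero]
      exact Submodule.mem_span_singleton.2 ⟨_, rfl⟩)
  d_mem hm := A.d_mem hm
  d_d m := Subtype.ext (A.d_d _)
  d_smul a m := Subtype.ext (A.d_mul _ _)

/-- Data for a `q`-graded DG algebra over `𝔽₂` given by generators and relations: degrees of the
generators, values of the differential on the generators, and relations, such that the relations
are homogeneous and the differential is homogeneous of degree `(1, 0)`, respects the relations and
squares to `0`. -/
structure QDGPresentation (Gen : Type) where
  deg : Gen → ℤ × ℤ
  rel : FreeAlgebra (ZMod 2) Gen → FreeAlgebra (ZMod 2) Gen → Prop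
  diff : Gen → FreeAlgebra (ZMod 2) Gen

namespace QDGPresentation

variable {Gen : Type} (S : QDGPresentation Gen)

/-- The algebra with the given generators and relations. -/
abbrev Alg : Type := RingQuot S.rel

/-- The class of a generator. -/
def gen (x : Gen) : S.Alg := RingQuot.mkAlgHom (ZMod 2) S.rel (FreeAlgebra.ι _ x)

/-- The value of the differential on a generator. -/
def dgen (x : Gen) : S.Alg := RingQuot.mkAlgHom (ZMod 2) S.rel (S.diff x)

/-- The product of a word in the generators. -/
def word (l : List Gen) : S.Alg := (l.map S.gen).prod

/-- The degree of a word in the generators. -/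
def wdeg (l : List Gen) : ℤ × ℤ := (l.map S.deg).sum

/-- The degree `g` part: the span of the words of degree `g`. -/
def gr (g : ℤ × ℤ) : AddSubgroup S.Alg := AddSubgroup.closure {a | ∃ l, S.wdeg l = g ∧ a = S.word l}

/-- The algebra map to the group algebra of the group of degrees with `x ↦ x·T^deg(x)`. -/
def coact₀ : FreeAlgebra (ZMod 2) Gen →ₐ[ZMod 2] AddMonoidAlgebra S.Alg (ℤ × ℤ) :=
  FreeAlgebra.lift _ (fun x => AddMonoidAlgebra.single (S.deg x) (S.gen x))

/-- The algebra map to the dual numbers with `x ↦ x + ε d(x)`. -/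
def dual₀ : FreeAlgebra (ZMod 2) Gen →ₐ[ZMod 2] DualNumber S.Alg :=
  FreeAlgebra.lift _ (fun x => TrivSqZeroExt.inl (S.gen x) + TrivSqZeroExt.inr (S.dgen x))

/-- The conditions under which a presentation defines a `q`-graded DG algebra. -/
structure Valid : Prop where
  coact_rel : ∀ a b, S.rel a b → S.coact₀ a = S.coact₀ b
  dual_rel : ∀ a b, S.rel a b → S.dual₀ a = S.dual₀ b
  dgen_mem : ∀ x, S.dgen x ∈ S.gr (S.deg x + (1, 0))
  dd : ∀ x, (S.dual₀ (S.diff x)).snd = 0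

variable {S}

lemma alg_induction {p : S.Alg → Prop} (zero : p 0) (word : ∀ l, p (S.word l))
    (add : ∀ a b, p a → p b → p (a + b)) (a : S.Alg) : p a := by
  have hz2 : ∀ c : ZMod 2, c = 0 ∨ c = 1 := by decide
  have hmem : ∀ a : S.Alg, a ∈ AddSubmonoid.closure (Set.range S.word) := by
    intro a
    obtain ⟨b, rfl⟩ := RingQuot.mkAlgHom_surjective (ZMod 2) S.rel a
    clear a
    induction b using FreeAlgebra.induction with
    | grade0 c =>
      rcases hz2 c with rfl | rfl
      · simp
      · exact AddSubmonoid.subset_closure ⟨[], by simp [QDGPresentation.word]⟩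
    | grade1 x => exact AddSubmonoid.subset_closure ⟨[x], by simp [QDGPresentation.word, gen]⟩
    | mul a b ha hb =>
      rw [map_mul]
      generalize RingQuot.mkAlgHom (ZMod 2) S.rel a = u at ha ⊢
      generalize RingQuot.mkAlgHom (ZMod 2) S.rel b = v at hb ⊢
      induction ha using AddSubmonoid.closure_induction with
      | mem x hx =>
        obtain ⟨l, rfl⟩ := hx
        induction hb using AddSubmonoid.closure_induction with
        | mem y hy =>
          obtain ⟨l', rfl⟩ := hy
          exact AddSubmonoid.subset_closure ⟨l ++ l', by simp [QDGPresentation.word]⟩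
        | zero => rw [mul_zero]; exact zero_mem _
        | add x y _ _ hx hy => rw [mul_add]; exact add_mem hx hy
      | zero => rw [zero_mul]; exact zero_mem _
      | add x y _ _ hx hy => rw [add_mul]; exact add_mem hx hy
    | add a b ha hb => rw [map_add]; exact add_mem ha hb
  have := hmem a
  induction this using AddSubmonoid.closure_induction with
  | mem x hx => obtain ⟨l, rfl⟩ := hx; exact word l
  | zero => exact zero
  | add x y _ _ hx hy => exact add _ _ hx hy

lemma word_mem (l : List Gen) : S.word l ∈ S.gr (S.wdeg l) :=
  AddSubgroup.subset_closure ⟨l, rfl, rfl⟩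

lemma gen_mem (x : Gen) : S.gen x ∈ S.gr (S.deg x) := by
  have := word_mem (S := S) [x]
  simpa [word, wdeg] using this

lemma gr_mul_mem {g k : ℤ × ℤ} {a b : S.Alg} (ha : a ∈ S.gr g) (hb : b ∈ S.gr k) :
    a * b ∈ S.gr (g + k) := by
  have h₁ : ∀ l, S.gr k ≤ (S.gr (S.wdeg l + k)).comap (AddMonoidHom.mulLeft (S.word l)) := by
    intro l
    refine (AddSubgroup.closure_le _).2 ?_
    rintro _ ⟨l', rfl, rfl⟩
    exact AddSubgroup.subset_closure ⟨l ++ l', by simp [wdeg], by simp [word]⟩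
  have h₂ : S.gr g ≤ (S.gr (g + k)).comap (AddMonoidHom.mulRight b) := by
    refine (AddSubgroup.closure_le _).2 ?_
    rintro _ ⟨l, rfl, rfl⟩
    exact h₁ l hb
  exact h₂ ha

/-- The coaction of the group of degrees. -/
def coact (h : S.Valid) : S.Alg →ₐ[ZMod 2] AddMonoidAlgebra S.Alg (ℤ × ℤ) :=
  RingQuot.liftAlgHom _ ⟨S.coact₀, fun a b => h.coact_rel a b⟩

lemma coact_word (h : S.Valid) (l : List Gen) :
    coact h (S.word l) = AddMonoidAlgebra.single (S.wdeg l) (S.word l) := by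
  induction l with
  | nil => exact map_one (coact h)
  | cons x l ih =>
    have e1 : S.word (x :: l) = S.gen x * S.word l := by simp [word]
    have e2 : S.wdeg (x :: l) = S.deg x + S.wdeg l := by simp [wdeg]
    have e3 : coact h (S.gen x) = AddMonoidAlgebra.single (S.deg x) (S.gen x) := by
      rw [coact, gen, RingQuot.liftAlgHom_mkAlgHom_apply, coact₀, FreeAlgebra.lift_ι_apply, gen]
    rw [e1, e2, map_mul, ih, e3, AddMonoidAlgebra.single_mul_single]

lemma gr_internal (h : S.Valid) : DirectSum.IsInternal S.gr := by
  refine internal_of_coaction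
    (AddMonoidAlgebra.coeffAddEquiv.toAddMonoidHom.comp (coact h).toRingHom.toAddMonoidHom) ?_ ?_
  · intro g a ha
    change (coact h a).coeff = Finsupp.single g a
    induction ha using AddSubgroup.closure_induction with
    | mem x hx =>
      obtain ⟨l, rfl, rfl⟩ := hx
      rw [coact_word, AddMonoidAlgebra.coeff_single]
    | zero => simp
    | add x y _ _ hx hy => rw [map_add, AddMonoidAlgebra.coeff_add, hx, hy, Finsupp.single_add]
    | neg x _ hx => rw [map_neg, AddMonoidAlgebra.coeff_neg, hx, Finsupp.single_neg]
  · intro a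
    exact alg_induction (zero_mem _) (fun l => AddSubgroup.mem_iSup_of_mem _ (word_mem l))
      (fun _ _ => add_mem) a

/-- The algebra map `a ↦ a + ε d(a)`. -/
def dual (h : S.Valid) : S.Alg →ₐ[ZMod 2] DualNumber S.Alg :=
  RingQuot.liftAlgHom _ ⟨S.dual₀, fun a b => h.dual_rel a b⟩

lemma dual_mk (h : S.Valid) (a : FreeAlgebra (ZMod 2) Gen) :
    dual h (RingQuot.mkAlgHom (ZMod 2) S.rel a) = S.dual₀ a :=
  RingQuot.liftAlgHom_mkAlgHom_apply _ _ _ _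

lemma dual_gen (h : S.Valid) (x : Gen) :
    dual h (S.gen x) = TrivSqZeroExt.inl (S.gen x) + TrivSqZeroExt.inr (S.dgen x) := by
  rw [gen, dual_mk, dual₀, FreeAlgebra.lift_ι_apply, gen]

lemma fst_dual (h : S.Valid) (a : S.Alg) : (dual h a).fst = a := by
  refine alg_induction (p := fun a => (dual h a).fst = a) (by simp) ?_
    (fun x y hx hy => by rw [map_add, TrivSqZeroExt.fst_add, hx, hy]) a
  intro l
  induction l with
  | nil => simp [word]
  | cons x l ih =>
    have e1 : S.word (x :: l) = S.gen x * S.word l := by simp [word]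
    rw [e1, map_mul, TrivSqZeroExt.fst_mul, ih, dual_gen]
    simp

/-- The differential. -/
def diffHom (h : S.Valid) : S.Alg →+ S.Alg :=
  AddMonoidHom.mk' (fun a => (dual h a).snd) (fun a b => by rw [map_add, TrivSqZeroExt.snd_add])

lemma diffHom_mul (h : S.Valid) (a b : S.Alg) :
    diffHom h (a * b) = diffHom h a * b + a * diffHom h b := by
  change (dual h (a * b)).snd = (dual h a).snd * b + a * (dual h b).snd
  rw [map_mul, DualNumber.snd_mul, fst_dual, fst_dual, add_comm]

lemma diffHom_gen (h : S.Valid) (x : Gen) : diffHom h (S.gen x) = S.dgen x := by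
  change (dual h (S.gen x)).snd = _
  rw [dual_gen]
  simp

lemma diffHom_one (h : S.Valid) : diffHom h 1 = 0 := by
  change (dual h 1).snd = _
  simp

lemma alg_add_self (a : S.Alg) : a + a = 0 := by
  have h : (2 : ZMod 2) = 0 := by decide
  have := congrArg (fun c : ZMod 2 => c • a) h
  simpa [two_smul] using this

/-- The `q`-graded DG algebra with the given generators, relations, degrees and differential. -/
def toQDGAlgebra (S : QDGPresentation Gen) (h : S.Valid) : QDGAlgebra where
  carrier := S.Alg
  gr := S.gr
  internal := gr_internal h
  one_mem := word_mem (S := S) []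
  mul_mem := gr_mul_mem
  d := diffHom h
  d_mem {g a} ha := by
    have hle : S.gr g ≤ (S.gr (g + (1, 0))).comap (diffHom h) := by
      refine (AddSubgroup.closure_le _).2 ?_
      rintro _ ⟨l, rfl, rfl⟩
      change diffHom h (S.word l) ∈ S.gr (S.wdeg l + (1, 0))
      clear ha
      induction l with
      | nil =>
        change diffHom h 1 ∈ _
        rw [diffHom_one]; exact zero_mem _
      | cons x l ih =>
        have e1 : S.word (x :: l) = S.gen x * S.word l := by simp [word]
        have e2 : S.wdeg (x :: l) = S.deg x + S.wdeg l := by simp [wdeg]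
        rw [e1, e2, diffHom_mul, diffHom_gen]
        refine add_mem ?_ ?_
        · rw [add_right_comm]
          exact gr_mul_mem (h.dgen_mem x) (word_mem l)
        · rw [add_assoc]
          exact gr_mul_mem (gen_mem x) ih
    exact hle ha
  d_d a := by
    refine alg_induction (p := fun a => diffHom h (diffHom h a) = 0) (by simp) ?_
      (fun x y hx hy => by rw [map_add, map_add, hx, hy, add_zero]) a
    intro l
    induction l with
    | nil =>
      change diffHom h (diffHom h 1) = 0
      rw [diffHom_one, map_zero]
    | cons x l ih =>
      have e1 : S.word (x :: l) = S.gen x * S.word l := by simp [word]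
      have e2 : diffHom h (S.dgen x) = 0 := by
        change (dual h (S.dgen x)).snd = 0
        rw [dgen, dual_mk, h.dd]
      rw [e1, diffHom_mul, map_add, diffHom_mul, diffHom_mul, ih, diffHom_gen, e2, zero_mul,
        zero_add, mul_zero, add_zero, alg_add_self]
  d_mul := diffHom_mul h

end QDGPresentation

namespace QDGPresentation

variable {Gen : Type} {S : QDGPresentation Gen}

lemma mk_rel {a b : FreeAlgebra (ZMod 2) Gen} (h : S.rel a b) :
    RingQuot.mkAlgHom (ZMod 2) S.rel a = RingQuot.mkAlgHom (ZMod 2) S.rel b :=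
  RingQuot.mkAlgHom_rel _ h

lemma mk_ι_mul (x y : Gen) :
    RingQuot.mkAlgHom (ZMod 2) S.rel (FreeAlgebra.ι _ x * FreeAlgebra.ι _ y) =
      S.gen x * S.gen y := map_mul _ _ _

lemma coact₀_ι (x : Gen) :
    S.coact₀ (FreeAlgebra.ι _ x) = AddMonoidAlgebra.single (S.deg x) (S.gen x) := by
  rw [coact₀, FreeAlgebra.lift_ι_apply]

lemma coact₀_ι_mul (x y : Gen) :
    S.coact₀ (FreeAlgebra.ι _ x * FreeAlgebra.ι _ y) =
      AddMonoidAlgebra.single (S.deg x + S.deg y) (S.gen x * S.gen y) := by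
  rw [map_mul, coact₀_ι, coact₀_ι, AddMonoidAlgebra.single_mul_single]

lemma fst_dual₀ (a : FreeAlgebra (ZMod 2) Gen) :
    (S.dual₀ a).fst = RingQuot.mkAlgHom (ZMod 2) S.rel a := by
  have : (TrivSqZeroExt.fstHom (ZMod 2) S.Alg S.Alg).comp S.dual₀ =
      RingQuot.mkAlgHom (ZMod 2) S.rel := by
    ext x
    simp [dual₀, gen]
  exact DFunLike.congr_fun this a

lemma snd_dual₀_ι (x : Gen) : (S.dual₀ (FreeAlgebra.ι _ x)).snd = S.dgen x := by
  simp [dual₀]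

lemma snd_dual₀_mul (a b : FreeAlgebra (ZMod 2) Gen) :
    (S.dual₀ (a * b)).snd = (S.dual₀ a).snd * RingQuot.mkAlgHom (ZMod 2) S.rel b +
      RingQuot.mkAlgHom (ZMod 2) S.rel a * (S.dual₀ b).snd := by
  rw [map_mul, DualNumber.snd_mul, fst_dual₀, fst_dual₀, add_comm]

lemma snd_dual₀_ι_mul (x y : Gen) :
    (S.dual₀ (FreeAlgebra.ι _ x * FreeAlgebra.ι _ y)).snd =
      S.dgen x * S.gen y + S.gen x * S.dgen y := by
  rw [snd_dual₀_mul, snd_dual₀_ι, snd_dual₀_ι]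
  rfl

end QDGPresentation

/-! ### The quiver and the algebra `R_n` -/

/-- The vertices: decreasing sequences of integers between `n` and `0`, encoded as the subsets of
`{0, …, n}`. -/
abbrev Vtx (n : ℕ) : Type := ↥(Finset.range (n + 1)).powerset

namespace Vtx

/-- The subset of `{0, …, n}` consisting of the elements of `x` that are at most `n`. -/
def of (n : ℕ) (x : Finset ℕ) : Vtx n :=
  ⟨x.filter (· < n + 1), Finset.mem_powerset.2 fun a ha =>
    Finset.mem_range.2 (Finset.mem_filter.1 ha).2⟩

/-- The empty sequence. -/
def empty (n : ℕ) : Vtx n := of n ∅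

end Vtx

/-- There is an arrow `x → y` labelled by `s`: `y` is the disjoint union of `x` and `{s + 1, s}`. -/
def IsArrow {n : ℕ} (s : ℕ) (x y : Vtx n) : Prop :=
  s ∉ x.1 ∧ s + 1 ∉ x.1 ∧ y.1 = insert (s + 1) (insert s x.1)

instance {n : ℕ} (s : ℕ) (x y : Vtx n) : Decidable (IsArrow s x y) :=
  inferInstanceAs (Decidable (_ ∧ _ ∧ _))

/-- The generators `e(x)` and `r(x → y)` of `R_n`. -/
inductive RGen (n : ℕ) : Type
  | e (x : Vtx n) : RGen n
  | r (s : ℕ) (x y : Vtx n) (h : IsArrow s x y) : RGen n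

namespace RGen

variable {n : ℕ}

/-- The generators as elements of the free algebra. -/
abbrev E (x : Vtx n) : FreeAlgebra (ZMod 2) (RGen n) := FreeAlgebra.ι _ (e x)

/-- A generator as an element of the free algebra. -/
abbrev Ar {s : ℕ} {x y : Vtx n} (h : IsArrow s x y) : FreeAlgebra (ZMod 2) (RGen n) :=
  FreeAlgebra.ι _ (r s x y h)

/-- The relations of `R_n`. -/
inductive Rel (n : ℕ) :
    FreeAlgebra (ZMod 2) (RGen n) → FreeAlgebra (ZMod 2) (RGen n) → Prop
  | e_e (x : Vtx n) : Rel n (E x * E x) (E x)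
  | e_e' (x y : Vtx n) : x ≠ y → Rel n (E x * E y) 0
  | e_r {s : ℕ} {x y : Vtx n} (h : IsArrow s x y) : Rel n (E x * Ar h) (Ar h)
  | r_e {s : ℕ} {x y : Vtx n} (h : IsArrow s x y) : Rel n (Ar h * E y) (Ar h)
  | r_r {s t : ℕ} {x y z w : Vtx n} (h₁ : IsArrow s x y) (h₂ : IsArrow t y w)
      (h₃ : IsArrow t x z) (h₄ : IsArrow s z w) : Rel n (Ar h₁ * Ar h₂) (Ar h₃ * Ar h₄)
  | one : Rel n 1 (∑ x, E x)

/-- The degrees of the generators of `R_n`. -/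
def deg : RGen n → ℤ × ℤ
  | e _ => (0, 0)
  | r s _ _ _ => (0, n - 1 - 2 * s)

end RGen

/-- The presentation of `R_n`, with differential `0`. -/
def Rn.pres (n : ℕ) : QDGPresentation (RGen n) where
  deg := RGen.deg
  rel := RGen.Rel n
  diff := fun _ => 0

open QDGPresentation in
lemma Rn.valid (n : ℕ) : (Rn.pres n).Valid where
  coact_rel a b h := by
    have hm := mk_rel (S := Rn.pres n) h
    cases h with
    | e_e x =>
      erw [coact₀_ι_mul, coact₀_ι]
      exact congrArg₂ AddMonoidAlgebra.single (add_zero _) ((mk_ι_mul _ _).symm.trans hm)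
    | e_e' x y h =>
      erw [coact₀_ι_mul, map_zero]
      rw [show (Rn.pres n).gen (RGen.e x) * (Rn.pres n).gen (RGen.e y) = 0 from
        (mk_ι_mul _ _).symm.trans (hm.trans (map_zero _))]
      exact AddMonoidAlgebra.single_zero _
    | e_r h =>
      erw [coact₀_ι_mul, coact₀_ι]
      exact congrArg₂ AddMonoidAlgebra.single (zero_add _) ((mk_ι_mul _ _).symm.trans hm)
    | r_e h =>
      erw [coact₀_ι_mul, coact₀_ι]
      exact congrArg₂ AddMonoidAlgebra.single (add_zero _) ((mk_ι_mul _ _).symm.trans hm)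
    | r_r h₁ h₂ h₃ h₄ =>
      erw [coact₀_ι_mul, coact₀_ι_mul]
      exact congrArg₂ AddMonoidAlgebra.single (add_comm _ _)
                ((mk_ι_mul _ _).symm.trans (hm.trans (mk_ι_mul _ _)))
    | one =>
      have key : ∀ x : Vtx n, (Rn.pres n).coact₀ (RGen.E x) =
        AddMonoidAlgebra.single 0 ((Rn.pres n).gen (RGen.e x)) := fun x => coact₀_ι _
      rw [map_one, map_sum] at hm ⊢
      simp only [key]
      rw [AddMonoidAlgebra.one_def, hm]
      exact map_sum (AddMonoidAlgebra.singleAddHom (R := (Rn.pres n).Alg) (0 : ℤ × ℤ)) _ _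
  dual_rel a b h := by
    have key : ∀ a, ((Rn.pres n).dual₀ a).snd = 0 := by
      intro a
      induction a using FreeAlgebra.induction with
      | grade0 c => rw [AlgHom.commutes]; rfl
      | grade1 x =>
        rw [snd_dual₀_ι]
        exact map_zero _
      | mul a b ha hb => rw [snd_dual₀_mul, ha, hb, zero_mul, mul_zero, add_zero]
      | add a b ha hb => rw [map_add, TrivSqZeroExt.snd_add, ha, hb, add_zero]
    refine TrivSqZeroExt.ext ?_ ?_
    · rw [fst_dual₀, fst_dual₀]
      exact mk_rel h
    · rw [key, key]
  dgen_mem x := by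
    rw [show (Rn.pres n).dgen x = 0 from map_zero _]
    exact zero_mem _
  dd x := by
    rw [show (Rn.pres n).diff x = 0 from rfl, map_zero]
    rfl

/-- The `q`-graded DG algebra `R_n`, with differential `0`. -/
def Rn (n : ℕ) : QDGAlgebra := (Rn.pres n).toQDGAlgebra (Rn.valid n)

namespace Rn

variable {n : ℕ}

/-- The idempotent `e(x)`. -/
def e (x : Vtx n) : Rn n := (Rn.pres n).gen (RGen.e x)

/-- The generator `r(x → y)`. -/
def r {s : ℕ} {x y : Vtx n} (h : IsArrow s x y) : Rn n := (Rn.pres n).gen (RGen.r s x y h)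

lemma e_mem (x : Vtx n) : e x ∈ (Rn n).gr 0 := QDGPresentation.gen_mem (S := Rn.pres n) (RGen.e x)

lemma d_e (x : Vtx n) : (Rn n).d (e x) = 0 :=
  (QDGPresentation.diffHom_gen (Rn.valid n) (RGen.e x)).trans (map_zero _)

end Rn

/-- The DG module `P(x) = R_n e(x)`. -/
def PR (n : ℕ) (x : Vtx n) : DGModule (Rn n) :=
  DGModule.principal (Rn n) (Rn.e x) (Rn.e_mem x) (Rn.d_e x)

/-! ### The DG algebra `R_n ⊠ R_n` -/

/-- The generators of `R_n ⊠ R_n`: the idempotents `e(x, y)` and the arrows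
`l = r(x, y → x', y)`, `r = r(x, y → x, y')`, `b = r(x, y → x', y')`, whose labels are `(s, ∅)`,
`(∅, t)` and `(s, s + 1)`. -/
inductive BGen (n : ℕ) : Type
  | e (x y : Vtx n) : BGen n
  | l (s : ℕ) (x x' : Vtx n) (h : IsArrow s x x') (y : Vtx n) : BGen n
  | r (x : Vtx n) (t : ℕ) (y y' : Vtx n) (k : IsArrow t y y') : BGen n
  | b (s : ℕ) (x x' y y' : Vtx n) (h : IsArrow s x x') (k : IsArrow (s + 1) y y') : BGen n

namespace BGen

variable {n : ℕ}

/-- The generators as elements of the free algebra. -/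
abbrev E (x y : Vtx n) : FreeAlgebra (ZMod 2) (BGen n) := FreeAlgebra.ι _ (e x y)

/-- A generator as an element of the free algebra. -/
abbrev L {s : ℕ} {x x' : Vtx n} (h : IsArrow s x x') (y : Vtx n) :
    FreeAlgebra (ZMod 2) (BGen n) := FreeAlgebra.ι _ (l s x x' h y)

/-- A generator as an element of the free algebra. -/
abbrev R (x : Vtx n) {t : ℕ} {y y' : Vtx n} (k : IsArrow t y y') :
    FreeAlgebra (ZMod 2) (BGen n) := FreeAlgebra.ι _ (r x t y y' k)

/-- A generator as an element of the free algebra. -/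
abbrev B {s : ℕ} {x x' y y' : Vtx n} (h : IsArrow s x x') (k : IsArrow (s + 1) y y') :
    FreeAlgebra (ZMod 2) (BGen n) := FreeAlgebra.ι _ (b s x x' y y' h k)

/-- The relations of `R_n ⊠ R_n`. -/
inductive Rel (n : ℕ) :
    FreeAlgebra (ZMod 2) (BGen n) → FreeAlgebra (ZMod 2) (BGen n) → Prop
  | e_e (x y : Vtx n) : Rel n (E x y * E x y) (E x y)
  | e_e' (x y x' y' : Vtx n) : ¬ (x = x' ∧ y = y') → Rel n (E x y * E x' y') 0
  | e_l {s : ℕ} {x x' : Vtx n} (h : IsArrow s x x') (y : Vtx n) : Rel n (E x y * L h y) (L h y)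
  | l_e {s : ℕ} {x x' : Vtx n} (h : IsArrow s x x') (y : Vtx n) : Rel n (L h y * E x' y) (L h y)
  | e_r (x : Vtx n) {t : ℕ} {y y' : Vtx n} (k : IsArrow t y y') : Rel n (E x y * R x k) (R x k)
  | r_e (x : Vtx n) {t : ℕ} {y y' : Vtx n} (k : IsArrow t y y') : Rel n (R x k * E x y') (R x k)
  | e_b {s : ℕ} {x x' y y' : Vtx n} (h : IsArrow s x x') (k : IsArrow (s + 1) y y') :
      Rel n (E x y * B h k) (B h k)
  | b_e {s : ℕ} {x x' y y' : Vtx n} (h : IsArrow s x x') (k : IsArrow (s + 1) y y') :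
      Rel n (B h k * E x' y') (B h k)
  | r_r (x : Vtx n) {s t : ℕ} {y y₁ y₂ y₃ : Vtx n} (k₁ : IsArrow s y y₁) (k₂ : IsArrow t y₁ y₃)
      (k₃ : IsArrow t y y₂) (k₄ : IsArrow s y₂ y₃) : Rel n (R x k₁ * R x k₂) (R x k₃ * R x k₄)
  | l_l {s t : ℕ} {x x₁ x₂ x₃ : Vtx n} (h₁ : IsArrow s x x₁) (h₂ : IsArrow t x₁ x₃)
      (h₃ : IsArrow t x x₂) (h₄ : IsArrow s x₂ x₃) (y : Vtx n) :
      Rel n (L h₁ y * L h₂ y) (L h₃ y * L h₄ y)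
  | l_r {s t : ℕ} {x x' y y' : Vtx n} (h : IsArrow s x x') (k : IsArrow t y y') : t ≠ s + 1 →
      Rel n (L h y * R x' k) (R x k * L h y')
  | b_r {s t : ℕ} {x x₁ y y₁ y₂ y₃ : Vtx n} (h : IsArrow s x x₁) (k₁ : IsArrow (s + 1) y y₁)
      (k₂ : IsArrow t y₁ y₃) (k₃ : IsArrow t y y₂) (k₄ : IsArrow (s + 1) y₂ y₃) :
      Rel n (B h k₁ * R x₁ k₂) (R x k₃ * B h k₄)
  | b_l {s t : ℕ} {x x₁ x₂ x₃ y y₁ : Vtx n} (h₁ : IsArrow s x x₁) (k : IsArrow (s + 1) y y₁)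
      (h₂ : IsArrow t x₁ x₃) (h₃ : IsArrow t x x₂) (h₄ : IsArrow s x₂ x₃) :
      Rel n (B h₁ k * L h₂ y₁) (L h₃ y * B h₄ k)
  | b_b {s t : ℕ} {x x₁ x₂ x₃ y y₁ y₂ y₃ : Vtx n}
      (h₁ : IsArrow s x x₁) (k₁ : IsArrow (s + 1) y y₁)
      (h₂ : IsArrow t x₁ x₃) (k₂ : IsArrow (t + 1) y₁ y₃)
      (h₃ : IsArrow t x x₂) (k₃ : IsArrow (t + 1) y y₂)
      (h₄ : IsArrow s x₂ x₃) (k₄ : IsArrow (s + 1) y₂ y₃) :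
      Rel n (B h₁ k₁ * B h₂ k₂) (B h₃ k₃ * B h₄ k₄)
  | one : Rel n 1 (∑ x, ∑ y, E x y)

/-- The degrees of the generators of `R_n ⊠ R_n`. -/
def deg : BGen n → ℤ × ℤ
  | e _ _ => (0, 0)
  | l s _ _ _ _ => (0, n - 1 - 2 * s)
  | r _ t _ _ _ => (0, n - 1 - 2 * t)
  | b s _ _ _ _ _ _ => (-1, (n - 1 - 2 * s) + (n - 1 - 2 * (s + 1)))

/-- The differentials of the generators of `R_n ⊠ R_n`. -/
def diff : BGen n → FreeAlgebra (ZMod 2) (BGen n)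
  | e _ _ => 0
  | l _ _ _ _ _ => 0
  | r _ _ _ _ _ => 0
  | b _ x x' y y' h k => L h y * R x' k + R x k * L h y'

end BGen

/-- The presentation of `R_n ⊠ R_n`. -/
def RBox.pres (n : ℕ) : QDGPresentation (BGen n) where
  deg := BGen.deg
  rel := BGen.Rel n
  diff := BGen.diff

namespace RBox

variable {n : ℕ}

/-- The generators of `R_n ⊠ R_n` in the quotient algebra. -/
abbrev g (x : BGen n) : (RBox.pres n).Alg := (RBox.pres n).gen x

lemma dgen_b {s : ℕ} {x x' y y' : Vtx n} (h : IsArrow s x x') (k : IsArrow (s + 1) y y') :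
    (RBox.pres n).dgen (.b s x x' y y' h k) =
      g (.l s x x' h y) * g (.r x' _ y y' k) + g (.r x _ y y' k) * g (.l s x x' h y') := by
  change RingQuot.mkAlgHom (ZMod 2) _ (_ * _ + _ * _) = _
  rw [map_add, map_mul, map_mul]
  rfl

lemma dgen_e (x y : Vtx n) : (RBox.pres n).dgen (.e x y) = 0 := map_zero _

lemma dgen_l {s : ℕ} {x x' : Vtx n} (h : IsArrow s x x') (y : Vtx n) :
    (RBox.pres n).dgen (.l s x x' h y) = 0 := map_zero _

lemma dgen_r (x : Vtx n) {t : ℕ} {y y' : Vtx n} (k : IsArrow t y y') :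
    (RBox.pres n).dgen (.r x t y y' k) = 0 := map_zero _

lemma rel_mul {a b c d : BGen n}
    (h : BGen.Rel n (FreeAlgebra.ι _ a * FreeAlgebra.ι _ b)
      (FreeAlgebra.ι _ c * FreeAlgebra.ι _ d)) : g a * g b = g c * g d :=
  (QDGPresentation.mk_ι_mul _ _).symm.trans
    ((QDGPresentation.mk_rel (S := RBox.pres n) h).trans (QDGPresentation.mk_ι_mul _ _))

lemma rel_mul' {a b c : BGen n}
    (h : BGen.Rel n (FreeAlgebra.ι _ a * FreeAlgebra.ι _ b) (FreeAlgebra.ι _ c)) :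
    g a * g b = g c :=
  (QDGPresentation.mk_ι_mul _ _).symm.trans (QDGPresentation.mk_rel (S := RBox.pres n) h)

lemma label_ne {s t : ℕ} {y y₁ y₂ : Vtx n} (k : IsArrow s y y₁) (k' : IsArrow t y₁ y₂) :
    t ≠ s ∧ t + 1 ≠ s ∧ t ≠ s + 1 := by
  obtain ⟨_, _, e⟩ := k
  obtain ⟨h1, h2, _⟩ := k'
  rw [e] at h1 h2
  simp only [Finset.mem_insert, not_or] at h1 h2
  omega

/-- Compatibility of the differential with the relation `b_b` on one factor. -/
lemma db_b {s t : ℕ} {x x₁ x₂ x₃ y y₁ y₂ y₃ : Vtx n}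
    (h₁ : IsArrow s x x₁) (k₁ : IsArrow (s + 1) y y₁)
    (h₂ : IsArrow t x₁ x₃) (k₂ : IsArrow (t + 1) y₁ y₃)
    (h₃ : IsArrow t x x₂) (k₃ : IsArrow (t + 1) y y₂)
    (h₄ : IsArrow s x₂ x₃) (k₄ : IsArrow (s + 1) y₂ y₃) :
    (RBox.pres n).dgen (.b s x x₁ y y₁ h₁ k₁) * g (.b t x₁ x₃ y₁ y₃ h₂ k₂) =
      g (.b t x x₂ y y₂ h₃ k₃) * (RBox.pres n).dgen (.b s x₂ x₃ y₂ y₃ h₄ k₄) := by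
  rw [dgen_b, dgen_b, add_mul, mul_add]
  refine congrArg₂ _ ?_ ?_
  · rw [mul_assoc, ← rel_mul (.b_r h₂ k₃ k₄ k₁ k₂), ← mul_assoc,
      ← rel_mul (.b_l h₃ k₃ h₄ h₁ h₂), mul_assoc]
  · rw [mul_assoc, ← rel_mul (.b_l h₃ k₂ h₄ h₁ h₂), ← mul_assoc,
      ← rel_mul (.b_r h₃ k₃ k₄ k₁ k₂), mul_assoc]

open QDGPresentation in
lemma valid (n : ℕ) : (RBox.pres n).Valid where
  coact_rel a b h := by
    have hm := mk_rel (S := RBox.pres n) h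
    have mm : ∀ (a b : BGen n), (RBox.pres n).coact₀ (FreeAlgebra.ι _ a * FreeAlgebra.ι _ b) =
      AddMonoidAlgebra.single (a.deg + b.deg) (g a * g b) := coact₀_ι_mul (S := RBox.pres n)
    have m1 : ∀ (a : BGen n), (RBox.pres n).coact₀ (FreeAlgebra.ι _ a) =
      AddMonoidAlgebra.single a.deg (g a) := coact₀_ι (S := RBox.pres n)
    cases h with
    | e_e' x y x' y' h =>
      rw [mm, map_zero, show g (.e x y) * g (.e x' y') = 0 from
        (mk_ι_mul _ _).symm.trans (hm.trans (map_zero _))]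
      exact AddMonoidAlgebra.single_zero _
    | one =>
      have key : ∀ x y : Vtx n, (RBox.pres n).coact₀ (BGen.E x y) =
        AddMonoidAlgebra.singleAddHom (R := (RBox.pres n).Alg) (0 : ℤ × ℤ) (g (.e x y)) :=
        fun x y => m1 _
      simp only [map_one, map_sum] at hm ⊢
      simp only [key, ← map_sum]
      rw [AddMonoidAlgebra.one_def, hm]
      rfl
    | e_e x y => rw [mm, m1]; exact congrArg₂ AddMonoidAlgebra.single (add_zero _) ((mk_ι_mul _ _).symm.trans hm)
    | e_l h y => rw [mm, m1]; exact congrArg₂ AddMonoidAlgebra.single (zero_add _) ((mk_ι_mul _ _).symm.trans hm)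
    | l_e h y => rw [mm, m1]; exact congrArg₂ AddMonoidAlgebra.single (add_zero _) ((mk_ι_mul _ _).symm.trans hm)
    | e_r x k => rw [mm, m1]; exact congrArg₂ AddMonoidAlgebra.single (zero_add _) ((mk_ι_mul _ _).symm.trans hm)
    | r_e x k => rw [mm, m1]; exact congrArg₂ AddMonoidAlgebra.single (add_zero _) ((mk_ι_mul _ _).symm.trans hm)
    | e_b h k => rw [mm, m1]; exact congrArg₂ AddMonoidAlgebra.single (zero_add _) ((mk_ι_mul _ _).symm.trans hm)
    | b_e h k => rw [mm, m1]; exact congrArg₂ AddMonoidAlgebra.single (add_zero _) ((mk_ι_mul _ _).symm.trans hm)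
    | r_r =>
      rw [mm, mm]
      exact congrArg₂ AddMonoidAlgebra.single (add_comm _ _)
        ((mk_ι_mul _ _).symm.trans (hm.trans (mk_ι_mul _ _)))
    | l_l =>
      rw [mm, mm]
      exact congrArg₂ AddMonoidAlgebra.single (add_comm _ _)
        ((mk_ι_mul _ _).symm.trans (hm.trans (mk_ι_mul _ _)))
    | l_r =>
      rw [mm, mm]
      exact congrArg₂ AddMonoidAlgebra.single (add_comm _ _)
        ((mk_ι_mul _ _).symm.trans (hm.trans (mk_ι_mul _ _)))
    | b_r =>
      rw [mm, mm]
      exact congrArg₂ AddMonoidAlgebra.single (add_comm _ _)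
        ((mk_ι_mul _ _).symm.trans (hm.trans (mk_ι_mul _ _)))
    | b_l =>
      rw [mm, mm]
      exact congrArg₂ AddMonoidAlgebra.single (add_comm _ _)
        ((mk_ι_mul _ _).symm.trans (hm.trans (mk_ι_mul _ _)))
    | b_b =>
      rw [mm, mm]
      exact congrArg₂ AddMonoidAlgebra.single (add_comm _ _)
        ((mk_ι_mul _ _).symm.trans (hm.trans (mk_ι_mul _ _)))
  dual_rel a b h := by
    refine TrivSqZeroExt.ext ?_ ?_
    · rw [fst_dual₀, fst_dual₀]
      exact mk_rel h
    have mm : ∀ (a b : BGen n),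
      ((RBox.pres n).dual₀ (FreeAlgebra.ι _ a * FreeAlgebra.ι _ b)).snd =
        (RBox.pres n).dgen a * g b + g a * (RBox.pres n).dgen b :=
      snd_dual₀_ι_mul (S := RBox.pres n)
    have m1 : ∀ (a : BGen n), ((RBox.pres n).dual₀ (FreeAlgebra.ι _ a)).snd =
      (RBox.pres n).dgen a := snd_dual₀_ι (S := RBox.pres n)
    cases h with
    | one =>
      have key : ∀ x y : Vtx n, (RBox.pres n).dual₀ (BGen.E x y) =
          TrivSqZeroExt.inl (g (.e x y)) := fun x y => by
        refine TrivSqZeroExt.ext (fst_dual₀ _) ((m1 _).trans (map_zero _))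
      simp only [map_one, map_sum, key, TrivSqZeroExt.snd_one, TrivSqZeroExt.snd_sum,
        TrivSqZeroExt.snd_inl, Finset.sum_const_zero]
    | e_e' x y x' y' h => rw [mm]; simp [dgen_e]
    | e_e x y => rw [mm, m1]; simp [dgen_e]
    | e_l h y => rw [mm, m1]; simp [dgen_e, dgen_l]
    | l_e h y => rw [mm, m1]; simp [dgen_e, dgen_l]
    | e_r x k => rw [mm, m1]; simp [dgen_e, dgen_r]
    | r_e x k => rw [mm, m1]; simp [dgen_e, dgen_r]
    | e_b h k =>
      rw [mm, m1, dgen_e, zero_mul, zero_add, dgen_b, mul_add, ← mul_assoc, ← mul_assoc,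
        rel_mul' (.e_l _ _), rel_mul' (.e_r _ _)]
    | b_e h k =>
      rw [mm, m1, dgen_e, mul_zero, add_zero, dgen_b, add_mul, mul_assoc, mul_assoc,
        rel_mul' (.l_e _ _), rel_mul' (.r_e _ _)]
    | r_r => rw [mm, mm]; simp [dgen_r]
    | l_l => rw [mm, mm]; simp [dgen_l]
    | l_r => rw [mm, mm]; simp [dgen_l, dgen_r]
    | b_r h k₁ k₂ k₃ k₄ =>
      rw [mm, mm, dgen_r, dgen_r, mul_zero, zero_mul, add_zero, zero_add, dgen_b, dgen_b, add_mul,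
        mul_add]
      have hne := (label_ne k₁ k₂).1
      refine congrArg₂ _ ?_ ?_
      · rw [mul_assoc, rel_mul (.r_r _ k₁ k₂ k₃ k₄), ← mul_assoc, rel_mul (.l_r h k₃ hne),
          mul_assoc]
      · rw [mul_assoc, rel_mul (.l_r h k₂ hne), ← mul_assoc, rel_mul (.r_r _ k₁ k₂ k₃ k₄),
          mul_assoc]
    | b_l h₁ k h₂ h₃ h₄ =>
      rw [mm, mm, dgen_l, dgen_l, mul_zero, zero_mul, add_zero, zero_add, dgen_b, dgen_b, add_mul,
        mul_add]
      have hne : _ + 1 ≠ _ + 1 := fun e => (label_ne h₁ h₂).1 (Nat.succ.inj e).symm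
      refine congrArg₂ _ ?_ ?_
      · rw [mul_assoc, ← rel_mul (.l_r h₂ k hne), ← mul_assoc, rel_mul (.l_l h₁ h₂ h₃ h₄ _),
          mul_assoc]
      · rw [mul_assoc, rel_mul (.l_l h₁ h₂ h₃ h₄ _), ← mul_assoc, ← rel_mul (.l_r h₃ k hne),
          mul_assoc]
    | b_b h₁ k₁ h₂ k₂ h₃ k₃ h₄ k₄ =>
      rw [mm, mm, db_b h₁ k₁ h₂ k₂ h₃ k₃ h₄ k₄, db_b h₃ k₃ h₄ k₄ h₁ k₁ h₂ k₂, add_comm]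
  dgen_mem x := by
    cases x with
    | e x y => rw [dgen_e]; exact zero_mem _
    | l s x x' h y => rw [dgen_l]; exact zero_mem _
    | r x t y y' k => rw [dgen_r]; exact zero_mem _
    | b s x x' y y' h k =>
      rw [dgen_b]
      have hd : ∀ a b : BGen n, a.deg + b.deg = (BGen.b s x x' y y' h k).deg + (1, 0) →
          g a * g b ∈ (RBox.pres n).gr ((BGen.b s x x' y y' h k).deg + (1, 0)) := by
        intro a b e
        rw [← e]
        exact gr_mul_mem (gen_mem (S := RBox.pres n) a) (gen_mem (S := RBox.pres n) b)
      refine add_mem (hd _ _ ?_) (hd _ _ ?_)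
      · simp [BGen.deg]
      · simp [BGen.deg]; ring
  dd x := by
    have mm : ∀ (a b : BGen n),
      ((RBox.pres n).dual₀ (FreeAlgebra.ι _ a * FreeAlgebra.ι _ b)).snd =
        (RBox.pres n).dgen a * g b + g a * (RBox.pres n).dgen b :=
      snd_dual₀_ι_mul (S := RBox.pres n)
    have z : ((RBox.pres n).dual₀ 0).snd = 0 := by rw [map_zero]; rfl
    cases x with
    | e x y => exact z
    | l s x x' h y => exact z
    | r x t y y' k => exact z
    | b s x x' y y' h k =>
      change ((RBox.pres n).dual₀ (_ * _ + _ * _)).snd = 0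
      rw [map_add, TrivSqZeroExt.snd_add, mm, mm]
      simp [dgen_l, dgen_r]

end RBox

/-- The `q`-graded DG algebra `R_n ⊠ R_n`. -/
def RBox (n : ℕ) : QDGAlgebra := (RBox.pres n).toQDGAlgebra (RBox.valid n)

namespace RBox

variable {n : ℕ}

/-- The generators of `R_n ⊠ R_n`. -/
def gen (x : BGen n) : RBox n := (RBox.pres n).gen x

lemma e_mem (x y : Vtx n) : gen (.e x y) ∈ (RBox n).gr 0 :=
  QDGPresentation.gen_mem (S := RBox.pres n) (.e x y)

lemma d_e (x y : Vtx n) : (RBox n).d (gen (.e x y)) = 0 :=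
  (QDGPresentation.diffHom_gen (RBox.valid n) (.e x y)).trans (map_zero _)

end RBox

/-- The DG module `P(x, y) = (R_n ⊠ R_n) e(x, y)`. -/
def PBox (n : ℕ) (p : Vtx n × Vtx n) : DGModule (RBox n) :=
  DGModule.principal (RBox n) (RBox.gen (.e p.1 p.2)) (RBox.e_mem p.1 p.2) (RBox.d_e p.1 p.2)

/-! ### The higher multiplication -/

section Multiplication

open LaurentPolynomial

variable {n : ℕ}

/-- The set of the `s` with `s ∈ x` and `s + 1 ∈ y`, which labels the adjacent increasing pairs. -/
def adj (x y : Vtx n) : Finset ℕ := x.1.filter (fun s => s + 1 ∈ y.1)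

/-- The list `s₁ > s₂ > ⋯ > s_p` of the elements of `adj x y`. -/
def adjList (x y : Vtx n) : List ℕ := (adj x y).sort (· ≥ ·)

/-- The sequence consisting of the `a ∈ x` with `lo + 1 ≤ a < hi` and the `b ∈ y` with
`lo + 1 < b ≤ hi`, or `none` (which stands for `0`) if it has repetitions. If `lo` or `hi` is `none`,
it is read as `-∞` or `+∞` respectively. -/
def alpha (x y : Vtx n) (lo hi : Option ℕ) : Option (Vtx n) :=
  let u := x.1.filter (fun a => (∀ s ∈ lo, s + 1 ≤ a) ∧ ∀ s ∈ hi, a < s)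
  let v := y.1.filter (fun b => (∀ s ∈ lo, s + 1 < b) ∧ ∀ s ∈ hi, b ≤ s)
  if Disjoint u v then some (Vtx.of n (u ∪ v)) else none

/-- The list `α₀, β(s₁), α₁, …, β(s_p), α_p`, where `α_i = α s_{i+1} s_i`; the second argument is
`s₀` and the third is the list of `s₁, …, s_p`. -/
def factors {F : Type} (α : Option ℕ → Option ℕ → F) (β : ℕ → F) : Option ℕ → List ℕ → List F
  | hi, [] => [α none hi]
  | hi, s :: l => α (some s) hi :: β s :: factors α β (some s) l

/-- The gluing of two sequences: their concatenation if that is decreasing, otherwise `none`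
(which stands for `0`). -/
def glue (x y : Vtx n) : Option (Vtx n) :=
  if ∀ a ∈ x.1, ∀ b ∈ y.1, b < a then some (Vtx.of n (x.1 ∪ y.1)) else none

/-- The cohomological shift `μ(x, y)`. -/
def mu (x y : Vtx n) : ℤ :=
  ∑ a ∈ x.1, ∑ b ∈ y.1, if a + 1 < b then (-1) ^ (a + b + 1) else 0

/-- A vertex or `0`, as an element of the free module on the vertices. -/
def vec (S : Type) [CommRing S] (o : Option (Vtx n)) : Vtx n →₀ S :=
  o.elim 0 (fun x => Finsupp.single x 1)

/-- The bilinear map with the given values on the basis vectors. -/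
def bilin {S : Type} [CommRing S] (f : Vtx n → Vtx n → (Vtx n →₀ S)) :
    (Vtx n →₀ S) →ₗ[S] (Vtx n →₀ S) →ₗ[S] (Vtx n →₀ S) :=
  Finsupp.lift _ S _ (fun x => Finsupp.lift _ S _ (fun y => f x y))

/-- The gluing map `G_k` of the elements of a list, over `ℤ[q^{±1}][h^{±1}]`. -/
def glueList (l : List (Vtx n →₀ ℤ[T;T⁻¹][T;T⁻¹])) : Vtx n →₀ ℤ[T;T⁻¹][T;T⁻¹] :=
  l.foldr (fun v w => bilin (fun x y => vec _ (glue x y)) v w) (Finsupp.single (Vtx.empty n) 1)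

/-- `β(s) = q^{2s+1-n} [∅] + h [s + 1, s]`. -/
def beta (n : ℕ) (s : ℕ) : Vtx n →₀ ℤ[T;T⁻¹][T;T⁻¹] :=
  Finsupp.single (Vtx.empty n) (C (T (2 * s + 1 - n))) +
    Finsupp.single (Vtx.of n {s + 1, s}) (T 1)

/-- The higher multiplication `M` on the basis vectors, with values in the free module over
`ℤ[q^{±1}][h^{±1}]`. -/
def higherMul (x y : Vtx n) : Vtx n →₀ ℤ[T;T⁻¹][T;T⁻¹] :=
  (T (mu x y) : ℤ[T;T⁻¹][T;T⁻¹]) •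
    glueList (factors (fun lo hi => vec _ (alpha x y lo hi)) (beta n) none (adjList x y))

/-- The specialization `h = -1`. -/
def specialize : ℤ[T;T⁻¹][T;T⁻¹] →+* ℤ[T;T⁻¹] :=
  LaurentPolynomial.eval₂ (RingHom.id _) (-1)

/-- The multiplication `m` on the basis vectors: the specialization of `M` to `h = -1`. -/
def mulVtx (x y : Vtx n) : Vtx n →₀ ℤ[T;T⁻¹] :=
  (higherMul x y).mapRange specialize (map_zero _)

/-! ### The bimodule `T_n` -/

/-- The gluing of two sequences or `0`. -/
def glueOpt (u v : Option (Vtx n)) : Option (Vtx n) := u.bind fun x => v.bind fun y => glue x y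

/-- `M_A(x, y)`, where the index set `A` is given as a set of elements of `adj x y` instead of a
set of indices of such elements. -/
def compMul (x y : Vtx n) (A : Finset ℕ) : Option (Vtx n) :=
  (factors (alpha x y) (fun s => some (if s ∈ A then Vtx.of n {s + 1, s} else Vtx.empty n))
    none (adjList x y)).foldr glueOpt (some (Vtx.empty n))

/-- The index set of the summands of `T_n`: the triples `x`, `y`, `A ⊆ adj x y`. -/
abbrev TIdx (n : ℕ) : Type := Σ p : Vtx n × Vtx n, ↥(adj p.1 p.2).powerset

namespace TIdx

/-- The vertex `x` of `i = (x, y, A)`. -/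
abbrev x (i : TIdx n) : Vtx n := i.1.1

/-- The vertex `y` of `i = (x, y, A)`. -/
abbrev y (i : TIdx n) : Vtx n := i.1.2

/-- The index set `A` of `i = (x, y, A)`. -/
abbrev A (i : TIdx n) : Finset ℕ := i.2.1

/-- `M_A(x, y)` for `i = (x, y, A)`. -/
def M (i : TIdx n) : Option (Vtx n) := compMul i.x i.y i.A

/-- The cohomological degree `k = μ(x, y) + |A|` of a summand. -/
def k (i : TIdx n) : ℤ := mu i.x i.y + i.A.card

/-- The `q`-shift `η(A)` of a summand. -/
def eta (i : TIdx n) : ℤ := ∑ s ∈ adj i.x i.y \ i.A, (2 * (s : ℤ) + 1 - n)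

end TIdx

/-- The idempotent of a vertex, and `0` for `0`. -/
def idem : Option (Vtx n) → Rn n
  | none => 0
  | some x => Rn.e x

lemma idem_mem (o : Option (Vtx n)) : idem o ∈ (Rn n).gr 0 := by
  cases o with
  | none => exact zero_mem _
  | some x => exact Rn.e_mem x

lemma d_idem (o : Option (Vtx n)) : (Rn n).d (idem o) = 0 := by
  cases o with
  | none => exact map_zero _
  | some x => exact Rn.d_e x

/-- `P(x)` for a vertex `x`, and `P(0) = 0`. -/
def POpt (o : Option (Vtx n)) : DGModule (Rn n) :=
  DGModule.principal (Rn n) (idem o) (idem_mem o) (d_idem o)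

/-- The generator `r(u → v)` with label `s` if there is such an arrow, otherwise `0`. -/
def rOpt (s : ℕ) : Option (Vtx n) → Option (Vtx n) → Rn n
  | some u, some v => if h : IsArrow s u v then Rn.r h else 0
  | _, _ => 0

/-- The left module underlying `T_n`: the direct sum of the `P(M_A(x, y)){η(A)}`, placed in
cohomological degree `μ(x, y) + |A|`. -/
def TMod (n : ℕ) : GrModule (Rn n) :=
  GrModule.pi (fun i : TIdx n => (POpt i.M).toGrModule.shift (-i.k, i.eta))

/-- The component in `P(M_A(x, y)) ⊆ R_n` of an element of `T_n`. -/
def TMod.comp (m : TMod n) (i : TIdx n) : Rn n :=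
  ((m i : POpt i.M) : Submodule.span (Rn n) {idem i.M}).1

/-- The matrix of the differential of `T_n`: the component from the summand `i = (x, y, A)` to the
summand `j = (x, y, B)` is right multiplication by `r(M_A → M_B)` if `B = A ⊔ {s}`. -/
def TMod.dMat (i j : TIdx n) : Rn n :=
  if i.1 = j.1 then
    ∑ s ∈ adj i.x i.y, if s ∉ i.A ∧ j.A = insert s i.A then rOpt s i.M j.M else 0
  else 0

/-- The matrix of the right multiplication by a generator of `R_n ⊠ R_n` on `T_n`: it maps the
summand `i` to the summand `j` through the right multiplication by `actMat g i j`.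
* `e(x, y)` is the projection to the summands of `x`, `y`.
* `r(x, y → x, y')` with label `(∅, t)` maps the summand of `x, y, A` to the one of `x, y', A'`,
  where `A' = A ∪ {t - 1}` if `t - 1 ∈ x` and `A' = A` otherwise, through `r(M_A → M_{A'})` if
  `t ∉ x`, and through the identity of `M_A = M_{A'}` if `t ∈ x`.
* `r(x, y → x', y)` with label `(t, ∅)` maps the summand of `x, y, A` to the one of `x', y, A'`,
  where `A' = A ∪ {t + 1}` if `t + 2 ∈ y` and `A' = A` otherwise, through `r(M_A → M_{A'})` if
  `t + 1 ∉ y`, and through the identity of `M_A = M_{A'}` if `t + 1 ∈ y`.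
* `r(x, y → x', y')` with label `(t, t + 1)` maps the summand of `x, y, A` to the one of
  `x', y', A` through the identity of `M_A`. -/
def TMod.actMat : BGen n → TIdx n → TIdx n → Rn n
  | .e x y, i, j => if i.1 = (x, y) ∧ i = j then idem j.M else 0
  | .r x t y y' _, i, j =>
    if i.1 = (x, y) ∧ j.1 = (x, y') ∧ j.A = i.A ∪ x.1.filter (fun a => a + 1 = t) then
      if t ∈ x.1 then idem j.M else rOpt t i.M j.M
    else 0
  | .l t x x' _ y, i, j =>
    if i.1 = (x, y) ∧ j.1 = (x', y) ∧ j.A = i.A ∪ (if t + 2 ∈ y.1 then {t + 1} else ∅) then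
      if t + 1 ∈ y.1 then idem j.M else rOpt t i.M j.M
    else 0
  | .b _ x x' y y' _ _, i, j =>
    if i.1 = (x, y) ∧ j.1 = (x', y') ∧ j.A = i.A then idem j.M else 0

/-- A DG bimodule structure on `T_n` is the standard one if its differential and the right
multiplications by the generators of `R_n ⊠ R_n` are given by the matrices above. -/
structure IsTn (τ : DGBimoduleStr (TMod n) (RBox n)) : Prop where
  d : ∀ (m : TMod n) (j : TIdx n),
    TMod.comp (τ.d m) j = ∑ i, TMod.comp m i * TMod.dMat i j
  act : ∀ (m : TMod n) (g : BGen n) (j : TIdx n),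
    TMod.comp (τ.act m (RBox.gen g)) j = ∑ i, TMod.comp m i * TMod.actMat g i j

/-! ### The Clifford algebra -/

/-- The defining relations of the algebra generated by the `X_i`. -/
inductive CliffRel (n : ℕ) :
    FreeAlgebra ℤ[T;T⁻¹] (Fin (n + 1)) → FreeAlgebra ℤ[T;T⁻¹] (Fin (n + 1)) → Prop
  | sq (i : Fin (n + 1)) :
      CliffRel n (FreeAlgebra.ι _ i * FreeAlgebra.ι _ i) 0
  | anticomm (i j : Fin (n + 1)) : 1 < |((i : ℕ) : ℤ) - ((j : ℕ) : ℤ)| →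
      CliffRel n (FreeAlgebra.ι _ i * FreeAlgebra.ι _ j)
        (-(FreeAlgebra.ι _ j * FreeAlgebra.ι _ i))
  | adjacent (i : Fin n) :
      CliffRel n
        (FreeAlgebra.ι _ i.castSucc * FreeAlgebra.ι _ i.succ +
          FreeAlgebra.ι _ i.succ * FreeAlgebra.ι _ i.castSucc)
        (algebraMap ℤ[T;T⁻¹] (FreeAlgebra ℤ[T;T⁻¹] (Fin (n + 1))) (T (2 * ((i : ℕ) : ℤ) + 1 - n)))

/-- The quadratic form `Q_n(∑ a_i X_i) = ∑ a_i a_{i+1} q^{2i+1-n}`. -/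
def cliffForm (n : ℕ) : QuadraticForm ℤ[T;T⁻¹] (Fin (n + 1) → ℤ[T;T⁻¹]) :=
  ∑ i : Fin n, (T (2 * ((i : ℕ) : ℤ) + 1 - n) : ℤ[T;T⁻¹]) •
    QuadraticMap.linMulLin (LinearMap.proj i.castSucc) (LinearMap.proj i.succ)

end Multiplication

/-- The class `[P(x)]` in `K₀(R_n)`. -/
def clsP {n : ℕ} (x : Vtx n) : K0 (PR n) := K0.cls _ (H0DGP.mk _ (PR n x) (DGP.proj x))

/-- The class `[P(x, y)]` in `K₀(R_n ⊠ R_n)`. -/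
def clsPBox {n : ℕ} (x y : Vtx n) : K0 (PBox n) :=
  K0.cls _ (H0DGP.mk _ (PBox n (x, y)) (DGP.proj (P := PBox n) (x, y)))

end

open scoped LaurentPolynomial TensorProduct

/-!
The theorem identifies three free `ℤ[q^{±1}]`-modules with a basis indexed by the subsets `x` of
`{0, …, n}`: the span of the ordered monomials in the Clifford generators, the span of the `x`
themselves with the multiplication `m_n`, and `K₀(R_n)`.

*The Clifford algebra.* The presented algebra acts on Fock space by `X_i = c_i + q_i c_{i+1}^*`
(`fockX`), where `c_i` and `c_i^*` are creation and annihilation operators and `q_i = q^{2i+1-n}`.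
Ordered monomials map the vacuum to distinct basis vectors, hence they are linearly independent; the
relations let one sort any word, hence they span (`cliffBasis`). In the product of the monomials of
`x` and `y` every pair `X_s X_{s+1}` with `s ∈ x`, `s + 1 ∈ y` becomes `q_s - X_{s+1} X_s`, and all
other exchanges only contribute signs. This gives a sum over the sets `A` of those `s` for which the
second term is chosen (`IsCliffGen.mon_mul_mon`), and `m_n(x, y)` expands into the same sum
(`mulVtx_eq`); so the structure constants agree (`cliffBasis_mul`). The Clifford algebra of `Q_n`
has the same presentation (`exists_cliff_equiv`). Associativity of `m_n` is inherited from the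
presented algebra.

*The bimodule.* `M_A(x, y)` is determined by a multiset of entries, and it is `0` if there are
repetitions (`compMul_eq`). The differential and the right multiplication by a generator of
`R_n ⊠ R_n` are matrices indexed by the summands of `T_n`. A nonzero coefficient of such a matrix
depends only on a label and on the entries at its source (`labelElt`), and labels commute
(`labelElt_comm`). Hence the relations and the Leibniz rule reduce to comparing which elements are
added to the index sets `A`; if a generator other than `b` makes a new `s` available without adding
it to `A`, then adding the entries `s + 1`, `s` creates a repetition
(`BGen.not_nodup_extra`), so the corresponding term of the differential vanishes. For `b` two
elements become available without such a repetition, and the two surviving terms are the two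
summands of `d b` (`actM_b_dM`). A bimodule structure is determined by the differential and the
action of the generators, which gives uniqueness (`existsUnique_isTn`).

*Grothendieck groups.* The classes of the generating modules span `K₀`, because all of `DGP(A)` is
built from them by shifts, cones and isomorphisms (`K0.span_eq_top`). For independence, every
idempotent `e_v` has an augmentation `A → 𝔽₂` with value `1` on `e_v` and `0` on the other
idempotents. The graded Euler characteristic of the homology of `𝔽₂ ⊗ -` is additive on
distinguished triangles (`DGModule.euler_distinguished`) and therefore defines a linear form on `K₀`
(`Augmentation.exists_eulerForm`); these forms are dual to the classes of the modules `A e_v`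
(`K0.exists_basis`). This applies to `R_n` and to `R_n ⊠ R_n`, and comparing the bases yields the
isomorphism of `K₀(R_n) ⊗ K₀(R_n)` with `K₀` of `H⁰(DGP(R_n ⊠ R_n))`.

*The functor.* Tensoring with a bimodule commutes with shifts and cones, hence is exact on homotopy
categories (`isExactFunctor_tensorDGP`). The module `T_n ⊗ P(x, y)` is `T_n e(x, y)`
(`DGBimoduleStr.nonempty_cut_iso`), a finite sum of shifted modules `P(M_A)` on which the
differential only increases `A`. Removing a summand with minimal `A` exhibits it as a cone
(`TMod.nonempty_cone_attach_iso`); by induction it lies in `DGP(R_n)` and its class is the sum of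
the classes of its summands (`TMod.exists_of_tensor`), which is `m_n(x, y)`.
-/

/-! ### Multisets attached to pairs of finite sets -/

noncomputable section

/-- The `s ∈ x` with `s + 1 ∈ y`. -/
def adjSet (x y : Finset ℕ) : Finset ℕ := x.filter (fun s => s + 1 ∈ y)

/-- The multiset of entries of the concatenated factors of the term of `M(x, y)` indexed by `A`:
the entries of `x` and `y` outside the adjacent pairs, and the pairs `s + 1, s` with `s ∈ A`. -/
def entries (x y A : Finset ℕ) : Multiset ℕ :=
  (x \ adjSet x y).val + (y \ (adjSet x y).map ⟨Nat.succ, Nat.succ_injective⟩).val + A.val +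
    (A.map ⟨Nat.succ, Nat.succ_injective⟩).val

lemma count_val (x : Finset ℕ) (c : ℕ) : x.val.count c = if c ∈ x then 1 else 0 :=
  Multiset.count_eq_of_nodup x.nodup

lemma count_entries_zero (x y A : Finset ℕ) : (entries x y A).count 0 =
    (if 0 ∈ x ∧ 1 ∉ y then 1 else 0) + (if 0 ∈ y then 1 else 0) + (if 0 ∈ A then 1 else 0) := by
  have h : ∀ B : Finset ℕ, 0 ∉ B.map ⟨Nat.succ, Nat.succ_injective⟩ := by simp
  simp only [entries, Multiset.count_add, count_val, Finset.mem_sdiff, h, not_false_eq_true,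
    and_true, if_false, add_zero, adjSet, Finset.mem_filter, zero_add, not_and]
  congr 3
  grind

lemma count_entries_succ (x y A : Finset ℕ) (c : ℕ) : (entries x y A).count (c + 1) =
    (if c + 1 ∈ x ∧ c + 2 ∉ y then 1 else 0) + (if c + 1 ∈ y ∧ c ∉ x then 1 else 0) +
      (if c + 1 ∈ A then 1 else 0) + (if c ∈ A then 1 else 0) := by
  have h : ∀ B : Finset ℕ, c + 1 ∈ B.map ⟨Nat.succ, Nat.succ_injective⟩ ↔ c ∈ B := by simp
  simp only [entries, Multiset.count_add, count_val, Finset.mem_sdiff, h, adjSet,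
    Finset.mem_filter]
  congr 3
  · grind
  · grind

/-- Two multisets of natural numbers agree if their counts at `0` and at the successors agree. -/
lemma multiset_ext_nat {m m' : Multiset ℕ} (h0 : m.count 0 = m'.count 0)
    (h : ∀ c, m.count (c + 1) = m'.count (c + 1)) : m = m' :=
  Multiset.ext.2 fun c => by cases c with
    | zero => exact h0
    | succ c => exact h c

/-- The integer `μ(x, y)` for finite sets. -/
def muSet (x y : Finset ℕ) : ℤ :=
  ∑ a ∈ x, ∑ b ∈ y, if a + 1 < b then (-1) ^ (a + b + 1) else 0

/-! ### Fock space -/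

section Fock

variable {S : Type} [CommRing S]

/-- The sign `(-1)^k` for an integer `k`. -/
def sg (S : Type) [CommRing S] (k : ℤ) : S := (((-1 : Sˣ) ^ k : Sˣ) : S)

lemma sg_zero : sg S 0 = 1 := by simp [sg]

lemma sg_add (k l : ℤ) : sg S (k + l) = sg S k * sg S l := by simp [sg, zpow_add]

lemma sg_one : sg S 1 = -1 := by simp [sg]

lemma sg_neg_one : sg S (-1) = -1 := by simp [sg]

lemma sg_neg (k : ℤ) : sg S (-k) = sg S k := by
  have h : ((-1 : Sˣ) ^ k)⁻¹ = (-1) ^ k := by rw [← inv_zpow]; simp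
  rw [sg, zpow_neg, h, sg]

/-- The sign of moving the generator with index `i` past the larger entries of `z`. -/
def passSign (S : Type) [CommRing S] (i : ℕ) (z : Finset ℕ) : S := (-1) ^ (z.filter (i < ·)).card

lemma passSign_insert {i j : ℕ} {z : Finset ℕ} (h : j ∉ z) :
    passSign S i (insert j z) = if i < j then -passSign S i z else passSign S i z := by
  unfold passSign
  rw [Finset.filter_insert]
  split_ifs with hij
  · rw [Finset.card_insert_of_notMem (by simp [h]), pow_succ]; simp
  · rfl

lemma passSign_erase {i j : ℕ} {z : Finset ℕ} (h : j ∈ z) :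
    passSign S i (z.erase j) = if i < j then -passSign S i z else passSign S i z := by
  have := passSign_insert (S := S) (i := i) (Finset.notMem_erase j z)
  rw [Finset.insert_erase h] at this
  rw [this]
  split_ifs <;> simp

lemma passSign_sq (i : ℕ) (z : Finset ℕ) : passSign S i z * passSign S i z = 1 := by
  unfold passSign
  rw [← mul_pow]; simp

variable {M : Type} [AddCommGroup M] [Module S M] (b : Module.Basis (Finset ℕ) S M)

/-- The creation operator on a free module with a basis indexed by the finite sets of natural
numbers. -/
def create (i : ℕ) : Module.End S M :=
  b.constr S fun z => if i ∈ z then 0 else passSign S i z • b (insert i z)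

/-- The annihilation operator. -/
def annihilate (i : ℕ) : Module.End S M :=
  b.constr S fun z => if i ∈ z then passSign S i z • b (z.erase i) else 0

lemma create_basis (i : ℕ) (z : Finset ℕ) : create b i (b z) =
    if i ∈ z then 0 else passSign S i z • b (insert i z) := b.constr_basis S _ z

lemma annihilate_basis (i : ℕ) (z : Finset ℕ) : annihilate b i (b z) =
    if i ∈ z then passSign S i z • b (z.erase i) else 0 := b.constr_basis S _ z

lemma create_sq (i : ℕ) : create b i * create b i = 0 := by
  refine b.ext fun z => ?_
  simp only [Module.End.mul_apply, create_basis, apply_ite (create b _), map_zero, map_smul]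
  by_cases hi : i ∈ z <;> simp [hi]

lemma annihilate_sq (i : ℕ) : annihilate b i * annihilate b i = 0 := by
  refine b.ext fun z => ?_
  simp only [Module.End.mul_apply, annihilate_basis, apply_ite (annihilate b _), map_zero,
    map_smul]
  by_cases hi : i ∈ z <;> simp [hi]

lemma create_create (i j : ℕ) : create b i * create b j = -(create b j * create b i) := by
  by_cases hij : i = j
  · subst hij; rw [create_sq, neg_zero]
  refine b.ext fun z => ?_
  simp only [Module.End.mul_apply, LinearMap.neg_apply, create_basis, apply_ite (create b _),
    map_zero, map_smul, Finset.mem_insert]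
  by_cases hi : i ∈ z <;> by_cases hj : j ∈ z
  all_goals simp only [hi, hj, hij, Ne.symm hij, or_self, or_true, if_true, if_false,
    smul_zero, neg_zero]
  rw [Finset.insert_comm, passSign_insert hi, passSign_insert hj, smul_smul, smul_smul, ← neg_smul]
  congr 1
  rcases lt_or_gt_of_ne hij with h | h <;> simp [h, h.not_gt] <;> ring

lemma annihilate_annihilate (i j : ℕ) :
    annihilate b i * annihilate b j = -(annihilate b j * annihilate b i) := by
  by_cases hij : i = j
  · subst hij; rw [annihilate_sq, neg_zero]
  refine b.ext fun z => ?_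
  simp only [Module.End.mul_apply, LinearMap.neg_apply, annihilate_basis,
    apply_ite (annihilate b _), map_zero, map_smul, Finset.mem_erase]
  by_cases hi : i ∈ z <;> by_cases hj : j ∈ z
  all_goals simp only [hi, hj, hij, Ne.symm hij, ne_eq, not_false_eq_true, and_self, and_false,
    if_true, if_false, smul_zero, neg_zero]
  rw [Finset.erase_right_comm, passSign_erase hi, passSign_erase hj, smul_smul, smul_smul,
    ← neg_smul]
  congr 1
  rcases lt_or_gt_of_ne hij with h | h <;> simp [h, h.not_gt] <;> ring

lemma create_annihilate (i j : ℕ) :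
    create b i * annihilate b j + annihilate b j * create b i = if i = j then 1 else 0 := by
  refine b.ext fun z => ?_
  simp only [Module.End.mul_apply, LinearMap.add_apply, annihilate_basis, create_basis,
    apply_ite (annihilate b _), apply_ite (create b _), map_zero, map_smul, Finset.mem_erase,
    Finset.mem_insert]
  by_cases hij : i = j
  · subst hij
    by_cases hi : i ∈ z
    · simp [hi, passSign_erase hi, Finset.insert_erase hi, smul_smul, passSign_sq]
    · simp [hi, passSign_insert hi, Finset.erase_insert hi, smul_smul, passSign_sq]
  · by_cases hi : i ∈ z <;> by_cases hj : j ∈ z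
    all_goals simp only [hi, hj, hij, Ne.symm hij, ne_eq, not_false_eq_true, and_self, and_false,
      or_self, or_true, if_true, if_false, smul_zero, add_zero, LinearMap.zero_apply]
    rw [passSign_erase hj, passSign_insert hi, Finset.erase_insert_of_ne hij, smul_smul, smul_smul,
      ← add_smul]
    convert zero_smul S _ using 2
    rcases lt_or_gt_of_ne hij with h | h <;> simp [h, h.not_gt] <;> ring

lemma anticomm_expand {E : Type} [Ring E] [Algebra S E] (a b c d : E) (p r : S) :
    (a + p • b) * (c + r • d) + (c + r • d) * (a + p • b) =
      (a * c + c * a) + r • (a * d + d * a) + p • (c * b + b * c) +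
        (p * r) • (b * d + d * b) := by
  simp only [mul_add, add_mul, smul_mul_assoc, mul_smul_comm, smul_add, smul_smul]
  rw [mul_comm r p]
  abel

lemma sq_expand {E : Type} [Ring E] [Algebra S E] (a b : E) (p : S) :
    (a + p • b) * (a + p • b) = a * a + p • (a * b + b * a) + (p * p) • (b * b) := by
  simp only [mul_add, add_mul, smul_mul_assoc, mul_smul_comm, smul_add, smul_smul]
  abel

/-- The action of the generator `X_i` of the Clifford algebra on Fock space. -/
def fockX (q : ℕ → S) (i : ℕ) : Module.End S M :=
  create b i + q i • annihilate b (i + 1)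

lemma fockX_anticomm (q : ℕ → S) (i j : ℕ) :
    fockX b q i * fockX b q j + fockX b q j * fockX b q i =
      algebraMap S _ ((if i = j + 1 then q j else 0) + if j = i + 1 then q i else 0) := by
  rw [fockX, fockX, anticomm_expand, create_annihilate, create_annihilate, create_create b i j,
    annihilate_annihilate b (i + 1) (j + 1), neg_add_cancel, neg_add_cancel, map_add,
    Algebra.algebraMap_eq_smul_one, Algebra.algebraMap_eq_smul_one]
  simp [ite_smul]

lemma fockX_sq (q : ℕ → S) (i : ℕ) : fockX b q i * fockX b q i = 0 := by
  rw [fockX, sq_expand, create_annihilate, create_sq, annihilate_sq]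
  simp

lemma fockX_basis_of_lt (q : ℕ → S) {i : ℕ} {z : Finset ℕ} (h : ∀ a ∈ z, a < i) :
    fockX b q i (b z) = b (insert i z) := by
  have h1 : i ∉ z := fun hi => (h i hi).false
  have h2 : i + 1 ∉ z := fun hi => by have := h _ hi; omega
  have h3 : z.filter (i < ·) = ∅ := Finset.filter_eq_empty_iff.2 fun a ha => (h a ha).not_gt
  simp [fockX, create_basis, annihilate_basis, h1, h2, passSign, h3]

end Fock

/-! ### Monomials in Clifford generators -/

section Monomials

variable {S : Type} [CommRing S] {C : Type} [Ring C] [Algebra S C]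

/-- The product of the `X_a` for `a` in a finite set, in decreasing order. -/
def mon (X : ℕ → C) (z : Finset ℕ) : C := ((z.sort (· ≥ ·)).map X).prod

/-- The monomial of a multiset, which is `0` if there are repetitions. -/
def monMul (X : ℕ → C) (m : Multiset ℕ) : C :=
  open Classical in if m.Nodup then mon X m.toFinset else 0

lemma mon_empty (X : ℕ → C) : mon X ∅ = 1 := by simp [mon]

lemma mon_insert (X : ℕ → C) {a : ℕ} {z : Finset ℕ} (h : ∀ b ∈ z, b < a) :
    mon X (insert a z) = X a * mon X z := by
  have ha : a ∉ z := fun h' => (h a h').false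
  rw [mon, mon, Finset.sort_insert _ (fun b hb => (h b hb).le) ha]
  simp

/-- The relations between the generators of a Clifford algebra. -/
structure IsCliffGen (X : ℕ → C) (q : ℕ → S) : Prop where
  sq : ∀ i, X i * X i = 0
  far : ∀ i j, i + 1 < j → X i * X j = -(X j * X i)
  adj : ∀ i, X i * X (i + 1) + X (i + 1) * X i = algebraMap S C (q i)

variable {X : ℕ → C} {q : ℕ → S}

/-- The product of a generator and a monomial is given by the action of the generator on Fock
space. -/
lemma IsCliffGen.X_mul_mon (h : IsCliffGen X q) (a : ℕ) (z : Finset ℕ) :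
    X a * mon X z = (if a ∈ z then 0 else passSign S a z • mon X (insert a z)) +
      if a + 1 ∈ z then (q a * passSign S (a + 1) z) • mon X (z.erase (a + 1)) else 0 := by
  induction z using Finset.induction_on_max with
  | empty => simpa [passSign, mon_empty] using (mon_insert X (z := ∅) (a := a) (by simp)).symm
  | insert m z hm ih =>
    have hmz : m ∉ z := fun h' => (hm m h').false
    rcases lt_or_ge m a with hma | hma
    · have h3 : ∀ b ∈ insert m z, b < a := by
        intro b hb
        rcases Finset.mem_insert.1 hb with rfl | hb
        · exact hma
        · exact (hm b hb).trans hma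
      have h1 : a ∉ insert m z := fun hi => (h3 a hi).false
      have h2 : a + 1 ∉ insert m z := fun hi => by have := h3 _ hi; omega
      have h4 : (insert m z).filter (a < ·) = ∅ :=
        Finset.filter_eq_empty_iff.2 fun b hb => (h3 b hb).not_gt
      rw [if_neg h1, if_neg h2, mon_insert X h3, passSign, h4]
      simp
    rw [mon_insert X hm, ← mul_assoc]
    rcases hma.eq_or_lt with rfl | hma
    · have h2 : a + 1 ∉ insert a z := by
        simp only [Finset.mem_insert, not_or]
        exact ⟨by omega, fun hi => by have := hm _ hi; omega⟩
      rw [h.sq, if_neg h2]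
      simp
    have hz : ∀ b ∈ insert a z, b < m := by
      intro b hb
      rcases Finset.mem_insert.1 hb with rfl | hb
      · exact hma
      · exact hm b hb
    have e1 : mon X (insert a (insert m z)) = X m * mon X (insert a z) := by
      rw [Finset.insert_comm, mon_insert X hz]
    rcases (Nat.succ_le_of_lt hma).eq_or_lt with rfl | hma'
    · have e2 : X a * X (a + 1) = algebraMap S C (q a) - X (a + 1) * X a :=
        eq_sub_of_add_eq (h.adj a)
      have h3 : (insert (a + 1) z).filter (a + 1 < ·) = ∅ := by
        refine Finset.filter_eq_empty_iff.2 fun b hb => ?_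
        rcases Finset.mem_insert.1 hb with rfl | hb
        · simp
        · exact (hm b hb).not_gt
      have h4 : a ∈ insert (a + 1) z ↔ a ∈ z := by simp
      simp only [Nat.succ_eq_add_one] at *
      rw [e2, sub_mul, mul_assoc, ih, if_neg hmz, add_zero, if_pos (Finset.mem_insert_self _ _),
        Finset.erase_insert hmz, passSign_insert hmz, if_pos (Nat.lt_succ_self a), e1,
        ← Algebra.smul_def]
      rw [passSign.eq_def S (a + 1), h3]
      by_cases haz : a ∈ z
      · simp [haz, h4]
      · simp [haz, h4]
        abel
    · have h4 : a ∈ insert m z ↔ a ∈ z := by simp [hma.ne]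
      have h5 : a + 1 ∈ insert m z ↔ a + 1 ∈ z := by simp [hma'.ne]
      have e2 : mon X ((insert m z).erase (a + 1)) = X m * mon X (z.erase (a + 1)) := by
        rw [Finset.erase_insert_of_ne hma'.ne', mon_insert]
        exact fun b hb => hm b (Finset.mem_of_mem_erase hb)
      rw [h.far a m hma', neg_mul, mul_assoc, ih, passSign_insert hmz, passSign_insert hmz, e1, e2,
        if_pos hma, if_pos hma']
      simp only [h4, h5]
      split_ifs <;> simp [mul_add, add_comm]

lemma monMul_eq (X : ℕ → C) {m : Multiset ℕ} (h : m.Nodup) : monMul X m = mon X m.toFinset := by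
  simp [monMul, h]

lemma monMul_eq_zero (X : ℕ → C) {m : Multiset ℕ} (h : ¬ m.Nodup) : monMul X m = 0 := by
  simp [monMul, h]

lemma passSign_toFinset {a : ℕ} {m : Multiset ℕ} (h : m.Nodup) :
    passSign S a m.toFinset = (-1) ^ (m.filter (a < ·)).card := by
  classical
  rw [passSign, ← Multiset.toFinset_filter, Multiset.toFinset_card_of_nodup (h.filter _)]

lemma IsCliffGen.X_mul_monMul (h : IsCliffGen X q) {a : ℕ} {m : Multiset ℕ} (ha : a + 1 ∉ m) :
    X a * monMul X m = (-1 : S) ^ (m.filter (a + 1 < ·)).card • monMul X (a ::ₘ m) := by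
  by_cases hm : m.Nodup
  · have e : m.filter (a < ·) = m.filter (a + 1 < ·) := by
      refine Multiset.filter_congr fun b hb => ?_
      have : b ≠ a + 1 := fun h' => ha (h' ▸ hb)
      omega
    rw [monMul_eq X hm, h.X_mul_mon, ← e, ← passSign_toFinset hm]
    by_cases ham : a ∈ m
    · rw [monMul_eq_zero X (m := a ::ₘ m) (by simp [ham])]
      simp [ham, ha]
    · rw [monMul_eq X (m := a ::ₘ m) (by simp [ham, hm])]
      simp [ham, ha]
  · rw [monMul_eq_zero X hm, monMul_eq_zero X (m := a ::ₘ m) (by simp [hm])]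
    simp

lemma IsCliffGen.X_mul_monMul_cons (h : IsCliffGen X q) {a : ℕ} {m : Multiset ℕ}
    (ha : a + 1 ∉ m) :
    X a * monMul X ((a + 1) ::ₘ m) = (-1 : S) ^ (m.filter (a + 1 < ·)).card •
      (q a • monMul X m - monMul X (a ::ₘ (a + 1) ::ₘ m)) := by
  by_cases hm : m.Nodup
  · have hm' : ((a + 1) ::ₘ m).Nodup := by simp [ha, hm]
    have e : m.filter (a < ·) = m.filter (a + 1 < ·) := by
      refine Multiset.filter_congr fun b hb => ?_
      have : b ≠ a + 1 := fun h' => ha (h' ▸ hb)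
      omega
    rw [monMul_eq X hm', h.X_mul_mon, passSign_toFinset hm', passSign_toFinset hm',
      Multiset.filter_cons_of_pos _ (by omega), Multiset.filter_cons_of_neg _ (by omega), e,
      monMul_eq X hm]
    have e3 : (((a + 1) ::ₘ m).toFinset.erase (a + 1)) = m.toFinset := by
      rw [Multiset.toFinset_cons, Finset.erase_insert (by simpa using ha)]
    rw [e3]
    by_cases ham : a ∈ m
    · rw [monMul_eq_zero X (m := a ::ₘ _) (by simp [ham])]
      simp [ham, smul_smul, mul_comm]
    · rw [monMul_eq X (m := a ::ₘ _) (by simp [ham, hm, ha])]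
      simp [ham, smul_smul, pow_succ, smul_sub, mul_comm]
      abel
  · rw [monMul_eq_zero X hm, monMul_eq_zero X (m := _ ::ₘ m) (by simp [hm]),
      monMul_eq_zero X (m := a ::ₘ _) (by simp [hm])]
    simp

lemma sg_sum (y : Finset ℕ) (f : ℕ → ℕ) :
    sg S (∑ b ∈ y, (-1) ^ f b) = (-1) ^ y.card := by
  classical
  induction y using Finset.induction_on with
  | empty => simp [sg]
  | insert b y hb ih =>
    rw [Finset.sum_insert hb, sg_add, ih, Finset.card_insert_of_notMem hb, pow_succ']
    congr 1
    rcases neg_one_pow_eq_or ℤ (f b) with h | h <;> rw [h] <;> simp [sg_one, sg_neg_one]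

lemma sg_muSet_insert {a : ℕ} {x : Finset ℕ} (y : Finset ℕ) (ha : a ∉ x) :
    sg S (muSet (insert a x) y) = (-1) ^ (y.filter (a + 1 < ·)).card * sg S (muSet x y) := by
  rw [muSet, Finset.sum_insert ha, sg_add, ← Finset.sum_filter, sg_sum]
  rfl

/-- The product of two monomials: the entries of the pairs `s, s + 1` are exchanged by
`X_s X_{s+1} = q_s - X_{s+1} X_s`, all other pairs that have to be exchanged anticommute. -/
theorem IsCliffGen.mon_mul_mon (h : IsCliffGen X q) (x y : Finset ℕ) :
    mon X x * mon X y = ∑ A ∈ (adjSet x y).powerset,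
      (sg S (muSet x y + A.card) * ∏ s ∈ adjSet x y \ A, q s) • monMul X (entries x y A) := by
  induction x using Finset.induction_on_max with
  | empty =>
    have e : entries ∅ y ∅ = y.val := by simp [entries, adjSet]
    simp [adjSet, mon_empty, muSet, sg_zero, e, monMul_eq X y.nodup]
  | insert a x hx ih =>
    have hax : a ∉ x := fun h' => (hx a h').false
    have hlt : ∀ A ∈ (adjSet x y).powerset, ∀ b ∈ A, b < a := fun A hA b hb =>
      hx b (Finset.mem_filter.1 (Finset.mem_powerset.1 hA hb)).1
    -- the entries larger than `a + 1` all come from `y`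
    have hf : ∀ A ∈ (adjSet x y).powerset, ∀ m : Multiset ℕ,
        (∀ c, a + 1 < c → m.count c = (entries x y A).count c) →
        (m.filter (a + 1 < ·)).card = (y.filter (a + 1 < ·)).card := by
      intro A hA m hm
      have : m.filter (a + 1 < ·) = (y.filter (a + 1 < ·)).val := by
        refine Multiset.ext.2 fun c => ?_
        rw [Multiset.count_filter, count_val]
        by_cases hc : a + 1 < c
        · obtain ⟨c, rfl⟩ : ∃ c', c = c' + 1 := ⟨c - 1, by omega⟩
          have h1 : c + 1 ∉ x := fun h' => by have := hx _ h'; omega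
          have h2 : c ∉ x := fun h' => by have := hx _ h'; omega
          have h3 : c + 1 ∉ A := fun h' => by have := hlt A hA _ h'; omega
          have h4 : c ∉ A := fun h' => by have := hlt A hA _ h'; omega
          rw [if_pos hc, hm _ hc, count_entries_succ]
          simp [h1, h2, h3, h4, hc]
        · simp [hc]
      rw [this]; rfl
    rw [mon_insert X hx, mul_assoc, ih, Finset.mul_sum]
    simp only [mul_smul_comm]
    by_cases hay : a + 1 ∈ y
    · have ea : adjSet (insert a x) y = insert a (adjSet x y) := by
        simp [adjSet, Finset.filter_insert, hay]
      have ha' : a ∉ adjSet x y := fun h' => hax (Finset.mem_filter.1 h').1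
      rw [ea, Finset.sum_powerset_insert ha', ← Finset.sum_add_distrib]
      refine Finset.sum_congr rfl fun A hA => ?_
      have haA : a ∉ A := fun h' => (hlt A hA a h').false
      have hsA : a + 1 ∉ A := fun h' => by have := hlt A hA _ h'; omega
      have hsx : a + 1 ∉ x := fun h' => by have := hx _ h'; omega
      have e1 : entries x y A = (a + 1) ::ₘ entries (insert a x) y A := by
        refine multiset_ext_nat ?_ fun c => ?_
        · simp only [Multiset.count_cons, count_entries_zero]
          grind
        · simp only [Multiset.count_cons, count_entries_succ]
          grind
      have e2 : entries (insert a x) y (insert a A) =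
          a ::ₘ (a + 1) ::ₘ entries (insert a x) y A := by
        refine multiset_ext_nat ?_ fun c => ?_
        · simp only [Multiset.count_cons, count_entries_zero]
          grind
        · simp only [Multiset.count_cons, count_entries_succ]
          grind
      have e3 : a + 1 ∉ entries (insert a x) y A := by
        rw [← Multiset.count_eq_zero, count_entries_succ]
        simp [haA, hsA, hsx]
      rw [e1, h.X_mul_monMul_cons e3, hf A hA _ fun c hc => by
        rw [e1, Multiset.count_cons_of_ne (by omega)]]
      have e4 : insert a (adjSet x y) \ A = insert a (adjSet x y \ A) :=
        Finset.insert_sdiff_of_notMem _ haA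
      have e5 : insert a (adjSet x y) \ insert a A = adjSet x y \ A := by
        ext c; simp only [Finset.mem_sdiff, Finset.mem_insert]; grind
      rw [e4, e5, Finset.prod_insert (by simp [ha']), Finset.card_insert_of_notMem haA, e2,
        Nat.cast_add, Nat.cast_one, sg_add, sg_add, sg_add, sg_add, sg_one, sg_muSet_insert y hax]
      simp only [smul_sub, smul_smul]
      rw [sub_eq_add_neg, ← neg_smul]
      congr 2 <;> ring
    · have ea : adjSet (insert a x) y = adjSet x y := by
        simp [adjSet, Finset.filter_insert, hay]
      rw [ea]
      refine Finset.sum_congr rfl fun A hA => ?_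
      have haA : a ∉ A := fun h' => (hlt A hA a h').false
      have hsA : a + 1 ∉ A := fun h' => by have := hlt A hA _ h'; omega
      have hsx : a + 1 ∉ x := fun h' => by have := hx _ h'; omega
      have e1 : entries (insert a x) y A = a ::ₘ entries x y A := by
        refine multiset_ext_nat ?_ fun c => ?_
        · simp only [Multiset.count_cons, count_entries_zero]
          grind
        · simp only [Multiset.count_cons, count_entries_succ]
          grind
      have e3 : a + 1 ∉ entries x y A := by
        rw [← Multiset.count_eq_zero, count_entries_succ]
        simp [haA, hsA, hsx, hay]
      rw [h.X_mul_monMul e3, hf A hA _ fun c hc => rfl, e1, smul_smul, sg_add, sg_add,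
        sg_muSet_insert y hax]
      congr 1; ring

/-- The monomials of the subsets of `{0, …, n}` span the subalgebra generated by the `X_i`,
`i ≤ n`. -/
lemma IsCliffGen.span_mon (h : IsCliffGen X q) (N : ℕ) {c : C}
    (hc : c ∈ Algebra.adjoin S (X '' Set.Iio N)) :
    c ∈ Submodule.span S (mon X '' {z | z ⊆ Finset.range N}) := by
  have key : ∀ i < N, ∀ c ∈ Submodule.span S (mon X '' {z | z ⊆ Finset.range N}),
      X i * c ∈ Submodule.span S (mon X '' {z | z ⊆ Finset.range N}) := by
    intro i hi c hc
    induction hc using Submodule.span_induction with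
    | mem c hc =>
      obtain ⟨z, hz, rfl⟩ := hc
      rw [h.X_mul_mon]
      refine add_mem ?_ ?_
      · split_ifs
        · exact zero_mem _
        · refine Submodule.smul_mem _ _ (Submodule.subset_span ⟨_, ?_, rfl⟩)
          exact Finset.insert_subset (Finset.mem_range.2 hi) hz
      · split_ifs
        · refine Submodule.smul_mem _ _ (Submodule.subset_span ⟨_, ?_, rfl⟩)
          exact (Finset.erase_subset _ _).trans hz
        · exact zero_mem _
    | zero => simp
    | add u v _ _ hu hv => rw [mul_add]; exact add_mem hu hv
    | smul r u _ hu => rw [mul_smul_comm]; exact Submodule.smul_mem _ _ hu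
  have key2 : ∀ c ∈ Algebra.adjoin S (X '' Set.Iio N),
      ∀ d ∈ Submodule.span S (mon X '' {z | z ⊆ Finset.range N}),
      c * d ∈ Submodule.span S (mon X '' {z | z ⊆ Finset.range N}) := by
    intro c hc
    induction hc using Algebra.adjoin_induction with
    | mem c hc =>
      obtain ⟨i, hi, rfl⟩ := hc
      exact key i hi
    | algebraMap r =>
      intro d hd
      rw [← Algebra.smul_def]
      exact Submodule.smul_mem _ _ hd
    | add u v _ _ hu hv => intro d hd; rw [add_mul]; exact add_mem (hu d hd) (hv d hd)
    | mul u v _ _ hu hv => intro d hd; rw [mul_assoc]; exact hu _ (hv d hd)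
  have h1 : (1 : C) ∈ Submodule.span S (mon X '' {z | z ⊆ Finset.range N}) :=
    Submodule.subset_span ⟨∅, by simp, mon_empty X⟩
  simpa using key2 c hc 1 h1

end Monomials

end

/-! ### The terms of the higher multiplication -/

noncomputable section

/-- The vertex given by a multiset of numbers, or `none` if there are repetitions. -/
def ofMultiset (n : ℕ) (m : Multiset ℕ) : Option (Vtx n) :=
  open Classical in if m.Nodup then some (Vtx.of n m.toFinset) else none

section

variable {n : ℕ}

lemma Vtx.le_of_mem {x : Vtx n} {a : ℕ} (h : a ∈ x.1) : a ≤ n :=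
  Nat.lt_succ_iff.1 (Finset.mem_range.1 (Finset.mem_powerset.1 x.2 h))

lemma Vtx.of_val_eq {u : Finset ℕ} (h : ∀ a ∈ u, a ≤ n) : (Vtx.of n u).1 = u :=
  Finset.filter_true_of_mem fun a ha => Nat.lt_succ_iff.2 (h a ha)

lemma ofMultiset_of_nodup {m : Multiset ℕ} (h : m.Nodup) :
    ofMultiset n m = some (Vtx.of n m.toFinset) := by
  rw [ofMultiset, if_pos h]

lemma ofMultiset_of_not_nodup {m : Multiset ℕ} (h : ¬ m.Nodup) : ofMultiset n m = none := by
  rw [ofMultiset, if_neg h]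

lemma ofMultiset_zero : ofMultiset n 0 = some (Vtx.empty n) := by
  rw [ofMultiset_of_nodup Multiset.nodup_zero]; rfl

/-- Gluing adds the multisets of entries, if the entries of the first one are at least as large as
those of the second one. -/
lemma glueOpt_ofMultiset {m m' : Multiset ℕ} (h : ∀ a ∈ m, ∀ b ∈ m', b ≤ a)
    (hm : ∀ a ∈ m, a ≤ n) (hm' : ∀ a ∈ m', a ≤ n) :
    glueOpt (ofMultiset n m) (ofMultiset n m') = ofMultiset n (m + m') := by
  by_cases h1 : m.Nodup
  · by_cases h2 : m'.Nodup
    · rw [ofMultiset_of_nodup h1, ofMultiset_of_nodup h2]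
      change glue _ _ = _
      rw [glue, Vtx.of_val_eq (by simpa using hm), Vtx.of_val_eq (by simpa using hm')]
      simp only [Multiset.mem_toFinset]
      by_cases h3 : ∀ a ∈ m, ∀ b ∈ m', b < a
      · have h4 : (m + m').Nodup := by
          rw [Multiset.nodup_add]
          exact ⟨h1, h2, Multiset.disjoint_left.2 fun ha hb => (h3 _ ha _ hb).false⟩
        rw [if_pos h3, ofMultiset_of_nodup h4, Multiset.toFinset_add]
      · have h4 : ¬ (m + m').Nodup := by
          rw [Multiset.nodup_add]
          rintro ⟨-, -, hd⟩
          refine h3 fun a ha b hb => lt_of_le_of_ne (h a ha b hb) ?_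
          rintro rfl
          exact Multiset.disjoint_left.1 hd ha hb
        rw [if_neg h3, ofMultiset_of_not_nodup h4]
    · rw [ofMultiset_of_not_nodup h2, ofMultiset_of_not_nodup (m := m + m')
        fun h' => h2 (Multiset.nodup_add.1 h').2.1]
      cases ofMultiset n m <;> rfl
  · rw [ofMultiset_of_not_nodup h1, ofMultiset_of_not_nodup (m := m + m')
      fun h' => h1 (Multiset.nodup_add.1 h').1]
    rfl

lemma alpha_some (x y : Vtx n) (lo : Option ℕ) (h : ℕ) : alpha x y lo (some h) = ofMultiset n
    ((x.1.filter (fun a => (∀ s ∈ lo, s + 1 ≤ a) ∧ a < h)).val +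
      (y.1.filter (fun b => (∀ s ∈ lo, s + 1 < b) ∧ b ≤ h)).val) := by
  have e1 : ∀ p : ℕ → Prop, (∀ s ∈ some h, p s) ↔ p h := by simp
  simp only [alpha, e1]
  split_ifs with hd
  · rw [ofMultiset_of_nodup, Multiset.toFinset_add, Finset.val_toFinset, Finset.val_toFinset]
    exact Multiset.nodup_add.2 ⟨Finset.nodup _, Finset.nodup _, Finset.disjoint_val.2 hd⟩
  · rw [ofMultiset_of_not_nodup]
    exact fun h' => hd (Finset.disjoint_val.1 (Multiset.nodup_add.1 h').2.2)

lemma alpha_congr (x y : Vtx n) (lo : Option ℕ) {hi hi' : Option ℕ}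
    (h₁ : ∀ a ∈ x.1, (∀ s ∈ hi, a < s) ↔ ∀ s ∈ hi', a < s)
    (h₂ : ∀ b ∈ y.1, (∀ s ∈ hi, b ≤ s) ↔ ∀ s ∈ hi', b ≤ s) :
    alpha x y lo hi = alpha x y lo hi' := by
  have e1 : x.1.filter (fun a => (∀ s ∈ lo, s + 1 ≤ a) ∧ ∀ s ∈ hi, a < s) =
      x.1.filter (fun a => (∀ s ∈ lo, s + 1 ≤ a) ∧ ∀ s ∈ hi', a < s) :=
    Finset.filter_congr fun a ha => and_congr_right fun _ => h₁ a ha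
  have e2 : y.1.filter (fun a => (∀ s ∈ lo, s + 1 < a) ∧ ∀ s ∈ hi, a ≤ s) =
      y.1.filter (fun a => (∀ s ∈ lo, s + 1 < a) ∧ ∀ s ∈ hi', a ≤ s) :=
    Finset.filter_congr fun b hb => and_congr_right fun _ => h₂ b hb
  simp only [alpha, e1, e2]

lemma alpha_none (x y : Vtx n) (lo : Option ℕ) :
    alpha x y lo none = alpha x y lo (some (n + 1)) := by
  refine alpha_congr x y lo (fun a ha => ?_) (fun b hb => ?_)
  · simp [Nat.lt_succ_iff.2 (Vtx.le_of_mem ha)]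
  · simp [(Vtx.le_of_mem hb).trans (Nat.le_succ n)]

lemma factors_none {F : Type} {α : Option ℕ → Option ℕ → F} (β : ℕ → F) {h : ℕ}
    (hα : ∀ lo, α lo none = α lo (some h)) (l : List ℕ) :
    factors α β none l = factors α β (some h) l := by
  cases l <;> simp [factors, hα]

lemma factors_congr {F : Type} (α : Option ℕ → Option ℕ → F) {β β' : ℕ → F} {l : List ℕ}
    (hi : Option ℕ) (h : ∀ t ∈ l, β t = β' t) : factors α β hi l = factors α β' hi l := by
  induction l generalizing hi with
  | nil => rfl
  | cons t l ih =>
    simp only [factors]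
    rw [h t (by simp), ih (some t) fun u hu => h u (by simp [hu])]

/-- The entries below `h`, if `s` is the largest element below `h` of the set of labels of adjacent
pairs. -/
lemma entries_split (x y A : Finset ℕ) {s h : ℕ} (hA : ∀ t ∈ A, t ∈ x ∧ t + 1 ∈ y) (hsx : s ∈ x)
    (hsy : s + 1 ∈ y) (hsh : s < h) (hgap : ∀ t ∈ x, t + 1 ∈ y → s < t → ¬ t < h) :
    (x.filter (fun a => s + 1 ≤ a ∧ a < h)).val + (y.filter (fun b => s + 1 < b ∧ b ≤ h)).val +
      ((if s ∈ A then {s + 1, s} else 0) +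
        entries (x.filter (· < s)) (y.filter (· ≤ s)) (A.filter (· < s))) =
      entries (x.filter (· < h)) (y.filter (· ≤ h)) (A.filter (· < h)) := by
  have hβ : ∀ c, (if s ∈ A then {s + 1, s} else 0 : Multiset ℕ).count c =
      (if s ∈ A ∧ c = s + 1 then 1 else 0) + (if s ∈ A ∧ c = s then 1 else 0) := by
    intro c
    by_cases h : s ∈ A <;> simp [h, Multiset.count_cons, Multiset.count_singleton, add_comm]
  refine multiset_ext_nat ?_ fun c => ?_
  · simp only [hβ, Multiset.count_add, count_val, count_entries_zero, Finset.mem_filter]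
    rcases lt_trichotomy 0 s with h1 | h1 | h1 <;> grind
  · simp only [hβ, Multiset.count_add, count_val, count_entries_succ, Finset.mem_filter]
    rcases lt_trichotomy c s with h1 | h1 | h1
    · by_cases h2 : c + 1 = s <;> grind
    · grind
    · by_cases h2 : c < h
      · by_cases h3 : c + 1 < h <;> grind
      · grind

/-- The gluing of the factors below `h` corresponds to the entries below `h`. -/
lemma foldr_factors (x y : Vtx n) (A : Finset ℕ) (hA : A ⊆ adj x y) (l : List ℕ) (h : ℕ)
    (hl : l.Pairwise (· > ·)) (hmem : ∀ s, s ∈ l ↔ s ∈ adj x y ∧ s < h) :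
    (factors (alpha x y) (fun s => some (if s ∈ A then Vtx.of n {s + 1, s} else Vtx.empty n))
      (some h) l).foldr glueOpt (some (Vtx.empty n)) =
    ofMultiset n (entries (x.1.filter (· < h)) (y.1.filter (· ≤ h)) (A.filter (· < h))) := by
  have hadj : ∀ s, s ∈ adj x y ↔ s ∈ x.1 ∧ s + 1 ∈ y.1 := fun s => Finset.mem_filter
  have hAx : ∀ s, s ∈ A → s ∈ x.1 ∧ s + 1 ∈ y.1 := fun s hs => (hadj s).1 (hA hs)
  induction l generalizing h with
  | nil =>
    have h1 : ∀ s, s ∈ adj x y → ¬ s < h := fun s hs hsh => by simpa using (hmem s).2 ⟨hs, hsh⟩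
    simp only [factors, List.foldr_cons, List.foldr_nil]
    rw [alpha_some, ← ofMultiset_zero, glueOpt_ofMultiset (by simp) ?_ (by simp)]
    · simp only [Option.mem_def, reduceCtorEq, false_implies, implies_true, true_and, add_zero]
      congr 1
      refine multiset_ext_nat ?_ fun c => ?_
      · simp only [Multiset.count_add, count_val, count_entries_zero, Finset.mem_filter]
        grind
      · simp only [Multiset.count_add, count_val, count_entries_succ, Finset.mem_filter]
        grind
    · intro a ha
      simp only [Multiset.mem_add, Finset.mem_val, Finset.mem_filter] at ha
      rcases ha with ha | ha <;> exact Vtx.le_of_mem ha.1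
  | cons s l ih =>
    have hs := (hmem s).1 (by simp)
    have hsx := (hadj s).1 hs.1
    have hl' := List.pairwise_cons.1 hl
    have hmem' : ∀ t, t ∈ l ↔ t ∈ adj x y ∧ t < s := by
      intro t
      refine ⟨fun ht => ⟨((hmem t).1 (by simp [ht])).1, hl'.1 t ht⟩, fun ht => ?_⟩
      have := (hmem t).2 ⟨ht.1, ht.2.trans hs.2⟩
      rcases List.mem_cons.1 this with rfl | h'
      · exact absurd ht.2 (lt_irrefl _)
      · exact h'
    have hgap : ∀ t, t ∈ x.1 → t + 1 ∈ y.1 → s < t → ¬ t < h := by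
      intro t ht ht' hst hth
      rcases List.mem_cons.1 ((hmem t).2 ⟨(hadj t).2 ⟨ht, ht'⟩, hth⟩) with rfl | h'
      · exact hst.false
      · exact (hl'.1 t h').not_gt hst
    simp only [factors, List.foldr_cons]
    rw [ih s hl'.2 hmem', alpha_some]
    have hβ : some (if s ∈ A then Vtx.of n {s + 1, s} else Vtx.empty n) =
        ofMultiset n (if s ∈ A then {s + 1, s} else 0) := by
      split_ifs
      · rw [ofMultiset_of_nodup (by simp)]
        congr 2
        ext; simp
      · rw [ofMultiset_zero]
    have b1 : ∀ b ∈ entries (x.1.filter (· < s)) (y.1.filter (· ≤ s)) (A.filter (· < s)),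
        b ≤ s := by
      intro b hb
      rw [← Multiset.count_pos] at hb
      cases b with
      | zero => omega
      | succ c =>
        rw [count_entries_succ] at hb
        simp only [Finset.mem_filter] at hb
        by_contra hc
        simp only [not_le] at hc
        rw [if_neg, if_neg, if_neg, if_neg] at hb
        · simp at hb
        all_goals omega
    have b2 : ∀ b ∈ (if s ∈ A then {s + 1, s} else 0 : Multiset ℕ), b = s + 1 ∨ b = s := by
      intro b hb
      split_ifs at hb
      · simpa using hb
      · simp at hb
    have hn1 : s + 1 ≤ n := Vtx.le_of_mem hsx.2
    have b3 : ∀ a ∈ ((x.1.filter (fun a => (∀ t ∈ some s, t + 1 ≤ a) ∧ a < h)).val +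
      (y.1.filter (fun b => (∀ t ∈ some s, t + 1 < b) ∧ b ≤ h)).val), s + 1 ≤ a ∧ a ≤ n := by
      intro a ha
      simp only [Multiset.mem_add, Finset.mem_val, Finset.mem_filter, Option.mem_def,
        Option.some.injEq, forall_eq'] at ha
      rcases ha with ha | ha
      · exact ⟨ha.2.1, Vtx.le_of_mem ha.1⟩
      · exact ⟨ha.2.1.le, Vtx.le_of_mem ha.1⟩
    rw [hβ, glueOpt_ofMultiset, glueOpt_ofMultiset]
    · congr 1
      rw [← entries_split x.1 y.1 A hAx hsx.1 hsx.2 hs.2 hgap]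
      simp only [Option.mem_def, Option.some.injEq, forall_eq']
    · intro a ha b hb
      have ha := b3 a ha
      rcases Multiset.mem_add.1 hb with hb | hb
      · have := b2 b hb; omega
      · have := b1 b hb; omega
    · exact fun a ha => (b3 a ha).2
    · intro b hb
      rcases Multiset.mem_add.1 hb with hb | hb
      · have := b2 b hb; omega
      · have := b1 b hb; omega
    · intro a ha b hb
      have := b2 a ha
      have := b1 b hb
      omega
    · intro b hb
      have := b2 b hb; omega
    · intro b hb
      have := b1 b hb; omega

/-- `M_A(x, y)` is the decreasing sequence of the entries, or `0` if there are repetitions. -/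
lemma compMul_eq (x y : Vtx n) {A : Finset ℕ} (hA : A ⊆ adj x y) :
    compMul x y A = ofMultiset n (entries x.1 y.1 A) := by
  have hx : ∀ a ∈ x.1, a < n + 1 := fun a ha => Nat.lt_succ_iff.2 (Vtx.le_of_mem ha)
  rw [compMul, factors_none _ (alpha_none x y), foldr_factors x y A hA]
  · congr 2
    · exact Finset.filter_true_of_mem hx
    · exact Finset.filter_true_of_mem fun b hb => (Vtx.le_of_mem hb).trans (Nat.le_succ n)
    · exact Finset.filter_true_of_mem fun a ha => hx a (Finset.mem_filter.1 (hA ha)).1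
  · exact (Finset.sortedGT_sort (adj x y)).pairwise
  · intro s
    rw [adjList, Finset.mem_sort]
    exact ⟨fun h => ⟨h, hx s (Finset.mem_filter.1 h).1⟩, fun h => h.1⟩

lemma entries_le (x y : Vtx n) {A : Finset ℕ} (hA : A ⊆ adj x y) :
    ∀ a ∈ entries x.1 y.1 A, a ≤ n := by
  intro a ha
  simp only [entries, Multiset.mem_add, Finset.mem_val, Finset.mem_sdiff, Finset.mem_map,
    Function.Embedding.coeFn_mk] at ha
  rcases ha with ((ha | ha) | ha) | ⟨b, hb, rfl⟩
  · exact Vtx.le_of_mem ha.1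
  · exact Vtx.le_of_mem ha.1
  · exact Vtx.le_of_mem (Finset.mem_filter.1 (hA ha)).1
  · exact Vtx.le_of_mem (Finset.mem_filter.1 (hA hb)).2

open LaurentPolynomial in
lemma bilin_vec {S : Type} [CommRing S] (u v : Option (Vtx n)) :
    bilin (S := S) (fun x y => vec S (glue x y)) (vec S u) (vec S v) = vec S (glueOpt u v) := by
  cases u with
  | none => simp [vec, glueOpt]
  | some x => cases v with
    | none => simp [vec, glueOpt]
    | some y => simp [vec, glueOpt, bilin]

open LaurentPolynomial in
/-- Expanding each factor `β(s) = q^{2s+1-n}[∅] + h[s+1, s]` of the gluing: `A` is the set of those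
`s` for which the second term is chosen. -/
lemma glueList_factors (α : Option ℕ → Option ℕ → Option (Vtx n)) (l : List ℕ) (hl : l.Nodup)
    (hi : Option ℕ) :
    glueList (factors (fun lo hi => vec _ (α lo hi)) (beta n) hi l) =
      ∑ A ∈ l.toFinset.powerset, ((T 1 : ℤ[T;T⁻¹][T;T⁻¹]) ^ A.card *
        ∏ s ∈ l.toFinset \ A, (C (T (2 * (s : ℤ) + 1 - n)) : ℤ[T;T⁻¹][T;T⁻¹])) •
        vec ℤ[T;T⁻¹][T;T⁻¹] ((factors α
          (fun s => some (if s ∈ A then Vtx.of n {s + 1, s} else Vtx.empty n)) hi l).foldr glueOpt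
            (some (Vtx.empty n))) := by
  have he : ∀ x : Vtx n, Finsupp.single x (1 : ℤ[T;T⁻¹][T;T⁻¹]) = vec _ (some x) := fun x => rfl
  induction l generalizing hi with
  | nil =>
    simp [factors, glueList, he, bilin_vec]
  | cons s l ih =>
    obtain ⟨hs, hl⟩ := List.nodup_cons.1 hl
    have hs' : s ∉ l.toFinset := by simpa using hs
    rw [List.toFinset_cons, Finset.sum_powerset_insert hs', ← Finset.sum_add_distrib]
    have e1 : glueList (factors (fun lo hi => vec _ (α lo hi)) (beta n) hi (s :: l)) =
        bilin (fun x y => vec _ (glue x y)) (vec _ (α (some s) hi))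
          (bilin (fun x y => vec _ (glue x y)) (beta n s)
            (glueList (factors (fun lo hi => vec _ (α lo hi)) (beta n) (some s) l))) := rfl
    have e2 : beta n s = (C (T (2 * s + 1 - n)) : ℤ[T;T⁻¹][T;T⁻¹]) • vec _ (some (Vtx.empty n)) +
        (T 1 : ℤ[T;T⁻¹][T;T⁻¹]) • vec _ (some (Vtx.of n {s + 1, s})) := by
      simp [beta, vec]
    rw [e1, ih hl, e2]
    simp only [map_sum, map_smul, map_add, LinearMap.add_apply, LinearMap.smul_apply, bilin_vec]
    refine Finset.sum_congr rfl fun A hA => ?_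
    have hsA : s ∉ A := fun h => hs' (Finset.mem_powerset.1 hA h)
    have e3 : insert s l.toFinset \ A = insert s (l.toFinset \ A) :=
      Finset.insert_sdiff_of_notMem _ hsA
    have e4 : insert s l.toFinset \ insert s A = l.toFinset \ A := by
      ext c; simp only [Finset.mem_sdiff, Finset.mem_insert]; grind
    have e6 : factors α (fun t => some (if t ∈ insert s A then Vtx.of n {t + 1, t} else
        Vtx.empty n)) (some s) l = factors α (fun t => some (if t ∈ A then Vtx.of n {t + 1, t} else
        Vtx.empty n)) (some s) l := by
      refine factors_congr α _ fun t ht => ?_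
      have : t ≠ s := fun h => hs (h ▸ ht)
      simp [this]
    simp only [factors, List.foldr_cons, e6, hsA, if_false, Finset.mem_insert_self, if_true]
    rw [e3, e4, Finset.prod_insert (by simp [hs]), Finset.card_insert_of_notMem hsA, pow_succ,
      smul_add, smul_smul, smul_smul]
    refine congrArg₂ _ (congrArg₂ _ ?_ rfl) (congrArg₂ _ ?_ rfl)
    · ring
    · ring

lemma sg_natCast {S : Type} [CommRing S] (k : ℕ) : sg S k = (-1) ^ k := by simp [sg]

open LaurentPolynomial in
lemma specialize_T (k : ℤ) : specialize (T k) = sg ℤ[T;T⁻¹] k := by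
  rw [specialize, eval₂_T]; rfl

open LaurentPolynomial in
/-- The expansion of `m_n(x, y)` into the classes of the summands of the fibre of `T_n`. -/
theorem mulVtx_eq (x y : Vtx n) : mulVtx x y = ∑ A ∈ (adj x y).powerset,
    (sg ℤ[T;T⁻¹] (mu x y + A.card) * ∏ s ∈ adj x y \ A, T (2 * (s : ℤ) + 1 - n)) •
      vec ℤ[T;T⁻¹] (compMul x y A) := by
  have hl : (adjList x y).toFinset = adj x y := Finset.sort_toFinset _ _
  have key : ∀ v : Vtx n →₀ ℤ[T;T⁻¹][T;T⁻¹], v.mapRange specialize (map_zero _) =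
      Finsupp.mapRange.addMonoidHom specialize.toAddMonoidHom v := fun v => rfl
  have hv : ∀ (c : ℤ[T;T⁻¹][T;T⁻¹]) (o : Option (Vtx n)),
      (c • vec ℤ[T;T⁻¹][T;T⁻¹] o).mapRange specialize (map_zero _) =
        specialize c • vec ℤ[T;T⁻¹] o := by
    intro c o
    cases o with
    | none => simp [vec]
    | some z => simp [vec, Finsupp.mapRange_single]
  rw [mulVtx, higherMul, glueList_factors (alpha x y) (adjList x y) (Finset.sort_nodup _ _), hl,
    Finset.smul_sum, key, map_sum]
  refine Finset.sum_congr rfl fun A _ => ?_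
  have hC : ∀ r : ℤ[T;T⁻¹], specialize (C r) = r := fun r => by
    rw [specialize, eval₂_C, RingHom.id_apply]
  rw [← key, smul_smul, hv, map_mul, map_mul, map_prod, map_pow, specialize_T, specialize_T, sg_one,
    sg_add, sg_natCast, mul_assoc]
  simp only [hC]
  rfl

end

end

/-! ### The Clifford algebra -/

noncomputable section

open LaurentPolynomial

section

variable {S : Type} [CommRing S] {C : Type} [Ring C] [Algebra S C] {X : ℕ → C} {q : ℕ → S}

lemma IsCliffGen.anticomm (h : IsCliffGen X q) (i j : ℕ) : X i * X j + X j * X i =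
    algebraMap S C ((if i = j + 1 then q j else 0) + if j = i + 1 then q i else 0) := by
  rcases lt_trichotomy i j with hij | rfl | hij
  · rw [if_neg (by omega), zero_add]
    split_ifs with hj
    · rw [hj, h.adj]
    · rw [h.far i j (by omega), map_zero, neg_add_cancel]
  · simp [h.sq]
  · rw [if_neg (show j ≠ i + 1 by omega), add_zero]
    split_ifs with hj
    · rw [hj, add_comm, h.adj]
    · rw [h.far j i (by omega), map_zero, add_neg_cancel]

end

variable (n : ℕ)

/-- The coefficients `q^{2i+1-n}`, `i < n`. -/
def cliffCoeff (i : ℕ) : ℤ[T;T⁻¹] := if i < n then T (2 * (i : ℤ) + 1 - n) else 0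

/-- The algebra with generators `X_i` and the Clifford relations. -/
abbrev CliffQuot : Type := RingQuot (CliffRel n)

/-- The generator `X_i` of the presented algebra, where `X_i = 0` for `i > n`. -/
def cliffX (i : ℕ) : CliffQuot n :=
  if h : i < n + 1 then RingQuot.mkAlgHom ℤ[T;T⁻¹] (CliffRel n) (FreeAlgebra.ι ℤ[T;T⁻¹] ⟨i, h⟩)
  else 0

variable {n}

lemma cliffX_fin (i : Fin (n + 1)) : cliffX n i =
    RingQuot.mkAlgHom ℤ[T;T⁻¹] (CliffRel n) (FreeAlgebra.ι ℤ[T;T⁻¹] i) := by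
  rw [cliffX, dif_pos i.2]

lemma cliffX_of_lt {i : ℕ} (h : n < i) : cliffX n i = 0 := by
  rw [cliffX, dif_neg (by omega)]

variable (n) in
lemma isCliffGen_cliffX : IsCliffGen (cliffX n) (cliffCoeff n) where
  sq i := by
    rcases le_or_gt i n with h | h
    · have := RingQuot.mkAlgHom_rel ℤ[T;T⁻¹] (CliffRel.sq (n := n) ⟨i, Nat.lt_succ_iff.2 h⟩)
      rw [map_mul, map_zero] at this
      rw [cliffX, dif_pos (Nat.lt_succ_iff.2 h), this]
    · rw [cliffX_of_lt h, zero_mul]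
  far i j hij := by
    rcases le_or_gt j n with h | h
    · have hi : i < n + 1 := by omega
      have := RingQuot.mkAlgHom_rel ℤ[T;T⁻¹] (CliffRel.anticomm (n := n) ⟨i, hi⟩
        ⟨j, Nat.lt_succ_iff.2 h⟩ (by rw [abs_sub_comm, lt_abs]; left; push_cast; omega))
      rw [map_mul, map_neg, map_mul] at this
      rw [cliffX, cliffX, dif_pos hi, dif_pos (Nat.lt_succ_iff.2 h), this]
    · rw [cliffX_of_lt h, zero_mul, mul_zero]
      exact (neg_zero (G := CliffQuot n)).symm
  adj i := by
    rcases lt_or_ge i n with h | h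
    · have := RingQuot.mkAlgHom_rel ℤ[T;T⁻¹] (CliffRel.adjacent (n := n) ⟨i, h⟩)
      rw [map_add, map_mul, map_mul, AlgHom.commutes] at this
      rw [cliffX, cliffX, dif_pos (by omega), dif_pos (by omega), cliffCoeff, if_pos h]
      exact this
    · rw [cliffX_of_lt (i := i + 1) (by omega), cliffCoeff, if_neg (by omega)]
      simp

/-- Algebra maps out of the presented algebra. -/
lemma exists_cliffQuot_lift {E : Type} [Ring E] [Algebra ℤ[T;T⁻¹] E] {Y : ℕ → E}
    (h : ∀ i j, i ≤ n → j ≤ n → Y i * Y j + Y j * Y i = algebraMap _ E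
      ((if i = j + 1 then cliffCoeff n j else 0) + if j = i + 1 then cliffCoeff n i else 0))
    (hsq : ∀ i ≤ n, Y i * Y i = 0) :
    ∃ Φ : CliffQuot n →ₐ[ℤ[T;T⁻¹]] E, ∀ i ≤ n, Φ (cliffX n i) = Y i := by
  refine ⟨RingQuot.liftAlgHom _ ⟨FreeAlgebra.lift _ fun i : Fin (n + 1) => Y i, ?_⟩, ?_⟩
  · intro a b hab
    cases hab with
    | sq i => simpa using hsq i (Nat.lt_succ_iff.1 i.2)
    | anticomm i j hij =>
      have h1 := h i j (Nat.lt_succ_iff.1 i.2) (Nat.lt_succ_iff.1 j.2)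
      rw [lt_abs] at hij
      rw [if_neg (by omega), if_neg (by omega), add_zero, map_zero] at h1
      simpa using eq_neg_of_add_eq_zero_left h1
    | adjacent i =>
      have h1 := h i (i + 1) i.2.le i.2
      rw [if_neg (by omega), if_pos rfl, zero_add, cliffCoeff, if_pos i.2] at h1
      simpa using h1
  · intro i hi
    rw [cliffX, dif_pos (Nat.lt_succ_iff.2 hi), RingQuot.liftAlgHom_mkAlgHom_apply,
      FreeAlgebra.lift_ι_apply]

lemma adjoin_cliffX : Algebra.adjoin ℤ[T;T⁻¹] (cliffX n '' Set.Iio (n + 1)) = ⊤ := by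
  have h1 : (cliffX n '' Set.Iio (n + 1)) = (RingQuot.mkAlgHom ℤ[T;T⁻¹] (CliffRel n)) ''
      Set.range (FreeAlgebra.ι ℤ[T;T⁻¹]) := by
    ext c
    constructor
    · rintro ⟨i, hi, rfl⟩
      exact ⟨_, ⟨⟨i, hi⟩, rfl⟩, by rw [cliffX, dif_pos (Set.mem_Iio.1 hi)]⟩
    · rintro ⟨_, ⟨i, rfl⟩, rfl⟩
      exact ⟨i, i.2, cliffX_fin i⟩
  rw [h1, ← AlgHom.map_adjoin, FreeAlgebra.adjoin_range_ι, Algebra.map_top, AlgHom.range_eq_top]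
  exact RingQuot.mkAlgHom_surjective _ _

lemma fock_mon (q : ℕ → ℤ[T;T⁻¹]) {M : Type} [AddCommGroup M] [Module ℤ[T;T⁻¹] M]
    (b : Module.Basis (Finset ℕ) ℤ[T;T⁻¹] M) (z : Finset ℕ) :
    mon (fockX b q) z (b ∅) = b z := by
  induction z using Finset.induction_on_max with
  | empty => rw [mon_empty, Module.End.one_apply]
  | insert a z hz ih => rw [mon_insert _ hz, Module.End.mul_apply, ih, fockX_basis_of_lt b q hz]

lemma map_mon {C E : Type} [Ring C] [Ring E] [Algebra ℤ[T;T⁻¹] C] [Algebra ℤ[T;T⁻¹] E]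
    (Φ : C →ₐ[ℤ[T;T⁻¹]] E) {X : ℕ → C} {Y : ℕ → E} {z : Finset ℕ} (h : ∀ i ∈ z, Φ (X i) = Y i) :
    Φ (mon X z) = mon Y z := by
  rw [mon, mon, map_list_prod, List.map_map]
  congr 1
  exact List.map_congr_left fun i hi => h i ((Finset.mem_sort _).1 hi)

/-- The monomials are linearly independent, because they map the vacuum vector to distinct basis
vectors of Fock space. -/
lemma linearIndependent_mon_of_basis {M : Type} [AddCommGroup M] [Module ℤ[T;T⁻¹] M]
    (b : Module.Basis (Finset ℕ) ℤ[T;T⁻¹] M) : LinearIndependent ℤ[T;T⁻¹]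
    (fun x : Vtx n => mon (cliffX n) x.1) := by
  obtain ⟨Φ, hΦ⟩ := exists_cliffQuot_lift (n := n) (Y := fockX b (cliffCoeff n))
    (fun i j _ _ => fockX_anticomm b _ i j) (fun i _ => fockX_sq b _ i)
  have h1 : LinearIndependent ℤ[T;T⁻¹] (fun x : Vtx n => b x.1) :=
    b.linearIndependent.comp _ Subtype.val_injective
  refine LinearIndependent.of_comp ((LinearMap.applyₗ (b ∅)).comp Φ.toLinearMap) ?_
  convert h1 using 1
  ext1 x
  have h2 := map_mon Φ (X := cliffX n) (Y := fockX b (cliffCoeff n)) (z := x.1)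
    fun i hi => hΦ i (Vtx.le_of_mem hi)
  exact (LinearMap.congr_fun h2 (b ∅)).trans (fock_mon _ b x.1)

lemma linearIndependent_mon : LinearIndependent ℤ[T;T⁻¹]
    (fun x : Vtx n => mon (cliffX n) x.1) :=
  linearIndependent_mon_of_basis (Finsupp.basisSingleOne (R := ℤ[T;T⁻¹]) (ι := Finset ℕ))

variable (n) in
/-- The basis of the presented algebra consisting of the ordered monomials. -/
def cliffBasis : Module.Basis (Vtx n) ℤ[T;T⁻¹] (CliffQuot n) :=
  Module.Basis.mk (linearIndependent_mon (n := n)) (by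
    intro c _
    have h1 : c ∈ Algebra.adjoin ℤ[T;T⁻¹] (cliffX n '' Set.Iio (n + 1)) := by
      rw [adjoin_cliffX]; trivial
    refine Submodule.span_mono ?_ ((isCliffGen_cliffX n).span_mon (n + 1) h1)
    rintro _ ⟨z, hz, rfl⟩
    exact ⟨⟨z, Finset.mem_powerset.2 hz⟩, rfl⟩)

lemma cliffBasis_apply (x : Vtx n) : cliffBasis n x = mon (cliffX n) x.1 := by
  rw [cliffBasis, Module.Basis.mk_apply]

lemma cliffBasis_empty : cliffBasis n (Vtx.empty n) = 1 := by
  rw [cliffBasis_apply, ← mon_empty (cliffX n)]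
  rfl

lemma cliffBasis_singleton (i : Fin (n + 1)) : cliffBasis n (Vtx.of n {(i : ℕ)}) = cliffX n i := by
  have h : (Vtx.of n {(i : ℕ)}).1 = {(i : ℕ)} :=
    Vtx.of_val_eq (by simpa using Nat.lt_succ_iff.1 i.2)
  rw [cliffBasis_apply, h, mon]
  simp

/-- The structure constants of the Clifford algebra are those of `m_n`. -/
theorem cliffBasis_mul (x y : Vtx n) :
    cliffBasis n x * cliffBasis n y = (mulVtx x y).sum fun z c => c • cliffBasis n z := by
  have e : ∀ v : Vtx n →₀ ℤ[T;T⁻¹], (v.sum fun z c => c • cliffBasis n z) =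
      Finsupp.linearCombination ℤ[T;T⁻¹] (cliffBasis n) v := fun v => rfl
  rw [e, mulVtx_eq, map_sum, cliffBasis_apply, cliffBasis_apply,
    (isCliffGen_cliffX n).mon_mul_mon]
  refine Finset.sum_congr rfl fun A hA => ?_
  have hA' := Finset.mem_powerset.1 hA
  rw [map_smul, compMul_eq x y hA']
  congr 1
  · congr 1
    refine Finset.prod_congr rfl fun s hs => ?_
    have hs := (Finset.mem_filter.1 (Finset.mem_sdiff.1 hs).1).2
    rw [cliffCoeff, if_pos (Nat.lt_of_succ_le (Vtx.le_of_mem hs))]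
  · by_cases h : (entries x.1 y.1 A).Nodup
    · rw [monMul_eq _ h, ofMultiset_of_nodup h, vec, Option.elim_some,
        Finsupp.linearCombination_single, one_smul, cliffBasis_apply, Vtx.of_val_eq]
      exact fun a ha => entries_le x y hA' a (by simpa using ha)
    · rw [monMul_eq_zero _ h, ofMultiset_of_not_nodup h, vec, Option.elim_none, map_zero]

lemma polar_cliffForm (a c : Fin (n + 1) → ℤ[T;T⁻¹]) : QuadraticMap.polar (cliffForm n) a c =
    ∑ i : Fin n, T (2 * ((i : ℕ) : ℤ) + 1 - n) *
      (a i.castSucc * c i.succ + c i.castSucc * a i.succ) := by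
  simp only [QuadraticMap.polar, cliffForm, sum_apply, smul_apply,
    QuadraticMap.linMulLin_apply, LinearMap.proj_apply, Pi.add_apply, smul_eq_mul,
    ← Finset.sum_sub_distrib]
  exact Finset.sum_congr rfl fun i _ => by ring

lemma polar_cliffForm_single (i j : Fin (n + 1)) :
    QuadraticMap.polar (cliffForm n) (Pi.single i 1) (Pi.single j 1) =
    (if (i : ℕ) = j + 1 then cliffCoeff n j else 0) +
      if (j : ℕ) = i + 1 then cliffCoeff n i else 0 := by
  have key : ∀ i j : Fin (n + 1), ∑ k : Fin n, T (2 * ((k : ℕ) : ℤ) + 1 - n) *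
      ((Pi.single i 1 : Fin (n + 1) → ℤ[T;T⁻¹]) k.castSucc *
        (Pi.single j 1 : Fin (n + 1) → ℤ[T;T⁻¹]) k.succ) =
      if (j : ℕ) = i + 1 then cliffCoeff n i else 0 := by
    intro i j
    split_ifs with h
    · have hi : (i : ℕ) < n := by omega
      rw [Finset.sum_eq_single ⟨i, hi⟩]
      · rw [show (⟨i, hi⟩ : Fin n).castSucc = i from rfl,
          show (⟨i, hi⟩ : Fin n).succ = j from Fin.ext h.symm, cliffCoeff, if_pos hi]
        simp
      · intro k _ hk
        have : k.castSucc ≠ i := fun h' => by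
          have h'' : (k : ℕ) = i := congrArg Fin.val h'
          exact hk (Fin.ext h'')
        simp [Pi.single_eq_of_ne this]
      · simp
    · refine Finset.sum_eq_zero fun k _ => ?_
      by_cases hk : k.castSucc = i
      · have : k.succ ≠ j := fun h' => h (by rw [← h', ← hk]; rfl)
        simp [Pi.single_eq_of_ne this]
      · simp [Pi.single_eq_of_ne hk]
  rw [polar_cliffForm]
  simp only [mul_add, Finset.sum_add_distrib]
  rw [key, key, add_comm]

lemma cliffForm_single (i : Fin (n + 1)) : cliffForm n (Pi.single i 1) = 0 := by
  simp only [cliffForm, sum_apply, smul_apply,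
    QuadraticMap.linMulLin_apply, LinearMap.proj_apply]
  refine Finset.sum_eq_zero fun k _ => ?_
  by_cases hk : k.castSucc = i
  · have : k.succ ≠ i := fun h' => by
      have := congrArg Fin.val (h'.trans hk.symm)
      simp at this
    simp [Pi.single_eq_of_ne this]
  · simp [Pi.single_eq_of_ne hk]

/-- Squares of linear combinations of the generators. -/
lemma IsCliffGen.linear_sq {C : Type} [Ring C] [Algebra ℤ[T;T⁻¹] C] {X : ℕ → C}
    (hg : IsCliffGen X (cliffCoeff n)) (a : Fin (n + 1) → ℤ[T;T⁻¹]) :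
    (∑ i, a i • X i) * (∑ i, a i • X i) =
      algebraMap ℤ[T;T⁻¹] (C) (cliffForm n a) := by
  let f : (Fin (n + 1) → ℤ[T;T⁻¹]) →ₗ[ℤ[T;T⁻¹]] C :=
    (Pi.basisFun ℤ[T;T⁻¹] (Fin (n + 1))).constr ℤ[T;T⁻¹] fun i => X i
  have hf1 : ∀ i, f (Pi.single i 1) = X i := fun i => by
    rw [← Pi.basisFun_apply, Module.Basis.constr_basis]
  have hf : ∀ a, f a = ∑ i, a i • X i := fun a => by
    rw [Module.Basis.constr_apply_fintype]; simp
  rw [← hf]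
  -- the polarizations of both sides are bilinear and agree on basis vectors
  have hpol : ∀ u v, f u * f v + f v * f u =
      algebraMap ℤ[T;T⁻¹] (C) (QuadraticMap.polar (cliffForm n) u v) := by
    let B₁ : (Fin (n + 1) → ℤ[T;T⁻¹]) →ₗ[ℤ[T;T⁻¹]] (Fin (n + 1) → ℤ[T;T⁻¹]) →ₗ[ℤ[T;T⁻¹]]
      C := (LinearMap.mul ℤ[T;T⁻¹] (C)).compl₁₂ f f
    let B₂ : (Fin (n + 1) → ℤ[T;T⁻¹]) →ₗ[ℤ[T;T⁻¹]] (Fin (n + 1) → ℤ[T;T⁻¹]) →ₗ[ℤ[T;T⁻¹]]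
      C := (QuadraticMap.polarBilin (cliffForm n)).compr₂
        (Algebra.linearMap ℤ[T;T⁻¹] (C))
    have hB : B₁ + B₁.flip = B₂ := by
      refine (Pi.basisFun ℤ[T;T⁻¹] (Fin (n + 1))).ext fun i =>
        (Pi.basisFun ℤ[T;T⁻¹] (Fin (n + 1))).ext fun j => ?_
      rw [Pi.basisFun_apply, Pi.basisFun_apply]
      change f _ * f _ + f _ * f _ = algebraMap _ _ (QuadraticMap.polar _ _ _)
      rw [hf1, hf1, hg.anticomm, polar_cliffForm_single]
    exact fun u v => LinearMap.congr_fun (LinearMap.congr_fun hB u) v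
  have hadd : ∀ u v, f u * f u = algebraMap ℤ[T;T⁻¹] (C) (cliffForm n u) →
      f v * f v = algebraMap ℤ[T;T⁻¹] (C) (cliffForm n v) →
      f (u + v) * f (u + v) = algebraMap ℤ[T;T⁻¹] (C) (cliffForm n (u + v)) := by
    intro u v hu hv
    have e : cliffForm n (u + v) = cliffForm n u + cliffForm n v +
        QuadraticMap.polar (cliffForm n) u v := by rw [QuadraticMap.polar]; ring
    rw [e, map_add (algebraMap _ _), map_add (algebraMap _ _), ← hpol, ← hu, ← hv, map_add f,
      add_mul, mul_add, mul_add]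
    abel
  have hs : ∀ i c, f (Pi.single i c) * f (Pi.single i c) =
      algebraMap ℤ[T;T⁻¹] (C) (cliffForm n (Pi.single i c)) := by
    intro i c
    have e : (Pi.single i c : Fin (n + 1) → ℤ[T;T⁻¹]) = c • Pi.single i 1 := by
      rw [← Pi.single_smul]; simp
    rw [e, map_smul, hf1, QuadraticMap.map_smul, cliffForm_single, smul_mul_smul_comm, hg.sq]
    simp
  rw [← Finset.univ_sum_single a]
  induction (Finset.univ : Finset (Fin (n + 1))) using Finset.induction_on with
  | empty => simp
  | insert i s hi ih =>
    rw [Finset.sum_insert hi]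
    exact hadd _ _ (hs _ _) ih

lemma ι_single_anticomm (i j : Fin (n + 1)) :
    CliffordAlgebra.ι (cliffForm n) (Pi.single i 1) * CliffordAlgebra.ι (cliffForm n)
      (Pi.single j 1) + CliffordAlgebra.ι (cliffForm n) (Pi.single j 1) *
      CliffordAlgebra.ι (cliffForm n) (Pi.single i 1) = algebraMap _ _
      ((if (i : ℕ) = j + 1 then cliffCoeff n j else 0) +
        if (j : ℕ) = i + 1 then cliffCoeff n i else 0) := by
  rw [CliffordAlgebra.ι_mul_ι_add_swap, polar_cliffForm_single]

/-- The presented algebra is the Clifford algebra of `Q_n`. -/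
theorem exists_cliff_equiv : ∃ e : CliffordAlgebra (cliffForm n) ≃ₐ[ℤ[T;T⁻¹]] CliffQuot n,
    ∀ i : Fin (n + 1), e (CliffordAlgebra.ι (cliffForm n) (Pi.single i 1)) = cliffX n i := by
  obtain ⟨Φ, hΦ⟩ := exists_cliffQuot_lift (n := n)
    (Y := fun i => if h : i < n + 1 then
      CliffordAlgebra.ι (cliffForm n) (Pi.single ⟨i, h⟩ 1) else 0)
    (fun i j hi hj => by
      rw [dif_pos (Nat.lt_succ_iff.2 hi), dif_pos (Nat.lt_succ_iff.2 hj)]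
      exact ι_single_anticomm _ _)
    (fun i hi => by
      rw [dif_pos (Nat.lt_succ_iff.2 hi), CliffordAlgebra.ι_sq_scalar, cliffForm_single, map_zero])
  have hΦ' : ∀ i : Fin (n + 1), Φ (cliffX n i) =
      CliffordAlgebra.ι (cliffForm n) (Pi.single i 1) := fun i => by
    rw [hΦ i (Nat.lt_succ_iff.1 i.2), dif_pos i.2]
  let f : (Fin (n + 1) → ℤ[T;T⁻¹]) →ₗ[ℤ[T;T⁻¹]] CliffQuot n :=
    (Pi.basisFun ℤ[T;T⁻¹] (Fin (n + 1))).constr ℤ[T;T⁻¹] fun i => cliffX n i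
  have hf1 : ∀ i, f (Pi.single i 1) = cliffX n i := fun i => by
    rw [← Pi.basisFun_apply, Module.Basis.constr_basis]
  have hf : ∀ a, f a * f a = algebraMap _ _ (cliffForm n a) := fun a => by
    rw [← (isCliffGen_cliffX n).linear_sq, Module.Basis.constr_apply_fintype]; simp
  let Ψ := CliffordAlgebra.lift (cliffForm n) ⟨f, hf⟩
  have hΨ : ∀ i : Fin (n + 1), Ψ (CliffordAlgebra.ι (cliffForm n) (Pi.single i 1)) =
      cliffX n i := fun i => by rw [CliffordAlgebra.lift_ι_apply, hf1]
  refine ⟨AlgEquiv.ofAlgHom Ψ Φ ?_ ?_, hΨ⟩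
  · refine RingQuot.ringQuot_ext' _ _ _ (FreeAlgebra.hom_ext (funext fun i => ?_))
    change Ψ (Φ (RingQuot.mkAlgHom _ _ (FreeAlgebra.ι _ i))) = RingQuot.mkAlgHom _ _ _
    rw [← cliffX_fin, hΦ', hΨ]
  · refine CliffordAlgebra.hom_ext ((Pi.basisFun ℤ[T;T⁻¹] (Fin (n + 1))).ext fun i => ?_)
    rw [Pi.basisFun_apply]
    change Φ (Ψ (CliffordAlgebra.ι _ _)) = CliffordAlgebra.ι _ _
    rw [hΨ, hΦ']

end

/-! ### Right multiplications between the summands of the bimodule -/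

noncomputable section

variable {n : ℕ}

namespace Rn

lemma e_mul_e (x : Vtx n) : e x * e x = e x :=
  (QDGPresentation.mk_ι_mul _ _).symm.trans
    (QDGPresentation.mk_rel (S := Rn.pres n) (RGen.Rel.e_e x))

lemma e_mul_r {s : ℕ} {x y : Vtx n} (h : IsArrow s x y) : e x * r h = r h :=
  (QDGPresentation.mk_ι_mul _ _).symm.trans
    (QDGPresentation.mk_rel (S := Rn.pres n) (RGen.Rel.e_r h))

lemma r_mul_e {s : ℕ} {x y : Vtx n} (h : IsArrow s x y) : r h * e y = r h :=
  (QDGPresentation.mk_ι_mul _ _).symm.trans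
    (QDGPresentation.mk_rel (S := Rn.pres n) (RGen.Rel.r_e h))

lemma r_mul_r {s t : ℕ} {x y z w : Vtx n} (h₁ : IsArrow s x y) (h₂ : IsArrow t y w)
    (h₃ : IsArrow t x z) (h₄ : IsArrow s z w) : r h₁ * r h₂ = r h₃ * r h₄ :=
  (QDGPresentation.mk_ι_mul _ _).symm.trans
    ((QDGPresentation.mk_rel (S := Rn.pres n) (RGen.Rel.r_r h₁ h₂ h₃ h₄)).trans
      (QDGPresentation.mk_ι_mul _ _))

lemma r_mem {s : ℕ} {x y : Vtx n} (h : IsArrow s x y) :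
    r h ∈ (Rn n).gr (0, (n : ℤ) - 1 - 2 * s) :=
  QDGPresentation.gen_mem (S := Rn.pres n) (RGen.r s x y h)

/-- The differential of `R_n` vanishes. -/
lemma d_eq_zero (a : Rn n) : (Rn n).d a = 0 := by
  have key : ∀ l, QDGPresentation.diffHom (Rn.valid n) ((Rn.pres n).word l) = 0 := by
    intro l
    induction l with
    | nil => exact QDGPresentation.diffHom_one _
    | cons x l ih =>
      have e1 : (Rn.pres n).word (x :: l) = (Rn.pres n).gen x * (Rn.pres n).word l := by
        simp [QDGPresentation.word]
      have e2 : QDGPresentation.diffHom (Rn.valid n) ((Rn.pres n).gen x) = 0 :=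
        (QDGPresentation.diffHom_gen (Rn.valid n) x).trans (map_zero _)
      rw [e1, QDGPresentation.diffHom_mul, ih, e2, mul_zero, zero_mul, add_zero]
  exact QDGPresentation.alg_induction (S := Rn.pres n)
    (p := fun a => QDGPresentation.diffHom (Rn.valid n) a = 0)
    (map_zero _) key (fun a b ha hb => by rw [map_add, ha, hb, add_zero]) a

end Rn

lemma idem_mul_self (o : Option (Vtx n)) : idem o * idem o = idem o := by
  cases o with
  | none => exact mul_zero _
  | some x => exact Rn.e_mul_e x

lemma idem_mul_rOpt (s : ℕ) (u v : Option (Vtx n)) : idem u * rOpt s u v = rOpt s u v := by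
  cases u with
  | none => exact zero_mul _
  | some x => cases v with
    | none => exact mul_zero _
    | some y =>
      simp only [rOpt, idem]
      split_ifs with h
      · exact Rn.e_mul_r h
      · exact mul_zero _

lemma rOpt_mul_idem (s : ℕ) (u v : Option (Vtx n)) : rOpt s u v * idem v = rOpt s u v := by
  cases u with
  | none => exact zero_mul _
  | some x => cases v with
    | none => exact mul_zero _
    | some y =>
      simp only [rOpt, idem]
      split_ifs with h
      · exact Rn.r_mul_e h
      · exact zero_mul _

lemma rOpt_mem (s : ℕ) (u v : Option (Vtx n)) :
    rOpt s u v ∈ (Rn n).gr (0, (n : ℤ) - 1 - 2 * s) := by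
  cases u with
  | none => exact zero_mem _
  | some x => cases v with
    | none => exact zero_mem _
    | some y =>
      simp only [rOpt]
      split_ifs with h
      · exact Rn.r_mem h
      · exact zero_mem _

/-- The entries which are added along a map with the given label: `t + 1` and `t` for the right
multiplication by an arrow with label `t`, and no entries for the identity (label `none`). -/
def labelEntries : Option ℕ → Multiset ℕ
  | none => 0
  | some t => {t + 1, t}

/-- The element of `R_n` with the given label which starts at the vertex with the given entries: an
arrow, or an idempotent if the label is `none`. -/
def labelElt (n : ℕ) (l : Option ℕ) (m : Multiset ℕ) : Rn n :=
  match l with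
  | none => idem (ofMultiset n m)
  | some t => rOpt t (ofMultiset n m) (ofMultiset n (m + {t + 1, t}))

lemma idem_mul_labelElt (l : Option ℕ) (m : Multiset ℕ) :
    idem (ofMultiset n m) * labelElt n l m = labelElt n l m := by
  cases l with
  | none => exact idem_mul_self _
  | some t => exact idem_mul_rOpt _ _ _

lemma labelElt_mul_idem (l : Option ℕ) (m : Multiset ℕ) :
    labelElt n l m * idem (ofMultiset n (m + labelEntries l)) = labelElt n l m := by
  cases l with
  | none => simpa [labelElt, labelEntries] using idem_mul_self (ofMultiset n m)
  | some t => exact rOpt_mul_idem _ _ _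

lemma labelElt_eq_zero (l : Option ℕ) {m : Multiset ℕ} (h : ¬ (m + labelEntries l).Nodup) :
    labelElt n l m = 0 := by
  rw [← labelElt_mul_idem, ofMultiset_of_not_nodup h]
  exact mul_zero _

/-- The `q`-degree of the elements with a given label. -/
def labelDeg (n : ℕ) : Option ℕ → ℤ
  | none => 0
  | some t => n - 1 - 2 * t

lemma labelElt_mem (l : Option ℕ) (m : Multiset ℕ) :
    labelElt n l m ∈ (Rn n).gr (0, labelDeg n l) := by
  cases l with
  | none => exact idem_mem _
  | some t => exact rOpt_mem _ _ _

lemma isArrow_of_nodup {m : Multiset ℕ} {t : ℕ} (hm : ∀ a ∈ m + {t + 1, t}, a ≤ n)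
    (h : (m + {t + 1, t}).Nodup) :
    IsArrow t (Vtx.of n m.toFinset) (Vtx.of n (m + {t + 1, t}).toFinset) := by
  have hm' : ∀ a ∈ m.toFinset, a ≤ n := fun a ha =>
    hm a (Multiset.mem_add.2 (Or.inl (Multiset.mem_toFinset.1 ha)))
  have hd : ∀ {a}, a ∈ m → a ∉ ({t + 1, t} : Multiset ℕ) :=
    Multiset.disjoint_left.1 (Multiset.nodup_add.1 h).2.2
  rw [IsArrow, Vtx.of_val_eq hm', Vtx.of_val_eq (fun a ha => hm a (Multiset.mem_toFinset.1 ha))]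
  refine ⟨fun h' => ?_, fun h' => ?_, ?_⟩
  · exact hd (Multiset.mem_toFinset.1 h') (by simp)
  · exact hd (Multiset.mem_toFinset.1 h') (by simp)
  · ext c
    simp only [Multiset.mem_toFinset, Multiset.mem_add, Finset.mem_insert, Multiset.insert_eq_cons,
      Multiset.mem_cons, Multiset.mem_singleton]
    tauto

lemma labelElt_some_of_nodup {m : Multiset ℕ} {t : ℕ} (hm : ∀ a ∈ m + {t + 1, t}, a ≤ n)
    (h : (m + {t + 1, t}).Nodup) : labelElt n (some t) m = Rn.r (isArrow_of_nodup hm h) := by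
  simp only [labelElt, ofMultiset_of_nodup h, ofMultiset_of_nodup (Multiset.nodup_add.1 h).1, rOpt]
  rw [dif_pos (isArrow_of_nodup hm h)]

/-- Maps with arbitrary labels commute. -/
lemma labelElt_comm (k l : Option ℕ) {m : Multiset ℕ}
    (hm : ∀ a ∈ m + labelEntries k + labelEntries l, a ≤ n) :
    labelElt n k m * labelElt n l (m + labelEntries k) =
      labelElt n l m * labelElt n k (m + labelEntries l) := by
  by_cases h : (m + labelEntries k + labelEntries l).Nodup
  · have e : m + labelEntries k + labelEntries l = m + labelEntries l + labelEntries k :=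
      add_right_comm _ _ _
    cases k with
    | none =>
      have h1 := idem_mul_labelElt (n := n) l m
      have h2 := labelElt_mul_idem (n := n) l m
      change idem _ * labelElt n l (m + 0) = labelElt n l m * idem _
      rw [add_zero, h1, h2]
    | some s => cases l with
      | none =>
        have h1 := idem_mul_labelElt (n := n) (some s) m
        have h2 := labelElt_mul_idem (n := n) (some s) m
        change labelElt n (some s) m * idem _ = idem _ * labelElt n (some s) (m + 0)
        rw [add_zero, h1, h2]
      | some t =>
        have hm' := hm
        have h' := h
        rw [e] at hm' h'
        have hml : ∀ a ∈ m + labelEntries (some s), a ≤ n := fun a ha =>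
          hm a (Multiset.mem_add.2 (Or.inl ha))
        have hmr : ∀ a ∈ m + labelEntries (some t), a ≤ n := fun a ha =>
          hm' a (Multiset.mem_add.2 (Or.inl ha))
        rw [labelElt_some_of_nodup hml (Multiset.nodup_add.1 h).1,
          labelElt_some_of_nodup hm h, labelElt_some_of_nodup hmr (Multiset.nodup_add.1 h').1,
          labelElt_some_of_nodup hm' h']
        have a4 := isArrow_of_nodup hm' h'
        have hE : Vtx.of n (m + labelEntries (some t) + {s + 1, s}).toFinset =
            Vtx.of n (m + labelEntries (some s) + {t + 1, t}).toFinset := by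
          rw [show m + labelEntries (some t) + {s + 1, s} =
            m + labelEntries (some s) + {t + 1, t} from e.symm]
        have key : ∀ (w : Vtx n) (a5 : IsArrow s (Vtx.of n (m + labelEntries (some t)).toFinset) w),
            w = Vtx.of n (m + labelEntries (some s) + {t + 1, t}).toFinset →
            Rn.r (isArrow_of_nodup hml (Multiset.nodup_add.1 h).1) *
              Rn.r (isArrow_of_nodup hm h) =
            Rn.r (isArrow_of_nodup hmr (Multiset.nodup_add.1 h').1) * Rn.r a5 := by
          rintro _ a5 rfl
          exact Rn.r_mul_r _ _ _ _
        exact key _ a4 hE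
  · have h' : ¬ (m + labelEntries l + labelEntries k).Nodup := by rwa [add_right_comm]
    rw [labelElt_eq_zero l h, labelElt_eq_zero k h', mul_zero, mul_zero]

/-! ### Entries along the generators of `R_n ⊠ R_n` -/

lemma entries_r (x y y' A : Finset ℕ) {t : ℕ} (h₁ : t ∉ y) (h₂ : t + 1 ∉ y)
    (hy : y' = insert (t + 1) (insert t y)) (hA : ∀ s ∈ A, s ∈ x ∧ s + 1 ∈ y) :
    entries x y' (A ∪ x.filter (fun a => a + 1 = t)) =
      entries x y A + labelEntries (if t ∈ x then none else some t) := by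
  have hl : ∀ c, (labelEntries (if t ∈ x then none else some t)).count c =
      (if t ∉ x ∧ c = t + 1 then 1 else 0) + (if t ∉ x ∧ c = t then 1 else 0) := by
    intro c
    by_cases h : t ∈ x <;>
      simp [h, labelEntries, Multiset.count_cons, Multiset.count_singleton, add_comm]
  subst hy
  refine multiset_ext_nat ?_ fun c => ?_
  · simp only [hl, Multiset.count_add, count_entries_zero, Finset.mem_filter, Finset.mem_insert,
      Finset.mem_union]
    clear hl
    grind
  · simp only [hl, Multiset.count_add, count_entries_succ, Finset.mem_filter, Finset.mem_insert,
      Finset.mem_union]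
    clear hl
    have a1 := hA c
    have a2 := hA (c + 1)
    by_cases e1 : c = t
    · subst e1; grind
    by_cases e2 : c + 1 = t
    · subst e2; grind
    by_cases e3 : c = t + 1
    · subst e3; grind
    grind

lemma entries_l (x x' y A : Finset ℕ) {t : ℕ} (h₁ : t ∉ x) (h₂ : t + 1 ∉ x)
    (hx : x' = insert (t + 1) (insert t x)) (hA : ∀ s ∈ A, s ∈ x ∧ s + 1 ∈ y) :
    entries x' y (A ∪ if t + 2 ∈ y then {t + 1} else ∅) =
      entries x y A + labelEntries (if t + 1 ∈ y then none else some t) := by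
  have hl : ∀ c, (labelEntries (if t + 1 ∈ y then none else some t)).count c =
      (if t + 1 ∉ y ∧ c = t + 1 then 1 else 0) + (if t + 1 ∉ y ∧ c = t then 1 else 0) := by
    intro c
    by_cases h : t + 1 ∈ y <;>
      simp [h, labelEntries, Multiset.count_cons, Multiset.count_singleton, add_comm]
  have hB : ∀ c, c ∈ (if t + 2 ∈ y then {t + 1} else ∅ : Finset ℕ) ↔ t + 2 ∈ y ∧ c = t + 1 := by
    intro c
    split_ifs with h <;> simp [h]
  subst hx
  refine multiset_ext_nat ?_ fun c => ?_
  · simp only [hl, hB, Multiset.count_add, count_entries_zero, Finset.mem_insert,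
      Finset.mem_union]
    clear hl hB
    grind
  · simp only [hl, hB, Multiset.count_add, count_entries_succ, Finset.mem_insert,
      Finset.mem_union]
    clear hl hB
    have a1 := hA c
    have a2 := hA (c + 1)
    by_cases e1 : c = t
    · subst e1; grind
    by_cases e2 : c + 1 = t
    · subst e2; grind
    by_cases e3 : c = t + 1
    · subst e3; grind
    grind

lemma entries_b (x x' y y' A : Finset ℕ) {s : ℕ} (h₁ : s ∉ x) (h₂ : s + 1 ∉ x)
    (hx : x' = insert (s + 1) (insert s x)) (k₁ : s + 1 ∉ y) (k₂ : s + 2 ∉ y)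
    (hy : y' = insert (s + 2) (insert (s + 1) y)) : entries x' y' A = entries x y A := by
  subst hx hy
  refine multiset_ext_nat ?_ fun c => ?_
  · simp only [count_entries_zero, Finset.mem_insert]
    grind
  · simp only [count_entries_succ, Finset.mem_insert]
    by_cases e1 : c = s
    · subst e1; grind
    by_cases e2 : c + 1 = s
    · subst e2; grind
    by_cases e3 : c = s + 1
    · subst e3; grind
    grind

/-- Adding `s` to the index set of a summand adds the entries `s + 1` and `s`. -/
lemma entries_insert (x y : Finset ℕ) {A : Finset ℕ} {s : ℕ} (h : s ∉ A) :
    entries x y (insert s A) = entries x y A + labelEntries (some s) := by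
  refine multiset_ext_nat ?_ fun c => ?_
  · simp only [labelEntries, Multiset.count_add, count_entries_zero, Finset.mem_insert,
      Multiset.insert_eq_cons, Multiset.count_cons, Multiset.count_singleton]
    grind
  · simp only [labelEntries, Multiset.count_add, count_entries_succ, Finset.mem_insert,
      Multiset.insert_eq_cons, Multiset.count_cons, Multiset.count_singleton]
    grind

/-! ### The degree `μ` along the generators of `R_n ⊠ R_n` -/

lemma mu_sign_cancel (k : ℕ) : (-1 : ℤ) ^ k + (-1) ^ (k + 1) = 0 := by ring

lemma muSet_r (x y : Finset ℕ) {t : ℕ} (h₁ : t ∉ y) (h₂ : t + 1 ∉ y) :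
    muSet x (insert (t + 1) (insert t y)) =
      muSet x y - (x.filter (fun a => a + 1 = t)).card := by
  rw [Finset.card_filter, muSet, muSet, Nat.cast_sum, ← Finset.sum_sub_distrib]
  refine Finset.sum_congr rfl fun a _ => ?_
  rw [Finset.sum_insert (by simp [h₂]), Finset.sum_insert h₁]
  rcases lt_trichotomy (a + 1) t with h | h | h
  · rw [if_pos (by omega), if_pos h, if_neg (by omega)]
    have := mu_sign_cancel (a + t + 1)
    rw [show a + (t + 1) + 1 = a + t + 1 + 1 by ring]
    push_cast
    linarith
  · rw [if_pos (by omega), if_neg (by omega), if_pos h, ← h]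
    have : (-1 : ℤ) ^ (a + (a + 1 + 1) + 1) = -1 := Odd.neg_one_pow ⟨a + 1, by ring⟩
    rw [this]
    push_cast
    ring
  · rw [if_neg (by omega), if_neg (by omega), if_neg (by omega)]
    simp

lemma muSet_l (x y : Finset ℕ) {t : ℕ} (h₁ : t ∉ x) (h₂ : t + 1 ∉ x) :
    muSet (insert (t + 1) (insert t x)) y =
      muSet x y - (if t + 2 ∈ y then {t + 1} else ∅ : Finset ℕ).card := by
  have e : ((if t + 2 ∈ y then {t + 1} else ∅ : Finset ℕ).card : ℤ) =
      ∑ b ∈ y, if b = t + 2 then 1 else 0 := by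
    rw [Finset.sum_ite_eq' y (t + 2)]
    split_ifs <;> simp
  rw [e, muSet, Finset.sum_insert (by simp [h₂]), Finset.sum_insert h₁, ← add_assoc,
    ← Finset.sum_add_distrib, add_comm, muSet, sub_eq_add_neg, ← Finset.sum_neg_distrib]
  congr 1
  refine Finset.sum_congr rfl fun b _ => ?_
  rcases lt_trichotomy b (t + 2) with h | h | h
  · rw [if_neg (by omega), if_neg (by omega), if_neg (by omega)]
    simp
  · rw [if_neg (by omega), if_pos (by omega), if_pos h, h]
    have : (-1 : ℤ) ^ (t + (t + 2) + 1) = -1 := Odd.neg_one_pow ⟨t + 1, by ring⟩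
    rw [this, zero_add]
  · rw [if_pos (by omega), if_pos (by omega), if_neg (by omega)]
    have := mu_sign_cancel (t + b + 1)
    rw [show t + 1 + b + 1 = t + b + 1 + 1 by ring]
    linarith

end

noncomputable section

variable {n : ℕ}

lemma mem_adj {x y : Vtx n} {s : ℕ} : s ∈ adj x y ↔ s ∈ x.1 ∧ s + 1 ∈ y.1 := Finset.mem_filter

/-! ### The combinatorics of the generators of `R_n ⊠ R_n` -/

namespace BGen

/-- The pair at which a generator starts. -/
def src : BGen n → Vtx n × Vtx n
  | .e x y => (x, y)
  | .l _ x _ _ y => (x, y)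
  | .r x _ y _ _ => (x, y)
  | .b _ x _ y _ _ _ => (x, y)

/-- The pair at which a generator ends. -/
def tgt : BGen n → Vtx n × Vtx n
  | .e x y => (x, y)
  | .l _ _ x' _ y => (x', y)
  | .r x _ _ y' _ => (x, y')
  | .b _ _ x' _ y' _ _ => (x', y')

/-- The elements of `adj` which become available along a generator and which its right
multiplication adds to the index set of a summand. -/
def newA : BGen n → Finset ℕ
  | .e _ _ => ∅
  | .l t _ _ _ y => if t + 2 ∈ y.1 then {t + 1} else ∅
  | .r x t _ _ _ => x.1.filter (fun a => a + 1 = t)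
  | .b _ _ _ _ _ _ _ => ∅

/-- The elements of `adj` which become available along a generator and which its right
multiplication does not add to the index set of a summand. -/
def extra : BGen n → Finset ℕ
  | .e _ _ => ∅
  | .l t _ _ _ y => if t + 1 ∈ y.1 then {t} else ∅
  | .r x t _ _ _ => if t ∈ x.1 then {t} else ∅
  | .b s _ _ _ _ _ _ => {s, s + 1}

/-- The label of the maps between summands by which a generator acts. -/
def lab : BGen n → Option ℕ
  | .e _ _ => none
  | .l t _ _ _ y => if t + 1 ∈ y.1 then none else some t
  | .r x t _ _ _ => if t ∈ x.1 then none else some t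
  | .b _ _ _ _ _ _ _ => none

lemma adj_tgt (g : BGen n) :
    adj g.tgt.1 g.tgt.2 = adj g.src.1 g.src.2 ∪ (g.newA ∪ g.extra) := by
  ext a
  cases g with
  | e x y => simp [src, tgt, newA, extra]
  | l t x x' h y =>
    have ⟨h1, h2, h3⟩ := h
    have e1 : a ∈ (if t + 2 ∈ y.1 then {t + 1} else ∅ : Finset ℕ) ↔ t + 2 ∈ y.1 ∧ a = t + 1 := by
      split_ifs with h <;> simp [h]
    have e2 : a ∈ (if t + 1 ∈ y.1 then {t} else ∅ : Finset ℕ) ↔ t + 1 ∈ y.1 ∧ a = t := by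
      split_ifs with h <;> simp [h]
    simp only [src, tgt, newA, extra, mem_adj, Finset.mem_union, e1, e2, h3,
      Finset.mem_insert]
    constructor
    · rintro ⟨rfl | rfl | h', h''⟩ <;> simp [*]
    · rintro (⟨h', h''⟩ | ⟨h', rfl⟩ | ⟨h', rfl⟩) <;> simp [*]
  | r x t y y' h =>
    have ⟨h1, h2, h3⟩ := h
    have e2 : a ∈ (if t ∈ x.1 then {t} else ∅ : Finset ℕ) ↔ t ∈ x.1 ∧ a = t := by
      split_ifs with h <;> simp [h]
    simp only [src, tgt, newA, extra, mem_adj, Finset.mem_union, e2, Finset.mem_filter, h3,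
      Finset.mem_insert, Nat.add_right_cancel_iff]
    constructor
    · rintro ⟨h', rfl | rfl | h''⟩ <;> simp [*]
    · rintro (⟨h', h''⟩ | ⟨h', rfl⟩ | ⟨h', rfl⟩) <;> simp [*]
  | b s x x' y y' h k =>
    have ⟨h1, h2, h3⟩ := h
    have ⟨k1, k2, k3⟩ := k
    simp only [src, tgt, newA, extra, mem_adj, Finset.mem_union, h3, k3,
      Finset.mem_insert, Finset.mem_singleton, Finset.notMem_empty]
    grind

lemma disjoint_adj_src (g : BGen n) :
    Disjoint (adj g.src.1 g.src.2) (g.newA ∪ g.extra) := by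
  rw [Finset.disjoint_left]
  intro a ha hb
  cases g with
  | e x y => simp [newA, extra] at hb
  | l t x x' h y =>
    have ⟨h1, h2, h3⟩ := h
    simp only [src, newA, extra, mem_adj, Finset.mem_union] at ha hb
    split_ifs at hb <;> simp at hb <;> grind
  | r x t y y' h =>
    have ⟨h1, h2, h3⟩ := h
    simp only [src, newA, extra, mem_adj, Finset.mem_union] at ha hb
    split_ifs at hb <;> simp at hb <;> grind
  | b s x x' y y' h k =>
    have ⟨h1, h2, h3⟩ := h
    simp only [src, newA, extra, mem_adj, Finset.mem_union, Finset.mem_insert,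
      Finset.mem_singleton, Finset.notMem_empty] at ha hb
    grind

lemma disjoint_newA_extra (g : BGen n) : Disjoint g.newA g.extra := by
  rw [Finset.disjoint_left]
  intro a ha hb
  cases g with
  | e x y => simp [extra] at hb
  | l t x x' h y =>
    simp only [newA, extra] at ha hb
    split_ifs at ha hb <;> simp at ha hb
    omega
  | r x t y y' h =>
    simp only [newA, extra, Finset.mem_filter] at ha hb
    split_ifs at hb <;> simp at hb
    omega
  | b s x x' y y' h k => simp [newA] at ha

lemma union_newA_subset (g : BGen n) {A : Finset ℕ} (hA : A ⊆ adj g.src.1 g.src.2) :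
    A ∪ g.newA ⊆ adj g.tgt.1 g.tgt.2 := by
  rw [adj_tgt]
  grind

lemma adj_sdiff (g : BGen n) {A : Finset ℕ} (hA : A ⊆ adj g.src.1 g.src.2) :
    adj g.tgt.1 g.tgt.2 \ (A ∪ g.newA) = (adj g.src.1 g.src.2 \ A) ∪ g.extra := by
  have h1 := Finset.disjoint_left.1 g.disjoint_adj_src
  have h2 := Finset.disjoint_left.1 g.disjoint_newA_extra
  rw [adj_tgt]
  ext a
  have := @h1 a
  have := @h2 a
  have := @hA a
  simp only [Finset.mem_union, Finset.mem_sdiff] at *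
  tauto

lemma disjoint_sdiff_extra (g : BGen n) (A : Finset ℕ) :
    Disjoint (adj g.src.1 g.src.2 \ A) g.extra :=
  (g.disjoint_adj_src.mono_left Finset.sdiff_subset).mono_right Finset.subset_union_right

lemma disjoint_newA (g : BGen n) {A : Finset ℕ} (hA : A ⊆ adj g.src.1 g.src.2) :
    Disjoint A g.newA :=
  (g.disjoint_adj_src.mono_left hA).mono_right Finset.subset_union_left

lemma entries_tgt (g : BGen n) {A : Finset ℕ} (hA : A ⊆ adj g.src.1 g.src.2) :
    entries g.tgt.1.1 g.tgt.2.1 (A ∪ g.newA) =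
      entries g.src.1.1 g.src.2.1 A + labelEntries g.lab := by
  have hA' : ∀ s ∈ A, s ∈ g.src.1.1 ∧ s + 1 ∈ g.src.2.1 := fun s hs => by
    simpa [adj] using hA hs
  cases g with
  | e x y => simp [src, tgt, newA, lab, labelEntries]
  | l t x x' h y => exact entries_l _ _ _ _ h.1 h.2.1 h.2.2 hA'
  | r x t y y' h => exact entries_r _ _ _ _ h.1 h.2.1 h.2.2 hA'
  | b s x x' y y' h k =>
    simpa [src, tgt, newA, lab, labelEntries] using
      entries_b _ _ _ _ A h.1 h.2.1 h.2.2 k.1 k.2.1 k.2.2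

/-- If the right multiplication by an arrow other than `b` makes a new element `s` of `adj`
available without adding it to the index set, then `s` or `s + 1` already is an entry. -/
lemma not_nodup_extra (g : BGen n) (hg : ∀ s x x' y y' h k, g ≠ .b s x x' y y' h k)
    {A : Finset ℕ} (hA : A ⊆ adj g.src.1 g.src.2) {s : ℕ} (hs : s ∈ g.extra) :
    ¬ (entries g.tgt.1.1 g.tgt.2.1 (A ∪ g.newA) + labelEntries (some s)).Nodup := by
  intro hn
  have hd := (Multiset.nodup_add.1 hn).2.2
  have hl : s ∈ labelEntries (some s) := by simp [labelEntries]
  have hl' : s + 1 ∈ labelEntries (some s) := by simp [labelEntries]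
  have h0 := Multiset.count_eq_zero.2 fun h => Multiset.disjoint_left.1 hd h hl
  have h1 := Multiset.count_eq_zero.2 fun h => Multiset.disjoint_left.1 hd h hl'
  cases g with
  | e x y => simp [extra] at hs
  | l t x x' h y =>
    obtain ⟨_, _, h3⟩ := h
    simp only [extra] at hs
    split_ifs at hs with ht
    · obtain rfl := Finset.mem_singleton.1 hs
      rw [count_entries_succ] at h1
      simp only [tgt, newA, h3] at h1
      by_cases h' : s + 2 ∈ y.1 <;> simp [h'] at h1
    · simp at hs
  | r x t y y' h =>
    obtain ⟨_, _, h3⟩ := h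
    simp only [extra] at hs
    split_ifs at hs with ht
    · obtain rfl := Finset.mem_singleton.1 hs
      cases s with
      | zero =>
        rw [count_entries_zero] at h0
        simp [tgt, h3] at h0
      | succ s =>
        rw [count_entries_succ] at h0
        simp only [tgt, newA, h3] at h0
        by_cases h' : s ∈ x.1 <;> simp [h'] at h0
    · simp at hs
  | b s x x' y y' h k => exact hg _ _ _ _ _ _ _ rfl

/-- The right multiplication by a generator has the cohomological degree of the generator. -/
lemma mu_tgt (g : BGen n) :
    mu g.tgt.1 g.tgt.2 + g.newA.card = mu g.src.1 g.src.2 + g.deg.1 := by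
  cases g with
  | e x y => simp [src, tgt, newA, deg]
  | l t x x' h y =>
    have := muSet_l x.1 y.1 h.1 h.2.1
    rw [← h.2.2] at this
    change muSet x'.1 y.1 + _ = muSet x.1 y.1 + 0
    rw [this, newA, sub_add_cancel, add_zero]
  | r x t y y' h =>
    have := muSet_r x.1 y.1 h.1 h.2.1
    rw [← h.2.2] at this
    change muSet x.1 y'.1 + _ = muSet x.1 y.1 + 0
    rw [this, newA, sub_add_cancel, add_zero]
  | b s x x' y y' h k =>
    have e1 := muSet_l x.1 y'.1 h.1 h.2.1
    have e2 := muSet_r x.1 y.1 k.1 k.2.1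
    rw [← h.2.2] at e1
    rw [← k.2.2] at e2
    have h1 : s + 2 ∈ y'.1 := by rw [k.2.2]; simp
    have h2 : x.1.filter (fun a => a + 1 = s + 1) = ∅ := by
      rw [Finset.filter_eq_empty_iff]
      rintro a ha e
      obtain rfl := Nat.succ.inj e
      exact h.1 ha
    rw [if_pos h1, Finset.card_singleton] at e1
    rw [h2, Finset.card_empty] at e2
    change muSet x'.1 y'.1 + _ = muSet x.1 y.1 + -1
    rw [e1, e2, newA]
    simp [sub_eq_add_neg]

/-- The right multiplication by a generator has the `q`-degree of the generator: the new
elements which are not added to the index set change `η` by the difference to the degree of the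
label. -/
lemma sum_extra (g : BGen n) :
    ∑ s ∈ g.extra, (2 * (s : ℤ) + 1 - n) = labelDeg n g.lab - g.deg.2 := by
  cases g with
  | e x y => simp [extra, lab, labelDeg, deg]
  | l t x x' h y =>
    simp only [extra, lab, deg]
    split_ifs <;> simp [labelDeg]
    ring
  | r x t y y' h =>
    simp only [extra, lab, deg]
    split_ifs <;> simp [labelDeg]
    ring
  | b s x x' y y' h k =>
    simp only [extra, lab, deg, labelDeg]
    rw [Finset.sum_pair (by simp)]
    push_cast
    ring

end BGen

/-! ### The matrices of the differential and of the right action -/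

namespace TIdx

lemma A_subset (i : TIdx n) : i.A ⊆ adj i.x i.y := Finset.mem_powerset.1 i.2.2

lemma ext {i j : TIdx n} (h : i.1 = j.1) (hA : i.A = j.A) : i = j := by
  obtain ⟨p, A⟩ := i
  obtain ⟨p', A'⟩ := j
  obtain rfl : p = p' := h
  obtain rfl : A = A' := Subtype.ext hA
  rfl

/-- The multiset of entries of `M_A(x, y)`. -/
def ent (i : TIdx n) : Multiset ℕ := entries i.x.1 i.y.1 i.A

lemma M_eq (i : TIdx n) : i.M = ofMultiset n i.ent := compMul_eq i.x i.y i.A_subset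

lemma ent_le (i : TIdx n) : ∀ a ∈ i.ent, a ≤ n := entries_le i.x i.y i.A_subset

/-- The summand to which a generator which starts at the pair of `i` maps the summand `i`. -/
def push (g : BGen n) (i : TIdx n) : TIdx n :=
  ⟨g.tgt, (i.A ∪ g.newA) ∩ adj g.tgt.1 g.tgt.2, Finset.mem_powerset.2 Finset.inter_subset_right⟩

lemma A_push {g : BGen n} {i : TIdx n} (h : i.1 = g.src) : (push g i).A = i.A ∪ g.newA := by
  refine Finset.inter_eq_left.2 (g.union_newA_subset ?_)
  rw [← h]
  exact i.A_subset

lemma ent_push {g : BGen n} {i : TIdx n} (h : i.1 = g.src) :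
    (push g i).ent = i.ent + labelEntries g.lab := by
  have h1 : i.A ⊆ adj g.src.1 g.src.2 := by
    rw [← h]
    exact i.A_subset
  change entries g.tgt.1.1 g.tgt.2.1 (push g i).A = entries i.1.1.1 i.1.2.1 i.A + _
  rw [A_push h, g.entries_tgt h1, h]

lemma eq_push_iff {g : BGen n} {i j : TIdx n} (h : i.1 = g.src) :
    j = push g i ↔ j.1 = g.tgt ∧ j.A = i.A ∪ g.newA := by
  rw [← A_push h]
  exact ⟨fun e => ⟨congrArg Sigma.fst e, congrArg TIdx.A e⟩, fun e => ext e.1 e.2⟩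

/-- The summand obtained from the summand `i` by adding `s` to the index set. -/
def ins (s : ℕ) (i : TIdx n) : TIdx n :=
  ⟨i.1, insert s i.A ∩ adj i.x i.y, Finset.mem_powerset.2 Finset.inter_subset_right⟩

lemma A_ins {s : ℕ} {i : TIdx n} (h : s ∈ adj i.x i.y \ i.A) : (ins s i).A = insert s i.A :=
  Finset.inter_eq_left.2
    (Finset.insert_subset (Finset.mem_sdiff.1 h).1 i.A_subset)

lemma ent_ins {s : ℕ} {i : TIdx n} (h : s ∈ adj i.x i.y \ i.A) :
    (ins s i).ent = i.ent + labelEntries (some s) := by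
  change entries i.1.1.1 i.1.2.1 (ins s i).A = _
  rw [A_ins h, entries_insert _ _ (Finset.mem_sdiff.1 h).2]
  rfl

lemma eq_ins_iff {s : ℕ} {i j : TIdx n} (h : s ∈ adj i.x i.y \ i.A) :
    j = ins s i ↔ i.1 = j.1 ∧ j.A = insert s i.A := by
  rw [← A_ins h]
  exact ⟨fun e => ⟨(congrArg Sigma.fst e).symm, congrArg TIdx.A e⟩, fun e => ext e.1.symm e.2⟩

end TIdx

open TIdx

namespace TMod

/-- The right multiplications by the generators as matrices. -/
def actM (g : BGen n) : Matrix (TIdx n) (TIdx n) (Rn n) := actMat g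

/-- The differential as a matrix. -/
def dM (n : ℕ) : Matrix (TIdx n) (TIdx n) (Rn n) := dMat

lemma actM_apply (g : BGen n) (i j : TIdx n) :
    actM g i j = if i.1 = g.src ∧ j = push g i then labelElt n g.lab i.ent else 0 := by
  by_cases h : i.1 = g.src
  swap
  · rw [if_neg (fun h' => h h'.1)]
    cases g <;> exact if_neg fun h' => h h'.1
  by_cases hj : j = push g i
  swap
  · rw [if_neg (fun h' => hj h'.2)]
    have hj' := fun e => hj ((eq_push_iff h).2 e)
    cases g with
    | e x y => exact if_neg fun h' => hj' ⟨by rw [← h'.2]; exact h,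
        by rw [← h'.2]; exact (Finset.union_empty _).symm⟩
    | l t x x' k y => exact if_neg fun h' => hj' h'.2
    | r x t y y' k => exact if_neg fun h' => hj' h'.2
    | b s x x' y y' k k' =>
      refine if_neg fun e => hj' ⟨e.2.1, ?_⟩
      exact e.2.2.trans (Finset.union_empty _).symm
  rw [if_pos ⟨h, hj⟩]
  obtain ⟨h1, h2⟩ := (eq_push_iff h).1 hj
  have he : j.ent = i.ent + labelEntries g.lab := by rw [hj, ent_push h]
  have e1 : labelEntries g.lab = 0 → idem j.M = labelElt n none i.ent := fun e => by
    rw [j.M_eq, he, e, add_zero]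
    rfl
  have e2 : ∀ t, g.lab = some t → rOpt t i.M j.M = labelElt n (some t) i.ent := fun t e => by
    rw [j.M_eq, i.M_eq, he, e]
    rfl
  cases g with
  | e x y =>
    refine (if_pos ⟨h, ?_⟩).trans (e1 rfl)
    exact ext (h.trans h1.symm) (h2.trans (Finset.union_empty _)).symm
  | l t x x' k y =>
    refine (if_pos ⟨h, h1, h2⟩).trans ?_
    by_cases ht : t + 1 ∈ y.1
    · simp only [BGen.lab, if_pos ht] at e1 ⊢
      exact e1 rfl
    · simp only [BGen.lab, if_neg ht] at e2 ⊢
      exact e2 t rfl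
  | r x t y y' k =>
    refine (if_pos ⟨h, h1, h2⟩).trans ?_
    by_cases ht : t ∈ x.1
    · simp only [BGen.lab, if_pos ht] at e1 ⊢
      exact e1 rfl
    · simp only [BGen.lab, if_neg ht] at e2 ⊢
      exact e2 t rfl
  | b s x x' y y' k k' =>
    exact (if_pos ⟨h, h1, h2.trans (Finset.union_empty _)⟩).trans (e1 rfl)

lemma dM_apply (i j : TIdx n) :
    dM n i j = ∑ s ∈ adj i.x i.y \ i.A, if j = ins s i then labelElt n (some s) i.ent else 0 := by
  have key : ∀ s ∈ adj i.x i.y \ i.A, (if j = ins s i then labelElt n (some s) i.ent else 0) =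
      if i.1 = j.1 then if s ∉ i.A ∧ j.A = insert s i.A then rOpt s i.M j.M else 0 else 0 := by
    intro s hs
    by_cases hj : j = ins s i
    · obtain ⟨h1, h2⟩ := (eq_ins_iff hs).1 hj
      rw [if_pos hj, if_pos h1, if_pos ⟨(Finset.mem_sdiff.1 hs).2, h2⟩, i.M_eq, j.M_eq, hj,
        ent_ins hs]
      rfl
    · have h' := fun e => hj ((eq_ins_iff hs).2 e)
      rw [if_neg hj]
      split_ifs with h1 h2
      · exact absurd ⟨h1, h2.2⟩ h'
      · rfl
      · rfl
  rw [Finset.sum_congr rfl key]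
  change (if i.1 = j.1 then _ else _) = _
  split_ifs with h
  · refine (Finset.sum_subset Finset.sdiff_subset fun s hs hs' => if_neg fun h' => ?_).symm
    exact hs' (Finset.mem_sdiff.2 ⟨hs, h'.1⟩)
  · exact Finset.sum_const_zero.symm

lemma actM_mul_idem (g : BGen n) (i j : TIdx n) : actM g i j * idem j.M = actM g i j := by
  rw [actM_apply]
  split_ifs with h
  · rw [h.2, M_eq, ent_push h.1, labelElt_mul_idem]
  · exact zero_mul _

lemma dM_mul_idem (i j : TIdx n) : dM n i j * idem j.M = dM n i j := by
  rw [dM_apply, Finset.sum_mul]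
  refine Finset.sum_congr rfl fun s hs => ?_
  split_ifs with h
  · rw [h, M_eq, ent_ins hs, labelElt_mul_idem]
  · exact zero_mul _

lemma actM_mul_apply {g g' : BGen n} (h : g.tgt = g'.src) (i k : TIdx n) :
    (actM g * actM g') i k = if i.1 = g.src ∧ k = push g' (push g i) then
      labelElt n g.lab i.ent * labelElt n g'.lab (i.ent + labelEntries g.lab) else 0 := by
  rw [Matrix.mul_apply]
  by_cases hi : i.1 = g.src
  · rw [Finset.sum_eq_single (push g i)]
    · rw [actM_apply, actM_apply, if_pos ⟨hi, rfl⟩, ent_push hi]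
      by_cases hk : k = push g' (push g i)
      · rw [if_pos ⟨h, hk⟩, if_pos ⟨hi, hk⟩]
      · rw [if_neg (fun e => hk e.2), if_neg (fun e => hk e.2), mul_zero]
    · intro j _ hj
      rw [actM_apply, if_neg (fun e => hj e.2), zero_mul]
    · simp
  · rw [if_neg (fun e => hi e.1)]
    refine Finset.sum_eq_zero fun j _ => ?_
    rw [actM_apply, if_neg (fun e => hi e.1), zero_mul]

lemma actM_mul_eq_zero {g g' : BGen n} (h : g.tgt ≠ g'.src) : actM g * actM g' = 0 := by
  ext i k
  rw [Matrix.mul_apply]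
  refine Finset.sum_eq_zero fun j _ => ?_
  rw [actM_apply, actM_apply]
  split_ifs with h1 h2
  · rw [h1.2] at h2
    exact absurd h2.1 h
  · exact mul_zero _
  · exact zero_mul _
  · exact zero_mul _

lemma push_push_congr {g g' h h' : BGen n} (hs : g.src = h.src) (hg : g.tgt = g'.src)
    (hh : h.tgt = h'.src) (ht : g'.tgt = h'.tgt)
    (hA : g.newA ∪ g'.newA = h.newA ∪ h'.newA) {i : TIdx n} (hi : i.1 = g.src) :
    push g' (push g i) = push h' (push h i) := by
  refine ext ht ?_
  rw [A_push hg, A_push hi, A_push hh, A_push (hi.trans hs), Finset.union_assoc, hA,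
    Finset.union_assoc]

lemma ent_push_push {g g' : BGen n} (hg : g.tgt = g'.src) {i : TIdx n} (hi : i.1 = g.src) :
    (push g' (push g i)).ent = i.ent + labelEntries g.lab + labelEntries g'.lab := by
  rw [ent_push hg, ent_push hi]

/-- The matrices of two parallel pairs of composable generators have equal products if the same
elements are added to the index sets and if the labels agree, possibly in the other order. -/
lemma actM_mul_congr {g g' h h' : BGen n} (hs : g.src = h.src) (hg : g.tgt = g'.src)
    (hh : h.tgt = h'.src) (ht : g'.tgt = h'.tgt) (hA : g.newA ∪ g'.newA = h.newA ∪ h'.newA)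
    (hl : (g.lab = h.lab ∧ g'.lab = h'.lab) ∨ (g.lab = h'.lab ∧ g'.lab = h.lab)) :
    actM g * actM g' = actM h * actM h' := by
  ext i k
  rw [actM_mul_apply hg, actM_mul_apply hh]
  by_cases hi : i.1 = g.src
  swap
  · rw [if_neg (fun e => hi e.1), if_neg (fun e => hi (e.1.trans hs.symm))]
  by_cases hk : k = push g' (push g i)
  swap
  · rw [if_neg (fun e => hk e.2), if_neg (fun e => hk (e.2.trans
      (push_push_congr hs hg hh ht hA hi).symm))]
  rw [if_pos ⟨hi, hk⟩, if_pos ⟨hi.trans hs, hk.trans (push_push_congr hs hg hh ht hA hi)⟩]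
  rcases hl with ⟨e1, e2⟩ | ⟨e1, e2⟩
  · rw [e1, e2]
  · rw [← e1, ← e2]
    refine labelElt_comm _ _ ?_
    rw [← ent_push_push hg hi]
    exact ent_le _

lemma actM_mul_eq {g g' h : BGen n} (hs : g.src = h.src) (hg : g.tgt = g'.src)
    (ht : g'.tgt = h.tgt) (hA : g.newA ∪ g'.newA = h.newA)
    (hl : (g.lab = none ∧ g'.lab = h.lab) ∨ (g.lab = h.lab ∧ g'.lab = none)) :
    actM g * actM g' = actM h := by
  ext i k
  rw [actM_mul_apply hg, actM_apply]
  by_cases hi : i.1 = g.src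
  swap
  · rw [if_neg (fun e => hi e.1), if_neg (fun e => hi (e.1.trans hs.symm))]
  have hp : push g' (push g i) = push h i := by
    refine ext ht ?_
    rw [A_push hg, A_push hi, A_push (hi.trans hs), Finset.union_assoc, hA]
  by_cases hk : k = push g' (push g i)
  swap
  · rw [if_neg (fun e => hk e.2), if_neg (fun e => hk (e.2.trans hp.symm))]
  rw [if_pos ⟨hi, hk⟩, if_pos ⟨hi.trans hs, hk.trans hp⟩]
  rcases hl with ⟨e1, e2⟩ | ⟨e1, e2⟩
  · rw [e1, e2]
    change idem _ * labelElt n h.lab (i.ent + 0) = _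
    rw [add_zero, idem_mul_labelElt]
  · rw [e1, e2]
    exact labelElt_mul_idem _ _

end TMod

end

noncomputable section

variable {n : ℕ}

open TIdx

namespace TMod

/-! ### The relations between the matrices -/

section Relations

open BGen

lemma actM_e_e (x y : Vtx n) : actM (.e x y) * actM (.e x y) = actM (.e x y) :=
  actM_mul_eq rfl rfl rfl rfl (Or.inl ⟨rfl, rfl⟩)

lemma actM_e_e' {x y x' y' : Vtx n} (h : ¬ (x = x' ∧ y = y')) :
    actM (.e x y) * actM (.e x' y') = 0 :=
  actM_mul_eq_zero fun e => h (Prod.ext_iff.1 e)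

lemma actM_src_mul (g : BGen n) : actM (.e g.src.1 g.src.2) * actM g = actM g :=
  actM_mul_eq rfl rfl rfl (Finset.empty_union _) (Or.inl ⟨rfl, rfl⟩)

lemma actM_mul_tgt (g : BGen n) : actM g * actM (.e g.tgt.1 g.tgt.2) = actM g :=
  actM_mul_eq rfl rfl rfl (Finset.union_empty _) (Or.inr ⟨rfl, rfl⟩)

lemma actM_r_r (x : Vtx n) {s t : ℕ} {y y₁ y₂ y₃ : Vtx n} (k₁ : IsArrow s y y₁)
    (k₂ : IsArrow t y₁ y₃) (k₃ : IsArrow t y y₂) (k₄ : IsArrow s y₂ y₃) :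
    actM (.r x s y y₁ k₁) * actM (.r x t y₁ y₃ k₂) =
      actM (.r x t y y₂ k₃) * actM (.r x s y₂ y₃ k₄) :=
  actM_mul_congr rfl rfl rfl rfl (Finset.union_comm _ _) (Or.inr ⟨rfl, rfl⟩)

lemma actM_l_l {s t : ℕ} {x x₁ x₂ x₃ : Vtx n} (h₁ : IsArrow s x x₁) (h₂ : IsArrow t x₁ x₃)
    (h₃ : IsArrow t x x₂) (h₄ : IsArrow s x₂ x₃) (y : Vtx n) :
    actM (.l s x x₁ h₁ y) * actM (.l t x₁ x₃ h₂ y) =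
      actM (.l t x x₂ h₃ y) * actM (.l s x₂ x₃ h₄ y) :=
  actM_mul_congr rfl rfl rfl rfl (Finset.union_comm _ _) (Or.inr ⟨rfl, rfl⟩)

lemma actM_l_r {s t : ℕ} {x x' y y' : Vtx n} (h : IsArrow s x x') (k : IsArrow t y y')
    (hne : t ≠ s + 1) :
    actM (.l s x x' h y) * actM (.r x' t y y' k) =
      actM (.r x t y y' k) * actM (.l s x x' h y') := by
  have ⟨h1, h2, h3⟩ := h
  have ⟨k1, k2, k3⟩ := k
  refine actM_mul_congr rfl rfl rfl rfl ?_ ?_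
  · ext a
    simp only [newA, h3, k3, Finset.mem_union, Finset.mem_filter, Finset.mem_insert]
    by_cases e : t = s + 2
    · subst e
      simp
      grind
    · have e1 : (s + 2 = t + 1 ∨ s + 2 = t ∨ s + 2 ∈ y.1) ↔ s + 2 ∈ y.1 := by
        constructor
        · rintro (e' | e' | e')
          · omega
          · omega
          · exact e'
        · tauto
      simp only [e1]
      split_ifs <;> simp <;> grind
  · by_cases e : t = s
    · subst e
      left
      simp [lab, h1, k2, h3, k3]
    · right
      simp only [lab, h3, k3, Finset.mem_insert, e, hne, false_or]
      simp [Ne.symm e, Ne.symm hne]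

lemma actM_b_r {s t : ℕ} {x x₁ y y₁ y₂ y₃ : Vtx n} (h : IsArrow s x x₁)
    (k₁ : IsArrow (s + 1) y y₁) (k₂ : IsArrow t y₁ y₃) (k₃ : IsArrow t y y₂)
    (k₄ : IsArrow (s + 1) y₂ y₃) :
    actM (.b s x x₁ y y₁ h k₁) * actM (.r x₁ t y₁ y₃ k₂) =
      actM (.r x t y y₂ k₃) * actM (.b s x x₁ y₂ y₃ h k₄) := by
  have ⟨h1, h2, h3⟩ := h
  have ⟨a, d, c⟩ := RBox.label_ne k₁ k₂
  refine actM_mul_congr rfl rfl rfl rfl ?_ ?_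
  · ext a
    simp only [newA, h3, Finset.mem_union, Finset.mem_filter, Finset.mem_insert]
    grind
  · right
    have e1 : ¬ t = s := fun e => d (by rw [e])
    simp [lab, h3, a, e1]

lemma actM_b_l {s t : ℕ} {x x₁ x₂ x₃ y y₁ : Vtx n} (h₁ : IsArrow s x x₁)
    (k : IsArrow (s + 1) y y₁) (h₂ : IsArrow t x₁ x₃) (h₃ : IsArrow t x x₂)
    (h₄ : IsArrow s x₂ x₃) :
    actM (.b s x x₁ y y₁ h₁ k) * actM (.l t x₁ x₃ h₂ y₁) =
      actM (.l t x x₂ h₃ y) * actM (.b s x₂ x₃ y y₁ h₄ k) := by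
  have ⟨k1, k2, k3⟩ := k
  have ⟨a, d, c⟩ := RBox.label_ne h₁ h₂
  refine actM_mul_congr rfl rfl rfl rfl ?_ ?_
  · have e1 : ¬ t + 1 = s := d
    simp [newA, k3, a, e1]
  · right
    simp [lab, k3, a, c]

lemma actM_b_b {s t : ℕ} {x x₁ x₂ x₃ y y₁ y₂ y₃ : Vtx n}
    (h₁ : IsArrow s x x₁) (k₁ : IsArrow (s + 1) y y₁)
    (h₂ : IsArrow t x₁ x₃) (k₂ : IsArrow (t + 1) y₁ y₃)
    (h₃ : IsArrow t x x₂) (k₃ : IsArrow (t + 1) y y₂)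
    (h₄ : IsArrow s x₂ x₃) (k₄ : IsArrow (s + 1) y₂ y₃) :
    actM (.b s x x₁ y y₁ h₁ k₁) * actM (.b t x₁ x₃ y₁ y₃ h₂ k₂) =
      actM (.b t x x₂ y y₂ h₃ k₃) * actM (.b s x₂ x₃ y₂ y₃ h₄ k₄) :=
  actM_mul_congr rfl rfl rfl rfl rfl (Or.inl ⟨rfl, rfl⟩)

lemma sum_actM_e (v : TIdx n → Rn n) (hv : ∀ i, v i * idem i.M = v i) (j : TIdx n) :
    Matrix.vecMul v (∑ x, ∑ y, actM (.e x y)) j = v j := by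
  have key : ∀ i, (∑ x, ∑ y, actM (.e x y) : Matrix (TIdx n) (TIdx n) (Rn n)) i j =
      if i = j then idem j.M else 0 := by
    intro i
    rw [Matrix.sum_apply, Finset.sum_eq_single j.x]
    · rw [Matrix.sum_apply, Finset.sum_eq_single j.y]
      · change (if i.1 = (j.x, j.y) ∧ i = j then idem j.M else 0) = _
        by_cases h : i = j
        · rw [if_pos h, if_pos ⟨h ▸ rfl, h⟩]
        · rw [if_neg h, if_neg fun h' => h h'.2]
      · intro y _ hy
        exact if_neg fun h => hy (by rw [← h.2]; exact (congrArg Prod.snd h.1).symm)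
      · simp
    · intro x _ hx
      rw [Matrix.sum_apply]
      refine Finset.sum_eq_zero fun y _ => ?_
      exact if_neg fun h => hx (by rw [← h.2]; exact (congrArg Prod.fst h.1).symm)
    · simp
  simp only [Matrix.vecMul, dotProduct, key, mul_ite, mul_zero]
  rw [Finset.sum_ite_eq' Finset.univ j, if_pos (Finset.mem_univ j), hv]

end Relations

lemma labelElt_swap (i : TIdx n) {s t : ℕ} (hs : s ∈ adj i.x i.y \ i.A)
    (ht : t ∈ adj i.x i.y \ i.A) (hne : s ≠ t) :
    labelElt n (some s) i.ent * labelElt n (some t) (i.ent + labelEntries (some s)) =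
      labelElt n (some t) i.ent * labelElt n (some s) (i.ent + labelEntries (some t)) := by
  refine labelElt_comm _ _ ?_
  have h : t ∈ adj (ins s i).x (ins s i).y \ (ins s i).A := by
    rw [A_ins hs]
    simp only [Finset.mem_sdiff, Finset.mem_insert, not_or] at ht ⊢
    exact ⟨ht.1, hne.symm, ht.2⟩
  have := (ins t (ins s i)).ent_le
  rwa [ent_ins h, ent_ins hs] at this

/-- The two terms which add `s` and `t` in either order are equal and cancel in characteristic `2`. -/
lemma dM_mul_dM : dM n * dM n = 0 := by
  ext i k
  rw [Matrix.mul_apply]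
  let U := adj i.x i.y \ i.A
  let F : ℕ × ℕ → Rn n := fun p => if k.1 = i.1 ∧ k.A = insert p.2 (insert p.1 i.A) then
    labelElt n (some p.1) i.ent * labelElt n (some p.2) (i.ent + labelEntries (some p.1)) else 0
  have key : ∑ j, dM n i j * dM n j k = ∑ s ∈ U, ∑ t ∈ U.erase s, F (s, t) := by
    have h1 : ∀ j, dM n i j * dM n j k =
        ∑ s ∈ U, if j = ins s i then labelElt n (some s) i.ent * dM n j k else 0 := by
      intro j
      rw [dM_apply i j, Finset.sum_mul]
      refine Finset.sum_congr rfl fun s _ => ?_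
      split_ifs <;> simp
    rw [Finset.sum_congr rfl fun j _ => h1 j, Finset.sum_comm]
    refine Finset.sum_congr rfl fun s hs => ?_
    rw [Finset.sum_ite_eq' Finset.univ (ins s i), if_pos (Finset.mem_univ _), dM_apply,
      Finset.mul_sum, ent_ins hs]
    have hU : adj (ins s i).x (ins s i).y \ (ins s i).A = U.erase s := by
      rw [A_ins hs]
      ext a
      simp only [U, Finset.mem_sdiff, Finset.mem_insert, Finset.mem_erase, not_or]
      change (a ∈ adj i.x i.y ∧ _) ↔ _
      tauto
    refine Finset.sum_congr hU fun t ht => ?_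
    have ht' : t ∈ adj (ins s i).x (ins s i).y \ (ins s i).A := by rwa [hU]
    have hk := eq_ins_iff (j := k) ht'
    rw [A_ins hs] at hk
    have hk' : k = ins t (ins s i) ↔ k.1 = i.1 ∧ k.A = insert t (insert s i.A) :=
      hk.trans (and_congr_left fun _ => eq_comm)
    simp only [F, hk', mul_ite, mul_zero]
  rw [key, Finset.sum_sigma']
  refine Finset.sum_involution (fun p _ => ⟨p.2, p.1⟩) ?_ ?_ ?_ ?_
  · rintro ⟨s, t⟩ h
    simp only [Finset.mem_sigma, Finset.mem_erase] at h
    have hc : F (t, s) = F (s, t) := by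
      simp only [F]
      rw [Finset.insert_comm s t, labelElt_swap i h.1 h.2.2 h.2.1.symm]
    rw [hc]
    exact (Rn n).add_self _
  · rintro ⟨s, t⟩ h _ e
    simp only [Finset.mem_sigma, Finset.mem_erase] at h
    exact h.2.1 (congrArg Sigma.fst e)
  · rintro ⟨s, t⟩ h
    simp only [Finset.mem_sigma, Finset.mem_erase] at h ⊢
    exact ⟨h.2.2, h.2.1.symm, h.1⟩
  · rintro ⟨s, t⟩ _
    rfl

/-- The matrix of a generator followed by the matrix of the differential. -/
lemma actM_mul_dM (g : BGen n) (i k : TIdx n) (hi : i.1 = g.src) :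
    (actM g * dM n) i k = (∑ s ∈ adj i.x i.y \ i.A, if k = ins s (push g i) then
        labelElt n g.lab i.ent * labelElt n (some s) (i.ent + labelEntries g.lab) else 0) +
      ∑ s ∈ g.extra, if k = ins s (push g i) then
        labelElt n g.lab i.ent * labelElt n (some s) (i.ent + labelEntries g.lab) else 0 := by
  have hA : i.A ⊆ adj g.src.1 g.src.2 := by rw [← hi]; exact i.A_subset
  have hU : adj (push g i).x (push g i).y \ (push g i).A = (adj i.x i.y \ i.A) ∪ g.extra := by
    rw [A_push hi]
    change _ = (adj i.1.1 i.1.2 \ i.A) ∪ _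
    rw [hi]
    exact g.adj_sdiff hA
  have hd : Disjoint (adj i.x i.y \ i.A) g.extra := by
    change Disjoint (adj i.1.1 i.1.2 \ i.A) g.extra
    rw [hi]
    exact g.disjoint_sdiff_extra _
  rw [← Finset.sum_union hd, ← hU, Matrix.mul_apply, Finset.sum_eq_single (push g i)]
  · rw [actM_apply, if_pos ⟨hi, rfl⟩, dM_apply, ent_push hi, Finset.mul_sum]
    exact Finset.sum_congr rfl fun s _ => by rw [mul_ite, mul_zero]
  · intro j _ hj
    rw [actM_apply, if_neg (fun e => hj e.2), zero_mul]
  · simp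

/-- The matrix of the differential followed by the matrix of a generator. -/
lemma dM_mul_actM (g : BGen n) (i k : TIdx n) (hi : i.1 = g.src) :
    (dM n * actM g) i k = ∑ s ∈ adj i.x i.y \ i.A, if k = ins s (push g i) then
        labelElt n g.lab i.ent * labelElt n (some s) (i.ent + labelEntries g.lab) else 0 := by
  have hA : i.A ⊆ adj g.src.1 g.src.2 := by rw [← hi]; exact i.A_subset
  have h1 : ∀ j, dM n i j * actM g j k = ∑ s ∈ adj i.x i.y \ i.A,
      if j = ins s i then labelElt n (some s) i.ent * actM g j k else 0 := by
    intro j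
    rw [dM_apply i j, Finset.sum_mul]
    refine Finset.sum_congr rfl fun s _ => ?_
    split_ifs <;> simp
  rw [Matrix.mul_apply, Finset.sum_congr rfl fun j _ => h1 j, Finset.sum_comm]
  refine Finset.sum_congr rfl fun s hs => ?_
  rw [Finset.sum_ite_eq' Finset.univ (ins s i), if_pos (Finset.mem_univ _), actM_apply]
  have hs' : s ∈ adj (push g i).x (push g i).y \ (push g i).A := by
    rw [A_push hi]
    change s ∈ adj g.tgt.1 g.tgt.2 \ _
    rw [g.adj_sdiff hA, ← hi]
    exact Finset.mem_union_left _ hs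
  have hp : push g (ins s i) = ins s (push g i) := by
    refine ext rfl ?_
    rw [A_push (show (ins s i).1 = g.src from hi), A_ins hs, A_ins hs', A_push hi,
      Finset.insert_union]
  rw [hp, ent_ins hs]
  by_cases hk : k = ins s (push g i)
  · rw [if_pos hk, if_pos ⟨hi, hk⟩]
    refine labelElt_comm _ _ ?_
    rw [← ent_ins hs, ← ent_push (show (ins s i).1 = g.src from hi)]
    exact ent_le _
  · rw [if_neg hk, if_neg fun e => hk e.2, mul_zero]

lemma mul_actM_of_ne (g : BGen n) (i k : TIdx n) (hi : i.1 ≠ g.src) :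
    (actM g * dM n) i k = 0 ∧ (dM n * actM g) i k = 0 := by
  constructor
  · rw [Matrix.mul_apply]
    refine Finset.sum_eq_zero fun j _ => ?_
    rw [actM_apply, if_neg (fun e => hi e.1), zero_mul]
  · rw [Matrix.mul_apply]
    refine Finset.sum_eq_zero fun j _ => ?_
    rw [actM_apply, dM_apply]
    by_cases hj : j.1 = g.src ∧ k = push g j
    · rw [Finset.sum_mul]
      refine Finset.sum_eq_zero fun s _ => ?_
      rw [if_neg fun e => hi ?_, zero_mul]
      rw [e] at hj
      exact hj.1
    · rw [if_neg hj, mul_zero]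

/-- The terms of the differential which the generator makes available vanish, since they create a
repetition of entries; all others commute with the generator. -/
lemma actM_dM_comm (g : BGen n) (hg : ∀ s x x' y y' h k, g ≠ .b s x x' y y' h k) :
    actM g * dM n = dM n * actM g := by
  ext i k
  by_cases hi : i.1 = g.src
  · have hA : i.A ⊆ adj g.src.1 g.src.2 := by rw [← hi]; exact i.A_subset
    rw [actM_mul_dM g i k hi, dM_mul_actM g i k hi]
    refine (congrArg _ (Finset.sum_eq_zero fun s hs => ?_)).trans (add_zero _)
    have h := g.not_nodup_extra hg hA hs
    rw [g.entries_tgt hA, ← hi] at h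
    rw [labelElt_eq_zero (some s) (m := i.ent + labelEntries g.lab) h, mul_zero, ite_self]
  · have h := mul_actM_of_ne g i k hi
    rw [h.1, h.2]

/-- The Leibniz rule for `b`: the elements `s` and `s + 1` become available along `b`, and the terms
of the differential which add them are the two summands of `d b`. -/
lemma actM_b_dM {s : ℕ} {x x' y y' : Vtx n} (h : IsArrow s x x') (k : IsArrow (s + 1) y y') :
    actM (.b s x x' y y' h k) * dM n = dM n * actM (.b s x x' y y' h k) +
      (actM (.l s x x' h y) * actM (.r x' (s + 1) y y' k) +
        actM (.r x (s + 1) y y' k) * actM (.l s x x' h y')) := by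
  have ⟨h1, h2, h3⟩ := h
  have ⟨k1, k2, k3⟩ := k
  ext i j
  rw [Matrix.add_apply, Matrix.add_apply, actM_mul_apply rfl, actM_mul_apply rfl]
  by_cases hi : i.1 = (x, y)
  swap
  · have h := mul_actM_of_ne (.b s x x' y y' h k) i j hi
    rw [h.1, h.2, if_neg fun e => hi e.1, if_neg fun e => hi e.1, add_zero, add_zero]
  have hA : i.A ⊆ adj x y := by
    have := i.A_subset
    change i.A ⊆ adj i.1.1 i.1.2 at this
    rwa [hi] at this
  have hb : i.1 = (BGen.b s x x' y y' h k).src := hi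
  have hAb := A_push hb
  have hmem : ∀ t ∈ ({s, s + 1} : Finset ℕ), t ∈ adj (push (.b s x x' y y' h k) i).x
      (push (.b s x x' y y' h k) i).y \ (push (.b s x x' y y' h k) i).A := by
    intro t ht
    rw [hAb]
    change t ∈ adj x' y' \ _
    rw [show adj x' y' = _ from BGen.adj_tgt (.b s x x' y y' h k)]
    have hd := Finset.disjoint_left.1 (BGen.disjoint_adj_src (.b s x x' y y' h k)).symm
    have ht' : t ∈ (BGen.b s x x' y y' h k).newA ∪ (BGen.b s x x' y y' h k).extra :=
      Finset.mem_union_right _ ht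
    refine Finset.mem_sdiff.2 ⟨Finset.mem_union_right _ ht', fun h' => ?_⟩
    rcases Finset.mem_union.1 h' with h' | h'
    · exact hd ht' (hA h')
    · simp [BGen.newA] at h'
  rw [actM_mul_dM _ i j hb, dM_mul_actM _ i j hb]
  congr 1
  change ∑ t ∈ ({s, s + 1} : Finset ℕ), _ = _
  rw [Finset.sum_pair (by simp)]
  refine congrArg₂ (· + ·) ?_ ?_
  · have e : push (.r x' (s + 1) y y' k) (push (.l s x x' h y) i) =
        ins s (push (.b s x x' y y' h k) i) := by
      refine ext rfl ?_
      rw [A_push rfl, A_push (show i.1 = (BGen.l s x x' h y).src from hi),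
        A_ins (hmem s (by simp)), hAb]
      ext a
      simp only [BGen.newA, h3, k2, Finset.mem_union, Finset.mem_insert, Finset.mem_filter]
      simp
      grind
    have l1 : (BGen.l s x x' h y).lab = some s := by simp [BGen.lab, k1]
    have l2 : (BGen.r x' (s + 1) y y' k).lab = none := by simp [BGen.lab, h3]
    have e' : (i.1 = (BGen.l s x x' h y).src ∧ j = ins s (push (.b s x x' y y' h k) i)) ↔
      j = ins s (push (.b s x x' y y' h k) i) := ⟨fun h => h.2, fun h => ⟨hi, h⟩⟩
    rw [e, l1, l2]
    simp only [e']
    congr 1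
    change idem _ * labelElt n (some s) (i.ent + 0) = labelElt n (some s) i.ent * idem _
    rw [add_zero, idem_mul_labelElt, labelElt_mul_idem]
  · have e : push (.l s x x' h y') (push (.r x (s + 1) y y' k) i) =
        ins (s + 1) (push (.b s x x' y y' h k) i) := by
      refine ext rfl ?_
      rw [A_push rfl, A_push (show i.1 = (BGen.r x (s + 1) y y' k).src from hi),
        A_ins (hmem (s + 1) (by simp)), hAb]
      ext a
      simp only [BGen.newA, k3, Finset.mem_union, Finset.mem_insert, Finset.mem_filter]
      simp
      grind
    have l1 : (BGen.r x (s + 1) y y' k).lab = some (s + 1) := by simp [BGen.lab, h2]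
    have l2 : (BGen.l s x x' h y').lab = none := by simp [BGen.lab, k3]
    have e' : (i.1 = (BGen.r x (s + 1) y y' k).src ∧
      j = ins (s + 1) (push (.b s x x' y y' h k) i)) ↔
      j = ins (s + 1) (push (.b s x x' y y' h k) i) := ⟨fun h => h.2, fun h => ⟨hi, h⟩⟩
    rw [e, l1, l2]
    simp only [e']
    congr 1
    change idem _ * labelElt n (some (s + 1)) (i.ent + 0) =
      labelElt n (some (s + 1)) i.ent * idem _
    rw [add_zero, idem_mul_labelElt, labelElt_mul_idem]

end TMod

end

noncomputable section

variable {n : ℕ}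

open TIdx

namespace TMod

/-! ### The bimodule `T_n` -/

lemma comp_add (m m' : TMod n) (i : TIdx n) : comp (m + m') i = comp m i + comp m' i := rfl

lemma comp_smul (a : Rn n) (m : TMod n) (i : TIdx n) : comp (a • m) i = a * comp m i := rfl

lemma ext {m m' : TMod n} (h : ∀ i, comp m i = comp m' i) : m = m' :=
  funext fun i => Subtype.ext (h i)

lemma comp_mul_idem (m : TMod n) (i : TIdx n) : comp m i * idem i.M = comp m i := by
  obtain ⟨a, ha⟩ := Submodule.mem_span_singleton.1
    ((m i : POpt i.M) : Submodule.span (Rn n) {idem i.M}).2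
  have ha' : a * idem i.M = comp m i := ha
  rw [← ha', mul_assoc, idem_mul_self]

/-- The element of `T_n` with the given components. -/
def mk (v : TIdx n → Rn n) (h : ∀ i, v i * idem i.M = v i) : TMod n := fun i =>
  (⟨v i, Submodule.mem_span_singleton.2 ⟨v i, h i⟩⟩ : Submodule.span (Rn n) {idem i.M})

lemma comp_mk (v : TIdx n → Rn n) (h : ∀ i, v i * idem i.M = v i) (i : TIdx n) :
    comp (mk v h) i = v i := rfl

lemma mem_gr {m : TMod n} {g : ℤ × ℤ} :
    m ∈ (TMod n).gr g ↔ ∀ i : TIdx n, comp m i ∈ (Rn n).gr (g + (-i.k, i.eta)) :=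
  ⟨fun h i => h i trivial, fun h i _ => h i⟩

/-- The right multiplication by a matrix. -/
def op (N : Matrix (TIdx n) (TIdx n) (Rn n)) (hN : ∀ i j, N i j * idem j.M = N i j) :
    TMod n →+ TMod n :=
  AddMonoidHom.mk' (fun m => mk (Matrix.vecMul (comp m) N) fun j => by
      simp only [Matrix.vecMul, dotProduct, Finset.sum_mul, mul_assoc, hN])
    fun m m' => ext fun i => congrFun (Matrix.add_vecMul N (comp m) (comp m')) i

lemma comp_op_apply {N : Matrix (TIdx n) (TIdx n) (Rn n)}
    (hN : ∀ i j, N i j * idem j.M = N i j) (m : TMod n) (j : TIdx n) :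
    comp (op N hN m) j = ∑ i, comp m i * N i j := rfl

lemma op_smul {N : Matrix (TIdx n) (TIdx n) (Rn n)} (hN : ∀ i j, N i j * idem j.M = N i j)
    (a : Rn n) (m : TMod n) : op N hN (a • m) = a • op N hN m :=
  ext fun j => by
    rw [comp_smul, comp_op_apply, comp_op_apply, Finset.mul_sum]
    exact Finset.sum_congr rfl fun i _ => mul_assoc _ _ _

lemma op_mem {N : Matrix (TIdx n) (TIdx n) (Rn n)} (hN : ∀ i j, N i j * idem j.M = N i j)
    {h : ℤ × ℤ} (hd : ∀ i j, N i j ∈ (Rn n).gr (h + (i.k - j.k, j.eta - i.eta)))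
    {g : ℤ × ℤ} {m : TMod n} (hm : m ∈ (TMod n).gr g) : op N hN m ∈ (TMod n).gr (g + h) := by
  refine mem_gr.2 fun j => ?_
  rw [comp_op_apply]
  refine sum_mem fun i _ => ?_
  have := (Rn n).mul_mem (mem_gr.1 hm i) (hd i j)
  convert this using 2
  ext
  · simp
    ring
  · simp
    ring

lemma dM_mem (i j : TIdx n) :
    dM n i j ∈ (Rn n).gr ((1, 0) + (i.k - j.k, j.eta - i.eta)) := by
  rw [dM_apply]
  refine sum_mem fun s hs => ?_
  split_ifs with h
  · have h1 : j.k = i.k + 1 := by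
      rw [h]
      change mu i.x i.y + ((ins s i).A.card : ℤ) = mu i.x i.y + (i.A.card : ℤ) + 1
      rw [A_ins hs, Finset.card_insert_of_notMem (Finset.mem_sdiff.1 hs).2]
      push_cast
      ring
    have h2 : i.eta = j.eta + (2 * (s : ℤ) + 1 - n) := by
      rw [h]
      change ∑ t ∈ adj i.x i.y \ i.A, _ = ∑ t ∈ adj i.x i.y \ (ins s i).A, _ + _
      rw [A_ins hs, Finset.sdiff_insert, Finset.sum_erase_add _ _ hs]
    convert labelElt_mem (some s) i.ent using 2
    ext
    · simp [h1]
    · simp only [h2, labelDeg, Prod.snd_add]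
      ring
  · exact zero_mem _

lemma actM_mem (g : BGen n) (i j : TIdx n) :
    actM g i j ∈ (Rn n).gr (g.deg + (i.k - j.k, j.eta - i.eta)) := by
  rw [actM_apply]
  split_ifs with h
  · obtain ⟨hi, hj⟩ := h
    have hA : i.A ⊆ adj g.src.1 g.src.2 := by rw [← hi]; exact i.A_subset
    have h1 : j.k = i.k + g.deg.1 := by
      have := g.mu_tgt
      rw [hj]
      change mu g.tgt.1 g.tgt.2 + ((push g i).A.card : ℤ) = mu i.1.1 i.1.2 + (i.A.card : ℤ) + _
      rw [A_push hi, Finset.card_union_of_disjoint (g.disjoint_newA hA), hi]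
      push_cast
      linarith
    have h2 : j.eta = i.eta + (labelDeg n g.lab - g.deg.2) := by
      rw [hj, ← g.sum_extra]
      change ∑ t ∈ adj g.tgt.1 g.tgt.2 \ (push g i).A, _ = ∑ t ∈ adj i.1.1 i.1.2 \ i.A, _ + _
      rw [A_push hi, g.adj_sdiff hA, hi, Finset.sum_union (g.disjoint_sdiff_extra _)]
    convert labelElt_mem g.lab i.ent using 2
    ext
    · simp [h1]
    · simp only [h2, Prod.snd_add]
      ring
  · exact zero_mem _

/-- The differential of `T_n`. -/
def dOp (n : ℕ) : TMod n →+ TMod n := op (dM n) dM_mul_idem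

/-- The right multiplication by a generator of `R_n ⊠ R_n`. -/
def actOp (g : BGen n) : TMod n →+ TMod n := op (actM g) (actM_mul_idem g)

lemma comp_dOp (m : TMod n) : comp (dOp n m) = Matrix.vecMul (comp m) (dM n) := rfl

lemma comp_actOp (g : BGen n) (m : TMod n) :
    comp (actOp g m) = Matrix.vecMul (comp m) (actM g) := rfl

lemma add_self (m : TMod n) : m + m = 0 := by
  have : ((1 : Rn n) + 1) • m = 0 := by rw [(Rn n).add_self, zero_smul]
  simpa [add_smul] using this

lemma actOp_actOp {g g' h h' : BGen n} (e : actM g * actM g' = actM h * actM h') (m : TMod n) :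
    actOp g' (actOp g m) = actOp h' (actOp h m) :=
  ext fun j => by
    rw [comp_actOp, comp_actOp, comp_actOp, comp_actOp, Matrix.vecMul_vecMul,
      Matrix.vecMul_vecMul, e]

lemma actOp_actOp' {g g' h : BGen n} (e : actM g * actM g' = actM h) (m : TMod n) :
    actOp g' (actOp g m) = actOp h m :=
  ext fun j => by
    rw [comp_actOp, comp_actOp, comp_actOp, Matrix.vecMul_vecMul, e]

/-- `T_n` as a vector space over `𝔽₂`. -/
@[reducible]
def zmodModule (n : ℕ) : Module (ZMod 2) (TMod n) :=
  AddCommGroup.zmodModule fun m => by rw [two_nsmul, add_self]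

attribute [local instance] zmodModule

/-- The right action of the free algebra on the generators of `R_n ⊠ R_n`. -/
def freeAct (n : ℕ) : FreeAlgebra (ZMod 2) (BGen n) →ₐ[ZMod 2]
    (Module.End (ZMod 2) (TMod n))ᵐᵒᵖ :=
  FreeAlgebra.lift (ZMod 2) fun g => MulOpposite.op ((actOp g).toZModLinearMap 2)

lemma freeAct_mul (a b : FreeAlgebra (ZMod 2) (BGen n)) (m : TMod n) :
    (freeAct n (a * b)).unop m = (freeAct n b).unop ((freeAct n a).unop m) := by
  rw [map_mul]
  rfl

lemma freeAct_ι (g : BGen n) (m : TMod n) :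
    (freeAct n (FreeAlgebra.ι _ g)).unop m = actOp g m := by
  rw [freeAct, FreeAlgebra.lift_ι_apply]
  rfl

lemma freeAct_ι_mul (g g' : BGen n) (m : TMod n) :
    (freeAct n (FreeAlgebra.ι _ g * FreeAlgebra.ι _ g')).unop m = actOp g' (actOp g m) := by
  rw [freeAct_mul, freeAct_ι, freeAct_ι]

lemma freeAct_rel {a b : FreeAlgebra (ZMod 2) (BGen n)} (h : BGen.Rel n a b) :
    freeAct n a = freeAct n b := by
  refine MulOpposite.unop_injective (LinearMap.ext fun m => ?_)
  cases h with
  | e_e x y =>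
    rw [freeAct_ι_mul, freeAct_ι]
    exact actOp_actOp' (actM_e_e x y) m
  | e_e' x y x' y' h =>
    rw [freeAct_ι_mul, map_zero]
    refine ext fun j => ?_
    rw [comp_actOp, comp_actOp, Matrix.vecMul_vecMul, actM_e_e' h, Matrix.vecMul_zero]
    rfl
  | e_l h y => rw [freeAct_ι_mul, freeAct_ι]; exact actOp_actOp' (actM_src_mul (.l _ _ _ h y)) m
  | l_e h y => rw [freeAct_ι_mul, freeAct_ι]; exact actOp_actOp' (actM_mul_tgt (.l _ _ _ h y)) m
  | e_r x k => rw [freeAct_ι_mul, freeAct_ι]; exact actOp_actOp' (actM_src_mul (.r x _ _ _ k)) m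
  | r_e x k => rw [freeAct_ι_mul, freeAct_ι]; exact actOp_actOp' (actM_mul_tgt (.r x _ _ _ k)) m
  | e_b h k =>
    rw [freeAct_ι_mul, freeAct_ι]; exact actOp_actOp' (actM_src_mul (.b _ _ _ _ _ h k)) m
  | b_e h k =>
    rw [freeAct_ι_mul, freeAct_ι]; exact actOp_actOp' (actM_mul_tgt (.b _ _ _ _ _ h k)) m
  | r_r x k₁ k₂ k₃ k₄ =>
    rw [freeAct_ι_mul, freeAct_ι_mul]; exact actOp_actOp (actM_r_r x k₁ k₂ k₃ k₄) m
  | l_l h₁ h₂ h₃ h₄ y =>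
    rw [freeAct_ι_mul, freeAct_ι_mul]; exact actOp_actOp (actM_l_l h₁ h₂ h₃ h₄ y) m
  | l_r h k hne =>
    rw [freeAct_ι_mul, freeAct_ι_mul]; exact actOp_actOp (actM_l_r h k hne) m
  | b_r h k₁ k₂ k₃ k₄ =>
    rw [freeAct_ι_mul, freeAct_ι_mul]; exact actOp_actOp (actM_b_r h k₁ k₂ k₃ k₄) m
  | b_l h₁ k h₂ h₃ h₄ =>
    rw [freeAct_ι_mul, freeAct_ι_mul]; exact actOp_actOp (actM_b_l h₁ k h₂ h₃ h₄) m
  | b_b h₁ k₁ h₂ k₂ h₃ k₃ h₄ k₄ =>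
    rw [freeAct_ι_mul, freeAct_ι_mul]
    exact actOp_actOp (actM_b_b h₁ k₁ h₂ k₂ h₃ k₃ h₄ k₄) m
  | one =>
    have h1 : (freeAct n 1).unop m = m := by
      rw [map_one]
      rfl
    have h2 : (freeAct n (∑ x, ∑ y, BGen.E x y)).unop m = ∑ x, ∑ y, actOp (.e x y) m := by
      have hF : ∀ a, (freeAct n a).unop m = (AddMonoidHom.mk' (fun a => (freeAct n a).unop m)
        (fun a b => by rw [map_add]; rfl)) a := fun _ => rfl
      rw [hF, map_sum]
      refine Finset.sum_congr rfl fun x _ => ?_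
      rw [map_sum]
      exact Finset.sum_congr rfl fun y _ => freeAct_ι _ m
    rw [h1, h2]
    refine ext fun j => ?_
    have h3 : ∀ (m' : Vtx n → Vtx n → TMod n),
        comp (∑ x, ∑ y, m' x y) j = ∑ x, ∑ y, comp (m' x y) j := by
      intro m'
      let F : TMod n →+ Rn n := AddMonoidHom.mk' (fun m => comp m j) (fun a b => comp_add a b j)
      change F _ = ∑ x, ∑ y, F (m' x y)
      rw [map_sum]
      exact Finset.sum_congr rfl fun x _ => map_sum F _ _
    rw [h3, ← sum_actM_e (comp m) (comp_mul_idem m) j, Matrix.vecMul_sum, Finset.sum_apply]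
    refine Finset.sum_congr rfl fun x _ => ?_
    rw [Matrix.vecMul_sum, Finset.sum_apply]
    rfl

/-- The right action of `R_n ⊠ R_n` on `T_n`. -/
def algAct (n : ℕ) : (RBox.pres n).Alg →ₐ[ZMod 2] (Module.End (ZMod 2) (TMod n))ᵐᵒᵖ :=
  RingQuot.liftAlgHom (ZMod 2) ⟨freeAct n, fun _ _ h => freeAct_rel h⟩

lemma algAct_gen (g : BGen n) (m : TMod n) :
    (algAct n ((RBox.pres n).gen g)).unop m = actOp g m := by
  rw [algAct, QDGPresentation.gen, RingQuot.liftAlgHom_mkAlgHom_apply]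
  exact freeAct_ι g m

/-- The right action of `R_n ⊠ R_n` on `T_n` as a biadditive map. -/
def rightAct (n : ℕ) : TMod n →+ (RBox.pres n).Alg →+ TMod n :=
  AddMonoidHom.mk' (fun m => AddMonoidHom.mk' (fun b => (algAct n b).unop m)
      fun b c => by rw [map_add]; rfl)
    fun m m' => by
      ext b
      exact map_add (algAct n b).unop m m'

lemma rightAct_one (m : TMod n) : rightAct n m 1 = m := by
  change (algAct n 1).unop m = m
  rw [map_one]
  rfl

lemma rightAct_mul (m : TMod n) (b c : (RBox.pres n).Alg) :
    rightAct n m (b * c) = rightAct n (rightAct n m b) c := by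
  change (algAct n (b * c)).unop m = _
  rw [map_mul]
  rfl

lemma rightAct_gen (g : BGen n) (m : TMod n) :
    rightAct n m ((RBox.pres n).gen g) = actOp g m := algAct_gen g m

lemma word_cons {Gen : Type} {S : QDGPresentation Gen} (x : Gen) (l : List Gen) :
    S.word (x :: l) = S.gen x * S.word l := by
  simp [QDGPresentation.word]

lemma rightAct_smul (a : Rn n) (m : TMod n) (b : (RBox.pres n).Alg) :
    rightAct n (a • m) b = a • rightAct n m b := by
  refine QDGPresentation.alg_induction (S := RBox.pres n)
    (p := fun b => ∀ m, rightAct n (a • m) b = a • rightAct n m b) ?_ ?_ ?_ b m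
  · intro m
    rw [map_zero, map_zero, smul_zero]
  · intro l
    induction l with
    | nil =>
      intro m
      exact (rightAct_one _).trans (congrArg _ (rightAct_one m).symm)
    | cons x l ih =>
      intro m
      rw [word_cons, rightAct_mul, rightAct_mul, rightAct_gen, rightAct_gen, ← ih]
      exact congrArg (fun z => rightAct n z _) (op_smul _ a m)
  · intro b c hb hc m
    rw [map_add, map_add, hb, hc, smul_add]

lemma rightAct_mem {g h : ℤ × ℤ} {m : TMod n} {b : (RBox.pres n).Alg}
    (hm : m ∈ (TMod n).gr g) (hb : b ∈ (RBox.pres n).gr h) :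
    rightAct n m b ∈ (TMod n).gr (g + h) := by
  have key : ∀ (l : List (BGen n)) (g : ℤ × ℤ) (m : TMod n), m ∈ (TMod n).gr g →
      rightAct n m ((RBox.pres n).word l) ∈ (TMod n).gr (g + (RBox.pres n).wdeg l) := by
    intro l
    induction l with
    | nil =>
      intro g m hm
      have e : g + (RBox.pres n).wdeg [] = g := add_zero g
      rw [e]
      exact (rightAct_one m).symm ▸ hm
    | cons x l ih =>
      intro g m hm
      have e : (RBox.pres n).wdeg (x :: l) = x.deg + (RBox.pres n).wdeg l := by
        simp [QDGPresentation.wdeg, RBox.pres]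
      rw [word_cons, rightAct_mul, rightAct_gen, e, ← add_assoc]
      exact ih _ _ (op_mem _ (actM_mem x) hm)
  have hle : (RBox.pres n).gr h ≤ ((TMod n).gr (g + h)).comap (rightAct n m) := by
    refine (AddSubgroup.closure_le _).2 ?_
    rintro _ ⟨l, rfl, rfl⟩
    exact key l g m hm
  exact hle hb

lemma dOp_dOp (m : TMod n) : dOp n (dOp n m) = 0 :=
  ext fun j => by
    rw [comp_dOp, comp_dOp, Matrix.vecMul_vecMul, dM_mul_dM, Matrix.vecMul_zero]
    rfl

lemma dOp_actOp (g : BGen n) (m : TMod n) :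
    dOp n (actOp g m) = actOp g (dOp n m) + rightAct n m ((RBox.pres n).dgen g) := by
  have hne : (∀ s x x' y y' h k, g ≠ .b s x x' y y' h k) → (RBox.pres n).dgen g = 0 →
      dOp n (actOp g m) = actOp g (dOp n m) + rightAct n m ((RBox.pres n).dgen g) := by
    intro hg h0
    rw [h0, map_zero, add_zero]
    refine ext fun j => ?_
    rw [comp_dOp, comp_actOp, comp_actOp, comp_dOp, Matrix.vecMul_vecMul, Matrix.vecMul_vecMul,
      actM_dM_comm g hg]
  cases g with
  | e x y => exact hne (fun _ _ _ _ _ _ _ e => nomatch e) (RBox.dgen_e x y)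
  | l t x x' h y => exact hne (fun _ _ _ _ _ _ _ e => nomatch e) (RBox.dgen_l h y)
  | r x t y y' k => exact hne (fun _ _ _ _ _ _ _ e => nomatch e) (RBox.dgen_r x k)
  | b s x x' y y' h k =>
    rw [RBox.dgen_b, map_add, rightAct_mul, rightAct_mul, rightAct_gen, rightAct_gen,
      rightAct_gen, rightAct_gen]
    refine ext fun j => ?_
    rw [comp_add, comp_add]
    simp only [comp_dOp, comp_actOp, Matrix.vecMul_vecMul, actM_b_dM, Matrix.vecMul_add,
      Pi.add_apply]

lemma dOp_rightAct (m : TMod n) (b : (RBox.pres n).Alg) :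
    dOp n (rightAct n m b) =
      rightAct n (dOp n m) b + rightAct n m (QDGPresentation.diffHom (RBox.valid n) b) := by
  refine QDGPresentation.alg_induction (S := RBox.pres n)
    (p := fun b => ∀ m, dOp n (rightAct n m b) = rightAct n (dOp n m) b +
      rightAct n m (QDGPresentation.diffHom (RBox.valid n) b)) ?_ ?_ ?_ b m
  · intro m
    simp only [map_zero, add_zero]
  · intro l
    induction l with
    | nil =>
      intro m
      have h1 : (RBox.pres n).word [] = 1 := rfl
      rw [h1, QDGPresentation.diffHom_one, map_zero, add_zero, rightAct_one, rightAct_one]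
    | cons x l ih =>
      intro m
      rw [word_cons, QDGPresentation.diffHom_mul, QDGPresentation.diffHom_gen, map_add,
        rightAct_mul, rightAct_mul, rightAct_mul, rightAct_mul, rightAct_gen, rightAct_gen, ih,
        dOp_actOp, map_add, AddMonoidHom.add_apply]
      abel
  · intro b c hb hc m
    simp only [map_add, hb, hc]
    abel

/-- The DG bimodule `T_n`. -/
def bimod (n : ℕ) : DGBimoduleStr (TMod n) (RBox n) where
  d := dOp n
  d_mem hm := op_mem _ dM_mem hm
  d_d := dOp_dOp
  d_smul a m := by
    rw [Rn.d_eq_zero, zero_smul, zero_add]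
    exact op_smul _ a m
  act := rightAct n
  act_one := rightAct_one
  act_mul := rightAct_mul
  smul_act := rightAct_smul
  act_mem := rightAct_mem
  d_act := dOp_rightAct

lemma isTn_bimod (n : ℕ) : IsTn (bimod n) where
  d _ _ := rfl
  act m g j := congrArg (fun z => comp z j) (rightAct_gen g m)

end TMod

lemma DGBimoduleStr.ext' {A B : QDGAlgebra} {M : GrModule A} {τ τ' : DGBimoduleStr M B}
    (hd : τ.d = τ'.d) (ha : τ.act = τ'.act) : τ = τ' := by
  cases τ
  cases τ'
  cases hd
  cases ha
  rfl

/-- The right action is determined by the action of the generators. -/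
lemma IsTn.unique {τ τ' : DGBimoduleStr (TMod n) (RBox n)} (h : IsTn τ) (h' : IsTn τ') :
    τ = τ' := by
  refine DGBimoduleStr.ext' ?_ ?_
  · ext m
    refine TMod.ext fun j => ?_
    rw [h.d, h'.d]
  · have hg : ∀ g m, τ.act m (RBox.gen g) = τ'.act m (RBox.gen g) := fun g m =>
      TMod.ext fun j => by rw [h.act, h'.act]
    ext m b
    refine QDGPresentation.alg_induction (S := RBox.pres n)
      (p := fun b => ∀ m, τ.act m b = τ'.act m b) ?_ ?_ ?_ b m
    · intro m
      exact (map_zero (τ.act m)).trans (map_zero (τ'.act m)).symm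
    · intro l
      induction l with
      | nil => exact fun m => (τ.act_one m).trans (τ'.act_one m).symm
      | cons x l ih =>
        intro m
        rw [TMod.word_cons]
        refine (τ.act_mul m (RBox.gen x) _).trans (Eq.trans ?_ (τ'.act_mul m (RBox.gen x) _).symm)
        rw [hg]
        exact ih _
    · intro b c hb hc m
      exact (map_add (τ.act m) b c).trans
        ((congrArg₂ _ (hb m) (hc m)).trans (map_add (τ'.act m) b c).symm)

lemma existsUnique_isTn (n : ℕ) : ∃! τ : DGBimoduleStr (TMod n) (RBox n), IsTn τ :=
  ⟨TMod.bimod n, TMod.isTn_bimod n, fun _ h => h.unique (TMod.isTn_bimod n)⟩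

end

noncomputable section

/-! ### Classes in the Grothendieck group -/

section Classes

open LaurentPolynomial Pretriangulated

variable {A : QDGAlgebra} {ι : Type} {P : ι → DGModule A}

namespace K0

lemma cls_distinguished {D : Triangle (H0DGP P)} (h : H0DGP.distinguished P D) :
    cls P D.obj₂ = cls P D.obj₁ + cls P D.obj₃ := by
  rw [← sub_eq_zero, ← sub_sub]
  change (K0.relations P).mkQ _ - (K0.relations P).mkQ _ - (K0.relations P).mkQ _ = 0
  rw [← map_sub, ← map_sub, Submodule.mkQ_apply, Submodule.Quotient.mk_eq_zero]
  exact Submodule.subset_span (Or.inr ⟨D, h, rfl⟩)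

lemma cls_qshift (X : H0DGP P) : cls P X.qshift = (T 1 : ℤ[T;T⁻¹]) • cls P X := by
  rw [← sub_eq_zero]
  change (K0.relations P).mkQ _ - _ • (K0.relations P).mkQ _ = 0
  rw [← map_smul, ← map_sub, Submodule.mkQ_apply, Submodule.Quotient.mk_eq_zero,
    Finsupp.smul_single, smul_eq_mul, mul_one]
  exact Submodule.subset_span (Or.inl ⟨X, rfl⟩)

/-- Linear maps out of the Grothendieck group. -/
lemma exists_lift {V : Type*} [AddCommGroup V] [Module ℤ[T;T⁻¹] V] (φ : H0DGP P → V)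
    (hq : ∀ X, φ X.qshift = (T 1 : ℤ[T;T⁻¹]) • φ X)
    (hd : ∀ D : Triangle (H0DGP P), H0DGP.distinguished P D →
      φ D.obj₂ = φ D.obj₁ + φ D.obj₃) :
    ∃ F : K0 P →ₗ[ℤ[T;T⁻¹]] V, ∀ X, F (cls P X) = φ X := by
  let F₀ : (H0DGP P →₀ ℤ[T;T⁻¹]) →ₗ[ℤ[T;T⁻¹]] V := Finsupp.linearCombination _ φ
  have h0 : ∀ X c, F₀ (Finsupp.single X c) = c • φ X := fun X c =>
    Finsupp.linearCombination_single _ _ _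
  have hle : K0.relations P ≤ LinearMap.ker F₀ := by
    refine Submodule.span_le.2 ?_
    rintro r (⟨X, rfl⟩ | ⟨D, hD, rfl⟩)
    · change F₀ _ = 0
      rw [map_sub, h0, h0, one_smul, hq, sub_self]
    · change F₀ _ = 0
      rw [map_sub, map_sub, h0, h0, h0, one_smul, one_smul, one_smul, hd D hD]
      abel
  refine ⟨(K0.relations P).liftQ F₀ hle, fun X => ?_⟩
  change (K0.relations P).liftQ F₀ hle ((K0.relations P).mkQ _) = _
  rw [Submodule.mkQ_apply, Submodule.liftQ_apply, h0, one_smul]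

end K0

lemma H0DG.distinguished_of_iso {D D' : Triangle (H0DG A)} (e : D ≅ D')
    (h : H0DG.distinguished A D') : H0DG.distinguished A D := by
  obtain ⟨M, N, f, ⟨e'⟩⟩ := h
  exact ⟨M, N, f, ⟨e ≪≫ e'⟩⟩

lemma H0DGP.distinguished_of_iso {D D' : Triangle (H0DGP P)} (e : D ≅ D')
    (h : H0DGP.distinguished P D') : H0DGP.distinguished P D :=
  H0DG.distinguished_of_iso ((DGP.property P).ι.mapTriangle.mapIso e) h

/-- The triangle of a cone in `H⁰(DGP(A))`. -/
def H0DGP.coneTriangle {M N : DGModule A} (f : M ⟶ N) (hM : DGP P M) (hN : DGP P N) :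
    Triangle (H0DGP P) :=
  Triangle.mk (X := H0DGP.mk P M hM) (Y := H0DGP.mk P N hN)
    (Z := H0DGP.mk P (DGModule.cone f) (.cone f hM hN))
    (ObjectProperty.homMk ((Quotient.functor (DGModule.homotopic A)).map f))
    (ObjectProperty.homMk ((Quotient.functor (DGModule.homotopic A)).map (DGModule.coneInl f)))
    ((DGP.property P).fullyFaithfulι.preimage
      (((Quotient.functor (DGModule.homotopic A)).mapTriangle.obj
          (DGModule.coneTriangle f)).mor₃ ≫
        ((DGP.property P).ι.commShiftIso (1 : ℤ)).inv.app (H0DGP.mk P M hM)))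

lemma H0DGP.distinguished_coneTriangle {M N : DGModule A} (f : M ⟶ N) (hM : DGP P M)
    (hN : DGP P N) : H0DGP.distinguished P (H0DGP.coneTriangle f hM hN) := by
  let e₁ : ((DGP.property P).ι.mapTriangle.obj (H0DGP.coneTriangle f hM hN)).obj₁ ≅
    ((Quotient.functor (DGModule.homotopic A)).mapTriangle.obj
      (DGModule.coneTriangle f)).obj₁ := Iso.refl ((Quotient.functor _).obj M)
  let e₂ : ((DGP.property P).ι.mapTriangle.obj (H0DGP.coneTriangle f hM hN)).obj₂ ≅
    ((Quotient.functor (DGModule.homotopic A)).mapTriangle.obj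
      (DGModule.coneTriangle f)).obj₂ := Iso.refl ((Quotient.functor _).obj N)
  let e₃ : ((DGP.property P).ι.mapTriangle.obj (H0DGP.coneTriangle f hM hN)).obj₃ ≅
    ((Quotient.functor (DGModule.homotopic A)).mapTriangle.obj
      (DGModule.coneTriangle f)).obj₃ := Iso.refl ((Quotient.functor _).obj (DGModule.cone f))
  refine ⟨M, N, f, ⟨Triangle.isoMk _ _ e₁ e₂ e₃ ?_ ?_ ?_⟩⟩
  · exact (Category.comp_id _).trans (Category.id_comp _).symm
  · exact (Category.comp_id _).trans (Category.id_comp _).symm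
  · have h1 : e₁.hom⟦(1 : ℤ)⟧' = 𝟙 _ := (CategoryTheory.shiftFunctor _ (1 : ℤ)).map_id _
    rw [h1]
    refine (Category.comp_id _).trans (Eq.trans ?_ (Category.id_comp _).symm)
    have key : ∀ (X Z : H0DGP P) (φ : (DGP.property P).ι.obj Z ⟶
        (CategoryTheory.shiftFunctor _ (1 : ℤ)).obj ((DGP.property P).ι.obj X)),
        (DGP.property P).ι.map ((DGP.property P).fullyFaithfulι.preimage
          (φ ≫ ((DGP.property P).ι.commShiftIso (1 : ℤ)).inv.app X)) ≫
          ((DGP.property P).ι.commShiftIso (1 : ℤ)).hom.app X = φ := by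
      intro X Z φ
      rw [Functor.FullyFaithful.map_preimage, Category.assoc, Iso.inv_hom_id_app]
      exact Category.comp_id _
    exact key (H0DGP.mk P M hM) (H0DGP.mk P (DGModule.cone f) (.cone f hM hN)) _

lemma K0.cls_iso {X Y : H0DGP P} (e : X ≅ Y) : cls P X = cls P Y := by
  have hD := H0DGP.distinguished_coneTriangle (P := P) (𝟙 Y.obj.as) Y.property Y.property
  have key : ∀ D : Triangle (H0DGP P), H0DGP.distinguished P D → ∀ e : X ≅ D.obj₂,
      cls P X = cls P D.obj₂ := by
    intro D hD e
    let D' : Triangle (H0DGP P) := Triangle.mk (X := D.obj₁) (Y := X) (Z := D.obj₃)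
      (D.mor₁ ≫ e.inv) (e.hom ≫ D.mor₂) D.mor₃
    have hD' : H0DGP.distinguished P D' := by
      refine H0DGP.distinguished_of_iso (D' := D) ?_ hD
      refine Triangle.isoMk _ _ (Iso.refl _) e (Iso.refl _) ?_ ?_ ?_
      · change (D.mor₁ ≫ e.inv) ≫ e.hom = 𝟙 D.obj₁ ≫ D.mor₁
        simp
      · change (e.hom ≫ D.mor₂) ≫ 𝟙 D.obj₃ = e.hom ≫ D.mor₂
        simp
      · change D.mor₃ ≫ (CategoryTheory.shiftFunctor _ (1 : ℤ)).map (𝟙 D.obj₁) =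
          𝟙 D.obj₃ ≫ D.mor₃
        simp
    exact (K0.cls_distinguished hD').trans (K0.cls_distinguished hD).symm
  exact key _ hD e

namespace K0

/-- The class of a DG module in `DGP(A)`. -/
def of {M : DGModule A} (h : DGP P M) : K0 P := cls P (H0DGP.mk P M h)

lemma of_iso {M N : DGModule A} (e : M ≅ N) (hM : DGP P M) (hN : DGP P N) :
    of hM = of hN :=
  cls_iso ((DGP.property P).isoMk ((Quotient.functor (DGModule.homotopic A)).mapIso e))

lemma of_cone {M N : DGModule A} (f : M ⟶ N) (hM : DGP P M) (hN : DGP P N) :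
    of (.cone f hM hN) = of hN - of hM := by
  have h : of hN = of hM + of (.cone f hM hN) :=
    cls_distinguished (H0DGP.distinguished_coneTriangle f hM hN)
  rw [h, add_sub_cancel_left]

end K0

namespace DGModule

/-- An additive bijection which preserves all the structure is an isomorphism of DG modules. -/
def isoOfLinearEquiv {M N : DGModule A} (e : M ≃ₗ[A] N) (hg : ∀ g m, m ∈ M.gr g ↔ e m ∈ N.gr g)
    (hd : ∀ m, e (M.d m) = N.d (e m)) : M ≅ N where
  hom := ⟨e.toLinearMap, mem_Z0.2 ⟨fun g m h => (hg g m).1 h, hd⟩⟩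
  inv := ⟨e.symm.toLinearMap, mem_Z0.2 ⟨fun g m h => (hg g _).2 (by
      change e (e.symm m) ∈ _
      rwa [e.apply_symm_apply]), fun m => e.injective (by
        change e (e.symm _) = e (M.d (e.symm m))
        rw [hd, e.apply_symm_apply, e.apply_symm_apply])⟩⟩
  hom_inv_id := hom_ext' fun m => e.symm_apply_apply m
  inv_hom_id := hom_ext' fun m => e.apply_symm_apply m

/-- Two zero modules are isomorphic. -/
def isoOfSubsingleton (M N : DGModule A) [Subsingleton M] [Subsingleton N] : M ≅ N :=
  isoOfLinearEquiv (0 : M ≃ₗ[A] N)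
    (fun g m => by
      rw [Subsingleton.elim m 0, map_zero]
      exact ⟨fun _ => zero_mem _, fun _ => zero_mem _⟩)
    fun m => Subsingleton.elim _ _

/-- The identity `(M.shift c).shift c' ≅ M.shift (c + c')`. -/
def shiftShiftIso (M : DGModule A) {c c' c'' : ℤ × ℤ} (h : c' + c = c'') :
    (M.shift c).shift c' ≅ M.shift c'' :=
  isoOfLinearEquiv (M := (M.shift c).shift c') (N := M.shift c'')
    (LinearEquiv.refl A M.carrier) (fun g m => by
      change m ∈ M.gr (g + c' + c) ↔ m ∈ M.gr (g + c'')
      rw [add_assoc, h]) fun _ => rfl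

/-- The zero DG module. -/
def zero (A : QDGAlgebra) : DGModule A where
  carrier := PUnit
  gr _ := ⊤
  internal := by
    refine internal_of_coaction 0 (fun g m _ => Finsupp.ext fun _ => Subsingleton.elim _ _)
      fun m => ?_
    rw [Subsingleton.elim m 0]
    exact zero_mem _
  smul_mem _ _ := trivial
  d := 0
  d_mem _ := trivial
  d_d _ := rfl
  d_smul _ _ := rfl

instance : Subsingleton (zero A) := inferInstanceAs (Subsingleton PUnit)

lemma zero_mem_Z0 (M N : DGModule A) : (0 : M →ₗ[A] N) ∈ Z0 M N := zero_mem _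

/-- The cone of `M ⟶ 0` is `M[1]`. -/
def coneZeroIso (M : DGModule A) :
    cone (⟨0, zero_mem_Z0 M (zero A)⟩ : M ⟶ zero A) ≅ M.shift (1, 0) :=
  isoOfLinearEquiv (M := cone (⟨0, zero_mem_Z0 M (zero A)⟩ : M ⟶ zero A)) (N := M.shift (1, 0))
    { (LinearMap.snd A (zero A).carrier M.carrier) with
      invFun := fun m => (0, m)
      left_inv := fun _ => Prod.ext (Subsingleton.elim _ _) rfl
      right_inv := fun _ => rfl }
    (fun _ _ => ⟨fun h => h.2, fun h => ⟨trivial, h⟩⟩) fun _ => rfl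

end DGModule

namespace K0

lemma of_subsingleton {M : DGModule A} [Subsingleton M] (h : DGP P M) : of h = 0 := by
  have hc : Subsingleton (DGModule.cone (𝟙 M)) := inferInstanceAs (Subsingleton (M × M))
  have := of_iso (P := P) (DGModule.isoOfSubsingleton M (DGModule.cone (𝟙 M))) h (.cone _ h h)
  rw [this, of_cone (𝟙 M) h h, sub_self]

lemma of_shift_one {M : DGModule A} (h : DGP P M) :
    of (DGP.shift (1, 0) h) = -of h := by
  have h0 : DGP P (DGModule.zero A) := DGP.zero _
  rw [← of_iso (DGModule.coneZeroIso M) (.cone _ h h0) (.shift _ h), of_cone _ h h0,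
    of_subsingleton h0, zero_sub]

lemma of_qshift_one {M : DGModule A} (h : DGP P M) :
    of (DGP.shift (0, 1) h) = (T 1 : ℤ[T;T⁻¹]) • of h :=
  cls_qshift (H0DGP.mk P M h)

lemma of_shift {M : DGModule A} (h : DGP P M) (c : ℤ × ℤ) :
    of (DGP.shift c h) = (sg ℤ[T;T⁻¹] c.1 * T c.2) • of h := by
  obtain ⟨a, b⟩ := c
  have hb : ∀ b : ℤ, of (DGP.shift (0, b) h) = (T b : ℤ[T;T⁻¹]) • of h := by
    have step : ∀ b : ℤ, of (DGP.shift (0, b + 1) h) =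
        (T 1 : ℤ[T;T⁻¹]) • of (DGP.shift (0, b) h) := fun b => by
      rw [← of_qshift_one]
      exact of_iso (M.shiftShiftIso (by simp [add_comm])).symm _ _
    intro b
    induction b with
    | zero =>
      rw [T_zero, one_smul]
      exact of_iso (DGModule.isoOfLinearEquiv (M := M.shift (0, 0)) (N := M)
        (LinearEquiv.refl A M.carrier) (fun g m => by
          change m ∈ M.gr (g + 0) ↔ m ∈ M.gr g
          rw [add_zero]) fun _ => rfl) _ _
    | succ b ih => rw [step, ih, smul_smul, ← T_add, add_comm]
    | pred b ih =>
      have := step (-b - 1)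
      rw [sub_add_cancel, ih] at this
      have h2 := congrArg (fun z => (T (-1) : ℤ[T;T⁻¹]) • z) this
      simp only [smul_smul, ← T_add] at h2
      rw [neg_add_cancel, T_zero, one_smul] at h2
      rw [← h2]
      congr 2
      ring
  have step : ∀ a : ℤ, of (DGP.shift (a + 1, b) h) = -of (DGP.shift (a, b) h) := fun a => by
    rw [← of_shift_one]
    exact of_iso (M.shiftShiftIso (by simp [add_comm])).symm _ _
  induction a with
  | zero => rw [hb, sg_zero, one_mul]
  | succ a ih => rw [step, ih, sg_add, sg_one]; simp
  | pred a ih =>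
    have := step (-a - 1)
    rw [sub_add_cancel, ih] at this
    rw [sub_eq_add_neg, sg_add, sg_neg_one, ← neg_eq_iff_eq_neg.2 this]
    simp

/-- The Grothendieck group is spanned by the classes of the generating DG modules. -/
lemma span_of (M : DGModule A) (h : DGP P M) :
    of h ∈ Submodule.span ℤ[T;T⁻¹] (Set.range fun i => of (DGP.proj (P := P) i)) := by
  induction h with
  | proj i => exact Submodule.subset_span ⟨i, rfl⟩
  | zero M => rw [of_subsingleton]; exact zero_mem _
  | shift c h ih => rw [of_shift h]; exact Submodule.smul_mem _ _ ih
  | cone f h h' ih ih' => rw [of_cone f h h']; exact sub_mem ih' ih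
  | iso e h ih => rw [← of_iso e h]; exact ih

lemma span_eq_top :
    Submodule.span ℤ[T;T⁻¹] (Set.range fun i => of (DGP.proj (P := P) i)) = ⊤ := by
  rw [eq_top_iff]
  rintro z -
  obtain ⟨z, rfl⟩ := (K0.relations P).mkQ_surjective z
  induction z using Finsupp.induction_linear with
  | zero => rw [map_zero]; exact zero_mem _
  | add x y hx hy => rw [map_add]; exact add_mem hx hy
  | single X c =>
    rw [← mul_one c, ← smul_eq_mul, ← Finsupp.smul_single, map_smul]
    exact Submodule.smul_mem _ _ (span_of X.obj.as X.property)

end K0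

end Classes

end

noncomputable section

/-! ### Exactness of tensor products -/

namespace DGBimoduleStr

variable {A B : QDGAlgebra} {M : GrModule A} (τ : DGBimoduleStr M B)

lemma tensMap_mem {N N' : DGModule B} (f : N →ₗ[B] N') {c : ℤ × ℤ}
    (hf : ∀ g, ∀ m ∈ N.gr g, f m ∈ N'.gr (g + c)) {g : ℤ × ℤ} {z : τ.tensor N}
    (hz : z ∈ (τ.tensor N).gr g) : τ.tensMap f z ∈ (τ.tensor N').gr (g + c) := by
  have hle : τ.tensGr N g ≤
      ((τ.tensor N').gr (g + c)).comap (τ.tensMap f).toAddMonoidHom := by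
    refine (AddSubgroup.closure_le _).2 ?_
    rintro _ ⟨i, j, m, n, hm, hn, rfl, rfl⟩
    change τ.tmk N' m (f n) ∈ τ.tensGr N' (i + j + c)
    rw [add_assoc]
    exact τ.tmk_mem N' hm (hf _ _ hn)
  exact hle hz

lemma tensMap_d {N N' : DGModule B} (f : N →ₗ[B] N') (hf : ∀ m, f (N.d m) = N'.d (f m))
    (z : τ.tensor N) : τ.tensMap f ((τ.tensor N).d z) = (τ.tensor N').d (τ.tensMap f z) := by
  refine τ.tensor_induction N (p := fun z => τ.tensMap f ((τ.tensor N).d z) =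
    (τ.tensor N').d (τ.tensMap f z)) (by simp only [map_zero]) (fun m n => ?_)
    (fun x y hx hy => by simp only [map_add, hx, hy]) z
  rw [tensor_d, map_add, tensMap_tmul, tensMap_tmul, tensMap_tmul, tensor_d, hf]

lemma subsingleton_tensor (N : DGModule B) [Subsingleton N] : Subsingleton (τ.tensor N) := by
  have h : ∀ z : τ.tensor N, z = 0 := fun z =>
    τ.tensor_induction N (p := fun z => z = 0) rfl
      (fun m n => by rw [Subsingleton.elim n 0, tmul_zero])
      (fun x y hx hy => by rw [hx, hy, add_zero]) z
  exact ⟨fun a b => (h a).trans (h b).symm⟩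

/-- Tensoring commutes with the shifts. -/
def tensorShiftIso (N : DGModule B) (c : ℤ × ℤ) : τ.tensor (N.shift c) ≅ (τ.tensor N).shift c :=
  let f : N.shift c →ₗ[B] N := (LinearMap.id : N.carrier →ₗ[B] N.carrier)
  let f' : N →ₗ[B] N.shift c := (LinearMap.id : N.carrier →ₗ[B] N.carrier)
  DGModule.isoOfLinearEquiv (M := τ.tensor (N.shift c)) (N := (τ.tensor N).shift c)
    (LinearEquiv.ofLinearMap (τ.tensMap f) (τ.tensMap f')
      (τ.tensor_hom_ext fun _ _ => rfl) (τ.tensor_hom_ext fun _ _ => rfl))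
    (fun g m => ⟨fun h => τ.tensMap_mem f (fun _ _ h => h) h, fun h => by
      have h' := τ.tensMap_mem f' (c := -c) (fun g m hm => by
        change m ∈ N.gr (g + -c + c)
        rwa [neg_add_cancel_right]) (show τ.tensMap f m ∈ (τ.tensor N).gr (g + c) from h)
      rw [add_neg_cancel_right] at h'
      have e : ∀ m, τ.tensMap f' (τ.tensMap f m) = m := fun m =>
        LinearMap.congr_fun (f := (τ.tensMap f').comp (τ.tensMap f)) (g := LinearMap.id)
          (τ.tensor_hom_ext fun _ _ => rfl) m
      rwa [e] at h'⟩)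
    (τ.tensMap_d f fun _ => rfl)

instance : τ.tensorFunctor.CommShift ℤ where
  commShiftIso k := NatIso.ofComponents (fun N => τ.tensorShiftIso N (k, 0))
    (fun _ => Subtype.ext (τ.tensor_hom_ext fun _ _ => rfl))
  commShiftIso_zero := by
    ext N
    exact Subtype.ext (τ.tensor_hom_ext fun _ _ => rfl)
  commShiftIso_add a b := by
    ext N
    exact Subtype.ext (τ.tensor_hom_ext fun _ _ => rfl)

/-- Tensoring commutes with cones. -/
def tensorConeIso {N N' : DGModule B} (f : N ⟶ N') :
    τ.tensor (DGModule.cone f) ≅ DGModule.cone (τ.tensorFunctor.map f) :=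
  let p₁ : DGModule.cone f →ₗ[B] N' := LinearMap.fst B N'.carrier N.carrier
  let p₂ : DGModule.cone f →ₗ[B] N := LinearMap.snd B N'.carrier N.carrier
  let i₁ : N' →ₗ[B] DGModule.cone f := LinearMap.inl B N'.carrier N.carrier
  let i₂ : N →ₗ[B] DGModule.cone f := LinearMap.inr B N'.carrier N.carrier
  let F : τ.tensor (DGModule.cone f) →ₗ[A] DGModule.cone (τ.tensorFunctor.map f) :=
    (LinearMap.prod (τ.tensMap p₁) (τ.tensMap p₂) :
      τ.tensor (DGModule.cone f) →ₗ[A] (τ.tensor N').carrier × (τ.tensor N).carrier)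
  let G : DGModule.cone (τ.tensorFunctor.map f) →ₗ[A] τ.tensor (DGModule.cone f) :=
    (LinearMap.coprod (τ.tensMap i₁) (τ.tensMap i₂) :
      (τ.tensor N').carrier × (τ.tensor N).carrier →ₗ[A] τ.tensor (DGModule.cone f))
  have hGF : ∀ z, G (F z) = z := fun z => LinearMap.congr_fun (f := G.comp F)
    (g := LinearMap.id) (τ.tensor_hom_ext fun m n => by
      change τ.tmul (DGModule.cone f) m (i₁ n.1) + τ.tmul (DGModule.cone f) m (i₂ n.2) = _
      rw [← tmul_add]
      exact congrArg _ (Prod.ext (add_zero _) (zero_add _))) z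
  have hF₁ : ∀ z, F (τ.tensMap i₁ z) = (z, 0) := fun z => Prod.ext
    (LinearMap.congr_fun (f := (τ.tensMap p₁).comp (τ.tensMap i₁)) (g := LinearMap.id)
      (τ.tensor_hom_ext fun m n => rfl) z)
    (LinearMap.congr_fun (f := (τ.tensMap p₂).comp (τ.tensMap i₁)) (g := 0)
      (τ.tensor_hom_ext fun m n => τ.tmul_zero N m) z)
  have hF₂ : ∀ z, F (τ.tensMap i₂ z) = (0, z) := fun z => Prod.ext
    (LinearMap.congr_fun (f := (τ.tensMap p₁).comp (τ.tensMap i₂)) (g := 0)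
      (τ.tensor_hom_ext fun m n => τ.tmul_zero N' m) z)
    (LinearMap.congr_fun (f := (τ.tensMap p₂).comp (τ.tensMap i₂)) (g := LinearMap.id)
      (τ.tensor_hom_ext fun m n => rfl) z)
  have hFG : ∀ z, F (G z) = z := fun z => by
    refine (map_add F _ _).trans ((congrArg₂ _ (hF₁ z.1) (hF₂ z.2)).trans ?_)
    exact Prod.ext (add_zero _) (zero_add _)
  DGModule.isoOfLinearEquiv (LinearEquiv.ofLinearMap F G (LinearMap.ext hFG) (LinearMap.ext hGF))
    (fun g z => ⟨fun h => by
      have h1 := τ.tensMap_mem p₁ (c := 0) (fun g m hm => by rw [add_zero]; exact hm.1) h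
      rw [add_zero] at h1
      exact ⟨h1, τ.tensMap_mem p₂ (c := (1, 0)) (fun g m hm => hm.2) h⟩, fun h => by
      have h1 := τ.tensMap_mem i₁ (c := 0) (fun g m hm => by
        rw [add_zero]
        exact ⟨hm, zero_mem _⟩) h.1
      have h2 := τ.tensMap_mem i₂ (c := -(1, 0)) (fun g m hm => by
        refine ⟨zero_mem _, ?_⟩
        rw [neg_add_cancel_right]
        exact hm) h.2
      rw [add_zero] at h1
      rw [add_neg_cancel_right] at h2
      have := add_mem h1 h2
      have e : τ.tensMap i₁ (F z).1 + τ.tensMap i₂ (F z).2 = z := hGF z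
      exact e ▸ this⟩)
    (fun z => τ.tensor_induction _ (p := fun z => F ((τ.tensor (DGModule.cone f)).d z) =
        (DGModule.cone (τ.tensorFunctor.map f)).d (F z)) (by simp only [map_zero])
      (fun m n => by
        rw [tensor_d, map_add]
        refine Prod.ext ?_ ?_
        · change τ.tmul N' (τ.d m) n.1 + τ.tmul N' m (N'.d n.1 + f.1 n.2) =
            (τ.tensor N').d (τ.tmul N' m n.1) + τ.tmul N' m (f.1 n.2)
          rw [tensor_d, tmul_add, add_assoc]
        · exact (τ.tensor_d N m n.2).symm)
      (fun x y hx hy => by rw [map_add, map_add, map_add, map_add, hx, hy]) z)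

instance : τ.tensorFunctor.Additive where
  map_add {_ N' _ _} := Subtype.ext (τ.tensor_hom_ext fun m _ => τ.tmul_add N' m _ _)

/-- Tensoring maps cone triangles to cone triangles. -/
def mapConeTriangleIso {N N' : DGModule B} (f : N ⟶ N') :
    τ.tensorFunctor.mapTriangle.obj (DGModule.coneTriangle f) ≅
      DGModule.coneTriangle (τ.tensorFunctor.map f) :=
  Pretriangulated.Triangle.isoMk _ _ (Iso.refl (τ.tensor N)) (Iso.refl (τ.tensor N'))
    (τ.tensorConeIso f)
    (Subtype.ext (τ.tensor_hom_ext fun _ _ => rfl))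
    (Subtype.ext (τ.tensor_hom_ext fun m _ =>
      Prod.ext rfl (τ.tmul_zero N m)))
    (Subtype.ext (τ.tensor_hom_ext fun _ _ => rfl))

instance : τ.tensorH0.CommShift ℤ :=
  inferInstanceAs ((CategoryTheory.Quotient.lift _ (τ.tensorFunctor ⋙
    CategoryTheory.Quotient.functor _) _).CommShift ℤ)

/-- The functor induced by tensoring commutes with the quotient functors. -/
def tensorH0Iso : CategoryTheory.Quotient.functor (DGModule.homotopic B) ⋙ τ.tensorH0 ≅
    τ.tensorFunctor ⋙ CategoryTheory.Quotient.functor (DGModule.homotopic A) :=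
  CategoryTheory.Quotient.lift.isLift _ _ _

instance : NatTrans.CommShift τ.tensorH0Iso.hom ℤ :=
  CategoryTheory.Quotient.liftCommShift_compatibility _ _ _ _

lemma tensorH0_distinguished {D : Pretriangulated.Triangle (H0DG B)}
    (h : H0DG.distinguished B D) : H0DG.distinguished A (τ.tensorH0.mapTriangle.obj D) := by
  obtain ⟨N, N', f, ⟨e⟩⟩ := h
  refine ⟨_, _, τ.tensorFunctor.map f, ⟨?_⟩⟩
  exact τ.tensorH0.mapTriangle.mapIso e ≪≫
    ((Functor.mapTriangleCompIso _ _).symm.app (DGModule.coneTriangle f)) ≪≫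
    ((Functor.mapTriangleIso τ.tensorH0Iso).app _) ≪≫
    ((Functor.mapTriangleCompIso _ _).app _) ≪≫
    (Quotient.functor (DGModule.homotopic A)).mapTriangle.mapIso (τ.mapConeTriangleIso f)

instance : τ.tensorH0.Additive where
  map_add {X Y f g} := by
    obtain ⟨f, rfl⟩ := (Quotient.functor (DGModule.homotopic B)).map_surjective f
    obtain ⟨g, rfl⟩ := (Quotient.functor (DGModule.homotopic B)).map_surjective g
    exact congrArg (Quotient.functor (DGModule.homotopic A)).map
      (τ.tensorFunctor.map_add (f := f) (g := g))

variable {ι κ : Type} {P : ι → DGModule B} {Q : κ → DGModule A}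

instance : ((DGP.property P).ι ⋙ τ.tensorH0).CommShift ℤ := inferInstance

instance (h : ∀ N, DGP P N → DGP Q (τ.tensor N)) : (τ.tensorDGP h).CommShift ℤ :=
  Functor.CommShift.ofComp ((DGP.property Q).liftCompιIso ((DGP.property P).ι ⋙ τ.tensorH0)
    (fun X => h _ X.property)) ℤ

lemma isExactFunctor_tensorDGP (h : ∀ N, DGP P N → DGP Q (τ.tensor N)) :
    IsExactFunctor (τ.tensorDGP h) := by
  refine ⟨⟨fun {X Y f g} => ?_⟩, inferInstance, fun D hD => ?_⟩
  · refine (DGP.property Q).ι.map_injective ?_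
    exact τ.tensorH0.map_add (f := f.hom) (g := g.hom)
  · let e : τ.tensorDGP h ⋙ (DGP.property Q).ι ≅ (DGP.property P).ι ⋙ τ.tensorH0 :=
      (DGP.property Q).liftCompιIso _ _
    have : NatTrans.CommShift e.hom ℤ := Functor.CommShift.ofComp_compatibility _ _
    refine H0DG.distinguished_of_iso ?_ (τ.tensorH0_distinguished hD)
    exact (Functor.mapTriangleCompIso _ _).symm.app D ≪≫ (Functor.mapTriangleIso e).app D ≪≫
      (Functor.mapTriangleCompIso _ _).app D

lemma dgp_tensor (h : ∀ i, DGP Q (τ.tensor (P i))) (N : DGModule B) (hN : DGP P N) :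
    DGP Q (τ.tensor N) := by
  induction hN with
  | proj i => exact h i
  | zero N =>
    have := τ.subsingleton_tensor N
    exact .zero _
  | shift c _ ih => exact .iso (τ.tensorShiftIso _ c).symm (.shift c ih)
  | cone f _ _ ih ih' => exact .iso (τ.tensorConeIso f).symm (.cone _ ih ih')
  | iso e _ ih => exact .iso (τ.tensorFunctor.mapIso e) ih

lemma exists_tensorK0 (h : ∀ N, DGP P N → DGP Q (τ.tensor N)) :
    ∃ κ : K0 P →ₗ[ℤ[T;T⁻¹]] K0 Q,
      ∀ N, κ (K0.cls _ N) = K0.cls _ ((τ.tensorDGP h).obj N) := by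
  refine K0.exists_lift (fun N => K0.cls Q ((τ.tensorDGP h).obj N)) (fun X => ?_) fun D hD => ?_
  · have e1 := K0.of_iso (P := Q) (τ.tensorShiftIso X.obj.as (0, 1))
      (h _ (.shift (0, 1) X.property)) (.shift (0, 1) (h _ X.property))
    exact e1.trans (K0.of_qshift_one (h _ X.property))
  · obtain ⟨_, _, hF⟩ := τ.isExactFunctor_tensorDGP h
    exact K0.cls_distinguished (hF D hD)

end DGBimoduleStr

end

noncomputable section

/-! ### Homology and Euler characteristics -/

namespace DGModule

open LaurentPolynomial

variable {A : QDGAlgebra}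

/-- The cycles of degree `g`. -/
def cyc (M : DGModule A) (g : ℤ × ℤ) : AddSubgroup M := M.gr g ⊓ M.d.ker

/-- The boundaries of degree `g`. -/
def bdry (M : DGModule A) (g : ℤ × ℤ) : AddSubgroup M := (M.gr (g + (-1, 0))).map M.d

/-- The homology of degree `g`. -/
def Homology (M : DGModule A) (g : ℤ × ℤ) : Type :=
  M.cyc g ⧸ (M.bdry g).addSubgroupOf (M.cyc g)

instance (M : DGModule A) (g : ℤ × ℤ) : AddCommGroup (M.Homology g) :=
  inferInstanceAs (AddCommGroup (M.cyc g ⧸ (M.bdry g).addSubgroupOf (M.cyc g)))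

/-- The homology class of a cycle. -/
def hcls (M : DGModule A) (g : ℤ × ℤ) : M.cyc g →+ M.Homology g := QuotientAddGroup.mk' _

lemma hcls_surjective (M : DGModule A) (g : ℤ × ℤ) : Function.Surjective (M.hcls g) :=
  QuotientAddGroup.mk'_surjective _

lemma hcls_eq_zero {M : DGModule A} {g : ℤ × ℤ} {z : M.cyc g} :
    M.hcls g z = 0 ↔ ∃ p ∈ M.gr (g + (-1, 0)), M.d p = z.1 :=
  (QuotientAddGroup.eq_zero_iff z).trans Iff.rfl

instance (M : DGModule A) (g : ℤ × ℤ) : Module (ZMod 2) (M.Homology g) :=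
  AddCommGroup.zmodModule fun x => by
    obtain ⟨z, rfl⟩ := M.hcls_surjective g x
    rw [two_nsmul, ← map_add, show z + z = 0 from Subtype.ext (M.add_self z.1), map_zero]

/-- The map on homology induced by an additive map which commutes with the differentials and
respects the degrees. -/
def hmap {A' : QDGAlgebra} {M : DGModule A} {N : DGModule A'} (φ : M.carrier →+ N.carrier)
    (hd : ∀ m, φ (M.d m) = N.d (φ m)) (c : ℤ × ℤ) (hc : ∀ g, ∀ m ∈ M.gr g, φ m ∈ N.gr (g + c))
    (g : ℤ × ℤ) : M.Homology g →+ N.Homology (g + c) :=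
  QuotientAddGroup.map _ _ ((φ.comp (M.cyc g).subtype).codRestrict (N.cyc (g + c))
    fun m => ⟨hc g _ m.2.1, by
      change N.d (φ m.1) = 0
      rw [← hd, show M.d m.1 = 0 from m.2.2, map_zero]⟩) (by
    rintro ⟨_, hm⟩ ⟨p, hp, rfl⟩
    refine ⟨φ p, ?_, (hd p).symm⟩
    have := hc _ p hp
    rwa [add_right_comm] at this)

/-- The dimension of the homology of degree `g`. -/
def hdim (M : DGModule A) (g : ℤ × ℤ) : ℕ := Module.finrank (ZMod 2) (M.Homology g)

/-- The total homology is finite. -/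
def FinHomology (M : DGModule A) : Prop :=
  (∀ g, Module.Finite (ZMod 2) (M.Homology g)) ∧ (Function.support M.hdim).Finite

lemma exists_homologyEquiv {A' : QDGAlgebra} {M : DGModule A} {N : DGModule A'} {g g' : ℤ × ℤ}
    (F : M.Homology g →+ N.Homology g') (hF : Function.Bijective F) :
    Nonempty (M.Homology g ≃ₗ[ZMod 2] N.Homology g') :=
  ⟨LinearEquiv.ofBijective (F.toZModLinearMap 2) hF⟩

/-- The map on homology induced by a morphism. -/
def hmor {M N : DGModule A} (f : M ⟶ N) (g : ℤ × ℤ) : M.Homology g →+ N.Homology g :=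
  QuotientAddGroup.map _ _ ((f.1.toAddMonoidHom.comp (M.cyc g).subtype).codRestrict (N.cyc g)
    fun m => ⟨(mem_Z0.1 f.2).1 g _ m.2.1, by
      change N.d (f.1 m.1) = 0
      rw [← (mem_Z0.1 f.2).2, show M.d m.1 = 0 from m.2.2, map_zero]⟩) (by
    rintro ⟨_, hm⟩ ⟨p, hp, rfl⟩
    exact ⟨f.1 p, (mem_Z0.1 f.2).1 _ p hp, ((mem_Z0.1 f.2).2 p).symm⟩)

lemma hmor_hcls {M N : DGModule A} (f : M ⟶ N) (g : ℤ × ℤ) (z : M.cyc g)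
    (hz : f.1 z.1 ∈ N.cyc g) : hmor f g (M.hcls g z) = N.hcls g ⟨f.1 z.1, hz⟩ := rfl

lemma map_mem_cyc {M N : DGModule A} (f : M ⟶ N) {g : ℤ × ℤ} {z : M} (hz : z ∈ M.cyc g) :
    f.1 z ∈ N.cyc g := ⟨(mem_Z0.1 f.2).1 g _ hz.1, by
      change N.d (f.1 z) = 0
      rw [← (mem_Z0.1 f.2).2, show M.d z = 0 from hz.2, map_zero]⟩

lemma hmor_comp {M N K : DGModule A} (f : M ⟶ N) (f' : N ⟶ K) (g : ℤ × ℤ) (x : M.Homology g) :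
    hmor (f ≫ f') g x = hmor f' g (hmor f g x) := by
  obtain ⟨z, rfl⟩ := M.hcls_surjective g x
  rfl

lemma hmor_id {M : DGModule A} (g : ℤ × ℤ) (x : M.Homology g) : hmor (𝟙 M) g x = x := by
  obtain ⟨z, rfl⟩ := M.hcls_surjective g x
  rfl

lemma hmor_homotopic {M N : DGModule A} {f f' : M ⟶ N} (h : homotopic A f f') (g : ℤ × ℤ)
    (x : M.Homology g) : hmor f g x = hmor f' g x := by
  obtain ⟨z, rfl⟩ := M.hcls_surjective g x
  obtain ⟨s, hs, e⟩ := h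
  rw [hmor_hcls f g z (map_mem_cyc f z.2), hmor_hcls f' g z (map_mem_cyc f' z.2), ← sub_eq_zero,
    ← map_sub, hcls_eq_zero]
  refine ⟨s z.1, hs _ _ z.2.1, ?_⟩
  have h1 : N.d (s z.1) + s (M.d z.1) = f.1 z.1 - f'.1 z.1 := LinearMap.congr_fun e z.1
  rw [show M.d z.1 = 0 from z.2.2, map_zero, add_zero] at h1
  exact h1

/-- Isomorphic objects of the homotopy category have isomorphic homology. -/
lemma exists_homologyEquiv_of_iso {M N : DGModule A}
    (e : (Quotient.functor (homotopic A)).obj M ≅ (Quotient.functor (homotopic A)).obj N)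
    (g : ℤ × ℤ) : Nonempty (M.Homology g ≃ₗ[ZMod 2] N.Homology g) := by
  obtain ⟨f, hf⟩ := (Quotient.functor (homotopic A)).map_surjective e.hom
  obtain ⟨f', hf'⟩ := (Quotient.functor (homotopic A)).map_surjective e.inv
  have h1 : homotopic A (f ≫ f') (𝟙 M) := by
    refine (Quotient.functor_map_eq_iff (homotopic A) _ _).1 ?_
    rw [Functor.map_comp, hf, hf', e.hom_inv_id, CategoryTheory.Functor.map_id]
  have h2 : homotopic A (f' ≫ f) (𝟙 N) := by
    refine (Quotient.functor_map_eq_iff (homotopic A) _ _).1 ?_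
    rw [Functor.map_comp, hf, hf', e.inv_hom_id, CategoryTheory.Functor.map_id]
  refine exists_homologyEquiv (hmor f g) ⟨Function.LeftInverse.injective (g := hmor f' g) ?_,
    Function.RightInverse.surjective (g := hmor f' g) ?_⟩
  · intro x
    rw [← hmor_comp, hmor_homotopic h1, hmor_id]
  · intro x
    rw [← hmor_comp, hmor_homotopic h2, hmor_id]

lemma exists_shiftHomologyEquiv (M : DGModule A) (c g : ℤ × ℤ) :
    Nonempty ((M.shift c).Homology g ≃ₗ[ZMod 2] M.Homology (g + c)) := by
  refine exists_homologyEquiv (hmap (M := M.shift c) (N := M) (AddMonoidHom.id M.carrier)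
    (fun _ => rfl) c (fun _ _ h => h) g) ⟨(injective_iff_map_eq_zero _).2 fun x hx => ?_,
    fun y => ?_⟩
  · obtain ⟨z, rfl⟩ := (M.shift c).hcls_surjective g x
    have hx' : M.hcls (g + c) ⟨z.1, z.2⟩ = 0 := hx
    obtain ⟨p, hp, e⟩ := hcls_eq_zero.1 hx'
    refine hcls_eq_zero.2 ⟨p, ?_, e⟩
    rw [add_right_comm] at hp
    exact hp
  · obtain ⟨z, rfl⟩ := M.hcls_surjective _ y
    exact ⟨(M.shift c).hcls g ⟨z.1, z.2⟩, rfl⟩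

section Cone

variable {M N : DGModule A} (f : M ⟶ N) (g : ℤ × ℤ)

/-- The connecting map in homology. No sign is needed, as the differential of the cone of `M ⟶ N`
restricts to that of `M` in characteristic `2`. -/
def hconn : (cone f).Homology g →+ M.Homology (g + (1, 0)) :=
  hmap (M := cone f) (N := M) (AddMonoidHom.snd N.carrier M.carrier) (fun _ => rfl) (1, 0)
    (fun _ _ h => h.2) g

/-- Exactness of the long exact homology sequence of a cone at the homology of the target. -/
lemma exact_hmor_inl : Function.Exact (hmor f g) (hmor (coneInl f) g) := by
  intro y
  obtain ⟨z, rfl⟩ := N.hcls_surjective g y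
  rw [hmor_hcls _ _ _ (map_mem_cyc (coneInl f) z.2), hcls_eq_zero]
  constructor
  · rintro ⟨⟨p, q⟩, ⟨hp, hq⟩, e⟩
    have e1 : N.d p + f.1 q = z.1 := congrArg Prod.fst e
    have e2 : M.d q = 0 := congrArg Prod.snd e
    have hq' : q ∈ M.gr (g + (-1, 0) + (1, 0)) := hq
    rw [add_assoc, show ((-1, 0) : ℤ × ℤ) + (1, 0) = 0 from rfl, add_zero] at hq'
    have hq'' : q ∈ M.cyc g := ⟨hq', e2⟩
    refine ⟨M.hcls g ⟨q, hq''⟩, ?_⟩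
    rw [hmor_hcls _ _ _ (map_mem_cyc f hq''), ← sub_eq_zero, ← map_sub, hcls_eq_zero]
    refine ⟨-p, neg_mem hp, ?_⟩
    change N.d (-p) = f.1 q - z.1
    rw [← e1, map_neg]
    abel
  · rintro ⟨x, hx⟩
    obtain ⟨q, rfl⟩ := M.hcls_surjective g x
    rw [hmor_hcls _ _ _ (map_mem_cyc f q.2), ← sub_eq_zero, ← map_sub, hcls_eq_zero] at hx
    obtain ⟨p, hp, e⟩ := hx
    have e' : N.d p = f.1 q.1 - z.1 := e
    have hnp : -p ∈ N.gr (g + (-1, 0)) := neg_mem hp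
    refine ⟨(-p, q.1), ⟨hnp, ?_⟩, Prod.ext ?_ q.2.2⟩
    · rw [add_assoc, show ((-1, 0) : ℤ × ℤ) + (1, 0) = 0 from rfl, add_zero]
      exact q.2.1
    · change N.d (-p) + f.1 q.1 = z.1
      rw [map_neg, e']
      abel

/-- Exactness of the long exact homology sequence of a cone at the homology of the cone. -/
lemma exact_inl_conn : Function.Exact (hmor (coneInl f) g) (hconn f g) := by
  intro y
  obtain ⟨z, rfl⟩ := (cone f).hcls_surjective g y
  have hz1 : z.1.1 ∈ N.gr g := z.2.1.1
  have hz2 : z.1.2 ∈ M.gr (g + (1, 0)) := z.2.1.2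
  have e1 : N.d z.1.1 + f.1 z.1.2 = 0 := congrArg Prod.fst (show (cone f).d z.1 = 0 from z.2.2)
  have e2 : M.d z.1.2 = 0 := congrArg Prod.snd (show (cone f).d z.1 = 0 from z.2.2)
  have hc : hconn f g ((cone f).hcls g z) = M.hcls (g + (1, 0)) ⟨z.1.2, hz2, e2⟩ := rfl
  rw [hc, hcls_eq_zero]
  constructor
  · rintro ⟨p, hp, e⟩
    have hp' : p ∈ M.gr g := by
      rwa [add_assoc, show ((1, 0) : ℤ × ℤ) + (-1, 0) = 0 from rfl, add_zero] at hp
    have hw : z.1.1 - f.1 p ∈ N.cyc g := by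
      have h1 : z.1.1 - f.1 p ∈ N.gr g := sub_mem hz1 ((mem_Z0.1 f.2).1 _ _ hp')
      refine ⟨h1, ?_⟩
      change N.d (z.1.1 - f.1 p) = 0
      have e' : M.d p = z.1.2 := e
      rw [map_sub, ← (mem_Z0.1 f.2).2, e', sub_eq_add_neg,
        show -f.1 z.1.2 = f.1 z.1.2 from neg_eq_of_add_eq_zero_left (N.add_self _), e1]
    refine ⟨N.hcls g ⟨_, hw⟩, ?_⟩
    rw [hmor_hcls _ _ _ (map_mem_cyc (coneInl f) hw), ← sub_eq_zero, ← map_sub, hcls_eq_zero]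
    have hnp : -p ∈ M.gr (g + (-1, 0) + (1, 0)) := by
      rw [add_assoc, show ((-1, 0) : ℤ × ℤ) + (1, 0) = 0 from rfl, add_zero]
      exact neg_mem hp'
    refine ⟨(0, -p), ⟨zero_mem _, hnp⟩, ?_⟩
    refine Prod.ext ?_ ?_
    · change N.d 0 + f.1 (-p) = z.1.1 - f.1 p - z.1.1
      rw [map_zero, map_neg]
      abel
    · change M.d (-p) = 0 - z.1.2
      rw [map_neg, zero_sub]
      exact congrArg _ e
  · rintro ⟨x, hx⟩
    obtain ⟨w, rfl⟩ := N.hcls_surjective g x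
    rw [hmor_hcls _ _ _ (map_mem_cyc (coneInl f) w.2), ← sub_eq_zero, ← map_sub,
      hcls_eq_zero] at hx
    obtain ⟨p, hp, e⟩ := hx
    have e' : M.d p.2 = 0 - z.1.2 := congrArg Prod.snd e
    refine ⟨-p.2, neg_mem ?_, ?_⟩
    · have := hp.2
      rwa [add_right_comm] at this
    · rw [map_neg, e', zero_sub, neg_neg]

/-- Exactness of the long exact homology sequence of a cone at the homology of the source. -/
lemma exact_conn_hmor : Function.Exact (hconn f g) (hmor f (g + (1, 0))) := by
  intro y
  obtain ⟨z, rfl⟩ := M.hcls_surjective _ y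
  rw [hmor_hcls _ _ _ (map_mem_cyc f z.2), hcls_eq_zero]
  constructor
  · rintro ⟨p, hp, e⟩
    have hp' : p ∈ N.gr g := by
      rwa [add_assoc, show ((1, 0) : ℤ × ℤ) + (-1, 0) = 0 from rfl, add_zero] at hp
    have e' : N.d p = f.1 z.1 := e
    have hw : ((p, z.1) : cone f) ∈ (cone f).cyc g := by
      refine ⟨⟨hp', z.2.1⟩, Prod.ext ?_ z.2.2⟩
      change N.d p + f.1 z.1 = 0
      rw [e', N.add_self]
    exact ⟨(cone f).hcls g ⟨_, hw⟩, rfl⟩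
  · rintro ⟨x, hx⟩
    obtain ⟨w, rfl⟩ := (cone f).hcls_surjective g x
    have hw1 : w.1.1 ∈ N.gr g := w.2.1.1
    have hw2 : w.1.2 ∈ M.gr (g + (1, 0)) := w.2.1.2
    have e1 : N.d w.1.1 + f.1 w.1.2 = 0 := congrArg Prod.fst (show (cone f).d w.1 = 0 from w.2.2)
    have e2 : M.d w.1.2 = 0 := congrArg Prod.snd (show (cone f).d w.1 = 0 from w.2.2)
    have hc : hconn f g ((cone f).hcls g w) = M.hcls (g + (1, 0)) ⟨w.1.2, hw2, e2⟩ := rfl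
    rw [hc, ← sub_eq_zero, ← map_sub, hcls_eq_zero] at hx
    obtain ⟨q, hq, e⟩ := hx
    have e' : M.d q = w.1.2 - z.1 := e
    refine ⟨-w.1.1 - f.1 q, sub_mem (neg_mem ?_) ((mem_Z0.1 f.2).1 _ _ hq), ?_⟩
    · rw [add_assoc, show ((1, 0) : ℤ × ℤ) + (-1, 0) = 0 from rfl, add_zero]
      exact hw1
    · change N.d (-w.1.1 - f.1 q) = f.1 z.1
      rw [map_sub, map_neg, ← (mem_Z0.1 f.2).2, e', map_sub, neg_eq_of_add_eq_zero_right e1]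
      abel

/-- The dimension count in a five term exact sequence. -/
lemma _root_.finrank_of_exact {K U V W X Y : Type*} [Field K] [AddCommGroup U] [AddCommGroup V]
    [AddCommGroup W] [AddCommGroup X] [AddCommGroup Y] [Module K U] [Module K V] [Module K W]
    [Module K X] [Module K Y] [Module.Finite K V] [Module.Finite K W] [Module.Finite K X]
    {a : U →ₗ[K] V} {b : V →ₗ[K] W} {c : W →ₗ[K] X} {a' : X →ₗ[K] Y} (h₁ : Function.Exact a b)
    (h₂ : Function.Exact b c) (h₃ : Function.Exact c a') :
    Module.finrank K W + (Module.finrank K (LinearMap.range a) +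
      Module.finrank K (LinearMap.range a')) = Module.finrank K V + Module.finrank K X := by
  have e1 := LinearMap.finrank_range_add_finrank_ker b
  have e2 := LinearMap.finrank_range_add_finrank_ker c
  have e3 := LinearMap.finrank_range_add_finrank_ker a'
  rw [h₁.linearMap_ker_eq] at e1
  rw [h₂.linearMap_ker_eq] at e2
  rw [h₃.linearMap_ker_eq] at e3
  omega

/-- The rank of the map induced on homology. -/
def hrank : ℕ := Module.finrank (ZMod 2) (LinearMap.range ((hmor f g).toZModLinearMap 2))

lemma hdim_cone (hM : M.FinHomology) (hN : N.FinHomology) (hC : (cone f).FinHomology) :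
    (cone f).hdim g + (hrank f g + hrank f (g + (1, 0))) = N.hdim g + M.hdim (g + (1, 0)) := by
  have := hM.1 (g + (1, 0))
  have := hN.1 g
  have := hC.1 g
  exact finrank_of_exact (a := (hmor f g).toZModLinearMap 2)
    (b := (hmor (coneInl f) g).toZModLinearMap 2) (c := (hconn f g).toZModLinearMap 2)
    (a' := (hmor f (g + (1, 0))).toZModLinearMap 2) (exact_hmor_inl f g) (exact_inl_conn f g)
    (exact_conn_hmor f g)

lemma hrank_le (hM : M.FinHomology) : hrank f g ≤ M.hdim g := by
  have := hM.1 g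
  exact LinearMap.finrank_range_le _

end Cone

/-- The alternating sum of a function on the degrees, as a Laurent polynomial. -/
def altSum (φ : ℤ × ℤ → ℕ) : ℤ[T;T⁻¹] :=
  ∑ᶠ g : ℤ × ℤ, (φ g : ℤ[T;T⁻¹]) * (sg ℤ[T;T⁻¹] g.1 * T (-g.2))

lemma altSum_add {φ ψ : ℤ × ℤ → ℕ} (hφ : φ.support.Finite) (hψ : ψ.support.Finite) :
    altSum (fun g => φ g + ψ g) = altSum φ + altSum ψ := by
  rw [altSum, altSum, altSum, ← finsum_add_distrib]
  · refine finsum_congr fun g => ?_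
    push_cast
    ring
  · exact hφ.subset fun g hg h => hg (by simp [h])
  · exact hψ.subset fun g hg h => hg (by simp [h])

lemma altSum_shift (φ : ℤ × ℤ → ℕ) : altSum (fun g => φ (g + (1, 0))) = -altSum φ := by
  rw [altSum, altSum, ← finsum_comp_equiv (Equiv.addRight ((1, 0) : ℤ × ℤ))
    (f := fun g => (φ g : ℤ[T;T⁻¹]) * (sg ℤ[T;T⁻¹] g.1 * T (-g.2))), ← finsum_neg_distrib]
  refine finsum_congr fun g => ?_
  simp [sg_add, sg_one]

lemma altSum_qshift (φ : ℤ × ℤ → ℕ) : altSum (fun g => φ (g + (0, 1))) = T 1 * altSum φ := by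
  rw [altSum, altSum, ← finsum_comp_equiv (Equiv.addRight ((0, 1) : ℤ × ℤ))
    (f := fun g => (φ g : ℤ[T;T⁻¹]) * (sg ℤ[T;T⁻¹] g.1 * T (-g.2))),
    ← smul_eq_mul, smul_finsum]
  refine finsum_congr fun g => ?_
  have : (T (-g.2) : ℤ[T;T⁻¹]) = T 1 * T (-(g.2 + 1)) := by
    rw [← T_add]
    congr 1
    ring
  simp only [Equiv.coe_addRight, Prod.fst_add, Prod.snd_add, add_zero, this, smul_eq_mul]
  ring

/-- The Euler characteristic: the alternating sum of the graded dimensions of the homology. -/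
def euler (M : DGModule A) : ℤ[T;T⁻¹] := altSum M.hdim

lemma hdim_congr {A' : QDGAlgebra} {M : DGModule A} {N : DGModule A'} {g g' : ℤ × ℤ}
    (e : Nonempty (M.Homology g ≃ₗ[ZMod 2] N.Homology g')) : M.hdim g = N.hdim g' := by
  obtain ⟨e⟩ := e
  exact e.finrank_eq

lemma euler_iso {M N : DGModule A}
    (e : (Quotient.functor (homotopic A)).obj M ≅ (Quotient.functor (homotopic A)).obj N) :
    M.euler = N.euler :=
  congrArg altSum (funext fun g => hdim_congr (exists_homologyEquiv_of_iso e g))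

lemma FinHomology.iso {M N : DGModule A} (h : M.FinHomology)
    (e : (Quotient.functor (homotopic A)).obj M ≅ (Quotient.functor (homotopic A)).obj N) :
    N.FinHomology := by
  refine ⟨fun g => ?_, ?_⟩
  · obtain ⟨e'⟩ := exists_homologyEquiv_of_iso e g
    have := h.1 g
    exact Module.Finite.equiv e'
  · have : N.hdim = M.hdim := funext fun g => (hdim_congr (exists_homologyEquiv_of_iso e g)).symm
    rw [this]
    exact h.2

lemma euler_qshift (M : DGModule A) : (M.shift (0, 1)).euler = T 1 * M.euler := by
  rw [euler, euler, ← altSum_qshift]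
  exact congrArg altSum (funext fun g => hdim_congr (M.exists_shiftHomologyEquiv (0, 1) g))

/-- In the dimension count for the long exact sequence of a cone the ranks of `H(f)` occur in pairs
of neighbouring degrees, so that they cancel in the alternating sum. -/
lemma euler_cone {M N : DGModule A} (f : M ⟶ N) (hM : M.FinHomology) (hN : N.FinHomology)
    (hC : (cone f).FinHomology) : N.euler = M.euler + (cone f).euler := by
  have hr : (hrank f).support.Finite := hM.2.subset fun g hg h => hg (by
    have := hrank_le f g hM
    rw [h] at this
    exact Nat.le_zero.1 this)
  have hs : ∀ {φ : ℤ × ℤ → ℕ}, φ.support.Finite →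
      (Function.support fun g => φ (g + (1, 0))).Finite := fun {φ} h =>
    h.preimage (f := fun g => g + (1, 0)) (add_left_injective _).injOn
  have h1 := congrArg altSum (funext fun g => hdim_cone f g hM hN hC)
  rw [altSum_add hC.2, altSum_add hr (hs hr), altSum_add hN.2 (hs hM.2), altSum_shift,
    altSum_shift, add_neg_cancel, add_zero] at h1
  · rw [euler, euler, euler, h1]
    abel
  · refine (hr.union (hs hr)).subset fun g hg => ?_
    by_contra h
    simp only [Set.mem_union, Function.mem_support, not_or, not_not] at h
    exact hg (by simp [h.1, h.2])

lemma euler_distinguished {D : Pretriangulated.Triangle (H0DG A)} (h : H0DG.distinguished A D)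
    (h₁ : D.obj₁.as.FinHomology) (h₂ : D.obj₂.as.FinHomology) (h₃ : D.obj₃.as.FinHomology) :
    D.obj₂.as.euler = D.obj₁.as.euler + D.obj₃.as.euler := by
  obtain ⟨M, N, f, ⟨e⟩⟩ := h
  have e₁ : (Quotient.functor (homotopic A)).obj D.obj₁.as ≅
    (Quotient.functor (homotopic A)).obj M := (Pretriangulated.Triangle.π₁).mapIso e
  have e₂ : (Quotient.functor (homotopic A)).obj D.obj₂.as ≅
    (Quotient.functor (homotopic A)).obj N := (Pretriangulated.Triangle.π₂).mapIso e
  have e₃ : (Quotient.functor (homotopic A)).obj D.obj₃.as ≅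
    (Quotient.functor (homotopic A)).obj (cone f) := (Pretriangulated.Triangle.π₃).mapIso e
  rw [euler_iso e₁, euler_iso e₂, euler_iso e₃]
  exact euler_cone f (h₁.iso e₁) (h₂.iso e₂) (h₃.iso e₃)

lemma gr_disjoint (M : DGModule A) {g g' : ℤ × ℤ} {m : M} (h : m ∈ M.gr g) (h' : m ∈ M.gr g')
    (hm : m ≠ 0) : g = g' := by
  obtain ⟨δ, hδ⟩ := exists_coaction M.internal
  have := (hδ g m h).symm.trans (hδ g' m h')
  exact ((Finsupp.single_eq_single_iff _ _ _ _).1 this).elim (fun h => h.1) fun h => absurd h.1 hm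

lemma subsingleton_homology (M : DGModule A) {g : ℤ × ℤ} (h : ∀ m ∈ M.gr g, m = 0) :
    Subsingleton (M.Homology g) := by
  refine ⟨fun x y => ?_⟩
  obtain ⟨x, rfl⟩ := M.hcls_surjective g x
  obtain ⟨y, rfl⟩ := M.hcls_surjective g y
  congr 1
  exact Subtype.ext ((h _ x.2.1).trans (h _ y.2.1).symm)

/-- In a finite DG module only finitely many degrees are nonzero, because a nonzero element is
homogeneous of at most one degree. -/
lemma finHomology_of_finite (M : DGModule A) [Finite M] : M.FinHomology := by
  refine ⟨fun g => ?_, ?_⟩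
  · have : Finite (M.Homology g) := Finite.of_surjective _ (M.hcls_surjective g)
    exact Module.Finite.of_finite
  · have h : ∀ g : Function.support M.hdim, ∃ m ∈ M.gr g.1, m ≠ 0 := by
      rintro ⟨g, hg⟩
      by_contra! h
      have := M.subsingleton_homology h
      exact hg Module.finrank_zero_of_subsingleton
    choose m hm hm0 using h
    exact Set.finite_coe_iff.1 (Finite.of_injective m fun a b e =>
      Subtype.ext (M.gr_disjoint (hm a) (e ▸ hm b) (hm0 a)))

lemma euler_eq_zero (M : DGModule A) [Subsingleton M] : M.euler = 0 := by
  have : M.hdim = 0 := funext fun g => by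
    have := M.subsingleton_homology (g := g) fun m _ => Subsingleton.elim _ _
    exact Module.finrank_zero_of_subsingleton
  rw [euler, this, altSum]
  simp

lemma euler_eq_one (M : DGModule A) {t : M} (ht : t ∈ M.gr 0) (h0 : t ≠ 0)
    (h : ∀ m : M, m = 0 ∨ m = t) : M.euler = 1 := by
  have hd : ∀ m, M.d m = 0 := by
    have hdt : M.d t = 0 := by
      rcases h (M.d t) with e | e
      · exact e
      · have := M.d_d t
        rw [e, e] at this
        exact absurd this h0
    intro m
    rcases h m with rfl | rfl
    · exact map_zero _
    · exact hdt
  have h1 : M.hdim 0 = 1 := by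
    refine finrank_eq_one (M.hcls 0 ⟨t, ht, hd t⟩) (fun e => ?_) fun w => ?_
    · obtain ⟨p, _, e'⟩ := hcls_eq_zero.1 e
      exact h0 (e'.symm.trans (hd p))
    · obtain ⟨z, rfl⟩ := M.hcls_surjective 0 w
      rcases h z.1 with e | e
      · refine ⟨0, ?_⟩
        rw [zero_smul, show z = 0 from Subtype.ext e, map_zero]
      · refine ⟨1, ?_⟩
        rw [one_smul]
        exact congrArg _ (Subtype.ext e.symm)
  have h2 : ∀ g ≠ 0, M.hdim g = 0 := fun g hg => by
    have := M.subsingleton_homology (g := g) fun m hm => by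
      by_contra hm0
      obtain rfl := (h m).resolve_left hm0
      exact hg (M.gr_disjoint hm ht h0)
    exact Module.finrank_zero_of_subsingleton
  rw [euler, altSum, finsum_eq_single _ 0 fun g hg => by rw [h2 g hg]; simp, h1]
  simp [sg_zero]

end DGModule

end

noncomputable section

/-! ### Augmentations and the bases of the Grothendieck groups -/

open LaurentPolynomial

/-- An augmentation of a `q`-graded DG algebra: a morphism of `q`-graded DG algebras to `𝔽₂`. -/
structure Augmentation (A : QDGAlgebra) where
  toRingHom : A →+* ZMod 2
  map_d : ∀ a, toRingHom (A.d a) = 0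
  map_gr : ∀ {g a}, g ≠ 0 → a ∈ A.gr g → toRingHom a = 0

namespace Augmentation

/-- The grading of `𝔽₂` concentrated in degree `0`. -/
def trivialGr (g : ℤ × ℤ) : AddSubgroup (ZMod 2) := if g = 0 then ⊤ else ⊥

lemma mem_trivialGr {g : ℤ × ℤ} {a : ZMod 2} : a ∈ trivialGr g ↔ (g ≠ 0 → a = 0) := by
  rw [trivialGr]
  split_ifs with h <;> simp [h]

lemma internal_trivialGr : DirectSum.IsInternal trivialGr := by
  refine internal_of_coaction (Finsupp.singleAddHom 0) (fun g a h => ?_) fun a =>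
    AddSubgroup.mem_iSup_of_mem 0 (mem_trivialGr.2 fun h => absurd rfl h)
  rw [mem_trivialGr] at h
  by_cases hg : g = 0
  · rw [hg]
    rfl
  · rw [h hg]
    simp

lemma mul_mem_trivialGr {g h : ℤ × ℤ} {a b : ZMod 2} (ha : a ∈ trivialGr g)
    (hb : b ∈ trivialGr h) : a * b ∈ trivialGr (g + h) := by
  rw [mem_trivialGr] at *
  intro hne
  by_cases hg : g = 0
  · rw [hb fun hh => hne (by rw [hg, hh, add_zero]), mul_zero]
  · rw [ha hg, zero_mul]

/-- The field `𝔽₂` as a `q`-graded DG algebra. -/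
def F2 : QDGAlgebra where
  carrier := ZMod 2
  gr := trivialGr
  internal := internal_trivialGr
  one_mem := mem_trivialGr.2 fun h => absurd rfl h
  mul_mem := mul_mem_trivialGr
  d := 0
  d_mem _ := zero_mem _
  d_d _ := rfl
  d_mul a b := by simp

/-- The field `𝔽₂` as a bigraded module over itself. -/
def F2Mod : GrModule F2 where
  carrier := ZMod 2
  module := inferInstanceAs (Module (ZMod 2) (ZMod 2))
  gr := trivialGr
  internal := internal_trivialGr
  smul_mem := mul_mem_trivialGr

variable {A : QDGAlgebra} (ε : Augmentation A)

/-- The field `𝔽₂`, with the algebra acting from the right through an augmentation. -/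
def bimod : DGBimoduleStr F2Mod A where
  d := 0
  d_mem _ := zero_mem _
  d_d _ := rfl
  d_smul a m := by
    have key : ∀ a m : ZMod 2, (0 : ZMod 2) = 0 * m + a * 0 := by decide
    exact key a m
  act := (AddMonoidHom.mul (R := ZMod 2)).compl₂ ε.toRingHom.toAddMonoidHom
  act_one := fun m : ZMod 2 => by
    change m * ε.toRingHom 1 = m
    rw [map_one, mul_one]
  act_mul := fun (m : ZMod 2) b c => by
    change m * ε.toRingHom (b * c) = m * ε.toRingHom b * ε.toRingHom c
    rw [map_mul, mul_assoc]
  smul_act a m b := mul_assoc (G := ZMod 2) a m (ε.toRingHom b)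
  act_mem {g h m b} hm hb := mul_mem_trivialGr hm (mem_trivialGr.2 fun hh => ε.map_gr hh hb)
  d_act := fun (m : ZMod 2) b => by
    change 0 = 0 * ε.toRingHom b + m * ε.toRingHom (A.d b)
    rw [ε.map_d, mul_zero, zero_mul, add_zero]

lemma bimod_act (m : ZMod 2) (b : A) : ε.bimod.act m b = m * ε.toRingHom b := rfl

section Principal

variable {e : A} (he : e ∈ A.gr 0) (hd : A.d e = 0) (hee : e * e = e)

/-- The generator of the module `A e`. -/
def _root_.DGModule.principalGen (e : A) (he : e ∈ A.gr 0) (hd : A.d e = 0) :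
    DGModule.principal A e he hd :=
  (⟨e, Submodule.mem_span_singleton_self e⟩ : Submodule.span A {e})

lemma exists_eq_tmul (z : ε.bimod.tensor (DGModule.principal A e he hd)) :
    ∃ m : ZMod 2, z = ε.bimod.tmul _ m (DGModule.principalGen e he hd) := by
  refine ε.bimod.tensor_induction _ (p := fun z => ∃ m : ZMod 2, z = ε.bimod.tmul _ m
    (DGModule.principalGen e he hd)) ⟨0, (ε.bimod.tmk_zero_left _ _).symm⟩ (fun m x => ?_)
    (fun x y hx hy => ?_) z
  · obtain ⟨x, hx⟩ := x
    obtain ⟨a, rfl⟩ := Submodule.mem_span_singleton.1 hx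
    exact ⟨ε.bimod.act m a, (ε.bimod.tmk_act _ m a (DGModule.principalGen e he hd)).symm⟩
  · obtain ⟨m, rfl⟩ := hx
    obtain ⟨m', rfl⟩ := hy
    exact ⟨m + m', (ε.bimod.tmk_add_left _ m m' _).symm⟩

lemma finite_tensor_principal : Finite (ε.bimod.tensor (DGModule.principal A e he hd)) :=
  Finite.of_surjective (fun m : ZMod 2 => ε.bimod.tmul _ m (DGModule.principalGen e he hd))
    fun z => by
      obtain ⟨m, rfl⟩ := ε.exists_eq_tmul he hd z
      exact ⟨m, rfl⟩

include hee in
lemma euler_tensor_principal_of_eq_zero (h : ε.toRingHom e = 0) :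
    (ε.bimod.tensor (DGModule.principal A e he hd)).euler = 0 := by
  have hz : ∀ z : ε.bimod.tensor (DGModule.principal A e he hd), z = 0 := fun z => by
    obtain ⟨m, rfl⟩ := ε.exists_eq_tmul he hd z
    have e1 : e • DGModule.principalGen e he hd = DGModule.principalGen e he hd :=
      Subtype.ext hee
    have e2 := ε.bimod.tmk_act (DGModule.principal A e he hd) m e (DGModule.principalGen e he hd)
    rw [e1, bimod_act, h, mul_zero] at e2
    exact e2.symm.trans (ε.bimod.tmk_zero_left _ _)
  have : Subsingleton (ε.bimod.tensor (DGModule.principal A e he hd)) :=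
    ⟨fun a b => (hz a).trans (hz b).symm⟩
  exact DGModule.euler_eq_zero _

lemma euler_tensor_principal_of_eq_one (h : ε.toRingHom e = 1) :
    (ε.bimod.tensor (DGModule.principal A e he hd)).euler = 1 := by
  refine DGModule.euler_eq_one _
    (t := ε.bimod.tmul _ (1 : ZMod 2) (DGModule.principalGen e he hd)) ?_ ?_ fun z => ?_
  · exact ε.bimod.tmk_mem (DGModule.principal A e he hd) (a := 0) (b := 0)
      (mem_trivialGr.2 fun h => absurd rfl h) he
  · obtain ⟨F, hF⟩ := ε.bimod.exists_tens_lift (DGModule.principal A e he hd)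
      ((AddMonoidHom.mul (R := ZMod 2)).compl₂ (ε.toRingHom.toAddMonoidHom.comp
        (Submodule.span A {e}).subtype.toAddMonoidHom)) (fun (m : ZMod 2) b x => by
          change m * ε.toRingHom b * ε.toRingHom x.1 = m * ε.toRingHom (b * x.1)
          rw [map_mul, mul_assoc])
    intro h0
    have h1 := hF (1 : ZMod 2) (DGModule.principalGen e he hd)
    have h2 : F (ε.bimod.tmk _ (1 : ZMod 2) (DGModule.principalGen e he hd)) = 0 :=
      (congrArg F h0).trans (map_zero F)
    rw [h2] at h1
    have h3 : (0 : ZMod 2) = 1 * ε.toRingHom e := h1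
    rw [h, mul_one] at h3
    exact zero_ne_one h3
  · obtain ⟨m, rfl⟩ := ε.exists_eq_tmul he hd z
    have : ∀ m : ZMod 2, m = 0 ∨ m = 1 := by decide
    rcases this m with rfl | rfl
    · exact Or.inl (ε.bimod.tmk_zero_left _ _)
    · exact Or.inr rfl

end Principal

lemma _root_.DGModule.finite_of_iso {M N : DGModule A} (i : M ≅ N) [Finite M] : Finite N :=
  Finite.of_surjective (fun m : M => i.hom.1 m) fun x =>
    ⟨i.inv.1 x, LinearMap.congr_fun (congrArg Subtype.val i.inv_hom_id) x⟩

variable {ι : Type} {P : ι → DGModule A}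

lemma finite_tensor (hP : ∀ i, Finite (ε.bimod.tensor (P i))) {N : DGModule A} (hN : DGP P N) :
    Finite (ε.bimod.tensor N) := by
  induction hN with
  | proj i => exact hP i
  | zero N =>
    have := ε.bimod.subsingleton_tensor N
    exact Finite.of_subsingleton
  | @shift M c h ih =>
    have : Finite ((ε.bimod.tensor M).shift c) := ih
    exact DGModule.finite_of_iso (ε.bimod.tensorShiftIso _ c).symm
  | @cone M N f h h' ih ih' =>
    have : Finite (DGModule.cone (ε.bimod.tensorFunctor.map f)) :=
      inferInstanceAs (Finite (ε.bimod.tensor N × ε.bimod.tensor M))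
    exact DGModule.finite_of_iso (ε.bimod.tensorConeIso f).symm
  | @iso M N i h ih =>
    have : Finite (ε.bimod.tensorFunctor.obj M) := ih
    exact DGModule.finite_of_iso (ε.bimod.tensorFunctor.mapIso i)

/-- The Euler characteristic of `𝔽₂ ⊗ -` is a linear form on the Grothendieck group. -/
lemma exists_eulerForm (hP : ∀ i, Finite (ε.bimod.tensor (P i))) :
    ∃ F : K0 P →ₗ[ℤ[T;T⁻¹]] ℤ[T;T⁻¹], ∀ i,
      F (K0.of (DGP.proj (P := P) i)) = (ε.bimod.tensor (P i)).euler := by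
  have hf : ∀ X : H0DGP P, (ε.bimod.tensor X.obj.as).FinHomology := fun X => by
    have := ε.finite_tensor hP X.property
    exact DGModule.finHomology_of_finite _
  have hq : ∀ X : H0DGP P, (ε.bimod.tensor X.qshift.obj.as).euler =
      (T 1 : ℤ[T;T⁻¹]) • (ε.bimod.tensor X.obj.as).euler := fun X => by
    rw [smul_eq_mul, ← DGModule.euler_qshift]
    exact DGModule.euler_iso ((Quotient.functor _).mapIso
      (ε.bimod.tensorShiftIso X.obj.as (0, 1)))
  have hd : ∀ D : Pretriangulated.Triangle (H0DGP P), H0DGP.distinguished P D →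
      (ε.bimod.tensor D.obj₂.obj.as).euler =
        (ε.bimod.tensor D.obj₁.obj.as).euler + (ε.bimod.tensor D.obj₃.obj.as).euler := by
    intro D hD
    have h := ε.bimod.tensorH0_distinguished hD
    generalize hE : ε.bimod.tensorH0.mapTriangle.obj ((DGP.property P).ι.mapTriangle.obj D) = E at h
    have h₁ : E.obj₁.as = ε.bimod.tensor D.obj₁.obj.as := by rw [← hE]; rfl
    have h₂ : E.obj₂.as = ε.bimod.tensor D.obj₂.obj.as := by rw [← hE]; rfl
    have h₃ : E.obj₃.as = ε.bimod.tensor D.obj₃.obj.as := by rw [← hE]; rfl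
    rw [← h₁, ← h₂, ← h₃]
    exact DGModule.euler_distinguished h (h₁ ▸ hf D.obj₁) (h₂ ▸ hf D.obj₂) (h₃ ▸ hf D.obj₃)
  obtain ⟨F, hF⟩ := K0.exists_lift (P := P) (fun X => (ε.bimod.tensor X.obj.as).euler) hq hd
  exact ⟨F, fun i => hF (H0DGP.mk P (P i) (DGP.proj i))⟩

end Augmentation

/-- The classes of the modules `A eᵢ` are a basis of the Grothendieck group if the idempotents `eᵢ`
are separated by augmentations. -/
lemma K0.exists_basis {A : QDGAlgebra} {ι : Type} [DecidableEq ι] (e : ι → A)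
    (he : ∀ i, e i ∈ A.gr 0) (hd : ∀ i, A.d (e i) = 0) (hee : ∀ i, e i * e i = e i)
    (ε : ι → Augmentation A) (h : ∀ i j, (ε i).toRingHom (e j) = if i = j then 1 else 0)
    (P : ι → DGModule A) (hP : ∀ i, P i = DGModule.principal A (e i) (he i) (hd i)) :
    ∃ b : Module.Basis ι ℤ[T;T⁻¹] (K0 P), ∀ i, b i = K0.of (DGP.proj (P := P) i) := by
  obtain rfl : P = fun i => DGModule.principal A (e i) (he i) (hd i) := funext hP
  choose F hF using fun i => (ε i).exists_eulerForm
    (P := fun i => DGModule.principal A (e i) (he i) (hd i))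
    fun j => (ε i).finite_tensor_principal (he j) (hd j)
  have hli : LinearIndependent ℤ[T;T⁻¹] fun i =>
      K0.of (DGP.proj (P := fun i => DGModule.principal A (e i) (he i) (hd i)) i) := by
    refine LinearIndependent.of_pairwise_dual_eq_zero_one _ F (fun i j hij => ?_) fun i => ?_
    · exact (hF i j).trans ((ε i).euler_tensor_principal_of_eq_zero (he j) (hd j) (hee j)
        ((h i j).trans (if_neg hij)))
    · exact (hF i i).trans
        ((ε i).euler_tensor_principal_of_eq_one (he i) (hd i) ((h i i).trans (if_pos rfl)))
  exact ⟨Module.Basis.mk hli K0.span_eq_top.ge, fun i => Module.Basis.mk_apply _ _ i⟩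

namespace QDGPresentation

variable {Gen : Type} {S : QDGPresentation Gen}

/-- An augmentation of an algebra given by generators and relations. -/
def augmentation (h : S.Valid) (φ : Gen → ZMod 2)
    (hrel : ∀ a b, S.rel a b → FreeAlgebra.lift (ZMod 2) φ a = FreeAlgebra.lift (ZMod 2) φ b)
    (hdeg : ∀ x, S.deg x ≠ 0 → φ x = 0)
    (hdiff : ∀ x, FreeAlgebra.lift (ZMod 2) φ (S.diff x) = 0) :
    Augmentation (S.toQDGAlgebra h) :=
  let ψ : S.Alg →ₐ[ZMod 2] ZMod 2 := RingQuot.liftAlgHom _ ⟨FreeAlgebra.lift (ZMod 2) φ, hrel⟩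
  have hgen : ∀ x, ψ (S.gen x) = φ x := fun x =>
    (RingQuot.liftAlgHom_mkAlgHom_apply _ _ _ _).trans (FreeAlgebra.lift_ι_apply _ _)
  have hdgen : ∀ x, ψ (S.dgen x) = 0 := fun x =>
    (RingQuot.liftAlgHom_mkAlgHom_apply _ _ _ _).trans (hdiff x)
  have hw : ∀ x l, S.word (x :: l) = S.gen x * S.word l := fun x l => by simp [word]
  have hword : ∀ l, ψ (diffHom h (S.word l)) = 0 := fun l => by
    induction l with
    | nil =>
      rw [show S.word [] = 1 from rfl, diffHom_one, map_zero]
    | cons x l ih =>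
      rw [hw, diffHom_mul, diffHom_gen, map_add, map_mul, map_mul, ih, hdgen, zero_mul, mul_zero,
        add_zero]
  have hwdeg : ∀ l, ψ (S.word l) = 0 ∨ S.wdeg l = 0 := fun l => by
    induction l with
    | nil => exact Or.inr rfl
    | cons x l ih =>
      rw [hw, map_mul, hgen, show S.wdeg (x :: l) = S.deg x + S.wdeg l by simp [wdeg]]
      by_cases hx : S.deg x = 0
      · rcases ih with ih | ih
        · exact Or.inl (by rw [ih, mul_zero])
        · exact Or.inr (by rw [hx, ih, add_zero])
      · exact Or.inl (by rw [hdeg x hx, zero_mul])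
  { toRingHom := ψ.toRingHom
    map_d := fun a => by
      refine alg_induction (p := fun a => ψ (diffHom h a) = 0) (by rw [map_zero, map_zero]) hword
        (fun x y hx hy => by rw [map_add, map_add, hx, hy, add_zero]) a
    map_gr := fun {g a} hg ha => by
      have hle : S.gr g ≤ ψ.toRingHom.toAddMonoidHom.ker := by
        refine (AddSubgroup.closure_le _).2 ?_
        rintro _ ⟨l, rfl, rfl⟩
        exact (hwdeg l).resolve_right hg
      exact hle ha }

lemma augmentation_gen (h : S.Valid) (φ : Gen → ZMod 2) (hrel hdeg hdiff) (x : Gen) :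
    (augmentation h φ hrel hdeg hdiff).toRingHom (S.gen x) = φ x :=
  (RingQuot.liftAlgHom_mkAlgHom_apply _ _ _ _).trans (FreeAlgebra.lift_ι_apply _ _)

end QDGPresentation

variable {n : ℕ}

/-- The augmentation which is `1` on `e(v)` and `0` on the other idempotents and on the arrows. -/
lemma Rn.exists_augmentation (v : Vtx n) :
    ∃ ε : Augmentation (Rn n), ∀ w, ε.toRingHom (Rn.e w) = if v = w then 1 else 0 := by
  let φ : RGen n → ZMod 2 := fun x => match x with
    | .e w => if v = w then 1 else 0
    | .r _ _ _ _ => 0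
  refine ⟨QDGPresentation.augmentation (Rn.valid n) φ (fun a b h => ?_) (fun x hx => ?_)
    fun x => map_zero _, fun w => QDGPresentation.augmentation_gen _ _ _ _ _ _⟩
  · have hE : ∀ w, FreeAlgebra.lift (ZMod 2) φ (RGen.E w) = if v = w then 1 else 0 := fun w =>
      FreeAlgebra.lift_ι_apply _ _
    have hA : ∀ {s x y} (h : IsArrow s x y), FreeAlgebra.lift (ZMod 2) φ (RGen.Ar h) = 0 :=
      fun h => FreeAlgebra.lift_ι_apply _ _
    cases h with
    | e_e x =>
      rw [map_mul, hE]
      split_ifs <;> rfl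
    | e_e' x y h =>
      rw [map_mul, hE, hE, map_zero]
      split_ifs with h1 h2
      · exact absurd (h1.symm.trans h2) h
      all_goals rfl
    | e_r h => rw [map_mul, hA, mul_zero]
    | r_e h => rw [map_mul, hA, zero_mul]
    | r_r h₁ h₂ h₃ h₄ => simp only [map_mul, hA, zero_mul]
    | one =>
      rw [map_one, map_sum]
      simp only [hE]
      rw [Finset.sum_ite_eq]
      simp
  · cases x with
    | e w => exact absurd rfl hx
    | r s x y h => rfl

/-- The augmentation which is `1` on `e(v)` and `0` on the other idempotents and on the arrows. -/
lemma RBox.exists_augmentation (v : Vtx n × Vtx n) :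
    ∃ ε : Augmentation (RBox n), ∀ w : Vtx n × Vtx n,
      ε.toRingHom (RBox.gen (.e w.1 w.2)) = if v = w then 1 else 0 := by
  let φ : BGen n → ZMod 2 := fun x => match x with
    | .e x y => if v = (x, y) then 1 else 0
    | _ => 0
  have hE : ∀ x y, FreeAlgebra.lift (ZMod 2) φ (BGen.E x y) = if v = (x, y) then 1 else 0 :=
    fun _ _ => FreeAlgebra.lift_ι_apply _ _
  have hL : ∀ {s x x'} (h : IsArrow s x x') y, FreeAlgebra.lift (ZMod 2) φ (BGen.L h y) = 0 :=
    fun _ _ => FreeAlgebra.lift_ι_apply _ _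
  have hR : ∀ x {t y y'} (k : IsArrow t y y'), FreeAlgebra.lift (ZMod 2) φ (BGen.R x k) = 0 :=
    fun _ _ _ _ _ => FreeAlgebra.lift_ι_apply _ _
  have hB : ∀ {s} {x x' y y' : Vtx n} (h : IsArrow s x x') (k : IsArrow (s + 1) y y'),
      FreeAlgebra.lift (ZMod 2) φ (BGen.B h k) = 0 :=
    fun _ _ => FreeAlgebra.lift_ι_apply _ _
  refine ⟨QDGPresentation.augmentation (RBox.valid n) φ (fun a b h => ?_) (fun x hx => ?_)
    fun x => ?_, fun w => QDGPresentation.augmentation_gen _ _ _ _ _ _⟩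
  · cases h with
    | e_e x y =>
      rw [map_mul, hE]
      split_ifs <;> rfl
    | e_e' x y x' y' h =>
      rw [map_mul, hE, hE, map_zero]
      split_ifs with h1 h2
      · exact absurd (Prod.mk.inj (h1.symm.trans h2)) h
      all_goals rfl
    | one =>
      rw [map_one, map_sum]
      simp only [map_sum, hE]
      rw [← Fintype.sum_prod_type', Finset.sum_ite_eq]
      simp
    | _ => simp only [map_mul, hL, hR, hB, mul_zero, zero_mul]
  · cases x with
    | e x y => exact absurd rfl hx
    | _ => rfl
  · cases x with
    | b s x x' y y' h k =>
      refine (map_add (FreeAlgebra.lift (ZMod 2) φ) _ _).trans ?_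
      rw [map_mul, map_mul, hL, hL, zero_mul, mul_zero, add_zero]
    | _ => exact map_zero _

lemma exists_basis_PR (n : ℕ) :
    ∃ b : Module.Basis (Vtx n) ℤ[T;T⁻¹] (K0 (PR n)), ∀ x, b x = clsP x := by
  choose ε hε using Rn.exists_augmentation (n := n)
  exact K0.exists_basis Rn.e Rn.e_mem Rn.d_e (fun x => idem_mul_self (some x)) ε hε (PR n)
    fun _ => rfl

lemma exists_basis_PBox (n : ℕ) :
    ∃ b : Module.Basis (Vtx n × Vtx n) ℤ[T;T⁻¹] (K0 (PBox n)),
      ∀ p, b p = clsPBox p.1 p.2 := by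
  choose ε hε using RBox.exists_augmentation (n := n)
  have hee : ∀ p : Vtx n × Vtx n,
      RBox.gen (.e p.1 p.2) * RBox.gen (.e p.1 p.2) = RBox.gen (.e p.1 p.2) :=
    fun p => RBox.rel_mul' (.e_e p.1 p.2)
  exact K0.exists_basis (fun p => RBox.gen (.e p.1 p.2)) (fun p => RBox.e_mem p.1 p.2)
    (fun p => RBox.d_e p.1 p.2) hee ε hε (PBox n)
    fun p => by rw [PBox]

end

noncomputable section

/-! ### Tensor products with the modules `A e` -/

/-- The image of an endomorphism of degree `0` of the underlying bigraded module, if it is fixed by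
the endomorphism and stable under the differential. -/
def DGModule.image {A : QDGAlgebra} (M : DGModule A) (π : M →ₗ[A] M)
    (hg : ∀ g, ∀ m ∈ M.gr g, π m ∈ M.gr g) (hd : ∀ m, π (M.d (π m)) = M.d (π m)) :
    DGModule A where
  carrier := LinearMap.range π
  gr g := (M.gr g).comap (LinearMap.range π).subtype.toAddMonoidHom
  internal := by
    obtain ⟨δ, hδ⟩ := exists_coaction M.internal
    refine internal_of_coaction' (LinearMap.range π).subtype.toAddMonoidHom
      Subtype.val_injective (δ.comp (LinearMap.range π).subtype.toAddMonoidHom)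
      (fun g m hm => hδ g _ hm) ?_
    rintro ⟨_, m, rfl⟩
    refine internal_induction (p := fun m => (⟨π m, m, rfl⟩ : LinearMap.range π) ∈
      ⨆ g, (M.gr g).comap (LinearMap.range π).subtype.toAddMonoidHom) M.internal ?_ ?_ ?_ m
    · rw [show (⟨π 0, 0, rfl⟩ : LinearMap.range π) = 0 from Subtype.ext (map_zero π)]
      exact zero_mem _
    · exact fun g m hm => AddSubgroup.mem_iSup_of_mem g (hg g m hm)
    · intro a b ha hb
      have e : (⟨π (a + b), a + b, rfl⟩ : LinearMap.range π) = ⟨π a, a, rfl⟩ + ⟨π b, b, rfl⟩ :=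
        Subtype.ext (map_add π a b)
      rw [e]
      exact add_mem ha hb
  smul_mem ha hm := M.smul_mem ha hm
  d := (M.d.comp (LinearMap.range π).subtype.toAddMonoidHom).codRestrict
    (LinearMap.range π).toAddSubgroup (by
      rintro ⟨_, m, rfl⟩
      exact ⟨_, hd m⟩)
  d_mem hm := M.d_mem hm
  d_d m := Subtype.ext (M.d_d _)
  d_smul a m := Subtype.ext (M.d_smul _ _)

/-- A morphism from a shift of a DG module. -/
def DGModule.ofShift {A : QDGAlgebra} {M N : DGModule A} {c : ℤ × ℤ} (f : M →ₗ[A] N)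
    (hg : ∀ g, ∀ m ∈ M.gr (g + c), f m ∈ N.gr g) (hd : ∀ m, f (M.d m) = N.d (f m)) :
    M.shift c ⟶ N :=
  ⟨f, DGModule.mem_Z0.2 ⟨hg, hd⟩⟩

/-- A criterion for a DG module to be the cone of a morphism from a shift. -/
lemma DGModule.nonempty_cone_ofShift_iso {A : QDGAlgebra} {M N K : DGModule A} {c : ℤ × ℤ}
    {f : M →ₗ[A] N} {hg : ∀ g, ∀ m ∈ M.gr (g + c), f m ∈ N.gr g}
    {hd : ∀ m, f (M.d m) = N.d (f m)} (φ : N →ₗ[A] K) (ψ : M →ₗ[A] K)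
    (hbij : Function.Bijective fun x : N.carrier × M.carrier => φ x.1 + ψ x.2)
    (hgr : ∀ g y x, φ y + ψ x ∈ K.gr g ↔ y ∈ N.gr g ∧ x ∈ M.gr (g + (1, 0) + c))
    (hφ : ∀ y, φ (N.d y) = K.d (φ y)) (hψ : ∀ x, φ (f x) + ψ (M.d x) = K.d (ψ x)) :
    Nonempty (cone (ofShift (c := c) f hg hd) ≅ K) := by
  let F : cone (ofShift (c := c) f hg hd) →ₗ[A] K :=
    { toFun := fun x => φ x.1 + ψ x.2
      map_add' := fun x y => by
        refine (congrArg₂ (· + ·) (map_add φ x.1 y.1) (map_add ψ x.2 y.2)).trans ?_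
        exact add_add_add_comm _ _ _ _
      map_smul' := fun a x => by
        refine (congrArg₂ (· + ·) (map_smul φ a x.1) (map_smul ψ a x.2)).trans ?_
        exact (smul_add _ _ _).symm }
  have hF : Function.Bijective F := hbij
  refine ⟨isoOfLinearEquiv (LinearEquiv.ofBijective F hF) (fun g x => (hgr g x.1 x.2).symm)
    fun x => ?_⟩
  have key : ∀ y x, φ (N.d y + f x) + ψ (M.d x) = K.d (φ y + ψ x) := fun y x => by
    rw [map_add, map_add, add_assoc, hψ, hφ]
  exact key x.1 x.2

namespace DGBimoduleStr

variable {A B : QDGAlgebra} {M : GrModule A} (τ : DGBimoduleStr M B)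

/-- The underlying left DG module of a DG bimodule. -/
abbrev toDGModule : DGModule A where
  toGrModule := M
  d := τ.d
  d_mem := τ.d_mem
  d_d := τ.d_d
  d_smul := τ.d_smul

/-- The right multiplication by an element. -/
def actRight (b : B) : τ.toDGModule →ₗ[A] τ.toDGModule where
  toFun m := τ.act m b
  map_add' m m' := by rw [map_add]; rfl
  map_smul' a m := τ.smul_act a m b

/-- The DG module `M e`, for a closed idempotent `e` of degree `0`. -/
def cut {e : B} (he : e ∈ B.gr 0) (hd : B.d e = 0) (hee : e * e = e) : DGModule A :=
  τ.toDGModule.image (τ.actRight e) (fun g m hm => by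
      have := τ.act_mem hm he
      rwa [add_zero] at this)
    (fun m => by
      change τ.act (τ.d (τ.act m e)) e = τ.d (τ.act m e)
      rw [τ.d_act, hd, map_zero, add_zero, ← τ.act_mul, hee])

/-- `M e` is isomorphic to `M ⊗ B e`. -/
lemma nonempty_cut_iso {e : B} (he : e ∈ B.gr 0) (hd : B.d e = 0) (hee : e * e = e) :
    Nonempty (τ.cut he hd hee ≅ τ.tensor (DGModule.principal B e he hd)) := by
  let P := DGModule.principal B e he hd
  let ê : P := DGModule.principalGen e he hd
  have heê : e • ê = ê := Subtype.ext hee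
  have hsurj : ∀ z : τ.tensor P, ∃ m : M, z = τ.tmul P m ê := by
    refine τ.tensor_induction P ⟨0, (τ.tmk_zero_left P ê).symm⟩ ?_ ?_
    · rintro m ⟨x, hx⟩
      obtain ⟨a, rfl⟩ := Submodule.mem_span_singleton.1 hx
      exact ⟨τ.act m a, (τ.tmk_act P m a ê).symm⟩
    · rintro _ _ ⟨m, rfl⟩ ⟨m', rfl⟩
      exact ⟨m + m', (τ.tmk_add_left P m m' ê).symm⟩
  obtain ⟨F, hF⟩ := τ.exists_tens_lift P (τ.act.compl₂
    (Submodule.span B {e}).subtype.toAddMonoidHom) (fun m b x => (τ.act_mul m b x.1).symm)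
  have hF' : ∀ m (x : P), F (τ.tmk P m x) = τ.act m x.1 := hF
  have hFdeg : ∀ g z, z ∈ τ.tensGr P g → F z ∈ M.gr g := by
    intro g z hz
    have hle : τ.tensGr P g ≤ (M.gr g).comap F := by
      refine (AddSubgroup.closure_le _).2 ?_
      rintro _ ⟨i, j, m, x, hm, hx, rfl, rfl⟩
      change F _ ∈ M.gr (i + j)
      rw [hF']
      exact τ.act_mem hm hx
    exact hle hz
  let G : τ.cut he hd hee →ₗ[A] τ.tensor P :=
    { toFun := fun m => τ.tmul P m.1 ê
      map_add' := fun m m' => τ.tmk_add_left P m.1 m'.1 ê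
      map_smul' := fun a m => (τ.smul_tmk P a m.1 ê).symm }
  have hFG : ∀ m : τ.cut he hd hee, F (G m) = m.1 := by
    rintro ⟨_, m, rfl⟩
    refine (hF' _ _).trans ?_
    change τ.act (τ.act m e) e = τ.act m e
    rw [← τ.act_mul, hee]
  have hG : Function.Bijective G := by
    refine ⟨fun m m' h => Subtype.ext ?_, fun z => ?_⟩
    · rw [← hFG m, ← hFG m', h]
    · obtain ⟨m, rfl⟩ := hsurj z
      refine ⟨⟨τ.act m e, m, rfl⟩, (τ.tmk_act P m e ê).trans ?_⟩
      rw [heê]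
      rfl
  refine ⟨DGModule.isoOfLinearEquiv (LinearEquiv.ofBijective G hG) (fun g m => ⟨fun h => ?_,
    fun h => ?_⟩) fun m => ?_⟩
  · have h' := τ.tmk_mem P (a := g) (b := 0) (m := m.1) (n := ê) h he
    rw [add_zero] at h'
    exact h'
  · have h' := hFdeg g _ h
    rw [show F (LinearEquiv.ofBijective G hG m) = m.1 from hFG m] at h'
    exact h'
  · refine Eq.trans ?_ (τ.tensor_d P m.1 ê).symm
    rw [show P.d ê = 0 from Subtype.ext hd, τ.tmul_zero, add_zero]
    rfl

end DGBimoduleStr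

/-! ### The class of `T_n ⊗ P(x, y)` -/

open LaurentPolynomial TIdx

variable {n : ℕ}

namespace TMod

/-- `T_n` as a left DG module. -/
abbrev dgMod (n : ℕ) : DGModule (Rn n) := (bimod n).toDGModule

/-- The projection to the summands with index in `S`. -/
def proj (S : Finset (TIdx n)) : dgMod n →ₗ[Rn n] dgMod n where
  toFun m := mk (fun i => if i ∈ S then comp m i else 0) fun i => by
    split_ifs
    · exact comp_mul_idem m i
    · exact zero_mul _
  map_add' m m' := ext fun i => by
    change (if i ∈ S then comp m i + comp m' i else 0) =
      (if i ∈ S then comp m i else 0) + if i ∈ S then comp m' i else 0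
    split_ifs
    · rfl
    · exact (add_zero 0).symm
  map_smul' a m := ext fun i => by
    change (if i ∈ S then a * comp m i else 0) = a * if i ∈ S then comp m i else 0
    split_ifs
    · rfl
    · exact (mul_zero a).symm

lemma comp_proj (S : Finset (TIdx n)) (m : dgMod n) (i : TIdx n) :
    comp (proj S m) i = if i ∈ S then comp m i else 0 := rfl

/-- The sets of summands which span a submodule stable under the differential. -/
def IsClosedSet (S : Finset (TIdx n)) : Prop :=
  ∀ i ∈ S, ∀ s ∈ adj i.x i.y \ i.A, ins s i ∈ S

lemma IsClosedSet.dM_eq_zero {S : Finset (TIdx n)} (hS : IsClosedSet S) {i j : TIdx n}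
    (hi : i ∈ S) (hj : j ∉ S) : dM n i j = 0 := by
  rw [dM_apply]
  refine Finset.sum_eq_zero fun s hs => if_neg fun h => hj ?_
  rw [h]
  exact hS i hi s hs

lemma dM_self (i : TIdx n) : dM n i i = 0 := by
  rw [dM_apply]
  refine Finset.sum_eq_zero fun s hs => if_neg fun h => (Finset.mem_sdiff.1 hs).2 ?_
  have := A_ins hs
  rw [← h] at this
  rw [this]
  exact Finset.mem_insert_self _ _

lemma proj_mem (S : Finset (TIdx n)) (g : ℤ × ℤ) (m : dgMod n) (hm : m ∈ (dgMod n).gr g) :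
    proj S m ∈ (dgMod n).gr g := by
  refine mem_gr.2 fun i => ?_
  rw [comp_proj]
  split_ifs
  · exact mem_gr.1 hm i
  · exact zero_mem _

lemma comp_d (m : dgMod n) (j : TIdx n) : comp ((dgMod n).d m) j = ∑ i, comp m i * dM n i j := rfl

lemma IsClosedSet.proj_d {S : Finset (TIdx n)} (hS : IsClosedSet S) (m : dgMod n) :
    proj S ((dgMod n).d (proj S m)) = (dgMod n).d (proj S m) :=
  ext fun j => by
    rw [comp_proj, comp_d]
    split_ifs with hj
    · rfl
    · refine (Finset.sum_eq_zero fun i _ => ?_).symm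
      rw [comp_proj]
      split_ifs with hi
      · rw [hS.dM_eq_zero hi hj, mul_zero]
      · exact zero_mul _

/-- The DG submodule of `T_n` spanned by the summands with index in a closed set. -/
def part (S : Finset (TIdx n)) (hS : IsClosedSet S) : DGModule (Rn n) :=
  (dgMod n).image (proj S) (proj_mem S) hS.proj_d

lemma comp_part {S : Finset (TIdx n)} {hS : IsClosedSet S} (m : part S hS) {i : TIdx n}
    (hi : i ∉ S) : comp m.1 i = 0 := by
  obtain ⟨_, m, rfl⟩ := m
  rw [comp_proj, if_neg hi]

/-- The inclusion of the summand `i`. -/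
def single (i : TIdx n) : POpt i.M →ₗ[Rn n] dgMod n where
  toFun p := mk (fun j => if j = i then p.1 else 0) fun j => by
    split_ifs with h
    · obtain ⟨a, ha⟩ := Submodule.mem_span_singleton.1 p.2
      have ha' : a * idem i.M = p.1 := ha
      rw [← ha', h, mul_assoc, idem_mul_self]
    · exact zero_mul _
  map_add' p p' := ext fun j => by
    rw [comp_mk, comp_add, comp_mk, comp_mk]
    split_ifs
    · rfl
    · exact (add_zero 0).symm
  map_smul' a p := ext fun j => by
    rw [comp_mk, comp_smul, comp_mk]
    split_ifs
    · rfl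
    · exact (mul_zero a).symm

lemma comp_single (i j : TIdx n) (p : POpt i.M) :
    comp (single i p) j = if j = i then p.1 else 0 := rfl

lemma comp_d_single (i j : TIdx n) (p : POpt i.M) :
    comp ((dgMod n).d (single i p)) j = p.1 * dM n i j := by
  rw [comp_d, Finset.sum_eq_single i]
  · rw [comp_single, if_pos rfl]
  · intro k _ hk
    rw [comp_single, if_neg hk, zero_mul]
  · exact fun h => absurd (Finset.mem_univ i) h

lemma single_mem {i : TIdx n} {p : POpt i.M} {g : ℤ × ℤ}
    (hp : p ∈ (POpt i.M).gr (g + (-i.k, i.eta))) : single i p ∈ (dgMod n).gr g := by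
  refine mem_gr.2 fun j => ?_
  rw [comp_single]
  split_ifs with h
  · rw [h]
    exact hp
  · exact zero_mem _

lemma d_single_add (i : TIdx n) (p p' : POpt i.M) : (dgMod n).d (single i (p + p')) =
    (dgMod n).d (single i p) + (dgMod n).d (single i p') := by
  rw [map_add, map_add]

lemma d_single_smul (i : TIdx n) (a : Rn n) (p : POpt i.M) :
    (dgMod n).d (single i (a • p)) = a • (dgMod n).d (single i p) := by
  rw [map_smul, (dgMod n).d_smul, Rn.d_eq_zero, zero_smul, zero_add]

section Cone

variable {S : Finset (TIdx n)} {i : TIdx n} (hi : i ∉ S) (hS : IsClosedSet S)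
  (hS' : IsClosedSet (insert i S))

include hS' in
lemma proj_d_single (p : POpt i.M) :
    proj S ((dgMod n).d (single i p)) = (dgMod n).d (single i p) :=
  ext fun j => by
    rw [comp_proj, comp_d_single]
    split_ifs with hj
    · rfl
    · by_cases hji : j = i
      · rw [hji, dM_self, mul_zero]
      · rw [hS'.dM_eq_zero (Finset.mem_insert_self i S)
          (fun h => (Finset.mem_insert.1 h).elim hji hj), mul_zero]

/-- The differential of `T_n` from the summand `i` to the summands in `S`. -/
def attachLin : POpt i.M →ₗ[Rn n] part S hS where
  toFun p := (⟨(dgMod n).d (single i p), _, proj_d_single hS' p⟩ : LinearMap.range (proj S))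
  map_add' p p' := Subtype.ext (d_single_add i p p')
  map_smul' a p := Subtype.ext (d_single_smul i a p)

lemma attachLin_mem {g : ℤ × ℤ} {p : POpt i.M}
    (hp : p ∈ (POpt i.M).gr (g + (-i.k - 1, i.eta))) :
    attachLin hS hS' p ∈ (part S hS).gr g := by
  have h1 : single i p ∈ (dgMod n).gr (g + (-1, 0)) := single_mem (by
    rw [add_assoc, show ((-1, 0) : ℤ × ℤ) + (-i.k, i.eta) = (-i.k - 1, i.eta) by
      ext <;> simp; ring]
    exact hp)
  have h2 := (dgMod n).d_mem h1
  rw [add_assoc, show ((-1, 0) : ℤ × ℤ) + (1, 0) = 0 from rfl, add_zero] at h2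
  exact h2

lemma attachLin_d (p : POpt i.M) :
    attachLin hS hS' ((POpt i.M).d p) = (part S hS).d (attachLin hS hS' p) := by
  rw [show (POpt i.M).d p = 0 from Subtype.ext (Rn.d_eq_zero _), map_zero]
  exact Subtype.ext ((dgMod n).d_d _).symm

/-- The attaching map of the summand `i`. -/
def attach : (POpt i.M).shift (-i.k - 1, i.eta) ⟶ part S hS :=
  DGModule.ofShift (attachLin hS hS') (fun _ _ => attachLin_mem hS hS') (attachLin_d hS hS')

variable {hS} in
include hi in
lemma proj_add_single (m : part S hS) (p : POpt i.M) : proj S (m.1 + single i p) = m.1 :=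
  ext fun j => by
    rw [comp_proj, comp_add, comp_single]
    split_ifs with hj hji
    · exact absurd (hji ▸ hj) hi
    · exact add_zero _
    · exact (comp_part m hj).symm

variable {hS} in
include hi in
lemma comp_add_single (m : part S hS) (p : POpt i.M) : comp (m.1 + single i p) i = p.1 := by
  rw [comp_add, comp_part m hi, comp_single, if_pos rfl, zero_add]

lemma proj_insert_add_single (m : part S hS) (p : POpt i.M) :
    proj (insert i S) (m.1 + single i p) = m.1 + single i p :=
  ext fun j => by
    rw [comp_proj]
    split_ifs with hj
    · rfl
    · rw [Finset.mem_insert, not_or] at hj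
      rw [comp_add, comp_part m hj.2, comp_single, if_neg hj.1, add_zero]

/-- The inclusion of the summands in `S` into those in `S ∪ {i}`. -/
def partIncl : part S hS →ₗ[Rn n] part (insert i S) hS' where
  toFun m := (⟨m.1, m.1, by
    have h := proj_insert_add_single (i := i) hS m 0
    rwa [map_zero, add_zero] at h⟩ : LinearMap.range (proj (insert i S)))
  map_add' _ _ := rfl
  map_smul' _ _ := rfl

/-- The inclusion of the summand `i` into the summands in `S ∪ {i}`. -/
def partSingle : POpt i.M →ₗ[Rn n] part (insert i S) hS' where
  toFun p := (⟨single i p, single i p, by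
    have h := proj_insert_add_single (i := i) hS 0 p
    rwa [show (0 : part S hS).1 = 0 from rfl, zero_add] at h⟩ :
      LinearMap.range (proj (insert i S)))
  map_add' p p' := Subtype.ext (map_add (single i) p p')
  map_smul' a p := Subtype.ext (map_smul (single i) a p)

include hi in
lemma bijective_partIncl_add_partSingle : Function.Bijective fun x : part S hS × POpt i.M =>
    partIncl hS hS' x.1 + partSingle hS hS' x.2 := by
  refine ⟨fun x y h => Prod.ext (Subtype.ext ?_) (Subtype.ext ?_), fun m => ?_⟩
  · exact (proj_add_single hi x.1 x.2).symm.trans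
      ((congrArg (fun z => proj S z.1) h).trans (proj_add_single hi y.1 y.2))
  · exact (comp_add_single hi x.1 x.2).symm.trans
      ((congrArg (fun z => comp z.1 i) h).trans (comp_add_single hi y.1 y.2))
  · refine ⟨((⟨proj S m.1, m.1, rfl⟩ : LinearMap.range (proj S)), m.1 i),
      Subtype.ext (ext fun j => ?_)⟩
    change (if j ∈ S then comp m.1 j else 0) + (if j = i then comp m.1 i else 0) = comp m.1 j
    split_ifs with hj hji hji
    · exact absurd (hji ▸ hj) hi
    · exact add_zero _
    · rw [hji, zero_add]
    · rw [comp_part m fun h => (Finset.mem_insert.1 h).elim hji hj, add_zero]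

include hi in
lemma add_single_mem {g : ℤ × ℤ} (m : part S hS) (p : POpt i.M) :
    m.1 + single i p ∈ (dgMod n).gr g ↔
      m.1 ∈ (dgMod n).gr g ∧ p.1 ∈ (Rn n).gr (g + (-i.k, i.eta)) := by
  refine ⟨fun h => ⟨?_, ?_⟩, fun h => add_mem h.1 (single_mem h.2)⟩
  · rw [← proj_add_single hi m p]
    exact proj_mem S g _ h
  · rw [← comp_add_single hi m p]
    exact mem_gr.1 h i

include hi in
/-- Adding a summand to a closed part amounts to taking the cone of its attaching map. -/
lemma nonempty_cone_attach_iso :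
    Nonempty (DGModule.cone (attach hS hS') ≅ part (insert i S) hS') := by
  refine DGModule.nonempty_cone_ofShift_iso (partIncl hS hS') (partSingle hS hS')
    (bijective_partIncl_add_partSingle hi hS hS') (fun g m p => ?_) (fun _ => rfl) fun p => ?_
  · have key : g + (1, 0) + (-i.k - 1, i.eta) = g + (-i.k, i.eta) := by
      ext <;> simp
    rw [key]
    exact add_single_mem hi hS m p
  · rw [show (POpt i.M).d p = 0 from Subtype.ext (Rn.d_eq_zero _), map_zero, add_zero]
    rfl

end Cone

/-- The class of `P(x)`, and `0` for `0`. -/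
def clsOpt (o : Option (Vtx n)) : K0 (PR n) := o.elim 0 clsP

lemma exists_of_POpt (o : Option (Vtx n)) : ∃ h : DGP (PR n) (POpt o), K0.of h = clsOpt o := by
  cases o with
  | none =>
    have : Subsingleton (POpt (none : Option (Vtx n))) := by
      have h : ∀ p : POpt (none : Option (Vtx n)), p = 0 := by
        rintro ⟨p, hp⟩
        obtain ⟨a, rfl⟩ := Submodule.mem_span_singleton.1 hp
        exact Subtype.ext (mul_zero a)
      exact ⟨fun a b => (h a).trans (h b).symm⟩
    exact ⟨.zero _, K0.of_subsingleton _⟩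
  | some x => exact ⟨DGP.proj (P := PR n) x, rfl⟩

/-- The class of a closed part of `T_n` is the sum of the classes of its summands. -/
lemma exists_of_part (S : Finset (TIdx n)) (hS : IsClosedSet S) :
    ∃ h : DGP (PR n) (part S hS),
      K0.of h = ∑ i ∈ S, (sg ℤ[T;T⁻¹] i.k * T i.eta) • clsOpt i.M := by
  induction hc : S.card generalizing S with
  | zero =>
    obtain rfl := Finset.card_eq_zero.1 hc
    have : Subsingleton (part (∅ : Finset (TIdx n)) hS) := by
      refine ⟨fun a b => Subtype.ext (ext fun i => ?_)⟩
      rw [comp_part a (Finset.notMem_empty i), comp_part b (Finset.notMem_empty i)]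
    exact ⟨.zero _, (K0.of_subsingleton _).trans Finset.sum_empty.symm⟩
  | succ c ih =>
    -- A summand with an index set of minimal size is not hit by the differential of the others.
    obtain ⟨i, hi, hmin⟩ := S.exists_min_image (fun i => i.A.card)
      (Finset.card_pos.1 (hc ▸ Nat.succ_pos c))
    obtain ⟨S', hiS', rfl⟩ : ∃ S', i ∉ S' ∧ insert i S' = S :=
      ⟨S.erase i, Finset.notMem_erase i S, Finset.insert_erase hi⟩
    have hS' : IsClosedSet S' := fun j hj s hs => by
      refine (Finset.mem_insert.1 (hS j (Finset.mem_insert_of_mem hj) s hs)).resolve_left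
        fun e => ?_
      have h1 := hmin j (Finset.mem_insert_of_mem hj)
      rw [← e, A_ins hs, Finset.card_insert_of_notMem (Finset.mem_sdiff.1 hs).2] at h1
      omega
    rw [Finset.card_insert_of_notMem hiS'] at hc
    obtain ⟨h, hh⟩ := ih S' hS' (Nat.succ.inj hc)
    obtain ⟨h₀, hh₀⟩ := exists_of_POpt i.M
    obtain ⟨e⟩ := nonempty_cone_attach_iso hiS' hS' hS
    have hcone := DGP.cone (attach hS' hS) (.shift _ h₀) h
    refine ⟨.iso e hcone, ?_⟩
    rw [← K0.of_iso e hcone (.iso e hcone), K0.of_cone _ (.shift _ h₀) h, K0.of_shift h₀, hh, hh₀,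
      Finset.sum_insert hiS', sub_eq_add_neg, ← neg_smul, add_comm]
    congr 2
    change -(sg ℤ[T;T⁻¹] (-i.k - 1) * T i.eta) = _
    rw [← neg_mul]
    congr 1
    rw [sub_eq_add_neg, sg_add, sg_neg_one, sg_neg, mul_neg, mul_one, neg_neg]

/-- The summands of `T_n` for the pair `x`, `y`. -/
def fiber (x y : Vtx n) : Finset (TIdx n) := Finset.univ.filter fun i => i.1 = (x, y)

lemma mem_fiber {x y : Vtx n} {i : TIdx n} : i ∈ fiber x y ↔ i.1 = (x, y) := by
  simp [fiber]

lemma isClosedSet_fiber (x y : Vtx n) : IsClosedSet (fiber x y) := fun _ hi _ _ =>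
  mem_fiber.2 (show _ from (mem_fiber.1 hi : _ = (x, y)))

lemma actRight_e (x y : Vtx n) :
    (bimod n).actRight (RBox.gen (.e x y)) = proj (fiber x y) :=
  LinearMap.ext fun m => ext fun j => by
    refine ((isTn_bimod n).act m (.e x y) j).trans ?_
    rw [comp_proj, Finset.sum_eq_single j]
    · change comp m j * (if j.1 = (x, y) ∧ j = j then idem j.M else 0) = _
      simp only [and_true, mem_fiber]
      split_ifs
      · exact comp_mul_idem m j
      · exact mul_zero _
    · intro i _ hij
      change comp m i * (if i.1 = (x, y) ∧ i = j then idem j.M else 0) = _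
      rw [if_neg fun h => hij h.2, mul_zero]
    · exact fun h => absurd (Finset.mem_univ j) h

lemma sum_fiber {V : Type*} [AddCommMonoid V] (x y : Vtx n) (f : Finset ℕ → V) :
    ∑ i ∈ fiber x y, f i.A = ∑ A ∈ (adj x y).powerset, f A := by
  refine Finset.sum_bij (fun i _ => i.A) (fun i hi => ?_) (fun i hi j hj h => ?_)
    (fun A hA => ⟨⟨(x, y), A, hA⟩, mem_fiber.2 rfl, rfl⟩) fun _ _ => rfl
  · have h := mem_fiber.1 hi
    have h' := i.A_subset
    rw [show i.x = x from congrArg Prod.fst h, show i.y = y from congrArg Prod.snd h] at h'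
    exact Finset.mem_powerset.2 h'
  · exact TIdx.ext ((mem_fiber.1 hi).trans (mem_fiber.1 hj).symm) h

/-- The class of `T_n ⊗ P(x, y)` is the product of `x` and `y`. -/
theorem exists_of_tensor (x y : Vtx n) : ∃ h : DGP (PR n) ((bimod n).tensor (PBox n (x, y))),
    K0.of h = (mulVtx x y).sum fun z c => c • clsP z := by
  obtain ⟨e⟩ := (bimod n).nonempty_cut_iso (RBox.e_mem x y) (RBox.d_e x y)
    (RBox.rel_mul' (.e_e x y))
  obtain ⟨h, hh⟩ := exists_of_part (fiber x y) (isClosedSet_fiber x y)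
  have hcut : (bimod n).cut (RBox.e_mem x y) (RBox.d_e x y) (RBox.rel_mul' (.e_e x y)) =
      part (fiber x y) (isClosedSet_fiber x y) := by
    simp only [DGBimoduleStr.cut, part, actRight_e]
  rw [hcut] at e
  refine ⟨.iso e h, ?_⟩
  refine (K0.of_iso e h (.iso e h)).symm.trans (hh.trans ?_)
  have hlin : ∀ v : Vtx n →₀ ℤ[T;T⁻¹], (v.sum fun z c => c • clsP z) =
      Finsupp.linearCombination ℤ[T;T⁻¹] clsP v := fun v => rfl
  have hvec : ∀ o : Option (Vtx n),
      Finsupp.linearCombination ℤ[T;T⁻¹] clsP (vec ℤ[T;T⁻¹] o) = clsOpt o := fun o => by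
    cases o with
    | none => exact map_zero _
    | some z => exact (Finsupp.linearCombination_single _ _ _).trans (one_smul _ _)
  rw [hlin, mulVtx_eq, map_sum, ← sum_fiber]
  refine Finset.sum_congr rfl fun i hi => ?_
  have hp := mem_fiber.1 hi
  have hx : i.x = x := congrArg Prod.fst hp
  have hy : i.y = y := congrArg Prod.snd hp
  rw [map_smul, hvec]
  have hT : ∀ (s : Finset ℕ) (f : ℕ → ℤ),
      (T (∑ a ∈ s, f a) : ℤ[T;T⁻¹]) = ∏ a ∈ s, T (f a) := fun s f => by
    induction s using Finset.cons_induction with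
    | empty => rfl
    | cons a s ha ih => rw [Finset.sum_cons, Finset.prod_cons, T_add, ih]
  rw [TIdx.k, TIdx.eta, hT, TIdx.M, hx, hy]

end TMod

end

noncomputable section

/-! ### The multiplication on `K₀(R_n)` -/

open LaurentPolynomial

variable {n : ℕ}

/-- The linear isomorphism from the presented algebra to `K₀(R_n)` which maps the ordered monomial
of `x` to `[P(x)]`. -/
def cliffEquivK0 (b : Module.Basis (Vtx n) ℤ[T;T⁻¹] (K0 (PR n))) :
    CliffQuot n ≃ₗ[ℤ[T;T⁻¹]] K0 (PR n) :=
  (cliffBasis n).equiv b (Equiv.refl _)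

/-- The multiplication on `K₀(R_n)` transported from the presented algebra. -/
def mulK0 (b : Module.Basis (Vtx n) ℤ[T;T⁻¹] (K0 (PR n))) :
    K0 (PR n) ⊗[ℤ[T;T⁻¹]] K0 (PR n) →ₗ[ℤ[T;T⁻¹]] K0 (PR n) :=
  (cliffEquivK0 b).toLinearMap ∘ₗ LinearMap.mul' ℤ[T;T⁻¹] (CliffQuot n) ∘ₗ
    TensorProduct.map (cliffEquivK0 b).symm.toLinearMap (cliffEquivK0 b).symm.toLinearMap

variable {b : Module.Basis (Vtx n) ℤ[T;T⁻¹] (K0 (PR n))} (hb : ∀ x, b x = clsP x)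

lemma mulK0_tmul (u v : K0 (PR n)) : mulK0 b (u ⊗ₜ v) =
    cliffEquivK0 b ((cliffEquivK0 b).symm u * (cliffEquivK0 b).symm v) := rfl

lemma mulK0_equiv (u v : CliffQuot n) :
    mulK0 b (cliffEquivK0 b u ⊗ₜ cliffEquivK0 b v) = cliffEquivK0 b (u * v) := by
  rw [mulK0_tmul, LinearEquiv.symm_apply_apply, LinearEquiv.symm_apply_apply]

include hb

lemma cliffEquivK0_basis (x : Vtx n) : cliffEquivK0 b (cliffBasis n x) = clsP x := by
  rw [cliffEquivK0, Module.Basis.equiv_apply, ← hb]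
  rfl

lemma cliffEquivK0_one : cliffEquivK0 b 1 = clsP (Vtx.empty n) := by
  rw [← cliffBasis_empty, cliffEquivK0_basis hb]

lemma cliffEquivK0_cliffX (i : Fin (n + 1)) :
    cliffEquivK0 b (cliffX n i) = clsP (Vtx.of n {(i : ℕ)}) := by
  rw [← cliffBasis_singleton, cliffEquivK0_basis hb]

lemma mulK0_clsP (x y : Vtx n) :
    mulK0 b (clsP x ⊗ₜ clsP y) = (mulVtx x y).sum fun z c => c • clsP z := by
  rw [← cliffEquivK0_basis hb, ← cliffEquivK0_basis hb, mulK0_equiv, cliffBasis_mul, map_finsuppSum]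
  refine Finsupp.sum_congr fun z _ => ?_
  rw [map_smul, cliffEquivK0_basis hb]

end

theorem mainTheorem2 (n : ℕ) (hn : 0 < n) :
    -- `K₀(R_n)` is free on the classes `[P(x)]`, and `m` is the multiplication `m_n`
    ∃ (b : Module.Basis (Vtx n) ℤ[T;T⁻¹] (K0 (PR n)))
      (m : K0 (PR n) ⊗[ℤ[T;T⁻¹]] K0 (PR n) →ₗ[ℤ[T;T⁻¹]] K0 (PR n)),
      (∀ x, b x = clsP x) ∧
      (∀ x y, m (clsP x ⊗ₜ clsP y) = (mulVtx x y).sum fun z c => c • clsP z) ∧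
      -- it is associative with unit `[P(∅)]`
      (∀ u v w, m (m (u ⊗ₜ v) ⊗ₜ w) = m (u ⊗ₜ m (v ⊗ₜ w))) ∧
      (∀ u, m (clsP (Vtx.empty n) ⊗ₜ u) = u ∧ m (u ⊗ₜ clsP (Vtx.empty n)) = u) ∧
      -- it is presented by the generators `X_i = [P([i])]` and the relations
      (∃ φ : RingQuot (CliffRel n) ≃ₗ[ℤ[T;T⁻¹]] K0 (PR n),
        φ 1 = clsP (Vtx.empty n) ∧ (∀ u v, φ (u * v) = m (φ u ⊗ₜ φ v)) ∧
        ∀ i : Fin (n + 1), φ (RingQuot.mkAlgHom ℤ[T;T⁻¹] (CliffRel n)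
          (FreeAlgebra.ι ℤ[T;T⁻¹] i)) = clsP (Vtx.of n {(i : ℕ)})) ∧
      -- it is the Clifford algebra of `Q_n`
      (∃ ψ : CliffordAlgebra (cliffForm n) ≃ₗ[ℤ[T;T⁻¹]] K0 (PR n),
        ψ 1 = clsP (Vtx.empty n) ∧ (∀ u v, ψ (u * v) = m (ψ u ⊗ₜ ψ v)) ∧
        ∀ i : Fin (n + 1), ψ (CliffordAlgebra.ι (cliffForm n) (Pi.single i 1)) =
          clsP (Vtx.of n {(i : ℕ)})) ∧
      -- the DG bimodule `T_n` is well defined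
      (∃! τ : DGBimoduleStr (TMod n) (RBox n), IsTn τ) ∧
      -- it induces an exact functor, and this functor induces `m_n`
      ∃ ε : K0 (PR n) ⊗[ℤ[T;T⁻¹]] K0 (PR n) ≃ₗ[ℤ[T;T⁻¹]] K0 (PBox n),
        (∀ x y, ε (clsP x ⊗ₜ clsP y) = clsPBox x y) ∧
        ∀ τ : DGBimoduleStr (TMod n) (RBox n), IsTn τ →
          ∃ h : ∀ N, DGP (PBox n) N → DGP (PR n) (τ.tensor N),
            IsExactFunctor (τ.tensorDGP h) ∧
            ∃ κ : K0 (PBox n) →ₗ[ℤ[T;T⁻¹]] K0 (PR n),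
              (∀ N, κ (K0.cls _ N) = K0.cls _ ((τ.tensorDGP h).obj N)) ∧
              ∀ u, κ (ε u) = m u := by
  
  obtain ⟨b, hb⟩ := exists_basis_PR n
  obtain ⟨c, hc⟩ := exists_basis_PBox n
  obtain ⟨e, he⟩ := exists_cliff_equiv (n := n)
  have hone : ∀ u, cliffEquivK0 b (1 * u) = cliffEquivK0 b u := fun u => by rw [one_mul]
  refine ⟨b, mulK0 b, hb, mulK0_clsP hb, fun u v w => ?_, fun u => ⟨?_, ?_⟩,
    ⟨cliffEquivK0 b, cliffEquivK0_one hb, fun u v => mulK0_equiv u v |>.symm, fun i => ?_⟩,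
    ⟨e.toLinearEquiv.trans (cliffEquivK0 b), ?_, fun u v => ?_, fun i => ?_⟩,
    existsUnique_isTn n, (b.tensorProduct b).equiv c (Equiv.refl _), fun x y => ?_,
    fun τ hτ => ?_⟩
  · simp only [mulK0_tmul, LinearEquiv.symm_apply_apply, mul_assoc]
  · rw [← cliffEquivK0_one hb, mulK0_tmul, LinearEquiv.symm_apply_apply, one_mul,
      LinearEquiv.apply_symm_apply]
  · rw [← cliffEquivK0_one hb, mulK0_tmul, LinearEquiv.symm_apply_apply, mul_one,
      LinearEquiv.apply_symm_apply]
  · rw [← cliffX_fin, cliffEquivK0_cliffX hb]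
  · exact (congrArg (cliffEquivK0 b) (map_one e)).trans (cliffEquivK0_one hb)
  · exact (congrArg (cliffEquivK0 b) (map_mul e u v)).trans (mulK0_equiv _ _).symm
  · exact (congrArg (cliffEquivK0 b) (he i)).trans (cliffEquivK0_cliffX hb i)
  · rw [← hb, ← hb, ← Module.Basis.tensorProduct_apply, Module.Basis.equiv_apply]
    exact hc (x, y)
  · obtain rfl := hτ.unique (TMod.isTn_bimod n)
    have h := (TMod.bimod n).dgp_tensor (P := PBox n) (Q := PR n)
      fun p => (TMod.exists_of_tensor p.1 p.2).choose
    obtain ⟨κ, hκ⟩ := (TMod.bimod n).exists_tensorK0 h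
    refine ⟨h, (TMod.bimod n).isExactFunctor_tensorDGP h, κ, hκ, fun u => ?_⟩
    have key : κ ∘ₗ ((b.tensorProduct b).equiv c (Equiv.refl _)).toLinearMap = mulK0 b := by
      refine (b.tensorProduct b).ext fun p => ?_
      obtain ⟨h', hh'⟩ := TMod.exists_of_tensor p.1 p.2
      rw [LinearMap.comp_apply, LinearEquiv.coe_coe, Module.Basis.equiv_apply, Equiv.refl_apply, hc,
        Module.Basis.tensorProduct_apply, hb, hb, mulK0_clsP hb, ← hh']
      exact hκ _
    exact LinearMap.congr_fun key u
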